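/- Let $a,b>0$, $a_1=-a_3=a$, $a_2=-a_4=\mathrm ib$. Let $\Delta_i$ (resp. $\Delta_i^\circ$) be the closed (resp. open) segment joining $0$ and $a_i$, oriented towards $0$, and $\Delta=\bigcup_{i=1}^4\Delta_i$. Let $w(z)=\sqrt{(z^2-a^2)(z^2+b^2)}$ be the branch holomorphic in $\mathbb C\setminus\Delta$ with $w(z)=z^2+\mathcal O(z)$ at infinity, $w_+$ its trace on the left side of $\Delta_i^\circ$, and put $\log w_+(s)=\log|w_+(s)|+(-1)^i\pi\mathrm i/2$ for $s\in\Delta_i^\circ$. Let $\mathfrak R$ be the genus one Riemann surface of $w$: two copies $\mathfrak R^{(0)},\mathfrak R^{(1)}$ of $\overline{\mathbb C}$ cut along $\Delta$ and glued crosswise, with projection $\pi$, points $z^{(k)}\in\mathfrak R^{(k)}$ over $z$, and the involution $(z^{(k)})^*=z^{(1-k)}$; on $\mathfrak R$ put $w(z^{(k)})=(-1)^kw(z)$. Bold letters denote points of $\mathfrak R$. Let $\boldsymbol\Delta=\pi^{-1}(\Delta)$, oriented so that $\mathfrak R^{(0)}$ lies on its left. Let $\boldsymbol\alpha$ be an involution-symmetric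 cycle on $\mathfrak R$ such that $\pi(\boldsymbol\alpha)$ is a rectifiable Jordan arc that joins $a_4$ and $a_1$ in the (closed) fourth quadrant and meets $\Delta$ only at these two points; $\boldsymbol\alpha$ is oriented towards $a_1$ on $\mathfrak R^{(0)}$ and away from $a_1$ on $\mathfrak R^{(1)}$. Integrals over $\boldsymbol\alpha$ are improper at the ramification points. Put $$\Omega(\boldsymbol s)=\Big(\oint_{\boldsymbol\alpha}\frac{\mathrm dt}{w(\boldsymbol t)}\Big)^{-1}\frac{\mathrm ds}{w(\boldsymbol s)},$$ and let $\Omega_{\boldsymbol z,\boldsymbol z^*}$ be the meromorphic differential with two simple poles at $\boldsymbol z$ and $\boldsymbol z^*$, with residues $1$ and $-1$, and with zero period on $\boldsymbol\alpha$. Let $\rho$ be a function on $\Delta$ of class $\mathcal W_1$. This means: (i) $\rho_i:=\rho|_{\Delta_i^\circ}$ equals $\rho_i^*(s)(s-a_i)^{\alpha_i}$, where $\rho_i^*$ is holomorphic and non-vanishing in a neighborhood of $\Delta_i$, $\alpha_i>-1$, and $(z-a_i)^{\alpha_i}$ is a branch holomorphic across $\Delta\setminus\{a_i\}$ (thus $\rho_i$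 extends holomorphically to a neighborhood of the origin); (ii) $\rho_1\rho_3/(\rho_2\rho_4)$ is constant near the origin; (iii) $\sum_{i=1}^4\rho_i(0)=0$. Choose branches of $\log\rho_i$ continuous on $\Delta_i\setminus\{a_i\}$, put $\log(\rho_iw_+)=\log\rho_i+\log w_+$, and let the branches be selected so that $$\nu:=\frac1{2\pi\mathrm i}\sum_{i=1}^4(-1)^i\log(\rho_iw_+)(0)\quad\text{satisfies}\quad \mathrm{Re}(\nu)\in\Big(-\frac12,\frac12\Big].$$ (Equivalently, $\nu$ is the number with $e^{2\pi\mathrm i\nu}=(\rho_2\rho_4/\rho_1\rho_3)(0)$ and $\mathrm{Re}(\nu)\in(-\frac12,\frac12]$.) Define $$S_\rho(\boldsymbol z)=\exp\Big\{-\frac1{4\pi\mathrm i}\oint_{\boldsymbol\Delta}\log(\rho w_+)(s)\,\Omega_{\boldsymbol z,\boldsymbol z^*}(\boldsymbol s)\Big\},\qquad c_\rho=\frac1{2\pi\mathrm i}\oint_{\boldsymbol\Delta}\log(\rho w_+)\,\Omega .$$ Then $S_\rho$ is holomorphic and non-vanishing in $\mathfrak R\setminus(\boldsymbol\Delta\cup\boldsymbol\alpha)$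 (including the points over infinity). It has continuous traces $S_{\rho+}$, $S_{\rho-}$ from the left and from the right on $\boldsymbol\Delta\cup\boldsymbol\alpha$ without the points over $a_1,a_2,a_3,a_4,0$, and there $$S_{\rho+}(\boldsymbol s)=S_{\rho-}(\boldsymbol s)\cdot\begin{cases}e^{2\pi\mathrm i c_\rho},&\boldsymbol s\in\boldsymbol\alpha,\\ 1/(\rho w_+)(s),&\boldsymbol s\in\boldsymbol\Delta.\end{cases}$$ Moreover $S_\rho(\boldsymbol z)S_\rho(\boldsymbol z^*)\equiv1$, and for $i,j\in\{1,2,3,4\}$ $$|S_\rho(z^{(0)})|\sim|z-a_i|^{-(2\alpha_i+1)/4}\ \text{ as } z\to a_i,\qquad |S_\rho(z^{(0)})|\sim|z|^{(-1)^j\mathrm{Re}(\nu)}\ \text{ as } \mathcal Q_j\ni z\to0,$$ where $z\notin\Delta\cup\pi(\boldsymbol\alpha)$, $\mathcal Q_j$ is the $j$-th open quadrant, and $f\sim g$ means that $C^{-1}f\le g\le Cf$ near the limit point for some constant $C>1$. -/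

import Mathlib

open Set Filter Topology MeasureTheory
open scoped NNReal

noncomputable section

namespace Cross

/-! ### The cross `Δ = [-a, a] ∪ [-ib, ib]`

The four endpoints are indexed by `i : Fin 4`, so that `endpt a b i` is the point usually denoted
`a_{i+1}`; the sign `(-1)^i` of the usual numbering becomes `(-1)^(i+1)`. -/

/-- The endpoints `a₁ = a`, `a₂ = ib`, `a₃ = -a`, `a₄ = -ib` of the cross. -/
def endpt (a b : ℝ) (i : Fin 4) : ℂ :=
  ![(a : ℂ), Complex.I * b, -(a : ℂ), -(Complex.I * b)] i

/-- The closed segment `Δ_i` joining the origin and the `i`-th endpoint. -/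
def seg (a b : ℝ) (i : Fin 4) : Set ℂ := segment ℝ 0 (endpt a b i)

/-- The open segment `Δ_i°`. -/
def seg' (a b : ℝ) (i : Fin 4) : Set ℂ := openSegment ℝ 0 (endpt a b i)

/-- The cross `Δ`. -/
def cross (a b : ℝ) : Set ℂ := ⋃ i, seg a b i

/-- The open quadrants of the plane, in the usual order. -/
def quadrant (j : Fin 4) : Set ℂ :=
  ![{z | 0 < z.re ∧ 0 < z.im}, {z | z.re < 0 ∧ 0 < z.im},
    {z | z.re < 0 ∧ z.im < 0}, {z | 0 < z.re ∧ z.im < 0}] j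

/-- The branch of `√((z² - a²)(z² + b²))` that is holomorphic in `ℂ ∖ Δ` and is `z² + O(z)` at
infinity. The principal square root below is cut exactly where `(z² + b²) / (z² - a²)` is a
nonpositive real number, that is, where `-b² ≤ z² < a²`. -/
def w (a b : ℝ) (z : ℂ) : ℂ :=
  (z ^ 2 - (a : ℂ) ^ 2) * ((z ^ 2 + (b : ℂ) ^ 2) / (z ^ 2 - (a : ℂ) ^ 2)) ^ (1 / 2 : ℂ)

/-- `log |w_+(s)| + (-1)^i πi/2`, the chosen logarithm of `w_+` on `Δ_i°`. -/
def logWPlus (a b : ℝ) (i : Fin 4) (s : ℂ) : ℂ :=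
  (Real.log (Real.sqrt ‖(s ^ 2 - (a : ℂ) ^ 2) * (s ^ 2 + (b : ℂ) ^ 2)‖) : ℂ)
    + (-1) ^ ((i : ℕ) + 1) * (Real.pi * Complex.I / 2)

/-- The trace `w_+` of `w` on `Δ_i` from the left, when `Δ_i` is oriented towards the origin:
`w_+(s) = (-1)^i i |w_+(s)|`, with `|w_+(s)|² = |(s² - a²)(s² + b²)|`. -/
def wPlus (a b : ℝ) (i : Fin 4) (s : ℂ) : ℂ :=
  (-1) ^ ((i : ℕ) + 1) * Complex.I *
    (Real.sqrt ‖(s ^ 2 - (a : ℂ) ^ 2) * (s ^ 2 + (b : ℂ) ^ 2)‖ : ℂ)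

theorem w_sq (a b : ℝ) (z : ℂ) :
    (w a b z) ^ 2 = (z ^ 2 - (a : ℂ) ^ 2) * (z ^ 2 + (b : ℂ) ^ 2) := by
  unfold w
  rw [mul_pow, one_div, Complex.cpow_ofNat_inv_pow]
  by_cases h : z ^ 2 - (a : ℂ) ^ 2 = 0
  · simp [h]
  · field_simp

/-! ### The Riemann surface `R` of `w` -/

/-- The finite part of the Riemann surface: the smooth affine curve
`ω² = (z² - a²)(z² + b²)`, with the subspace topology. -/
def Curve (a b : ℝ) : Type :=
  {p : ℂ × ℂ // p.2 ^ 2 = (p.1 ^ 2 - (a : ℂ) ^ 2) * (p.1 ^ 2 + (b : ℂ) ^ 2)}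

instance (a b : ℝ) : TopologicalSpace (Curve a b) :=
  inferInstanceAs (TopologicalSpace {p : ℂ × ℂ //
    p.2 ^ 2 = (p.1 ^ 2 - (a : ℂ) ^ 2) * (p.1 ^ 2 + (b : ℂ) ^ 2)})

/-- The projection `π` on the finite part. -/
def Curve.z {a b : ℝ} (p : Curve a b) : ℂ := p.1.1

/-- The function `w` on the finite part of the surface. -/
def Curve.ω {a b : ℝ} (p : Curve a b) : ℂ := p.1.2

/-- The Riemann surface: the affine curve and the two points `∞^(0)`, `∞^(1)` over infinity. -/
inductive Surface (a b : ℝ) : Type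
  | pt (p : Curve a b) : Surface a b
  | infty (k : Fin 2) : Surface a b

/-- The involution of the affine curve that exchanges the two points over `z`. -/
def Curve.star {a b : ℝ} (p : Curve a b) : Curve a b :=
  ⟨(p.z, -p.ω), by simpa [Curve.z, Curve.ω] using p.2⟩

/-- The conformal involution `z^(k) ↦ z^(1-k)`. -/
def Surface.star {a b : ℝ} : Surface a b → Surface a b
  | .pt p => .pt p.star
  | .infty k => .infty (1 - k)

/-- The point `z^(k)` of the `k`-th sheet over a finite `z ∉ Δ`, where `ω = (-1)^k w(z)`. -/
def lift (a b : ℝ) (k : Fin 2) (z : ℂ) : Curve a b :=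
  ⟨(z, (-1) ^ (k : ℕ) * w a b z), by
    have h : ((-1 : ℂ) ^ (k : ℕ)) ^ 2 = 1 := by rw [← pow_mul, mul_comm, pow_mul]; simp
    simp only [mul_pow, h, one_mul, w_sq]⟩

/-- The finite part of the open sheet `R^(k) ∖ π⁻¹(Δ)`. -/
def sheet (a b : ℝ) (k : Fin 2) : Set (Curve a b) := lift a b k '' (cross a b)ᶜ

/-- A function is holomorphic at a point of the surface if near this point it is a holomorphic
function of the local coordinate: `z` at a finite unramified point, `ω` at a ramification
point, `1/z` at the points over infinity. -/
def HolomorphicAt {a b : ℝ} (f : Surface a b → ℂ) : Surface a b → Prop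
  | .pt p => (p.ω ≠ 0 → ∃ g : ℂ → ℂ, AnalyticAt ℂ g p.z ∧ ∀ᶠ q in 𝓝 p, f (.pt q) = g q.z) ∧
      (p.ω = 0 → ∃ g : ℂ → ℂ, AnalyticAt ℂ g 0 ∧ ∀ᶠ q in 𝓝 p, f (.pt q) = g q.ω)
  | .infty k => ∃ g : ℂ → ℂ, AnalyticAt ℂ g 0 ∧ f (.infty k) = g 0 ∧
      ∀ᶠ z in Bornology.cobounded ℂ, f (.pt (lift a b k z)) = g z⁻¹

/-! ### Cycles -/

/-- `γ : [0,1] → ℂ` parametrizes a rectifiable Jordan arc from `a₄ = -ib` to `a₁ = a` that lies in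
the closed fourth quadrant and meets `Δ` at its endpoints only. (Rectifiable arcs are
exactly those with an injective Lipschitz parametrization.) -/
structure IsAlphaArc (a b : ℝ) (γ : ℝ → ℂ) : Prop where
  lipschitz : ∃ K : ℝ≥0, LipschitzOnWith K γ (Icc 0 1)
  injOn : InjOn γ (Icc 0 1)
  source : γ 0 = endpt a b 3
  target : γ 1 = endpt a b 0
  quadrant : ∀ t ∈ Ioo (0 : ℝ) 1, 0 ≤ (γ t).re ∧ (γ t).im ≤ 0
  avoids : ∀ t ∈ Ioo (0 : ℝ) 1, γ t ∉ cross a b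

/-- The integral of the differential `F(z, ω) dz` along the lift `t ↦ (γ t, v t)` of an open arc
`γ` to the surface. The integral is improper at the endpoints of the arc, where `F` may
be infinite. -/
def liftIntegral (γ v : ℝ → ℂ) (F : ℂ → ℂ → ℂ) : ℂ :=
  limUnder (𝓝[>] (0 : ℝ)) fun ε => ∫ t in ε..(1 - ε), F (γ t) (v t) * deriv γ t

/-- The integral over an involution-symmetric cycle: first along the lift `(γ, v)` of the arc
`γ`, then backwards along the other lift `(γ, -v)`. -/
def cycleIntegral (γ v : ℝ → ℂ) (F : ℂ → ℂ → ℂ) : ℂ :=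
  liftIntegral γ v F - liftIntegral γ (fun t => -v t) F

/-- `∮_α F(z, ω) dz`. The cycle `α` runs over `γ` towards `a₁` on `R^(0)`, and back on `R^(1)`. -/
def alphaIntegral (a b : ℝ) (γ : ℝ → ℂ) (F : ℂ → ℂ → ℂ) : ℂ :=
  cycleIntegral γ (fun t => w a b (γ t)) F

/-- `∮_Δ f(z) F(z, ω) dz` over `π⁻¹(Δ)`, for a function `f` that is given by `f i` on `Δ_i`. The
surface cycle keeps `R^(0)` on its left: over `Δ_i` it runs towards the origin along the
boundary values `w_+` of `R^(0)` from the left of `Δ_i`, and away from the origin along the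
boundary values `-w_+` of `R^(0)` from the right of `Δ_i`. -/
def deltaIntegral (a b : ℝ) (f : Fin 4 → ℂ → ℂ) (F : ℂ → ℂ → ℂ) : ℂ :=
  ∑ i, cycleIntegral (fun t => (1 - t) * endpt a b i)
    (fun t => wPlus a b i ((1 - t) * endpt a b i)) (fun s ω => f i s * F s ω)

/-- The coefficient (of `dz`) of the holomorphic differential with unit period on `α`. -/
def Omega (a b : ℝ) (γ : ℝ → ℂ) (_z ω : ℂ) : ℂ :=
  (alphaIntegral a b γ fun _ v => 1 / v)⁻¹ * (1 / ω)

/-- The coefficient of a differential with simple poles at `P` and `P*` with residues `1` and `-1`: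
it is `w(P) / (s - z) · ds / w(s)` if `P` lies over a finite point `z`, and
`-(-1)^k s ds / w(s)` if `P = ∞^(k)`. -/
def thirdKind {a b : ℝ} : Surface a b → ℂ → ℂ → ℂ
  | .pt p, s, ω => p.ω / (s - p.z) * (1 / ω)
  | .infty k, s, ω => -(-1) ^ (k : ℕ) * s * (1 / ω)

/-- The coefficient of the differential `Ω_{P,P*}`: the differential with simple poles at `P` and
`P*` with residues `1` and `-1`, normalized to have zero period on `α`. -/
def OmegaThird {a b : ℝ} (γ : ℝ → ℂ) (P : Surface a b) (s ω : ℂ) : ℂ :=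
  thirdKind P s ω - alphaIntegral a b γ (thirdKind P) * Omega a b γ s ω

/-! ### Weights -/

/-- The branch of `(z - a_i)^α` that is holomorphic off the ray `{t a_i : t ≥ 1}`. (Any other branch
holomorphic across `Δ ∖ {a_i}` is a constant multiple of it near `Δ ∖ {a_i}`.) -/
def branchPow (a b : ℝ) (i : Fin 4) (α : ℝ) (z : ℂ) : ℂ :=
  (-endpt a b i) ^ (α : ℂ) * (1 - z / endpt a b i) ^ (α : ℂ)

/-- The analytic continuation `ρ_i(z) = ρ_i^*(z) (z - a_i)^{α_i}` of the weight on `Δ_i`. -/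
def rhoExt (a b : ℝ) (α : Fin 4 → ℝ) (h : Fin 4 → ℂ → ℂ) (i : Fin 4) (z : ℂ) : ℂ :=
  h i z * branchPow a b i (α i) z

/-- `ρ` belongs to the class `W_ℓ`, with exponents `α_i` and holomorphic factors `ρ_i^* = h i`. -/
structure IsWeight (a b : ℝ) (ℓ : ℕ∞) (ρ : ℂ → ℂ) (α : Fin 4 → ℝ) (h : Fin 4 → ℂ → ℂ) :
    Prop where
  exponent : ∀ i, -1 < α i
  analytic : ∀ i, AnalyticOnNhd ℂ (h i) (seg a b i)
  ne_zero : ∀ i, ∀ z ∈ seg a b i, h i z ≠ 0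
  eq_rho : ∀ i, ∀ s ∈ seg' a b i, ρ s = rhoExt a b α h i s
  ratio : ∃ c : ℂ, ∀ᶠ z in 𝓝 (0 : ℂ),
    rhoExt a b α h 0 z * rhoExt a b α h 2 z / (rhoExt a b α h 1 z * rhoExt a b α h 3 z) = c
  sum_zero : ∑ i, rhoExt a b α h i 0 = 0
  matching : ∀ l : ℕ, (l : ℕ∞) < ℓ → ∀ i j,
    iteratedDeriv l (rhoExt a b α h i) 0 / rhoExt a b α h i 0 =
      iteratedDeriv l (rhoExt a b α h j) 0 / rhoExt a b α h j 0

/-- `log (ρ_i w_+) = log ρ_i + log w_+` for a given choice `L i` of `log ρ_i`. -/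
def logRhoW (a b : ℝ) (L : Fin 4 → ℂ → ℂ) (i : Fin 4) (s : ℂ) : ℂ :=
  L i s + logWPlus a b i s

/-- `ν = (1 / 2πi) ∑ (-1)^i log (ρ_i w_+)(0)`. -/
def nu (a b : ℝ) (L : Fin 4 → ℂ → ℂ) : ℂ :=
  1 / (2 * Real.pi * Complex.I) * ∑ i : Fin 4, (-1) ^ ((i : ℕ) + 1) * logRhoW a b L i 0

/-- `L i` is a branch of `log ρ_i` that is continuous on `Δ_i ∖ {a_i}`, and the branches are
selected so that `Re ν ∈ (-1/2, 1/2]`. -/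
structure IsLogBranch (a b : ℝ) (α : Fin 4 → ℝ) (h : Fin 4 → ℂ → ℂ) (L : Fin 4 → ℂ → ℂ) :
    Prop where
  continuousOn : ∀ i, ContinuousOn (L i) (seg a b i \ {endpt a b i})
  exp_eq : ∀ i, ∀ s ∈ seg a b i \ {endpt a b i}, Complex.exp (L i s) = rhoExt a b α h i s
  normalized : (nu a b L).re ∈ Ioc (-(1 / 2) : ℝ) (1 / 2)

/-! ### The Szegő function -/

/-- `c_ρ = (1 / 2πi) ∮_Δ log (ρ w_+) Ω`. -/
def cRho (a b : ℝ) (γ : ℝ → ℂ) (L : Fin 4 → ℂ → ℂ) : ℂ :=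
  1 / (2 * Real.pi * Complex.I) * deltaIntegral a b (logRhoW a b L) (Omega a b γ)

/-- The Szegő function `S_ρ(P) = exp (-(1 / 4πi) ∮_Δ log (ρ w_+) Ω_{P,P*})`. -/
def szego (a b : ℝ) (γ : ℝ → ℂ) (L : Fin 4 → ℂ → ℂ) (P : Surface a b) : ℂ :=
  Complex.exp (-(1 / (4 * Real.pi * Complex.I)) *
    deltaIntegral a b (logRhoW a b L) (OmegaThird γ P))

/-! ### Sides of the cuts -/

/-- `Δ ∪ π(α)`. -/
def cuts (a b : ℝ) (γ : ℝ → ℂ) : Set ℂ := cross a b ∪ γ '' Icc 0 1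

/-- The points of the surface over `Δ ∪ π(α)`, i.e. the set `Δ ∪ α` on the surface. -/
def surfaceCuts (a b : ℝ) (γ : ℝ → ℂ) : Set (Surface a b) :=
  {P | ∃ p : Curve a b, P = .pt p ∧ p.z ∈ cuts a b γ}

/-- `Δ ∪ α` on the surface, without the points over `0, a₁, a₂, a₃, a₄`. -/
def regularCuts (a b : ℝ) (γ : ℝ → ℂ) : Set (Curve a b) :=
  {p | p.z ∈ cuts a b γ ∧ p.z ≠ 0 ∧ ∀ i, p.z ≠ endpt a b i}

/-- The bounded component of `ℂ ∖ (Δ ∪ π(α))`. It is bounded by the positively oriented Jordan curve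
`a₄ → a₁ → 0 → a₄` formed by `π(α)`, `Δ₁`, `Δ₄`, so it lies to the left of `π(α)`. -/
def innerDomain (a b : ℝ) (γ : ℝ → ℂ) : Set ℂ :=
  {z ∈ (cuts a b γ)ᶜ | Bornology.IsBounded (connectedComponentIn (cuts a b γ)ᶜ z)}

/-- The unbounded component of `ℂ ∖ (Δ ∪ π(α))`, which lies to the right of `π(α)`. -/
def outerDomain (a b : ℝ) (γ : ℝ → ℂ) : Set ℂ :=
  {z ∈ (cuts a b γ)ᶜ | ¬ Bornology.IsBounded (connectedComponentIn (cuts a b γ)ᶜ z)}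

/-- The left (`+`) side of the cycle `α`, which is oriented towards `a₁` on `R^(0)` and away
from `a₁` on `R^(1)`. -/
def alphaLeft (a b : ℝ) (γ : ℝ → ℂ) : Set (Curve a b) :=
  lift a b 0 '' innerDomain a b γ ∪ lift a b 1 '' outerDomain a b γ

/-- The right (`-`) side of the cycle `α`. -/
def alphaRight (a b : ℝ) (γ : ℝ → ℂ) : Set (Curve a b) :=
  lift a b 0 '' outerDomain a b γ ∪ lift a b 1 '' innerDomain a b γ

/-- `f ∼ g` along the filter `l`: there is `C > 1` with `C⁻¹ f ≤ g ≤ C f` eventually. -/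
def Comparable (l : Filter ℂ) (f g : ℂ → ℝ) : Prop :=
  ∃ C : ℝ, 1 < C ∧ ∀ᶠ z in l, C⁻¹ * f z ≤ g z ∧ g z ≤ C * f z

end Cross

end

namespace Cross

/-! ### Lipschitz curves -/

/-! Everything reduces to Cauchy integrals over the four segments, each written in the affine
coordinate `coord` with t = 0 at a_i and t = 1 at the origin. At a point over z where w takes the
value ω, the differential Ω_{z,z*} equals (ω/(s - z) - A/B) ds/w(s), where A and B are the α-periods
of ω ds/((s - z)w) and of ds/w. On the closed fourth quadrant w has a branch `wQuad` that is
continuous up to the cross, so Cauchy's theorem pushes the arc onto Δ₄ and Δ₁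
(`tendsto_integral_arc`). For the kernel 1/(s - z) a residue appears when z lies between the arc and
the cross (`tendsto_integral_div_arc`). The result is the formula of `szego_pt`: S = exp(-ω C(z) +
2πi c_ρ (ω/w(z)) χ(z)). Here χ is the indicator of the bounded component of the complement of the
cuts, and C is the Cauchy integral over the cross of the density (log(ρw₊) + 2πi c_ρ ε)/w₊, with ε =
1 on Δ₁ and Δ₄ and ε = 0 on Δ₂ and Δ₃.

The assertions are read off from this formula. The exponent is odd in ω, which is the symmetry. Off
the cuts C and w are holomorphic and χ is locally constant. The constant c_ρ is exactly what makes
the total integral of the density vanish (`crossIntegral_density_one`), so C = O(z⁻²) compensates w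
~ z² at infinity. Across α only χ changes, which gives the factor e^{2πi c_ρ}. Across Δ the
Sokhotski–Plemelj formula (`exists_tendsto_cauchy`) makes ωC jump by log(ρw₊) + 2πi c_ρ ε, and the
values of χ seen from the two sheets remove the term with ε.

At a_i the density is F(t)/√t with F logarithmic. Its Cauchy integral is πF(|ζ|)/√(-ζ) up to
O(|ζ|^{-1/2}) (`exists_norm_cauchy_zero_le`), and multiplication by w ~ ±√(-ζ) leaves (α_i + 1/2)
log|ζ|/2 in ωC. At the origin each Cauchy integral behaves like its density at t = 1 times log|z|
(`exists_norm_cauchy_one_le`). These densities add up to 2πν/(ab), and w tends to ±i ab with a sign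
alternating over the quadrants.

The topological input is that the closed curve formed by the arc, Δ₁ and Δ₄ has winding number 1
about each bounded component and 0 about the unbounded one (`winding_eq`). It is proved directly: an
arc cannot contain the frontier of a bounded set disjoint from it (`not_frontier_subset_arc`), so a
bounded component must come up to the midpoint of Δ₁, where the jump of the Cauchy integral gives
the winding number. -/

theorem integral_eq_sub_of_lipschitz {f f' : ℝ → ℂ} {c d : ℝ} (hcd : c ≤ d) {K : ℝ≥0}
    (hf : LipschitzOnWith K f (Icc c d))
    (hf' : ∀ᵐ t : ℝ, t ∈ Ioo c d → HasDerivAt f (f' t) t) :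
    IntervalIntegrable f' volume c d ∧ ∫ t in c..d, f' t = f d - f c := by
  have hb : ∀ᵐ t : ℝ, t ∈ Ioo c d → ‖f' t‖ ≤ K ∧ deriv f t = f' t := by
    filter_upwards [hf'] with t ht htm
    exact ⟨(ht htm).le_of_lipschitzOn (Icc_mem_nhds htm.1 htm.2) hf, (ht htm).deriv⟩
  have hne : ∀ᵐ t : ℝ, t ≠ d := by simp [ae_iff, measure_singleton]
  have hne' : ∀ᵐ t : ℝ, t ≠ c := by simp [ae_iff, measure_singleton]
  have hii : IntervalIntegrable f' volume c d := by
    rw [intervalIntegrable_iff_integrableOn_Ioo_of_le hcd]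
    refine Integrable.of_bound (μ := volume.restrict (Ioo c d)) ?_ (K : ℝ) ?_
    · refine ((measurable_deriv f).aestronglyMeasurable (μ := volume.restrict (Ioo c d))).congr ?_
      rw [Filter.EventuallyEq, ae_restrict_iff' measurableSet_Ioo]
      filter_upwards [hb] with t ht htm using (ht htm).2
    · rw [ae_restrict_iff' measurableSet_Ioo]
      filter_upwards [hb] with t ht htm using (ht htm).1
  refine ⟨hii, ?_⟩
  have hI : LipschitzOnWith K (fun t => ∫ s in c..t, f' s) (uIcc c d) := by
    rw [uIcc_of_le hcd]
    refine LipschitzOnWith.of_dist_le_mul fun x hx y hy => ?_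
    have h1 : IntervalIntegrable f' volume c x :=
      hii.mono_set (by rw [uIcc_of_le hx.1, uIcc_of_le hcd]; exact Icc_subset_Icc_right hx.2)
    have h2 : IntervalIntegrable f' volume c y :=
      hii.mono_set (by rw [uIcc_of_le hy.1, uIcc_of_le hcd]; exact Icc_subset_Icc_right hy.2)
    rw [dist_eq_norm, intervalIntegral.integral_interval_sub_left h1 h2, dist_eq_norm,
      Real.norm_eq_abs]
    refine intervalIntegral.norm_integral_le_of_norm_le_const_ae ?_
    filter_upwards [hb, hne, hne'] with t ht h3 h4 htm
    have : t ∈ Icc c d := by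
      have := uIoc_subset_uIcc htm
      rw [mem_uIcc] at this
      rcases this with h | h
      · exact ⟨hy.1.trans h.1, h.2.trans hx.2⟩
      · exact ⟨hx.1.trans h.1, h.2.trans hy.2⟩
    exact (ht ⟨lt_of_le_of_ne this.1 (Ne.symm h4), lt_of_le_of_ne this.2 h3⟩).1
  rw [← uIcc_of_le hcd] at hf
  -- The difference of f and the indefinite integral of f' is absolutely continuous, and by Lebesgue
  -- differentiation its derivative vanishes almost everywhere.
  obtain ⟨C, hC⟩ := AbsolutelyContinuousOnInterval.const_of_ae_hasDerivAt_zero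
    (hf.absolutelyContinuousOnInterval.sub hI.absolutelyContinuousOnInterval) (by
      filter_upwards [hf', hne, hne', hii.ae_hasDerivAt_integral] with t ht h3 h4 h5 htm
      have htm' := htm
      rw [uIcc_of_le hcd] at htm'
      have := (ht ⟨lt_of_le_of_ne htm'.1 (Ne.symm h4), lt_of_le_of_ne htm'.2 h3⟩).sub
        (h5 htm c left_mem_uIcc)
      simpa using this)
  have e1 := hC d right_mem_uIcc
  have e2 := hC c left_mem_uIcc
  simp only [Pi.sub_apply, intervalIntegral.integral_same, sub_zero] at e1 e2
  rw [← e2] at e1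
  linear_combination -e1

theorem ae_hasDerivAt_of_lipschitz {γ : ℝ → ℂ} {c d : ℝ} {K : ℝ≥0}
    (hγ : LipschitzOnWith K γ (Icc c d)) :
    ∀ᵐ t : ℝ, t ∈ Ioo c d → HasDerivAt γ (deriv γ t) t := by
  filter_upwards [hγ.ae_differentiableWithinAt_of_mem] with t ht htm
  exact ((ht ⟨htm.1.le, htm.2.le⟩).differentiableAt (Icc_mem_nhds htm.1 htm.2)).hasDerivAt

/-- The chain rule and the fundamental theorem of calculus along a Lipschitz curve. -/
theorem integral_comp_mul_deriv_of_lipschitz {γ : ℝ → ℂ} {c d : ℝ} (hcd : c ≤ d) {K : ℝ≥0}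
    (hγ : LipschitzOnWith K γ (Icc c d)) {F k : ℂ → ℂ}
    (hF : ∀ t ∈ Icc c d, ∀ᶠ s in 𝓝 (γ t), HasDerivAt F (k s) s) :
    IntervalIntegrable (fun t => k (γ t) * deriv γ t) volume c d ∧
      ∫ t in c..d, k (γ t) * deriv γ t = F (γ d) - F (γ c) := by
  have hL : LocallyLipschitzOn (Icc c d) (F ∘ γ) := by
    intro t ht
    have han : AnalyticAt ℂ F (γ t) := by
      rw [Complex.analyticAt_iff_eventually_differentiableAt]
      exact (hF t ht).mono fun s hs => hs.differentiableAt
    obtain ⟨K', s, hs, hK'⟩ := (han.contDiffAt (n := 1)).exists_lipschitzOnWith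
    have hc : ContinuousWithinAt γ (Icc c d) t := hγ.continuousOn t ht
    refine ⟨K' * K, γ ⁻¹' s ∩ Icc c d, inter_mem (hc hs) self_mem_nhdsWithin, ?_⟩
    exact hK'.comp (hγ.mono inter_subset_right) (fun x hx => hx.1)
  obtain ⟨K', hK'⟩ := hL.exists_lipschitzOnWith_of_compact isCompact_Icc
  refine integral_eq_sub_of_lipschitz hcd hK' ?_
  filter_upwards [ae_hasDerivAt_of_lipschitz hγ] with t ht htm
  exact (hF t ⟨htm.1.le, htm.2.le⟩).self_of_nhds.comp_of_eq t (ht htm) rfl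

theorem intervalIntegrable_deriv_of_lipschitz {γ : ℝ → ℂ} {K : ℝ≥0}
    (hγ : LipschitzOnWith K γ (Icc 0 1)) : IntervalIntegrable (deriv γ) volume 0 1 :=
  (integral_eq_sub_of_lipschitz zero_le_one hγ (ae_hasDerivAt_of_lipschitz hγ)).1

/-! ### Primitives of functions with integrable singularities -/

/-- The primitive of `k` that vanishes at `c`, as an integral along straight segments. -/
noncomputable def radialPrimitive (k : ℂ → ℂ) (c s : ℂ) : ℂ :=
  (s - c) * ∫ t in (0 : ℝ)..1, k (c + t * (s - c))

/-- A thin tube around the segment from c to s is convex and contained in O, so k has a primitive g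
there; on the tube the radial integral equals g - g(c). -/
theorem hasDerivAt_radialPrimitive {k : ℂ → ℂ} {c s : ℂ} {O : Set ℂ} (hO : IsOpen O)
    (hk : DifferentiableOn ℂ k O) (hs : ∀ t ∈ Icc (0 : ℝ) 1, c + t * (s - c) ∈ O) :
    ∀ᶠ s' in 𝓝 s, HasDerivAt (radialPrimitive k c) (k s') s' := by
  have hseg : segment ℝ c s ⊆ O := by
    rw [segment_eq_image']
    rintro _ ⟨t, ht, rfl⟩
    simpa using hs t ht
  have hcomp : IsCompact (segment ℝ c s) := by
    rw [segment_eq_image']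
    exact isCompact_Icc.image (by fun_prop)
  obtain ⟨δ, hδ, hsub⟩ := hcomp.exists_thickening_subset_open hO hseg
  set V := Metric.thickening δ (segment ℝ c s) with hV
  have hVc : Convex ℝ V := (convex_segment c s).thickening δ
  have hVo : IsOpen V := Metric.isOpen_thickening
  obtain ⟨g, hg⟩ := hVc.exists_forall_hasDerivWithinAt (hk.mono hsub)
  have hg' : ∀ x ∈ V, HasDerivAt g (k x) x := fun x hx => (hg x hx).hasDerivAt (hVo.mem_nhds hx)
  have hcV : c ∈ V := Metric.self_subset_thickening hδ _ (left_mem_segment ℝ c s)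
  have hsV : s ∈ V := Metric.self_subset_thickening hδ _ (right_mem_segment ℝ c s)
  have hKg : ∀ x ∈ V, radialPrimitive k c x = g x - g c := by
    intro x hx
    have hmem : ∀ t ∈ uIcc (0 : ℝ) 1, c + t * (x - c) ∈ V := by
      intro t ht
      rw [uIcc_of_le zero_le_one] at ht
      have := hVc.add_smul_sub_mem hcV hx ht
      simpa using this
    have hline : ∀ t : ℝ, HasDerivAt (fun t : ℝ => c + (t : ℂ) * (x - c)) (x - c) t := by
      intro t
      simpa using ((Complex.ofRealCLM.hasDerivAt (x := t)).mul_const (x - c)).const_add c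
    have h := intervalIntegral.integral_eq_sub_of_hasDerivAt
      (f := fun t : ℝ => g (c + t * (x - c))) (f' := fun t : ℝ => k (c + t * (x - c)) * (x - c))
      (a := 0) (b := 1)
      (fun t ht => (hg' _ (hmem t ht)).comp_of_eq t (hline t) rfl) (by
        apply ContinuousOn.intervalIntegrable
        refine ContinuousOn.mul ?_ continuousOn_const
        refine (hk.continuousOn.mono hsub).comp (by fun_prop) hmem)
    rw [intervalIntegral.integral_mul_const] at h
    rw [radialPrimitive, mul_comm, h]
    simp
  filter_upwards [hVo.mem_nhds hsV] with s' hs'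
  refine ((hg' s' hs').sub_const (g c)).congr_of_eventuallyEq ?_
  filter_upwards [hVo.mem_nhds hs'] with x hx using hKg x hx

/-! ### Arcs do not bound -/

/-- The differences of f divided by 2πi are continuous and integer valued on a connected set; a
nonzero integer would force an intermediate value ±1/2. -/
theorem eqOn_of_exp_eq_const {X : Type*} [TopologicalSpace X] {S : Set X} (hS : IsPreconnected S)
    {f : X → ℂ} (hf : ContinuousOn f S) {C : ℂ} (hC : ∀ x ∈ S, Complex.exp (f x) = C) {x y : X}
    (hx : x ∈ S) (hy : y ∈ S) : f x = f y := by
  by_contra hne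
  have him : IsPreconnected ((fun x => ((f x - f y) / (2 * Real.pi * Complex.I)).re) '' S) :=
    hS.image _ (Complex.continuous_re.comp_continuousOn
      ((hf.sub continuousOn_const).div_const _))
  have hint : ∀ z ∈ S, ∃ n : ℤ, f z = f y + n * (2 * Real.pi * Complex.I) := fun z hz =>
    Complex.exp_eq_exp_iff_exists_int.1 ((hC z hz).trans (hC y hy).symm)
  have hval : ∀ z (n : ℤ), f z = f y + n * (2 * Real.pi * Complex.I) →
      ((f z - f y) / (2 * Real.pi * Complex.I)).re = n := by
    intro z n h
    rw [h, add_sub_cancel_left, mul_div_cancel_right₀ _ Complex.two_pi_I_ne_zero]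
    simp
  obtain ⟨n, hn⟩ := hint x hx
  have hn0 : n ≠ 0 := by rintro rfl; exact hne (by simpa using hn)
  have hord := him.ordConnected
  have hx' : (n : ℝ) ∈ (fun x => ((f x - f y) / (2 * Real.pi * Complex.I)).re) '' S :=
    ⟨x, hx, hval x n hn⟩
  have hy' : (0 : ℝ) ∈ (fun x => ((f x - f y) / (2 * Real.pi * Complex.I)).re) '' S :=
    ⟨y, hy, by simp⟩
  have key : ∀ q ∈ (fun x => ((f x - f y) / (2 * Real.pi * Complex.I)).re) '' S,
      ∃ m : ℤ, (m : ℝ) = q := by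
    rintro _ ⟨z, hz, rfl⟩
    obtain ⟨m, hm⟩ := hint z hz
    exact ⟨m, (hval z m hm).symm⟩
  rcases lt_or_gt_of_ne hn0 with h | h
  · have h1 : (n : ℝ) ≤ -1 := by exact_mod_cast (by omega : n ≤ -1)
    obtain ⟨m, hm⟩ := key (-(1 / 2)) (hord.out hx' hy' ⟨by linarith, by norm_num⟩)
    have : (2 * m : ℝ) = -1 := by rw [hm]; norm_num
    have : (2 * m : ℤ) = -1 := by exact_mod_cast this
    omega
  · have h1 : (1 : ℝ) ≤ n := by exact_mod_cast (by omega : 1 ≤ n)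
    obtain ⟨m, hm⟩ := key (1 / 2) (hord.out hy' hx' ⟨by norm_num, by linarith⟩)
    have : (2 * m : ℝ) = 1 := by rw [hm]; norm_num
    have : (2 * m : ℤ) = 1 := by exact_mod_cast this
    omega

theorem exists_continuous_log {X : Type*} [TopologicalSpace X] [LocallyPathConnectedSpace X]
    [SimplyConnectedSpace X] [Nonempty X] {g : X → ℂ} (hg : Continuous g) (h0 : ∀ x, g x ≠ 0) :
    ∃ f : X → ℂ, Continuous f ∧ ∀ x, Complex.exp (f x) = g x := by
  obtain ⟨f, ⟨-, hf⟩, -⟩ := Complex.isCoveringMapOn_exp.existsUnique_continuousMap_lifts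
    ⟨g, hg⟩ (Complex.exp_log (h0 (Classical.arbitrary X))) h0
  exact ⟨f, map_continuous f, fun x => congrFun hf x⟩

/-- A zero-free continuous function on the plane has a continuous logarithm, but along the circle
the logarithm of z - p gains 2πi. -/
theorem exists_eq_zero_of_eq_sub {h : ℂ → ℂ} (hc : Continuous h) {p : ℂ} {R : ℝ} (hR : 0 < R)
    (hh : ∀ z, ‖z - p‖ = R → h z = z - p) : ∃ z, h z = 0 := by
  by_contra! h0
  obtain ⟨f, hf, hfe⟩ := exists_continuous_log hc h0
  have h1 : ∀ θ ∈ (univ : Set ℝ),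
      Complex.exp (f (p + R * Complex.exp (θ * Complex.I)) - θ * Complex.I) = R := by
    intro θ _
    have hn : ‖p + R * Complex.exp (θ * Complex.I) - p‖ = R := by
      simp [Complex.norm_exp_ofReal_mul_I, abs_of_pos hR]
    rw [Complex.exp_sub, hfe, hh _ hn]
    field_simp
    simp
  have h2 := eqOn_of_exp_eq_const isPreconnected_univ (f := fun θ : ℝ =>
    f (p + R * Complex.exp (θ * Complex.I)) - θ * Complex.I) (by fun_prop) h1
    (mem_univ 0) (mem_univ (2 * Real.pi))
  simp only [Complex.ofReal_zero, zero_mul, Complex.exp_zero, mul_one, sub_zero,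
    Complex.ofReal_mul, Complex.ofReal_ofNat, Complex.exp_two_pi_mul_I] at h2
  exact Complex.two_pi_I_ne_zero (by linear_combination h2)

/-- The frontier of a nonempty bounded set is not contained in an arc disjoint from it. -/
theorem not_frontier_subset_arc {V : Set ℂ} (hVb : Bornology.IsBounded V)
    (hVn : V.Nonempty) {e : ℝ → ℂ} {c d : ℝ} (hcd : c ≤ d) (he : ContinuousOn e (Icc c d))
    (hinj : InjOn e (Icc c d)) (hdisj : ∀ t ∈ Icc c d, e t ∉ V) :
    ¬ frontier V ⊆ e '' Icc c d := by
  intro hfr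
  obtain ⟨p, hp⟩ := hVn
  -- The arc, prolonged by constants to the whole line, never meets p ∈ V, so e - p has a continuous
  -- logarithm along it.
  obtain ⟨ℓ, hℓ, hℓe⟩ := exists_continuous_log (X := ℝ) (g := fun t => IccExtend hcd
    ((Icc c d).domRestrict e) t - p) (by
      refine Continuous.sub ?_ continuous_const
      exact (continuousOn_iff_continuous_domRestrict.1 he).Icc_extend') (by
      intro t ht
      rw [sub_eq_zero] at ht
      refine hdisj _ (projIcc c d hcd t).2 ?_
      rw [IccExtend] at ht
      change e _ = p at ht
      rwa [ht])
  have hemb : IsClosedEmbedding ((Icc c d).domRestrict e) :=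
    (continuousOn_iff_continuous_domRestrict.1 he).isClosedEmbedding
      (injOn_iff_injective.1 hinj)
  -- An injective arc is a closed embedding, so by Tietze's theorem the logarithm extends from the
  -- arc to the plane.
  obtain ⟨G, hG⟩ := ContinuousMap.exists_extension hemb
    ⟨(Icc c d).domRestrict ℓ, hℓ.comp continuous_subtype_val⟩
  have hG' : ∀ z ∈ frontier V, Complex.exp (G z) = z - p := by
    intro z hz
    obtain ⟨t, ht, rfl⟩ := hfr hz
    have h1 := DFunLike.congr_fun hG ⟨t, ht⟩
    change G (e t) = ℓ t at h1
    rw [h1, hℓe, IccExtend_of_mem hcd _ ht]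
    simp
  classical
  obtain ⟨R, hR⟩ := hVb.subset_ball p
  have hR0 : 0 < R := by simpa using hR hp
  -- The functions exp G on V and z - p off V agree on the frontier, which lies in the arc. The
  -- glued function is continuous, has no zero because p ∈ V, and is z - p on a large circle: a
  -- contradiction.
  obtain ⟨z, hz⟩ := exists_eq_zero_of_eq_sub (h := V.piecewise (fun z => Complex.exp (G z))
    (fun z => z - p)) (Continuous.piecewise (fun z hz => hG' z hz) (by fun_prop) (by fun_prop))
    hR0 (by
      intro z hz
      rw [piecewise_eq_of_notMem]
      intro hzV
      have := hR hzV
      rw [Metric.mem_ball, dist_eq_norm] at this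
      linarith)
  by_cases hzV : z ∈ V
  · rw [piecewise_eq_of_mem _ _ _ hzV] at hz
    exact Complex.exp_ne_zero _ hz
  · rw [piecewise_eq_of_notMem _ _ _ hzV, sub_eq_zero] at hz
    exact hzV (hz ▸ hp)

end Cross

namespace Cross

/-! ### Cauchy integrals over the unit interval -/

/-- The denominator p - qζ serves two purposes: q = 1 gives Cauchy integrals over a curve p, and p =
1 gives their expansion in the coordinate 1/z at infinity. -/
theorem hasDerivAt_integral_div {φ : ℝ → ℂ} (hφ : IntervalIntegrable φ volume 0 1) {p q : ℝ → ℂ}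
    (hp : ContinuousOn p (Icc 0 1)) (hq : ContinuousOn q (Icc 0 1)) {ζ : ℂ}
    (h0 : ∀ t ∈ Icc (0 : ℝ) 1, p t - q t * ζ ≠ 0) :
    HasDerivAt (fun ζ => ∫ t in (0 : ℝ)..1, φ t / (p t - q t * ζ))
      (∫ t in (0 : ℝ)..1, φ t * q t / (p t - q t * ζ) ^ 2) ζ := by
  have hne : (Icc (0 : ℝ) 1).Nonempty := ⟨0, by simp⟩
  obtain ⟨t₀, ht₀, hmin⟩ := isCompact_Icc.exists_isMinOn hne
    (f := fun t => ‖p t - q t * ζ‖) (by fun_prop)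
  obtain ⟨t₁, ht₁, hmax⟩ := isCompact_Icc.exists_isMaxOn hne (f := fun t => ‖q t‖) (by fun_prop)
  set m := ‖p t₀ - q t₀ * ζ‖ with hm
  have hm0 : 0 < m := norm_pos_iff.2 (h0 t₀ ht₀)
  set Q := ‖q t₁‖ with hQ
  have hQ0 : 0 ≤ Q := norm_nonneg _
  -- On this ball q(t)x moves by at most m/2, half of the minimum modulus of the denominator at ζ;
  -- the summand 1 in Q + 1 covers the case Q = 0.
  have hlow : ∀ t ∈ Icc (0 : ℝ) 1, ∀ x ∈ Metric.ball ζ (m / (2 * (Q + 1))),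
      m / 2 ≤ ‖p t - q t * x‖ := by
    intro t ht x hx
    rw [Metric.mem_ball, dist_eq_norm] at hx
    have h1 : m ≤ ‖p t - q t * ζ‖ := hmin ht
    have h2 : ‖q t‖ ≤ Q := hmax ht
    have h3 : p t - q t * ζ = (p t - q t * x) + q t * (x - ζ) := by ring
    have h4 : ‖q t * (x - ζ)‖ ≤ m / 2 := by
      rw [norm_mul]
      calc ‖q t‖ * ‖x - ζ‖ ≤ (Q + 1) * (m / (2 * (Q + 1))) := by
            gcongr; linarith
        _ = m / 2 := by field_simp
    have := norm_add_le (p t - q t * x) (q t * (x - ζ))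
    rw [← h3] at this
    linarith
  have huI : ∀ t ∈ uIoc (0 : ℝ) 1, t ∈ Icc (0 : ℝ) 1 := by
    intro t ht; rw [uIoc_of_le zero_le_one] at ht; exact ⟨ht.1.le, ht.2⟩
  have hmball : ζ ∈ Metric.ball ζ (m / (2 * (Q + 1))) := Metric.mem_ball_self (by positivity)
  have hcont : ∀ x ∈ Metric.ball ζ (m / (2 * (Q + 1))),
      ContinuousOn (fun t => (p t - q t * x)⁻¹) (uIcc 0 1) := by
    intro x hx
    rw [uIcc_of_le zero_le_one]
    refine ContinuousOn.inv₀ (by fun_prop) fun t ht => ?_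
    exact norm_pos_iff.1 (lt_of_lt_of_le (by positivity) (hlow t ht x hx))
  have hint : ∀ x ∈ Metric.ball ζ (m / (2 * (Q + 1))),
      IntervalIntegrable (fun t => φ t / (p t - q t * x)) volume 0 1 := by
    intro x hx
    simp only [div_eq_mul_inv]
    exact hφ.mul_continuousOn (hcont x hx)
  refine (intervalIntegral.hasDerivAt_integral_of_dominated_loc_of_deriv_le
    (F := fun ζ t => φ t / (p t - q t * ζ))
    (F' := fun ζ t => φ t * q t / (p t - q t * ζ) ^ 2)
    (bound := fun t => ‖φ t‖ * (Q / (m / 2) ^ 2))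
    (Metric.ball_mem_nhds ζ (show 0 < m / (2 * (Q + 1)) by positivity)) ?_ (hint ζ hmball) ?_ ?_
      ?_ ?_).2
  · filter_upwards [Metric.ball_mem_nhds ζ (show 0 < m / (2 * (Q + 1)) by positivity)] with x hx
    have := (hint x hx).aestronglyMeasurable_restrict_uIoc
    exact this
  · have : IntervalIntegrable (fun t => φ t * (q t * ((p t - q t * ζ)⁻¹) ^ 2)) volume 0 1 := by
      refine hφ.mul_continuousOn (ContinuousOn.mul ?_ ((hcont ζ hmball).pow 2))
      rwa [uIcc_of_le zero_le_one]
    have := this.aestronglyMeasurable_restrict_uIoc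
    refine this.congr (Eventually.of_forall fun t => ?_)
    simp only [div_eq_mul_inv, inv_pow]
    ring
  · refine Eventually.of_forall fun t ht x hx => ?_
    rw [norm_div, norm_mul, norm_pow, mul_div_assoc]
    have h1 := hlow t (huI t ht) x hx
    have h2 : ‖q t‖ ≤ Q := hmax (huI t ht)
    gcongr
  · exact hφ.norm.mul_const _
  · refine Eventually.of_forall fun t ht x hx => ?_
    have h1 : p t - q t * x ≠ 0 :=
      norm_pos_iff.1 (lt_of_lt_of_le (by positivity) (hlow t (huI t ht) x hx))
    have h2 : HasDerivAt (fun x => p t - q t * x) (-q t) x := by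
      simpa using ((hasDerivAt_id x).const_mul (q t)).const_sub (p t)
    have := (hasDerivAt_const x (φ t)).div h2 h1
    convert! this using 1
    ring

/-- The Cauchy integral over the unit interval. -/
noncomputable def cauchy (φ : ℝ → ℂ) (ζ : ℂ) : ℂ := ∫ t in (0 : ℝ)..1, φ t / (t - ζ)

/-- The unit interval as a subset of the plane. -/
def unitSeg : Set ℂ := (fun t : ℝ => (t : ℂ)) '' Icc 0 1

theorem isClosed_unitSeg : IsClosed unitSeg :=
  (isCompact_Icc.image Complex.continuous_ofReal).isClosed

theorem sub_ne_zero_of_notMem_unitSeg {ζ : ℂ} (hζ : ζ ∉ unitSeg) {t : ℝ} (ht : t ∈ Icc (0 : ℝ) 1) :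
    (t : ℂ) - ζ ≠ 0 := fun h => hζ ⟨t, ht, sub_eq_zero.1 h⟩

theorem hasDerivAt_cauchy {φ : ℝ → ℂ} (hφ : IntervalIntegrable φ volume 0 1) {ζ : ℂ}
    (hζ : ζ ∉ unitSeg) :
    HasDerivAt (cauchy φ) (∫ t in (0 : ℝ)..1, φ t / (t - ζ) ^ 2) ζ := by
  have := hasDerivAt_integral_div hφ (p := fun t => (t : ℂ)) (q := fun _ => 1) (by fun_prop)
    (by fun_prop) (ζ := ζ) (fun t ht => by simpa using sub_ne_zero_of_notMem_unitSeg hζ ht)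
  change HasDerivAt (fun ζ => ∫ t in (0 : ℝ)..1, φ t / (t - ζ)) _ _
  simpa using this

theorem analyticAt_cauchy {φ : ℝ → ℂ} (hφ : IntervalIntegrable φ volume 0 1) {ζ : ℂ}
    (hζ : ζ ∉ unitSeg) : AnalyticAt ℂ (cauchy φ) ζ := by
  rw [Complex.analyticAt_iff_eventually_differentiableAt]
  filter_upwards [isClosed_unitSeg.isOpen_compl.mem_nhds hζ] with z hz
  exact (hasDerivAt_cauchy hφ hz).differentiableAt

theorem intervalIntegrable_div_sub {φ : ℝ → ℂ} (hφ : IntervalIntegrable φ volume 0 1) {ζ : ℂ}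
    (hζ : ζ ∉ unitSeg) : IntervalIntegrable (fun t : ℝ => φ t / (t - ζ)) volume 0 1 := by
  simp only [div_eq_mul_inv]
  refine hφ.mul_continuousOn (ContinuousOn.inv₀ (by fun_prop) fun t ht => ?_)
  rw [uIcc_of_le zero_le_one] at ht
  exact sub_ne_zero_of_notMem_unitSeg hζ ht

/-- `F` is Lipschitz on `(0, 1]` as a function of the logarithm of its argument. -/
def LogLipschitz (M : ℝ) (F : ℝ → ℂ) : Prop :=
  ∀ t ∈ Ioc (0 : ℝ) 1, ∀ u ∈ Ioc (0 : ℝ) 1, ‖F t - F u‖ ≤ M * |Real.log t - Real.log u|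

theorem LogLipschitz.continuousOn {M : ℝ} {F : ℝ → ℂ} (hF : LogLipschitz M F) :
    ContinuousOn F (Ioc 0 1) := by
  intro t ht
  rw [ContinuousWithinAt, tendsto_iff_norm_sub_tendsto_zero]
  refine squeeze_zero' (Eventually.of_forall fun _ => norm_nonneg _)
    (eventually_mem_nhdsWithin.mono fun u hu => hF u hu t ht) ?_
  have : Tendsto (fun u => M * |Real.log u - Real.log t|) (𝓝[Ioc 0 1] t)
      (𝓝 (M * |Real.log t - Real.log t|)) :=
    ((((Real.continuousAt_log ht.1.ne').tendsto.mono_left nhdsWithin_le_nhds).sub_const _).abs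
      ).const_mul M
  simpa using this

theorem LogLipschitz.norm_le {M : ℝ} {F : ℝ → ℂ} (hF : LogLipschitz M F) {t : ℝ}
    (ht : t ∈ Ioc (0 : ℝ) 1) : ‖F t‖ ≤ ‖F 1‖ + M * |Real.log t| := by
  have h := hF t ht 1 (by simp)
  rw [Real.log_one, sub_zero] at h
  have := norm_le_insert' (F t) (F 1)
  linarith

theorem LogLipschitz.nonneg {M : ℝ} {F : ℝ → ℂ} (hF : LogLipschitz M F) : 0 ≤ M := by
  have h := hF (Real.exp (-1)) ⟨Real.exp_pos _, by simp⟩ 1 (by simp)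
  simp only [Real.log_exp, Real.log_one, sub_zero, abs_neg, abs_one, mul_one] at h
  exact (norm_nonneg _).trans h

theorem LogLipschitz.intervalIntegrable {M : ℝ} {F : ℝ → ℂ} (hF : LogLipschitz M F) :
    IntervalIntegrable (fun t => F t / (Real.sqrt t : ℂ)) volume 0 1 := by
  have hM := hF.nonneg
  -- Since |log t| ≤ 4 t^(-1/4) on (0, 1], these two integrable powers dominate the integrand.
  have hg : IntervalIntegrable (fun t : ℝ => ‖F 1‖ * t ^ (-(1 / 2) : ℝ) +
      M * 4 * t ^ (-(3 / 4) : ℝ)) volume 0 1 :=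
    ((intervalIntegral.intervalIntegrable_rpow' (by norm_num)).const_mul _).add
      ((intervalIntegral.intervalIntegrable_rpow' (by norm_num)).const_mul _)
  refine hg.mono_fun ?_ ?_
  · rw [uIoc_of_le zero_le_one]
    refine ContinuousOn.aestronglyMeasurable ?_ measurableSet_Ioc
    refine hF.continuousOn.div (by fun_prop) fun t ht => ?_
    simpa using (Real.sqrt_pos.2 ht.1).ne'
  · rw [uIoc_of_le zero_le_one, EventuallyLE, ae_restrict_iff' measurableSet_Ioc]
    refine Eventually.of_forall fun t ht => ?_
    have h1 := hF.norm_le ht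
    have h2 := Real.abs_log_mul_self_rpow_lt t (1 / 4) ht.1 ht.2 (by norm_num)
    rw [abs_mul, abs_of_pos (Real.rpow_pos_of_pos ht.1 _)] at h2
    have h4 : |Real.log t| * t ^ (-(1 / 2) : ℝ) ≤ 4 * t ^ (-(3 / 4) : ℝ) := by
      have e : t ^ (-(1 / 2) : ℝ) = t ^ (1 / 4 : ℝ) * t ^ (-(3 / 4) : ℝ) := by
        rw [← Real.rpow_add ht.1]; norm_num
      rw [e, ← mul_assoc]
      have := Real.rpow_pos_of_pos ht.1 (-(3 / 4) : ℝ)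
      gcongr
      linarith
    have h5 : ‖F t / (Real.sqrt t : ℂ)‖ = ‖F t‖ * t ^ (-(1 / 2) : ℝ) := by
      rw [norm_div, Complex.norm_real, Real.norm_of_nonneg (Real.sqrt_nonneg _),
        Real.rpow_neg ht.1.le, Real.sqrt_eq_rpow, div_eq_mul_inv]
    have h6 := Real.rpow_pos_of_pos ht.1 (-(1 / 2) : ℝ)
    rw [h5]
    refine le_trans ?_ (le_abs_self _)
    calc ‖F t‖ * t ^ (-(1 / 2) : ℝ) ≤ (‖F 1‖ + M * |Real.log t|) * t ^ (-(1 / 2) : ℝ) := by gcongr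
      _ = ‖F 1‖ * t ^ (-(1 / 2) : ℝ) + M * (|Real.log t| * t ^ (-(1 / 2) : ℝ)) := by ring
      _ ≤ ‖F 1‖ * t ^ (-(1 / 2) : ℝ) + M * (4 * t ^ (-(3 / 4) : ℝ)) := by gcongr
      _ = _ := by ring

theorem log_sub_log_le {x y : ℝ} (hx : 0 < x) (hxy : x ≤ y) :
    Real.log y - Real.log x ≤ (y - x) / x := by
  rw [← Real.log_div (by linarith) hx.ne']
  refine (Real.log_le_sub_one_of_pos (div_pos (by linarith) hx)).trans_eq ?_
  field_simp

theorem abs_log_sub_log_le {δ x y : ℝ} (hδ : 0 < δ) (hx : δ ≤ x) (hy : δ ≤ y) :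
    |Real.log x - Real.log y| ≤ |x - y| / δ := by
  rcases le_total x y with h | h
  · have := log_sub_log_le (hδ.trans_le hx) h
    rw [abs_sub_comm, abs_sub_comm x y,
      abs_of_nonneg (sub_nonneg.2 (Real.log_le_log (hδ.trans_le hx) h)),
      abs_of_nonneg (sub_nonneg.2 h)]
    exact this.trans (by gcongr)
  · have := log_sub_log_le (hδ.trans_le hy) h
    rw [abs_of_nonneg (sub_nonneg.2 (Real.log_le_log (hδ.trans_le hy) h)),
      abs_of_nonneg (sub_nonneg.2 h)]
    exact this.trans (by gcongr)

/-- Away from 0 both the logarithm and 1/√t are Lipschitz. This provides the local regularity needed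
for the Plemelj formula and at the endpoint t = 1. -/
theorem LogLipschitz.exists_lipschitz {M : ℝ} {F : ℝ → ℂ} (hF : LogLipschitz M F) {δ : ℝ}
    (hδ : 0 < δ) : ∃ C, 0 ≤ C ∧ ∀ t ∈ Icc δ 1, ∀ u ∈ Icc δ 1,
      ‖F t / (Real.sqrt t : ℂ) - F u / (Real.sqrt u : ℂ)‖ ≤ C * |t - u| := by
  have hM := hF.nonneg
  set s := Real.sqrt δ with hs
  have hs0 : 0 < s := Real.sqrt_pos.2 hδ
  refine ⟨M / δ / s + (‖F 1‖ + M * |Real.log δ|) * (1 / (2 * s * (s * s))), by positivity,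
    fun t ht u hu => ?_⟩
  have ht0 := hδ.trans_le ht.1
  have hu0 := hδ.trans_le hu.1
  have hst : s ≤ Real.sqrt t := Real.sqrt_le_sqrt ht.1
  have hsu : s ≤ Real.sqrt u := Real.sqrt_le_sqrt hu.1
  have hst0 := hs0.trans_le hst
  have hsu0 := hs0.trans_le hsu
  have e : F t / (Real.sqrt t : ℂ) - F u / (Real.sqrt u : ℂ) =
      (F t - F u) / (Real.sqrt t : ℂ) +
        F u * (((Real.sqrt u - Real.sqrt t) / (Real.sqrt t * Real.sqrt u) : ℝ) : ℂ) := by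
    have h1 : (Real.sqrt t : ℂ) ≠ 0 := by exact_mod_cast hst0.ne'
    have h2 : (Real.sqrt u : ℂ) ≠ 0 := by exact_mod_cast hsu0.ne'
    push_cast
    field_simp
    ring
  have h1 : ‖(F t - F u) / (Real.sqrt t : ℂ)‖ ≤ M / δ / s * |t - u| := by
    rw [norm_div, Complex.norm_real, Real.norm_of_nonneg (Real.sqrt_nonneg _)]
    calc ‖F t - F u‖ / Real.sqrt t ≤ (M * (|t - u| / δ)) / s := by
          gcongr
          exact (hF t ⟨ht0, ht.2⟩ u ⟨hu0, hu.2⟩).trans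
            (by gcongr; exact abs_log_sub_log_le hδ ht.1 hu.1)
      _ = _ := by ring
  have h2 : |(Real.sqrt u - Real.sqrt t) / (Real.sqrt t * Real.sqrt u)| ≤
      1 / (2 * s * (s * s)) * |t - u| := by
    have h3 : t - u = (Real.sqrt t - Real.sqrt u) * (Real.sqrt t + Real.sqrt u) := by
      have := Real.mul_self_sqrt ht0.le
      have := Real.mul_self_sqrt hu0.le
      linarith
    rw [abs_div, abs_of_pos (by positivity : 0 < Real.sqrt t * Real.sqrt u), h3, abs_mul,
      abs_of_pos (by positivity : 0 < Real.sqrt t + Real.sqrt u), abs_sub_comm]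
    rw [div_le_iff₀ (by positivity)]
    have h4 : 2 * s ≤ Real.sqrt t + Real.sqrt u := by linarith
    have h5 : s * s ≤ Real.sqrt t * Real.sqrt u := by gcongr
    have h6 : 1 ≤ 1 / (2 * s * (s * s)) *
        ((Real.sqrt t + Real.sqrt u) * (Real.sqrt t * Real.sqrt u)) := by
      rw [one_div, ← div_eq_inv_mul, le_div_iff₀ (by positivity), one_mul]
      gcongr
    nlinarith [abs_nonneg (Real.sqrt t - Real.sqrt u)]
  have h3 : ‖F u‖ ≤ ‖F 1‖ + M * |Real.log δ| := by
    refine (hF.norm_le ⟨hu0, hu.2⟩).trans ?_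
    gcongr 2
    rw [abs_of_nonpos (Real.log_nonpos hu0.le hu.2),
      abs_of_nonpos (Real.log_nonpos hδ.le (hu.1.trans hu.2))]
    have := Real.log_le_log hδ hu.1
    linarith
  rw [e]
  refine (norm_add_le _ _).trans ?_
  rw [add_mul, norm_mul, Complex.norm_real, Real.norm_eq_abs, mul_assoc (‖F 1‖ + _)]
  gcongr

/-! #### Behavior at the endpoint with a square-root singularity -/

/-- With p = x^(1/4) and q = y^(1/4) the left side is 4(log q - log p) ≤ 4(q - p)/p, and (q - p)q³ ≤
q⁴ - p⁴. The weights 1/4 and 3/4 are chosen so that, after multiplication by t^(-1/2), the bound is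
integrable both towards 0 and away from it. -/
theorem log_sub_log_le_rpow {x y : ℝ} (hx : 0 < x) (hxy : x ≤ y) :
    Real.log y - Real.log x ≤ 4 * (y - x) / (x ^ (1 / 4 : ℝ) * y ^ (3 / 4 : ℝ)) := by
  have hy : 0 < y := hx.trans_le hxy
  set p := x ^ (1 / 4 : ℝ) with hp
  set q := y ^ (1 / 4 : ℝ) with hq
  have hp0 : 0 < p := Real.rpow_pos_of_pos hx _
  have hq0 : 0 < q := Real.rpow_pos_of_pos hy _
  have hpx : p ^ 4 = x := by
    rw [hp, ← Real.rpow_natCast, ← Real.rpow_mul hx.le]; norm_num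
  have hqy : q ^ 4 = y := by
    rw [hq, ← Real.rpow_natCast, ← Real.rpow_mul hy.le]; norm_num
  have hq3 : y ^ (3 / 4 : ℝ) = q ^ 3 := by
    rw [hq, ← Real.rpow_natCast, ← Real.rpow_mul hy.le]; norm_num
  have hpq : p ≤ q := Real.rpow_le_rpow hx.le hxy (by norm_num)
  have h := log_sub_log_le hp0 hpq
  rw [hq3, ← hpx, ← hqy, Real.log_pow, Real.log_pow]
  push_cast
  rw [le_div_iff₀ (by positivity)]
  rw [le_div_iff₀ hp0] at h
  have h1 : p ^ 3 ≤ q ^ 3 := by gcongr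
  nlinarith [pow_pos hq0 3, mul_le_mul_of_nonneg_right h (pow_pos hq0 3).le,
    mul_le_mul_of_nonneg_left h1 hp0.le]

theorem norm_sub_ge (t : ℝ) (ht : 0 ≤ t) (ζ : ℂ) : |t - ‖ζ‖| ≤ ‖(t : ℂ) - ζ‖ := by
  have := abs_norm_sub_norm_le (t : ℂ) ζ
  rwa [Complex.norm_real, Real.norm_of_nonneg ht] at this

/-- With q² = ζ the integrand has the primitive -(1/q)(log(√t + q) - log(√t - q)). The choice q =
-i√(-ζ) has negative imaginary part, so both arguments stay off the real axis for every t. -/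
theorem integral_inv_sqrt_mul_sub {ζ : ℂ} (hζ : -ζ ∈ Complex.slitPlane) :
    (-ζ) ^ (1 / 2 : ℂ) * ∫ t in (0 : ℝ)..1, 1 / (Real.sqrt t : ℂ) / (t - ζ) =
      Real.pi - Complex.I * (Complex.log (1 + -Complex.I * (-ζ) ^ (1 / 2 : ℂ)) -
        Complex.log (1 + Complex.I * (-ζ) ^ (1 / 2 : ℂ))) := by
  set η := (-ζ) ^ (1 / 2 : ℂ) with hη
  have hζ0 : -ζ ≠ 0 := Complex.slitPlane_ne_zero hζ
  have hη2 : η ^ 2 = -ζ := by rw [hη, one_div, Complex.cpow_ofNat_inv_pow]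
  have hre : 0 < η.re := by
    rw [hη, Complex.cpow_def_of_ne_zero hζ0, Complex.exp_re]
    have ha := Complex.neg_pi_lt_arg (-ζ)
    have hb := lt_of_le_of_ne (Complex.arg_le_pi (-ζ)) (Complex.mem_slitPlane_iff_arg.1 hζ).1
    have him : (Complex.log (-ζ) * (1 / 2)).im = (-ζ).arg / 2 := by
      rw [show (1 / 2 : ℂ) = ((1 / 2 : ℝ) : ℂ) by norm_num, Complex.im_mul_ofReal, Complex.log_im]
      ring
    rw [him]
    exact mul_pos (Real.exp_pos _) (Real.cos_pos_of_mem_Ioo ⟨by linarith, by linarith⟩)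
  set q := -Complex.I * η with hq
  have hqim : q.im < 0 := by simpa [hq] using hre
  have hq2 : q ^ 2 = ζ := by rw [hq, mul_pow, hη2]; simp
  have hq0 : q ≠ 0 := by rintro h; rw [h] at hqim; simp at hqim
  have hzseg : ζ ∉ unitSeg := by
    rintro ⟨t, ht, rfl⟩
    rw [Complex.mem_slitPlane_iff] at hζ
    simp at hζ
    linarith [ht.1]
  have hslit1 : ∀ y : ℝ, (y : ℂ) + q ∈ Complex.slitPlane := fun y => Or.inr (by
    simpa using hqim.ne)
  have hslit2 : ∀ y : ℝ, (y : ℂ) - q ∈ Complex.slitPlane := fun y => Or.inr (by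
    simpa using hqim.ne)
  have key := intervalIntegral.integral_eq_sub_of_hasDerivAt_of_le (a := 0) (b := 1) zero_le_one
    (f := fun t : ℝ => -(1 / q) * (Complex.log ((Real.sqrt t : ℂ) + q) -
      Complex.log ((Real.sqrt t : ℂ) - q)))
    (f' := fun t : ℝ => 1 / (Real.sqrt t : ℂ) / (t - ζ)) (by
      have c1 : Continuous fun t : ℝ => Complex.log ((Real.sqrt t : ℂ) + q) :=
        Continuous.clog (by fun_prop) (fun t => hslit1 _)
      have c2 : Continuous fun t : ℝ => Complex.log ((Real.sqrt t : ℂ) - q) :=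
        Continuous.clog (by fun_prop) (fun t => hslit2 _)
      fun_prop) (by
      intro t ht
      have hs : HasDerivAt (fun t : ℝ => (Real.sqrt t : ℂ)) ((1 / (2 * Real.sqrt t) : ℝ) : ℂ) t :=
        (Real.hasDerivAt_sqrt ht.1.ne').ofReal_comp
      have h1 := (hs.add_const q).clog_real (hslit1 (Real.sqrt t))
      have h2 := (hs.sub_const q).clog_real (hslit2 (Real.sqrt t))
      have h3 := (h1.sub h2).const_mul (-(1 / q))
      convert! h3 using 1
      have hs0 : (Real.sqrt t : ℂ) ≠ 0 := by exact_mod_cast (Real.sqrt_pos.2 ht.1).ne'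
      have hs2 : (t : ℂ) = (Real.sqrt t : ℂ) ^ 2 := by
        rw [← Complex.ofReal_pow, Real.sq_sqrt ht.1.le]
      have n1 := Complex.slitPlane_ne_zero (hslit1 (Real.sqrt t))
      have n2 := Complex.slitPlane_ne_zero (hslit2 (Real.sqrt t))
      have n3 : (Real.sqrt t : ℂ) ^ 2 - q ^ 2 ≠ 0 := by
        rw [sq_sub_sq]; exact mul_ne_zero n1 n2
      rw [hs2, ← hq2]
      push_cast
      field_simp
      ring) (by
      have : LogLipschitz 0 (fun _ => 1) := by intro t _ u _; simp
      exact intervalIntegrable_div_sub this.intervalIntegrable hzseg)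
  rw [key]
  simp only [Real.sqrt_one, Real.sqrt_zero, Complex.ofReal_one, Complex.ofReal_zero, zero_add,
    zero_sub]
  -- As q lies in the lower half plane, arg(-q) = arg q + π; this is the source of the main term π.
  have hlog : Complex.log (-q) - Complex.log q = Real.pi * Complex.I := by
    apply Complex.ext
    · simp [Complex.log_re]
    · simp [Complex.log_im, Complex.arg_neg_eq_arg_add_pi_of_im_neg hqim]
  have hη0 : η ≠ 0 := by rintro h; rw [h] at hre; simp at hre
  have hηq : η * (1 / q) = Complex.I := by
    rw [hq]; field_simp; simp
  have hmq : (1 : ℂ) + Complex.I * η = 1 - q := by rw [hq]; ring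
  rw [hmq]
  linear_combination (-(Complex.log (1 + q) - Complex.log (1 - q)) +
    (Complex.log q - Complex.log (-q))) * hηq - Complex.I * hlog - Real.pi * Complex.I_sq

end Cross

/-! ### Cauchy integrals with a square-root singularity -/

namespace Cross

/-- The increment of F from t to |ζ| is controlled by |t - |ζ||, which is at most |t - ζ| and
cancels the kernel. What remains is 4M|ζ|^(-3/4) t^(-3/4) below |ζ| and 4M|ζ|^(-1/4) t^(-5/4) above
it; each integrates to at most 16M|ζ|^(-1/2). -/
theorem norm_integral_le_of_logLipschitz {M : ℝ} {F : ℝ → ℂ} (hF : LogLipschitz M F) {ζ : ℂ}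
    (h0 : 0 < ‖ζ‖) (h1 : ‖ζ‖ ≤ 1) (hζ : ζ ∉ unitSeg) :
    ‖∫ t in (0 : ℝ)..1, (F t - F ‖ζ‖) / (Real.sqrt t : ℂ) / (t - ζ)‖ ≤
      32 * M * ‖ζ‖ ^ (-(1 / 2) : ℝ) := by
  have hM := hF.nonneg
  set r := ‖ζ‖ with hr
  have hint : IntervalIntegrable (fun t : ℝ => (F t - F r) / (Real.sqrt t : ℂ) / (t - ζ))
      volume 0 1 := by
    refine intervalIntegrable_div_sub ?_ hζ
    refine LogLipschitz.intervalIntegrable (M := M) (F := fun t => F t - F r) ?_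
    intro t ht u hu
    simpa using hF t ht u hu
  have hi1 : IntervalIntegrable (fun t : ℝ => (F t - F r) / (Real.sqrt t : ℂ) / (t - ζ))
      volume 0 r := hint.mono_set (by
    rw [uIcc_of_le h0.le, uIcc_of_le zero_le_one]; exact Icc_subset_Icc_right h1)
  have hi2 : IntervalIntegrable (fun t : ℝ => (F t - F r) / (Real.sqrt t : ℂ) / (t - ζ))
      volume r 1 := hint.mono_set (by
    rw [uIcc_of_le h1, uIcc_of_le zero_le_one]; exact Icc_subset_Icc_left h0.le)
  rw [← intervalIntegral.integral_add_adjacent_intervals hi1 hi2]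
  have hpt : ∀ t ∈ Ioc (0 : ℝ) 1, ∀ D : ℝ, |Real.log t - Real.log r| ≤ D * |t - r| → 0 ≤ D →
      ‖(F t - F r) / (Real.sqrt t : ℂ) / (t - ζ)‖ ≤ M * D * t ^ (-(1 / 2) : ℝ) := by
    intro t ht D hD hD0
    have ha := hF t ht r ⟨h0, h1⟩
    have hb := norm_sub_ge t ht.1.le ζ
    have hc : 0 < ‖(t : ℂ) - ζ‖ :=
      norm_pos_iff.2 (sub_ne_zero_of_notMem_unitSeg hζ ⟨ht.1.le, ht.2⟩)
    have hs : ‖(Real.sqrt t : ℂ)‖ = Real.sqrt t := by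
      rw [Complex.norm_real, Real.norm_of_nonneg (Real.sqrt_nonneg _)]
    have hs0 := Real.sqrt_pos.2 ht.1
    rw [norm_div, norm_div, hs, Real.rpow_neg ht.1.le, ← Real.sqrt_eq_rpow, ← div_eq_mul_inv,
      div_div, div_le_div_iff₀ (by positivity) hs0]
    have : ‖F t - F r‖ ≤ M * D * ‖(t : ℂ) - ζ‖ := by
      calc ‖F t - F r‖ ≤ M * (D * |t - r|) := ha.trans (by gcongr)
        _ ≤ M * (D * ‖(t : ℂ) - ζ‖) := by gcongr
        _ = _ := by ring
    nlinarith
  have hr34 : 0 < r ^ (3 / 4 : ℝ) := Real.rpow_pos_of_pos h0 _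
  have hr14 : 0 < r ^ (1 / 4 : ℝ) := Real.rpow_pos_of_pos h0 _
  have b1 : ‖∫ t in (0 : ℝ)..r, (F t - F r) / (Real.sqrt t : ℂ) / (t - ζ)‖ ≤
      ∫ t in (0 : ℝ)..r, 4 * M * r ^ (-(3 / 4) : ℝ) * t ^ (-(3 / 4) : ℝ) := by
    refine intervalIntegral.norm_integral_le_of_norm_le h0.le ?_
      ((intervalIntegral.intervalIntegrable_rpow' (by norm_num)).const_mul _)
    refine Eventually.of_forall fun t ht => ?_
    have ht14 := Real.rpow_pos_of_pos ht.1 (1 / 4 : ℝ)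
    refine (hpt t ⟨ht.1, ht.2.trans h1⟩ (4 / (t ^ (1 / 4 : ℝ) * r ^ (3 / 4 : ℝ))) ?_
      (by positivity)).trans_eq ?_
    · rw [abs_sub_comm, abs_of_nonneg (sub_nonneg.2 (Real.log_le_log ht.1 ht.2)), abs_sub_comm,
        abs_of_nonneg (sub_nonneg.2 ht.2), div_mul_eq_mul_div]
      exact log_sub_log_le_rpow ht.1 ht.2
    · have e : t ^ (-(3 / 4) : ℝ) = t ^ (-(1 / 2) : ℝ) * t ^ (-(1 / 4) : ℝ) := by
        rw [← Real.rpow_add ht.1]; norm_num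
      rw [e, Real.rpow_neg ht.1.le (1 / 4), Real.rpow_neg h0.le]
      field_simp
  have b2 : ‖∫ t in r..(1 : ℝ), (F t - F r) / (Real.sqrt t : ℂ) / (t - ζ)‖ ≤
      ∫ t in r..(1 : ℝ), 4 * M * r ^ (-(1 / 4) : ℝ) * t ^ (-(5 / 4) : ℝ) := by
    refine intervalIntegral.norm_integral_le_of_norm_le h1 ?_ ?_
    · refine Eventually.of_forall fun t ht => ?_
      have ht0 := h0.trans ht.1
      have ht34 := Real.rpow_pos_of_pos ht0 (3 / 4 : ℝ)
      refine (hpt t ⟨ht0, ht.2⟩ (4 / (r ^ (1 / 4 : ℝ) * t ^ (3 / 4 : ℝ))) ?_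
        (by positivity)).trans_eq ?_
      · rw [abs_of_nonneg (sub_nonneg.2 (Real.log_le_log h0 ht.1.le)),
          abs_of_nonneg (sub_nonneg.2 ht.1.le), div_mul_eq_mul_div]
        exact log_sub_log_le_rpow h0 ht.1.le
      · have e : t ^ (-(5 / 4) : ℝ) = t ^ (-(1 / 2) : ℝ) * t ^ (-(3 / 4) : ℝ) := by
          rw [← Real.rpow_add ht0]; norm_num
        rw [e, Real.rpow_neg ht0.le (3 / 4), Real.rpow_neg h0.le]
        field_simp
    · refine (intervalIntegral.intervalIntegrable_rpow (Or.inr ?_)).const_mul _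
      rw [uIcc_of_le h1]
      exact fun h => absurd h.1 (not_le.2 h0)
  have c1 : ∫ t in (0 : ℝ)..r, 4 * M * r ^ (-(3 / 4) : ℝ) * t ^ (-(3 / 4) : ℝ) =
      16 * M * r ^ (-(1 / 2) : ℝ) := by
    rw [intervalIntegral.integral_const_mul, integral_rpow (Or.inl (by norm_num))]
    have e : r ^ (-(1 / 2) : ℝ) = r ^ (-(3 / 4) : ℝ) * r ^ (1 / 4 : ℝ) := by
      rw [← Real.rpow_add h0]; norm_num
    rw [e]
    norm_num
    ring
  have c2 : ∫ t in r..(1 : ℝ), 4 * M * r ^ (-(1 / 4) : ℝ) * t ^ (-(5 / 4) : ℝ) ≤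
      16 * M * r ^ (-(1 / 2) : ℝ) := by
    rw [intervalIntegral.integral_const_mul, integral_rpow (Or.inr ⟨by norm_num, by
      rw [uIcc_of_le h1]
      exact fun h => absurd h.1 (not_le.2 h0)⟩)]
    have e : r ^ (-(1 / 2) : ℝ) = r ^ (-(1 / 4) : ℝ) * r ^ (-(1 / 4) : ℝ) := by
      rw [← Real.rpow_add h0]; norm_num
    have hpos := Real.rpow_pos_of_pos h0 (-(1 / 4) : ℝ)
    rw [e]
    norm_num
    have := mul_nonneg hM hpos.le
    nlinarith
  calc _ ≤ _ := norm_add_le _ _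
    _ ≤ 16 * M * r ^ (-(1 / 2) : ℝ) + 16 * M * r ^ (-(1 / 2) : ℝ) :=
      add_le_add (b1.trans_eq c1) (b2.trans c2)
    _ = _ := by ring

theorem neg_mem_slitPlane_of_notMem_unitSeg {ζ : ℂ} (h1 : ‖ζ‖ ≤ 1) (hζ : ζ ∉ unitSeg) :
    -ζ ∈ Complex.slitPlane := by
  rw [Complex.mem_slitPlane_iff]
  by_contra! h
  simp only [Complex.neg_re, Complex.neg_im, neg_eq_zero, neg_nonpos] at h
  refine hζ ⟨ζ.re, ⟨h.1, (Complex.re_le_norm ζ).trans h1⟩, ?_⟩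
  apply Complex.ext <;> simp [h.2]

theorem norm_cpow_half (z : ℂ) : ‖z ^ (1 / 2 : ℂ)‖ = Real.sqrt ‖z‖ := by
  have h : (z ^ (1 / 2 : ℂ)) ^ 2 = z := by rw [one_div, Complex.cpow_ofNat_inv_pow]
  rw [← h, norm_pow, Real.sqrt_sq (norm_nonneg _), h]

/-- Near the endpoint `0` the Cauchy integral of `F t / √t` is `π F(|ζ|) / √(-ζ)` up to
`O(|ζ|^{-1/2})`. -/
theorem exists_norm_cauchy_zero_le {M : ℝ} {F : ℝ → ℂ} (hF : LogLipschitz M F) :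
    ∃ C, ∀ ζ : ℂ, ‖ζ‖ ≤ 1 / 4 → ζ ∉ unitSeg →
      ‖(-ζ) ^ (1 / 2 : ℂ) * cauchy (fun t => F t / (Real.sqrt t : ℂ)) ζ - Real.pi * F ‖ζ‖‖ ≤ C := by
  have hM := hF.nonneg
  refine ⟨32 * M + 3 * (‖F 1‖ + M * 4), fun ζ h4 hζ => ?_⟩
  have h1 : ‖ζ‖ ≤ 1 := h4.trans (by norm_num)
  have h0 : 0 < ‖ζ‖ := by
    rw [norm_pos_iff]
    rintro rfl
    exact hζ ⟨0, by simp, by simp⟩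
  have hsl := neg_mem_slitPlane_of_notMem_unitSeg h1 hζ
  set r := ‖ζ‖ with hr
  set η := (-ζ) ^ (1 / 2 : ℂ) with hη
  have hηn : ‖η‖ = Real.sqrt r := by rw [hη, norm_cpow_half, norm_neg]
  -- Freezing F at |ζ| splits the integral into a remainder of order |ζ|^(-1/2) and an explicit
  -- integral of 1/√t. In the latter, the logarithms of 1 ± iη are O(√|ζ|), which absorbs the
  -- logarithmic growth of F.
  have hsplit : cauchy (fun t => F t / (Real.sqrt t : ℂ)) ζ =
      (∫ t in (0 : ℝ)..1, (F t - F r) / (Real.sqrt t : ℂ) / (t - ζ)) +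
        F r * ∫ t in (0 : ℝ)..1, 1 / (Real.sqrt t : ℂ) / (t - ζ) := by
    rw [cauchy, ← intervalIntegral.integral_const_mul, ← intervalIntegral.integral_add]
    · congr 1; ext t; ring
    · refine intervalIntegrable_div_sub ?_ hζ
      refine LogLipschitz.intervalIntegrable (M := M) (F := fun t => F t - F r) ?_
      intro t ht u hu
      simpa using hF t ht u hu
    · refine (intervalIntegrable_div_sub ?_ hζ).const_mul _
      refine LogLipschitz.intervalIntegrable (M := 0) (F := fun _ => 1) ?_
      intro t _ u _
      simp
  have hT0 := integral_inv_sqrt_mul_sub hsl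
  rw [← hη] at hT0
  have e : η * cauchy (fun t => F t / (Real.sqrt t : ℂ)) ζ - Real.pi * F r =
      η * (∫ t in (0 : ℝ)..1, (F t - F r) / (Real.sqrt t : ℂ) / (t - ζ)) -
        F r * (Complex.I * (Complex.log (1 + -Complex.I * η) -
          Complex.log (1 + Complex.I * η))) := by
    rw [hsplit, mul_add]
    linear_combination F r * hT0
  have hs : Real.sqrt r ≤ 1 / 2 := by
    rw [Real.sqrt_le_left (by norm_num)]; norm_num; linarith
  have l1 : ‖Complex.log (1 + -Complex.I * η)‖ ≤ 3 / 2 * Real.sqrt r := by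
    have := Complex.norm_log_one_add_half_le_self (z := -Complex.I * η) (by simpa [hηn] using hs)
    simpa [hηn] using this
  have l2 : ‖Complex.log (1 + Complex.I * η)‖ ≤ 3 / 2 * Real.sqrt r := by
    have := Complex.norm_log_one_add_half_le_self (z := Complex.I * η) (by simpa [hηn] using hs)
    simpa [hηn] using this
  have hFr : ‖F r‖ * Real.sqrt r ≤ ‖F 1‖ + M * 4 := by
    have h2 := Real.abs_log_mul_self_rpow_lt r (1 / 2) h0 h1 (by norm_num)
    rw [abs_mul, abs_of_pos (Real.rpow_pos_of_pos h0 _), ← Real.sqrt_eq_rpow] at h2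
    have h3 := hF.norm_le ⟨h0, h1⟩
    have h5 := norm_nonneg (F 1)
    have h6 := Real.sqrt_nonneg r
    calc ‖F r‖ * Real.sqrt r ≤ (‖F 1‖ + M * |Real.log r|) * Real.sqrt r := by gcongr
      _ = ‖F 1‖ * Real.sqrt r + M * (|Real.log r| * Real.sqrt r) := by ring
      _ ≤ ‖F 1‖ * 1 + M * 4 := by gcongr <;> linarith
      _ = _ := by ring
  rw [e]
  refine (norm_sub_le _ _).trans ?_
  rw [norm_mul, hηn, norm_mul, norm_mul, Complex.norm_I, one_mul]
  have a1 := norm_integral_le_of_logLipschitz hF h0 h1 hζ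
  have a2 : Real.sqrt r * (32 * M * r ^ (-(1 / 2) : ℝ)) = 32 * M := by
    rw [Real.rpow_neg h0.le, ← Real.sqrt_eq_rpow]
    have := (Real.sqrt_pos.2 h0).ne'
    field_simp
  have a3 : ‖Complex.log (1 + -Complex.I * η) - Complex.log (1 + Complex.I * η)‖ ≤
      3 * Real.sqrt r := (norm_sub_le _ _).trans (by linarith)
  refine add_le_add ?_ ?_
  · rw [← a2]; gcongr
  · calc _ ≤ ‖F r‖ * (3 * Real.sqrt r) := by gcongr
      _ = 3 * (‖F r‖ * Real.sqrt r) := by ring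
      _ ≤ _ := by gcongr

/-! #### Behavior at the regular endpoint -/

theorem integral_one_div_sub (c d : ℝ) {ζ : ℂ} (hζ : ζ.im ≠ 0) :
    ∫ t in c..d, 1 / ((t : ℂ) - ζ) = Complex.log (d - ζ) - Complex.log (c - ζ) := by
  have hsl : ∀ t : ℝ, (t : ℂ) - ζ ∈ Complex.slitPlane := fun t => Or.inr (by simpa using hζ)
  refine intervalIntegral.integral_eq_sub_of_hasDerivAt (f := fun t : ℝ => Complex.log (t - ζ))
    (fun t _ => ?_) ?_
  · have h1 : HasDerivAt (fun t : ℝ => (t : ℂ) - ζ) 1 t :=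
      (Complex.ofRealCLM.hasDerivAt (x := t)).sub_const ζ
    exact h1.clog_real (hsl t)
  · refine ContinuousOn.intervalIntegrable fun t _ => ?_
    refine ContinuousAt.continuousWithinAt ?_
    have := Complex.slitPlane_ne_zero (hsl t)
    fun_prop (disch := assumption)

theorem notMem_unitSeg_of_im_ne_zero {ζ : ℂ} (hζ : ζ.im ≠ 0) : ζ ∉ unitSeg := by
  rintro ⟨t, -, rfl⟩
  simp at hζ

/-- On [0, 1/2] the kernel is bounded by 4. On [1/2, 1] the density is frozen at u = 1 - |1 - ζ|:
the quotient that remains is bounded by K, and the frozen part is a difference of logarithms.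
Passing from φ(u) to φ(1) costs at most K r|log r| with r = |1 - ζ|. -/
theorem exists_norm_cauchy_one_le {φ : ℝ → ℂ} (hφ : IntervalIntegrable φ volume 0 1) {K : ℝ}
    (hK : ∀ t ∈ Icc (1 / 2 : ℝ) 1, ∀ u ∈ Icc (1 / 2 : ℝ) 1, ‖φ t - φ u‖ ≤ K * |t - u|) :
    ∃ C, ∀ ζ : ℂ, ‖1 - ζ‖ ≤ 1 / 4 → ζ.im ≠ 0 →
      ‖cauchy φ ζ - φ 1 * Real.log ‖1 - ζ‖‖ ≤ C := by
  have hK0 : 0 ≤ K := by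
    have := (norm_nonneg _).trans (hK 1 (by norm_num) (1 / 2) (by norm_num))
    rw [abs_of_pos (by norm_num)] at this
    linarith
  refine ⟨(∫ t in (0 : ℝ)..(1 / 2), ‖φ t‖ * 4) + K * (1 / 2) +
    (‖φ 1‖ + K) * (Real.pi + (Real.log 4 + Real.pi)) + K, fun ζ h4 him => ?_⟩
  set r := ‖1 - ζ‖ with hr
  have hζ := notMem_unitSeg_of_im_ne_zero him
  have h0 : 0 < r := by
    rw [hr, norm_pos_iff]
    intro h
    rw [← sub_eq_zero.1 h] at him
    simp at him
  have hge : ∀ t : ℝ, t ≤ 1 → |t - (1 - r)| ≤ ‖(t : ℂ) - ζ‖ := by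
    intro t ht
    have := norm_sub_ge (1 - t) (by linarith) (1 - ζ)
    rw [← hr] at this
    rw [show (t : ℂ) - ζ = -(((1 - t : ℝ) : ℂ) - (1 - ζ)) by push_cast; ring, norm_neg]
    rwa [show t - (1 - r) = -(1 - t - r) by ring, abs_neg]
  -- The frozen point has the same distance to 1 as ζ, and therefore |t - u| ≤ |t - ζ| for t ≤ 1.
  set u := 1 - r with hu
  have hum : u ∈ Icc (1 / 2 : ℝ) 1 := ⟨by linarith, by linarith⟩
  have i1 := (intervalIntegrable_div_sub hφ hζ).mono_set (c := 0) (d := 1 / 2) (by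
    rw [uIcc_of_le (by norm_num), uIcc_of_le zero_le_one]; exact Icc_subset_Icc_right (by norm_num))
  have i2 := (intervalIntegrable_div_sub hφ hζ).mono_set (c := 1 / 2) (d := 1) (by
    rw [uIcc_of_le (by norm_num), uIcc_of_le zero_le_one]; exact Icc_subset_Icc_left (by norm_num))
  have i3 : IntervalIntegrable (fun t : ℝ => 1 / ((t : ℂ) - ζ)) volume (1 / 2) 1 :=
    (intervalIntegrable_div_sub (φ := fun _ => 1) (by simp) hζ).mono_set (by
      rw [uIcc_of_le (by norm_num), uIcc_of_le zero_le_one]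
      exact Icc_subset_Icc_left (by norm_num))
  have i4 : IntervalIntegrable (fun t : ℝ => (φ t - φ u) / ((t : ℂ) - ζ)) volume (1 / 2) 1 := by
    have := i2.sub (i3.const_mul (φ u))
    refine this.congr fun t _ => ?_
    ring
  have e : cauchy φ ζ = (∫ t in (0 : ℝ)..(1 / 2), φ t / (t - ζ)) +
      (∫ t in (1 / 2 : ℝ)..1, (φ t - φ u) / (t - ζ)) +
      φ u * (Complex.log (1 - ζ) - Complex.log (1 / 2 - ζ)) := by
    have h := integral_one_div_sub (1 / 2) 1 him
    push_cast at h
    rw [← h, cauchy, ← intervalIntegral.integral_add_adjacent_intervals i1 i2, add_assoc,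
      ← intervalIntegral.integral_const_mul, ← intervalIntegral.integral_add i4 (i3.const_mul _)]
    congr 2
    ext t
    ring
  have b1 : ‖∫ t in (0 : ℝ)..(1 / 2), φ t / (t - ζ)‖ ≤ ∫ t in (0 : ℝ)..(1 / 2), ‖φ t‖ * 4 := by
    refine intervalIntegral.norm_integral_le_of_norm_le (by norm_num) ?_
      ((hφ.norm.mono_set (by
        rw [uIcc_of_le (by norm_num), uIcc_of_le zero_le_one]
        exact Icc_subset_Icc_right (by norm_num))).mul_const _)
    refine Eventually.of_forall fun t ht => ?_
    rw [norm_div, div_eq_mul_inv]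
    gcongr
    rw [inv_le_comm₀ (lt_of_lt_of_le (by rw [abs_pos]; linarith [ht.2])
      (hge t (by linarith [ht.2]))) (by norm_num)]
    refine le_trans ?_ (hge t (by linarith [ht.2]))
    rw [abs_of_nonpos (by linarith [ht.2])]
    linarith [ht.2]
  have b2 : ‖∫ t in (1 / 2 : ℝ)..1, (φ t - φ u) / (t - ζ)‖ ≤ K * (1 / 2) := by
    have := intervalIntegral.norm_integral_le_of_norm_le_const (a := 1 / 2) (b := 1) (C := K)
      (f := fun t : ℝ => (φ t - φ u) / ((t : ℂ) - ζ)) (fun t ht => by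
        rw [uIoc_of_le (by norm_num)] at ht
        have hpos : 0 < ‖(t : ℂ) - ζ‖ :=
          norm_pos_iff.2 (sub_ne_zero_of_notMem_unitSeg hζ ⟨by linarith [ht.1], ht.2⟩)
        rw [norm_div, div_le_iff₀ hpos]
        refine (hK t ⟨ht.1.le, ht.2⟩ u hum).trans ?_
        gcongr
        exact hge t ht.2)
    rwa [abs_of_pos (by norm_num), show (1 : ℝ) - 1 / 2 = 1 / 2 by norm_num] at this
  have hφu : ‖φ u‖ ≤ ‖φ 1‖ + K := by
    have h := hK u hum 1 (by norm_num)
    have h2 : |u - 1| ≤ 1 := by rw [abs_le]; constructor <;> linarith [hum.1, hum.2]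
    have h3 := norm_le_insert' (φ u) (φ 1)
    nlinarith
  have hlog1 : ‖Complex.log (1 - ζ) - Real.log r‖ ≤ Real.pi := by
    have : Complex.log (1 - ζ) - Real.log r = (1 - ζ).arg * Complex.I := by
      rw [Complex.log, ← hr]; ring
    rw [this, norm_mul, Complex.norm_I, mul_one, Complex.norm_real]
    exact Complex.abs_arg_le_pi _
  have hlog2 : ‖Complex.log (1 / 2 - ζ)‖ ≤ Real.log 4 + Real.pi := by
    have hn1 : 1 / 4 ≤ ‖(1 / 2 : ℂ) - ζ‖ := by
      have := hge (1 / 2) (by norm_num)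
      push_cast at this
      refine le_trans ?_ this
      rw [abs_of_nonpos (by linarith)]
      linarith
    have hn2 : ‖(1 / 2 : ℂ) - ζ‖ ≤ 4 := by
      have : (1 / 2 : ℂ) - ζ = (1 - ζ) - 1 / 2 := by ring
      rw [this]
      refine (norm_sub_le _ _).trans ?_
      norm_num
      linarith
    rw [Complex.log]
    refine (norm_add_le _ _).trans ?_
    rw [norm_mul, Complex.norm_I, mul_one, Complex.norm_real, Complex.norm_real]
    refine add_le_add ?_ (Complex.abs_arg_le_pi _)
    rw [Real.norm_eq_abs, abs_le]
    constructor
    · rw [← Real.log_inv]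
      exact Real.log_le_log (by norm_num) (by linarith)
    · exact Real.log_le_log (by linarith) hn2
  have hsm : ‖φ u - φ 1‖ * |Real.log r| ≤ K := by
    have h := hK u hum 1 (by norm_num)
    have h3 : |u - 1| = r := by rw [hu, show 1 - r - 1 = -r by ring, abs_neg, abs_of_pos h0]
    rw [h3] at h
    have h2 := Real.abs_log_mul_self_lt r h0 (by linarith)
    rw [abs_mul, abs_of_pos h0] at h2
    calc _ ≤ K * r * |Real.log r| := by gcongr
      _ = K * (|Real.log r| * r) := by ring
      _ ≤ K * 1 := by gcongr
      _ = K := mul_one K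
  have e2 : cauchy φ ζ - φ 1 * Real.log r = (∫ t in (0 : ℝ)..(1 / 2), φ t / (t - ζ)) +
      (∫ t in (1 / 2 : ℝ)..1, (φ t - φ u) / (t - ζ)) +
      φ u * ((Complex.log (1 - ζ) - Real.log r) - Complex.log (1 / 2 - ζ)) +
      (φ u - φ 1) * Real.log r := by rw [e]; ring
  rw [e2]
  have b3 : ‖φ u * ((Complex.log (1 - ζ) - Real.log r) - Complex.log (1 / 2 - ζ))‖ ≤
      (‖φ 1‖ + K) * (Real.pi + (Real.log 4 + Real.pi)) := by
    rw [norm_mul]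
    gcongr
    exact (norm_sub_le _ _).trans (add_le_add hlog1 hlog2)
  have b4 : ‖(φ u - φ 1) * Real.log r‖ ≤ K := by
    rwa [norm_mul, Complex.norm_real, Real.norm_eq_abs]
  refine (norm_add_le _ _).trans (add_le_add ?_ b4)
  exact norm_add₃_le.trans (add_le_add (add_le_add b1 b2) b3)

/-! #### Boundary values in the interior -/

/-- The Sokhotski–Plemelj formula. -/
theorem exists_tendsto_cauchy {φ : ℝ → ℂ} (hφ : IntervalIntegrable φ volume 0 1) {x δ K : ℝ}
    (hδ : 0 < δ) (hsub : Icc (x - δ) (x + δ) ⊆ Icc 0 1)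
    (hK : ∀ t ∈ Icc (x - δ) (x + δ), ∀ u ∈ Icc (x - δ) (x + δ), ‖φ t - φ u‖ ≤ K * |t - u|) :
    ∃ c : ℂ, Tendsto (cauchy φ) (𝓝[{z | 0 < z.im}] (x : ℂ)) (𝓝 (c + Real.pi * Complex.I * φ x)) ∧
      Tendsto (cauchy φ) (𝓝[{z | z.im < 0}] (x : ℂ)) (𝓝 (c - Real.pi * Complex.I * φ x)) := by
  have hxm : x ∈ Icc (x - δ) (x + δ) := ⟨by linarith, by linarith⟩
  have hK0 : 0 ≤ K := by
    have := (norm_nonneg _).trans (hK x hxm (x + δ) ⟨by linarith, by linarith⟩)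
    rw [show x - (x + δ) = -δ by ring, abs_neg, abs_of_pos hδ] at this
    exact nonneg_of_mul_nonneg_left this hδ
  set J := Icc (x - δ) (x + δ) with hJ
  have hφre : Tendsto (fun ζ : ℂ => φ ζ.re) (𝓝 (x : ℂ)) (𝓝 (φ x)) := by
    have h1 : Tendsto φ (𝓝 x) (𝓝 (φ x)) := by
      rw [tendsto_iff_norm_sub_tendsto_zero]
      refine squeeze_zero' (g := fun t => K * |t - x|) (Eventually.of_forall fun _ => norm_nonneg _)
        ?_ ?_
      · filter_upwards [Icc_mem_nhds (show x - δ < x by linarith) (show x < x + δ by linarith)]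
          with t ht using hK t ht x hxm
      · have : Tendsto (fun t => K * |t - x|) (𝓝 x) (𝓝 (K * |x - x|)) :=
          Continuous.tendsto (by fun_prop) x
        simpa using this
    refine h1.comp ?_
    have := Complex.continuous_re.tendsto (x : ℂ)
    simpa using this
  have hreJ : ∀ ζ ∈ Metric.ball (x : ℂ) (δ / 2), ζ.re ∈ J := by
    intro ζ hζ
    rw [Metric.mem_ball, dist_eq_norm] at hζ
    have := (Complex.abs_re_le_norm (ζ - x)).trans_lt hζ
    rw [Complex.sub_re, Complex.ofReal_re, abs_lt] at this
    exact ⟨by linarith, by linarith⟩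
  -- Subtracting the value at the moving point Re ζ, not at x, bounds the quotient on J by K,
  -- because |t - Re ζ| ≤ |t - ζ|. Dominated convergence then needs no restriction on how ζ tends to
  -- x.
  have hψ : Tendsto (fun ζ : ℂ => ∫ t in (0 : ℝ)..1,
      (φ t - J.indicator (fun _ => φ ζ.re) t) * ((t : ℂ) - ζ)⁻¹) (𝓝 (x : ℂ))
      (𝓝 (∫ t in (0 : ℝ)..1, (φ t - J.indicator (fun _ => φ x) t) * ((t : ℂ) - x)⁻¹)) := by
    refine intervalIntegral.tendsto_integral_filter_of_dominated_convergence
      (fun t => K + ‖φ t‖ * (2 / δ)) ?_ ?_ ?_ ?_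
    · refine Eventually.of_forall fun ζ => ?_
      refine (hφ.aestronglyMeasurable_restrict_uIoc.sub
        (measurable_const.indicator measurableSet_Icc).aestronglyMeasurable).mul
        (Measurable.aestronglyMeasurable (by fun_prop))
    · filter_upwards [Metric.ball_mem_nhds (x : ℂ) (half_pos hδ)] with ζ hζ
      refine Eventually.of_forall fun t _ => ?_
      rw [norm_mul, norm_inv]
      by_cases ht : t ∈ J
      · rw [indicator_of_mem ht]
        have h1 := hK t ht ζ.re (hreJ ζ hζ)
        have h2 : |t - ζ.re| ≤ ‖(t : ℂ) - ζ‖ := by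
          simpa using Complex.abs_re_le_norm ((t : ℂ) - ζ)
        have h3 : ‖φ t - φ ζ.re‖ * ‖(t : ℂ) - ζ‖⁻¹ ≤ K := by
          rw [← div_eq_mul_inv]
          exact div_le_of_le_mul₀ (norm_nonneg _) hK0 (h1.trans (by gcongr))
        have : 0 ≤ ‖φ t‖ * (2 / δ) := by positivity
        linarith
      · rw [indicator_of_notMem ht, sub_zero]
        have h1 : δ / 2 ≤ ‖(t : ℂ) - ζ‖ := by
          rw [Metric.mem_ball, dist_eq_norm] at hζ
          have h2 : δ ≤ ‖(t : ℂ) - x‖ := by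
            rw [← Complex.ofReal_sub, Complex.norm_real, Real.norm_eq_abs]
            by_contra! h
            rw [abs_lt] at h
            exact ht ⟨by linarith, by linarith⟩
          have h3 := norm_sub_le_norm_sub_add_norm_sub (t : ℂ) ζ x
          linarith
        have h4 : ‖(t : ℂ) - ζ‖⁻¹ ≤ 2 / δ := by
          rw [← inv_div]
          exact inv_anti₀ (by positivity) h1
        have : ‖φ t‖ * ‖(t : ℂ) - ζ‖⁻¹ ≤ ‖φ t‖ * (2 / δ) := by gcongr
        linarith
    · exact intervalIntegrable_const.add (hφ.norm.mul_const _)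
    · have hne : ∀ᵐ t : ℝ, t ≠ x := by simp [ae_iff, measure_singleton]
      filter_upwards [hne] with t ht _
      have ht' : (t : ℂ) - x ≠ 0 := by
        rw [sub_ne_zero]; exact_mod_cast ht
      refine Tendsto.mul (Tendsto.sub tendsto_const_nhds ?_) ?_
      · by_cases htJ : t ∈ J
        · simpa [indicator_of_mem htJ] using hφre
        · simp [indicator_of_notMem htJ]
      · exact (tendsto_const_nhds.sub tendsto_id).inv₀ ht'
  set c := ∫ t in (0 : ℝ)..1, (φ t - J.indicator (fun _ => φ x) t) * ((t : ℂ) - x)⁻¹ with hc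
  have hsplit : ∀ ζ : ℂ, ζ.im ≠ 0 → cauchy φ ζ = (∫ t in (0 : ℝ)..1,
      (φ t - J.indicator (fun _ => φ ζ.re) t) * ((t : ℂ) - ζ)⁻¹) +
      φ ζ.re * (Complex.log ((x + δ : ℝ) - ζ) - Complex.log ((x - δ : ℝ) - ζ)) := by
    intro ζ hζ
    have hζ' := notMem_unitSeg_of_im_ne_zero hζ
    have hx1 := hsub (left_mem_Icc.2 (by linarith))
    have hx2 := hsub (right_mem_Icc.2 (by linarith))
    have i1 := intervalIntegrable_div_sub hφ hζ'
    have i2 : IntervalIntegrable (fun t : ℝ => 1 / ((t : ℂ) - ζ)) volume 0 1 :=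
      intervalIntegrable_div_sub (φ := fun _ => 1) (by simp) hζ'
    have i3 : IntervalIntegrable (J.indicator fun t : ℝ => 1 / ((t : ℂ) - ζ)) volume 0 1 := by
      rw [intervalIntegrable_iff] at i2 ⊢
      exact i2.indicator measurableSet_Icc
    have e1 : ∫ t in (0 : ℝ)..1, J.indicator (fun t : ℝ => 1 / ((t : ℂ) - ζ)) t =
        Complex.log ((x + δ : ℝ) - ζ) - Complex.log ((x - δ : ℝ) - ζ) := by
      rw [← integral_one_div_sub (x - δ) (x + δ) hζ, intervalIntegral.integral_of_le zero_le_one,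
        intervalIntegral.integral_of_le (by linarith), ← integral_Icc_eq_integral_Ioc,
        ← integral_Icc_eq_integral_Ioc, setIntegral_indicator measurableSet_Icc,
        inter_eq_self_of_subset_right hsub]
    rw [← e1, ← intervalIntegral.integral_const_mul, cauchy, ← intervalIntegral.integral_add]
    · congr 1
      ext t
      by_cases ht : t ∈ J
      · simp only [indicator_of_mem ht]; ring
      · simp only [indicator_of_notMem ht]; ring
    · refine (i1.sub (i3.const_mul (φ ζ.re))).congr fun t _ => ?_
      by_cases ht : t ∈ J
      · simp only [indicator_of_mem ht]; ring
      · simp only [indicator_of_notMem ht]; ring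
    · exact i3.const_mul _
  have hz : ((x - δ : ℝ) : ℂ) - x = ((-δ : ℝ) : ℂ) := by push_cast; ring
  have hlogp : Tendsto (fun ζ : ℂ => Complex.log ((x + δ : ℝ) - ζ)) (𝓝 (x : ℂ))
      (𝓝 (Real.log δ)) := by
    have h1 : ((x + δ : ℝ) : ℂ) - x = (δ : ℂ) := by push_cast; ring
    have h2 : Tendsto (fun ζ : ℂ => ((x + δ : ℝ) : ℂ) - ζ) (𝓝 (x : ℂ)) (𝓝 (δ : ℂ)) := by
      rw [← h1]; exact tendsto_const_nhds.sub tendsto_id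
    rw [Complex.ofReal_log hδ.le]
    exact h2.clog (Or.inl (by simpa using hδ))
  have hshift : Tendsto (fun ζ : ℂ => ((x - δ : ℝ) : ℂ) - ζ) (𝓝 (x : ℂ)) (𝓝 ((-δ : ℝ) : ℂ)) := by
    rw [← hz]; exact tendsto_const_nhds.sub tendsto_id
  have hnorm : ‖((-δ : ℝ) : ℂ)‖ = δ := by
    rw [Complex.norm_real, norm_neg, Real.norm_of_nonneg hδ.le]
  -- The explicit part is φ(Re ζ) times log(x + δ - ζ) - log(x - δ - ζ). The terms log δ cancel, and
  -- the second argument tends to -δ from the side of the cut opposite to that of ζ, leaving ±πi.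
  refine ⟨c, ?_, ?_⟩
  · have hl := (Complex.tendsto_log_nhdsWithin_im_neg_of_re_neg_of_im_zero
      (z := ((-δ : ℝ) : ℂ)) (by simpa using hδ) (by simp)).comp
      (tendsto_nhdsWithin_iff.2 ⟨hshift.mono_left (nhdsWithin_le_nhds (s := {z | 0 < z.im})), by
        filter_upwards [self_mem_nhdsWithin] with ζ (hζ : 0 < ζ.im)
        simpa using hζ⟩)
    rw [hnorm] at hl
    have := (hψ.mono_left (nhdsWithin_le_nhds (s := {z : ℂ | 0 < z.im}))).add
      ((hφre.mono_left nhdsWithin_le_nhds).mul ((hlogp.mono_left nhdsWithin_le_nhds).sub hl))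
    refine (this.congr' ?_).trans_eq ?_
    · filter_upwards [self_mem_nhdsWithin] with ζ (hζ : 0 < ζ.im)
      exact (hsplit ζ hζ.ne').symm
    · congr 1; ring
  · have hl := (Complex.tendsto_log_nhdsWithin_im_nonneg_of_re_neg_of_im_zero
      (z := ((-δ : ℝ) : ℂ)) (by simpa using hδ) (by simp)).comp
      (tendsto_nhdsWithin_iff.2 ⟨hshift.mono_left (nhdsWithin_le_nhds (s := {z | z.im < 0})), by
        filter_upwards [self_mem_nhdsWithin] with ζ (hζ : ζ.im < 0)
        simpa using hζ.le⟩)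
    rw [hnorm] at hl
    have := (hψ.mono_left (nhdsWithin_le_nhds (s := {z : ℂ | z.im < 0}))).add
      ((hφre.mono_left nhdsWithin_le_nhds).mul ((hlogp.mono_left nhdsWithin_le_nhds).sub hl))
    refine (this.congr' ?_).trans_eq ?_
    · filter_upwards [self_mem_nhdsWithin] with ζ (hζ : ζ.im < 0)
      exact (hsplit ζ hζ.ne).symm
    · congr 1; ring

end Cross

namespace Cross

/-! ### Geometry of the cross -/

theorem mem_seg_iff {a b : ℝ} {i : Fin 4} {z : ℂ} :
    z ∈ seg a b i ↔ ∃ t ∈ Icc (0 : ℝ) 1, z = (1 - t) * endpt a b i := by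
  rw [seg, segment_eq_image]
  constructor
  · rintro ⟨θ, hθ, rfl⟩
    exact ⟨1 - θ, ⟨by linarith [hθ.2], by linarith [hθ.1]⟩, by simp⟩
  · rintro ⟨t, ht, rfl⟩
    exact ⟨1 - t, ⟨by linarith [ht.2], by linarith [ht.1]⟩, by simp⟩

theorem mem_seg'_iff {a b : ℝ} {i : Fin 4} {z : ℂ} :
    z ∈ seg' a b i ↔ ∃ t ∈ Ioo (0 : ℝ) 1, z = (1 - t) * endpt a b i := by
  rw [seg', openSegment_eq_image]
  constructor
  · rintro ⟨θ, hθ, rfl⟩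
    exact ⟨1 - θ, ⟨by linarith [hθ.2], by linarith [hθ.1]⟩, by simp⟩
  · rintro ⟨t, ht, rfl⟩
    exact ⟨1 - t, ⟨by linarith [ht.2], by linarith [ht.1]⟩, by simp⟩

theorem endpt_ne_zero {a b : ℝ} (ha : 0 < a) (hb : 0 < b) (i : Fin 4) : endpt a b i ≠ 0 := by
  fin_cases i <;> simp [endpt, ha.ne', hb.ne']

/-- The affine coordinate that is `0` at the `i`-th endpoint and `1` at the origin. -/
noncomputable def coord (a b : ℝ) (i : Fin 4) (z : ℂ) : ℂ := 1 - z / endpt a b i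

theorem coord_notMem {a b : ℝ} (ha : 0 < a) (hb : 0 < b) {i : Fin 4} {z : ℂ} (hz : z ∉ seg a b i) :
    coord a b i z ∉ unitSeg := by
  rintro ⟨t, ht, h⟩
  refine hz (mem_seg_iff.2 ⟨t, ht, ?_⟩)
  have := endpt_ne_zero ha hb i
  have h' : (t : ℂ) = 1 - z / endpt a b i := h
  rw [h']
  field_simp
  ring

theorem continuous_coord {a b : ℝ} (i : Fin 4) : Continuous (coord a b i) := by
  unfold coord; fun_prop

theorem hasDerivAt_coord {a b : ℝ} (i : Fin 4) (z : ℂ) :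
    HasDerivAt (coord a b i) (-(endpt a b i)⁻¹) z := by
  have := ((hasDerivAt_id z).div_const (endpt a b i)).const_sub 1
  change HasDerivAt (fun z => 1 - z / endpt a b i) _ z
  simpa [neg_div] using this

theorem mem_seg_zero {a b : ℝ} (ha : 0 < a) {z : ℂ} :
    z ∈ seg a b 0 ↔ z.im = 0 ∧ 0 ≤ z.re ∧ z.re ≤ a := by
  rw [mem_seg_iff]
  constructor
  · rintro ⟨t, ht, rfl⟩
    have h1 := ht.1
    have h2 := ht.2
    simp only [endpt, Matrix.cons_val_zero]
    refine ⟨by simp, ?_, ?_⟩ <;> simp <;> nlinarith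
  · rintro ⟨h1, h2, h3⟩
    refine ⟨1 - z.re / a, ⟨by rw [sub_nonneg, div_le_one ha]; exact h3,
      by rw [sub_le_self_iff]; positivity⟩, ?_⟩
    have : (a : ℂ) ≠ 0 := by exact_mod_cast ha.ne'
    apply Complex.ext <;> simp [endpt, h1, ha.ne']

theorem mem_seg_one {a b : ℝ} (hb : 0 < b) {z : ℂ} :
    z ∈ seg a b 1 ↔ z.re = 0 ∧ 0 ≤ z.im ∧ z.im ≤ b := by
  rw [mem_seg_iff]
  constructor
  · rintro ⟨t, ht, rfl⟩
    have h1 := ht.1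
    have h2 := ht.2
    simp only [endpt, Matrix.cons_val_one]
    refine ⟨by simp, ?_, ?_⟩ <;> simp <;> nlinarith
  · rintro ⟨h1, h2, h3⟩
    refine ⟨1 - z.im / b, ⟨by rw [sub_nonneg, div_le_one hb]; exact h3,
      by rw [sub_le_self_iff]; positivity⟩, ?_⟩
    apply Complex.ext <;> simp [endpt, h1, hb.ne']

theorem mem_seg_two {a b : ℝ} (ha : 0 < a) {z : ℂ} :
    z ∈ seg a b 2 ↔ z.im = 0 ∧ z.re ≤ 0 ∧ -a ≤ z.re := by
  rw [mem_seg_iff]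
  constructor
  · rintro ⟨t, ht, rfl⟩
    have h1 := ht.1
    have h2 := ht.2
    simp only [endpt, Matrix.cons_val]
    refine ⟨by simp, ?_, ?_⟩ <;> simp <;> nlinarith
  · rintro ⟨h1, h2, h3⟩
    refine ⟨1 - (-z.re) / a, ⟨by rw [sub_nonneg, div_le_one ha]; linarith,
      by rw [sub_le_self_iff]; exact div_nonneg (by linarith) ha.le⟩, ?_⟩
    apply Complex.ext <;> simp [endpt, h1, ha.ne']

theorem mem_seg_three {a b : ℝ} (hb : 0 < b) {z : ℂ} :
    z ∈ seg a b 3 ↔ z.re = 0 ∧ z.im ≤ 0 ∧ -b ≤ z.im := by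
  rw [mem_seg_iff]
  constructor
  · rintro ⟨t, ht, rfl⟩
    have h1 := ht.1
    have h2 := ht.2
    simp only [endpt, Matrix.cons_val]
    refine ⟨by simp, ?_, ?_⟩ <;> simp <;> nlinarith
  · rintro ⟨h1, h2, h3⟩
    refine ⟨1 - (-z.im) / b, ⟨by rw [sub_nonneg, div_le_one hb]; linarith,
      by rw [sub_le_self_iff]; exact div_nonneg (by linarith) hb.le⟩, ?_⟩
    apply Complex.ext <;> simp [endpt, h1, hb.ne']

theorem mem_cross_iff {a b : ℝ} {z : ℂ} : z ∈ cross a b ↔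
    z ∈ seg a b 0 ∨ z ∈ seg a b 1 ∨ z ∈ seg a b 2 ∨ z ∈ seg a b 3 := by
  rw [cross, mem_iUnion]
  constructor
  · rintro ⟨i, hi⟩; fin_cases i <;> simp_all
  · rintro (h | h | h | h) <;> exact ⟨_, h⟩

theorem isCompact_seg {a b : ℝ} (i : Fin 4) : IsCompact (seg a b i) := by
  rw [seg, segment_eq_image']
  exact isCompact_Icc.image (by fun_prop)

theorem isCompact_cross (a b : ℝ) : IsCompact (cross a b) := isCompact_iUnion fun i => isCompact_seg i

theorem endpt_mem_seg {a b : ℝ} (i : Fin 4) : endpt a b i ∈ seg a b i := right_mem_segment ℝ _ _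

theorem endpt_mem_cross {a b : ℝ} (i : Fin 4) : endpt a b i ∈ cross a b :=
  mem_iUnion.2 ⟨i, endpt_mem_seg i⟩

theorem zero_mem_cross {a b : ℝ} : (0 : ℂ) ∈ cross a b :=
  mem_iUnion.2 ⟨0, left_mem_segment ℝ _ _⟩

/-- The closed fourth quadrant. -/
def closedQuadrant : Set ℂ := {z | 0 ≤ z.re ∧ z.im ≤ 0}

theorem isClosed_closedQuadrant : IsClosed closedQuadrant :=
  (isClosed_le continuous_const Complex.continuous_re).inter
    (isClosed_le Complex.continuous_im continuous_const)

namespace IsAlphaArc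

variable {a b : ℝ} {γ : ℝ → ℂ}

theorem continuousOn (hγ : IsAlphaArc a b γ) : ContinuousOn γ (Icc 0 1) :=
  hγ.lipschitz.choose_spec.continuousOn

theorem isCompact_cuts (hγ : IsAlphaArc a b γ) : IsCompact (cuts a b γ) :=
  (isCompact_cross a b).union (isCompact_Icc.image_of_continuousOn hγ.continuousOn)

theorem isOpen_compl (hγ : IsAlphaArc a b γ) : IsOpen (cuts a b γ)ᶜ :=
  hγ.isCompact_cuts.isClosed.isOpen_compl

theorem mem_closedQuadrant (ha : 0 < a) (hb : 0 < b) (hγ : IsAlphaArc a b γ) {t : ℝ}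
    (ht : t ∈ Icc (0 : ℝ) 1) : γ t ∈ closedQuadrant := by
  rcases eq_or_lt_of_le ht.1 with h | h
  · rw [← h, hγ.source]
    constructor <;> simp [endpt, hb.le]
  rcases eq_or_lt_of_le ht.2 with h' | h'
  · rw [h', hγ.target]
    constructor <;> simp [endpt, ha.le]
  exact hγ.quadrant t ⟨h, h'⟩

end IsAlphaArc

/-! ### The winding number of the curve formed by the arc and two segments -/

/-- `∫ ds / (s - z)` over the closed curve formed by the arc and the segments `Δ₁`, `Δ₄`. -/
noncomputable def winding (a b : ℝ) (γ : ℝ → ℂ) (z : ℂ) : ℂ :=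
  (∫ t in (0 : ℝ)..1, deriv γ t / (γ t - z)) + cauchy (fun _ => 1) (coord a b 0 z) -
    cauchy (fun _ => 1) (coord a b 3 z)

theorem integral_inv_sq_sub {ζ : ℂ} (hζ : ζ ∉ unitSeg) :
    ∫ t in (0 : ℝ)..1, 1 / ((t : ℂ) - ζ) ^ 2 = 1 / (-ζ) - 1 / (1 - ζ) := by
  have hne : ∀ t ∈ uIcc (0 : ℝ) 1, (t : ℂ) - ζ ≠ 0 := by
    intro t ht
    rw [uIcc_of_le zero_le_one] at ht
    exact sub_ne_zero_of_notMem_unitSeg hζ ht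
  have h := intervalIntegral.integral_eq_sub_of_hasDerivAt (a := 0) (b := 1)
    (f := fun t : ℝ => -((t : ℂ) - ζ)⁻¹) (f' := fun t : ℝ => 1 / ((t : ℂ) - ζ) ^ 2)
    (fun t ht => by
      have h1 : HasDerivAt (fun t : ℝ => (t : ℂ) - ζ) 1 t :=
        (Complex.ofRealCLM.hasDerivAt (x := t)).sub_const ζ
      have h2 := (h1.fun_inv (hne t ht)).fun_neg
      convert! h2 using 1
      ring) (by
      refine ContinuousOn.intervalIntegrable fun t ht => ContinuousAt.continuousWithinAt ?_
      have := hne t ht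
      fun_prop (disch := simpa using this))
  rw [h]
  simp only [Complex.ofReal_one, Complex.ofReal_zero, one_div]
  ring

/-- The derivative of each of the three integrals is a difference of values of 1/(s - z) at the ends
of the piece. The arc from a₄ to a₁, Δ₁ and Δ₄ reversed close up, so these terms cancel. -/
theorem hasDerivAt_winding {a b : ℝ} (ha : 0 < a) (hb : 0 < b) {γ : ℝ → ℂ}
    (hγ : IsAlphaArc a b γ) {z : ℂ} (hz : z ∉ cuts a b γ) : HasDerivAt (winding a b γ) 0 z := by
  obtain ⟨K, hK⟩ := hγ.lipschitz
  have hne : ∀ t ∈ Icc (0 : ℝ) 1, γ t - z ≠ 0 := fun t ht h =>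
    hz (Or.inr ⟨t, ht, sub_eq_zero.1 h⟩)
  have hseg : ∀ i, z ∉ seg a b i := fun i h => hz (Or.inl (mem_iUnion.2 ⟨i, h⟩))
  have h1 : HasDerivAt (fun z => ∫ t in (0 : ℝ)..1, deriv γ t / (γ t - z))
      (1 / (endpt a b 3 - z) - 1 / (endpt a b 0 - z)) z := by
    have hd := hasDerivAt_integral_div (intervalIntegrable_deriv_of_lipschitz hK) (p := γ)
      (q := fun _ => 1) hγ.continuousOn (by fun_prop) (ζ := z) (by simpa using hne)
    have hc := (integral_comp_mul_deriv_of_lipschitz zero_le_one hK (F := fun s => -(s - z)⁻¹)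
      (k := fun s => 1 / (s - z) ^ 2) (fun t ht => by
        filter_upwards [isOpen_ne.mem_nhds (sub_ne_zero.1 (hne t ht))] with s hs
        have h2 := (((hasDerivAt_id s).sub_const z).fun_inv (sub_ne_zero.2 hs)).fun_neg
        convert! h2 using 1
        simp only [id]
        ring)).2
    rw [hγ.source, hγ.target] at hc
    simp only [one_mul] at hd
    convert! hd using 1
    rw [show (1 / (endpt a b 3 - z) - 1 / (endpt a b 0 - z)) =
      -(endpt a b 0 - z)⁻¹ - -(endpt a b 3 - z)⁻¹ by ring, ← hc]
    congr 1
    ext t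
    ring
  have h2 : ∀ i, HasDerivAt (fun z => cauchy (fun _ => 1) (coord a b i z))
      (1 / z - 1 / (z - endpt a b i)) z := by
    intro i
    have hζ := coord_notMem ha hb (hseg i)
    have hd := (hasDerivAt_cauchy (φ := fun _ => 1) (by simp) hζ).comp z (hasDerivAt_coord i z)
    rw [integral_inv_sq_sub hζ] at hd
    convert! hd using 1
    have e0 := endpt_ne_zero ha hb i
    have z0 : z ≠ 0 := fun h => hz (Or.inl (h ▸ zero_mem_cross))
    have z1 : z - endpt a b i ≠ 0 := fun h =>
      hz (Or.inl (sub_eq_zero.1 h ▸ endpt_mem_cross i))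
    have z2 : 1 - coord a b i z = z / endpt a b i := by rw [coord]; ring
    have z3 : -coord a b i z = (z - endpt a b i) / endpt a b i := by
      rw [coord]; field_simp; ring
    rw [z2, z3]
    field_simp
    ring
  have h3 := (h1.add (h2 0)).sub (h2 3)
  convert! h3 using 1
  rw [show endpt a b 3 - z = -(z - endpt a b 3) by ring,
    show endpt a b 0 - z = -(z - endpt a b 0) by ring, div_neg, div_neg]
  ring

theorem tendsto_integral_div_sub_cobounded {φ p : ℝ → ℂ} (hφ : IntervalIntegrable φ volume 0 1)
    (hp : ContinuousOn p (Icc 0 1)) :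
    Tendsto (fun z => ∫ t in (0 : ℝ)..1, φ t / (p t - z)) (Bornology.cobounded ℂ) (𝓝 0) := by
  obtain ⟨R, hR⟩ := isCompact_Icc.exists_bound_of_continuousOn hp
  rw [tendsto_zero_iff_norm_tendsto_zero]
  have hlim : Tendsto (fun z : ℂ => (∫ t in (0 : ℝ)..1, ‖φ t‖) * (‖z‖ - R)⁻¹)
      (Bornology.cobounded ℂ) (𝓝 0) := by
    have : Tendsto (fun z : ℂ => ‖z‖ - R) (Bornology.cobounded ℂ) atTop :=
      tendsto_atTop_add_const_right _ _ tendsto_norm_cobounded_atTop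
    simpa using this.inv_tendsto_atTop.const_mul (∫ t in (0 : ℝ)..1, ‖φ t‖)
  refine squeeze_zero' (Eventually.of_forall fun _ => norm_nonneg _) ?_ hlim
  filter_upwards [tendsto_norm_cobounded_atTop.eventually_gt_atTop R] with z hz
  rw [← intervalIntegral.integral_mul_const]
  refine intervalIntegral.norm_integral_le_of_norm_le zero_le_one ?_ (hφ.norm.mul_const _)
  refine Eventually.of_forall fun t ht => ?_
  rw [norm_div, div_eq_mul_inv]
  have h1 := hR t ⟨ht.1.le, ht.2⟩
  have h2 := norm_sub_norm_le z (p t)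
  rw [norm_sub_rev] at h2
  gcongr
  · linarith

theorem tendsto_coord_cobounded {a b : ℝ} (ha : 0 < a) (hb : 0 < b) (i : Fin 4) :
    Tendsto (coord a b i) (Bornology.cobounded ℂ) (Bornology.cobounded ℂ) := by
  rw [← tendsto_norm_atTop_iff_cobounded]
  have h0 := norm_pos_iff.2 (endpt_ne_zero ha hb i)
  have h1 : Tendsto (fun z : ℂ => ‖z‖ / ‖endpt a b i‖ - 1) (Bornology.cobounded ℂ) atTop :=
    tendsto_atTop_add_const_right _ _ (tendsto_norm_cobounded_atTop.atTop_div_const h0)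
  refine tendsto_atTop_mono (fun z => ?_) h1
  have := norm_sub_norm_le (z / endpt a b i) 1
  rw [norm_div, norm_one, norm_sub_rev] at this
  exact this

theorem tendsto_cauchy_coord_cobounded {a b : ℝ} (ha : 0 < a) (hb : 0 < b) (i : Fin 4) {φ : ℝ → ℂ}
    (hφ : IntervalIntegrable φ volume 0 1) :
    Tendsto (fun z => cauchy φ (coord a b i z)) (Bornology.cobounded ℂ) (𝓝 0) :=
  (tendsto_integral_div_sub_cobounded hφ (by fun_prop)).comp (tendsto_coord_cobounded ha hb i)

theorem tendsto_winding_cobounded {a b : ℝ} (ha : 0 < a) (hb : 0 < b) {γ : ℝ → ℂ}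
    (hγ : IsAlphaArc a b γ) : Tendsto (winding a b γ) (Bornology.cobounded ℂ) (𝓝 0) := by
  obtain ⟨K, hK⟩ := hγ.lipschitz
  unfold winding
  have := ((tendsto_integral_div_sub_cobounded (intervalIntegrable_deriv_of_lipschitz hK)
    hγ.continuousOn).add (tendsto_cauchy_coord_cobounded ha hb 0 (φ := fun _ => 1) (by simp))).sub
      (tendsto_cauchy_coord_cobounded ha hb 3 (φ := fun _ => 1) (by simp))
  simpa using this

theorem winding_eq_of_mem {a b : ℝ} (ha : 0 < a) (hb : 0 < b) {γ : ℝ → ℂ}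
    (hγ : IsAlphaArc a b γ) {V : Set ℂ} (hVo : IsOpen V) (hV : IsPreconnected V)
    (hsub : V ⊆ (cuts a b γ)ᶜ) {x y : ℂ} (hx : x ∈ V) (hy : y ∈ V) :
    winding a b γ x = winding a b γ y :=
  hVo.is_const_of_deriv_eq_zero hV
    (fun _ hz => (hasDerivAt_winding ha hb hγ (hsub hz)).differentiableAt.differentiableWithinAt)
    (fun _ hz => (hasDerivAt_winding ha hb hγ (hsub hz)).deriv) hx hy

/-- The winding integral is constant on the component and tends to 0 at infinity. If the constant
were not 0, the component would avoid a neighborhood of infinity. -/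
theorem winding_eq_zero_of_not_isBounded {a b : ℝ} (ha : 0 < a) (hb : 0 < b) {γ : ℝ → ℂ}
    (hγ : IsAlphaArc a b γ) {z : ℂ} (hz : z ∉ cuts a b γ)
    (hub : ¬ Bornology.IsBounded (connectedComponentIn (cuts a b γ)ᶜ z)) :
    winding a b γ z = 0 := by
  rw [← norm_eq_zero]
  by_contra hne
  have hpos : 0 < ‖winding a b γ z‖ := lt_of_le_of_ne (norm_nonneg _) (Ne.symm hne)
  have hev := (tendsto_winding_cobounded ha hb hγ).norm
  rw [norm_zero] at hev
  have h1 := hev.eventually_lt_const hpos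
  refine hub (Bornology.isBounded_def.2 (mem_of_superset h1 fun y hy' hy => ?_))
  change ‖winding a b γ y‖ < _ at hy'
  rw [winding_eq_of_mem ha hb hγ hγ.isOpen_compl.connectedComponentIn
    isPreconnected_connectedComponentIn (connectedComponentIn_subset _ _) hy
    (mem_connectedComponentIn hz)] at hy'
  exact lt_irrefl _ hy'

theorem mem_cuts_cases {a b : ℝ} (ha : 0 < a) (hb : 0 < b) {γ : ℝ → ℂ} (hγ : IsAlphaArc a b γ)
    {z : ℂ} (hz : z ∈ cuts a b γ) :
    z ∈ closedQuadrant ∨ (z.re = 0 ∧ 0 ≤ z.im ∧ z.im ≤ b) ∨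
      (z.im = 0 ∧ z.re ≤ 0 ∧ -a ≤ z.re) := by
  rcases hz with hz | ⟨t, ht, rfl⟩
  · rcases mem_cross_iff.1 hz with h | h | h | h
    · rw [mem_seg_zero ha] at h
      exact Or.inl ⟨h.2.1, h.1.le⟩
    · rw [mem_seg_one hb] at h; exact Or.inr (Or.inl h)
    · rw [mem_seg_two ha] at h; exact Or.inr (Or.inr h)
    · rw [mem_seg_three hb] at h
      exact Or.inl ⟨h.1.ge, h.2.1⟩
  · exact Or.inl (hγ.mem_closedQuadrant ha hb ht)

/-- Points outside the closed fourth quadrant lie in unbounded components. -/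
theorem not_isBounded_of_notMem_closedQuadrant {a b : ℝ} (ha : 0 < a) (hb : 0 < b) {γ : ℝ → ℂ}
    (hγ : IsAlphaArc a b γ) {z : ℂ} (hz : z ∉ cuts a b γ) (hzQ : z ∉ closedQuadrant) :
    ¬ Bornology.IsBounded (connectedComponentIn (cuts a b γ)ᶜ z) := by
  have ray : ∀ v : ℂ, v ≠ 0 → (∀ y : ℝ, 0 ≤ y → z + y * v ∉ cuts a b γ) →
      ¬ Bornology.IsBounded (connectedComponentIn (cuts a b γ)ᶜ z) := by
    intro v hv h hbd
    have hsub : (fun y : ℝ => z + y * v) '' Ici 0 ⊆ connectedComponentIn (cuts a b γ)ᶜ z := by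
      refine IsPreconnected.subset_connectedComponentIn
        (isPreconnected_Ici.image _ (by fun_prop)) ⟨0, by simp, by simp⟩ ?_
      rintro _ ⟨y, hy, rfl⟩
      exact h y hy
    obtain ⟨R, hR⟩ := (hbd.subset hsub).exists_norm_le
    have hv0 := norm_pos_iff.2 hv
    have hy0 : 0 ≤ (|R| + ‖z‖ + 1) / ‖v‖ := by positivity
    have h1 := hR _ ⟨(|R| + ‖z‖ + 1) / ‖v‖, hy0, rfl⟩
    have h2 := norm_sub_le (z + (((|R| + ‖z‖ + 1) / ‖v‖ : ℝ) : ℂ) * v) z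
    rw [add_sub_cancel_left, norm_mul, Complex.norm_real, Real.norm_of_nonneg hy0,
      div_mul_cancel₀ _ hv0.ne'] at h2
    have := le_abs_self R
    simp only at h1
    linarith
  have hcr : ∀ x, x ∉ cuts a b γ → x ∉ cross a b := fun x hx h => hx (Or.inl h)
  have hz' := hcr z hz
  rw [mem_cross_iff, mem_seg_one hb, mem_seg_two ha] at hz'
  -- Upwards from a point of the upper half plane only Δ₂ could be hit, and then the point itself
  -- would lie on Δ₂. In the remaining case Re z < 0, and the same holds for the ray to the left and
  -- Δ₃.
  by_cases him : 0 < z.im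
  · refine ray Complex.I Complex.I_ne_zero fun y hy hmem => hz' (Or.inr (Or.inl ?_))
    rcases mem_cuts_cases ha hb hγ hmem with h | h | h
    · have := h.2; simp at this; linarith
    · simp only [Complex.add_re, Complex.mul_re, Complex.ofReal_re, Complex.I_re, mul_zero,
        Complex.ofReal_im, Complex.I_im, mul_one, sub_self, add_zero, Complex.add_im,
        Complex.mul_im] at h
      exact ⟨h.1, him.le, by linarith⟩
    · have := h.1; simp at this; linarith
  · have hre : z.re < 0 := by
      by_contra! h
      exact hzQ ⟨h, not_lt.1 him⟩
    refine ray (-1) (by simp) fun y hy hmem => hz' (Or.inr (Or.inr (Or.inl ?_)))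
    rcases mem_cuts_cases ha hb hγ hmem with h | h | h
    · have := h.1; simp at this; linarith
    · have := h.1; simp at this; linarith
    · simp at h
      exact ⟨h.1, hre.le, by linarith⟩

end Cross

/-! ### Winding number one about the bounded component -/

namespace Cross

variable {a b : ℝ} {γ : ℝ → ℂ}

/-- The midpoint of Δ₁ has positive distance from the arc and from the other segments, so near it
the cuts are just a piece of the real axis. This is where the closed curve is opened and where the
jump is computed. -/
theorem IsAlphaArc.exists_ball (ha : 0 < a) (hb : 0 < b) (hγ : IsAlphaArc a b γ) :
    ∃ r, 0 < r ∧ r < a / 2 ∧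
      ∀ z ∈ Metric.ball ((a / 2 : ℝ) : ℂ) r, z ∈ cuts a b γ ↔ z.im = 0 := by
  have hnot : ((a / 2 : ℝ) : ℂ) ∉ γ '' Icc 0 1 := by
    rintro ⟨t, ht, h⟩
    rcases eq_or_lt_of_le ht.1 with h0 | h0
    · rw [← h0, hγ.source] at h
      have := congrArg Complex.im h
      simp [endpt] at this
      exact hb.ne' this
    rcases eq_or_lt_of_le ht.2 with h1 | h1
    · rw [h1, hγ.target] at h
      have := congrArg Complex.re h
      simp [endpt] at this
      linarith
    refine hγ.avoids t ⟨h0, h1⟩ ?_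
    rw [h, mem_cross_iff, mem_seg_zero ha]
    refine Or.inl ⟨by simp, ?_, ?_⟩ <;> simp <;> linarith
  have hcl := (isCompact_Icc.image_of_continuousOn hγ.continuousOn).isClosed
  obtain ⟨r, hr, hsub⟩ := Metric.isOpen_iff.1 hcl.isOpen_compl _ hnot
  refine ⟨min r (a / 4), lt_min hr (by linarith), (min_le_right _ _).trans_lt (by linarith),
    fun z hz => ?_⟩
  have hz1 : z ∈ Metric.ball ((a / 2 : ℝ) : ℂ) r := Metric.ball_subset_ball (min_le_left _ _) hz
  have hz2 : ‖z - ((a / 2 : ℝ) : ℂ)‖ < a / 4 := by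
    rw [← dist_eq_norm]
    exact (Metric.mem_ball.1 hz).trans_le (min_le_right _ _)
  have hre := (Complex.abs_re_le_norm _).trans_lt hz2
  rw [Complex.sub_re, Complex.ofReal_re, abs_lt] at hre
  constructor
  · rintro (h | h)
    · rcases mem_cross_iff.1 h with h | h | h | h
      · exact ((mem_seg_zero ha).1 h).1
      · have := ((mem_seg_one hb).1 h).1; linarith
      · exact ((mem_seg_two ha).1 h).1
      · have := ((mem_seg_three hb).1 h).1; linarith
    · exact absurd h (hsub hz1)
  · intro h
    exact Or.inl (mem_cross_iff.2 (Or.inl ((mem_seg_zero ha).2 ⟨h, by linarith, by linarith⟩)))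

/-- The arc that runs from `x` to `0` and `-ib` along `Δ₁` and `Δ₄`, then along `γ`, and then from
`a` back along `Δ₁`. -/
noncomputable def brokenArc (a b : ℝ) (γ : ℝ → ℂ) (u : ℝ) : ℂ :=
  if u ≤ b then (max (-u) 0 : ℝ) - (max u 0 : ℝ) * Complex.I
  else if u ≤ b + 1 then γ (u - b) else ((a - (u - b - 1) : ℝ) : ℂ)

theorem brokenArc_first {u : ℝ} (h : u ≤ b) :
    brokenArc a b γ u = (max (-u) 0 : ℝ) - (max u 0 : ℝ) * Complex.I := if_pos h

theorem brokenArc_second {u : ℝ} (h : b < u) (h' : u ≤ b + 1) :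
    brokenArc a b γ u = γ (u - b) := by
  rw [brokenArc, if_neg (not_le.2 h), if_pos h']

theorem brokenArc_third {u : ℝ} (h : b + 1 < u) :
    brokenArc a b γ u = ((a - (u - b - 1) : ℝ) : ℂ) := by
  rw [brokenArc, if_neg (by linarith), if_neg (by linarith)]

theorem continuousOn_brokenArc (hb : 0 < b) (hγ : IsAlphaArc a b γ) (c d : ℝ) :
    ContinuousOn (brokenArc a b γ) (Icc c d) := by
  have hG : Continuous (IccExtend zero_le_one ((Icc (0 : ℝ) 1).domRestrict γ)) :=
    (continuousOn_iff_continuous_domRestrict.1 hγ.continuousOn).Icc_extend'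
  have hc : Continuous fun u : ℝ => if u ≤ b then (max (-u) 0 : ℝ) - (max u 0 : ℝ) * Complex.I
      else if u ≤ b + 1 then IccExtend zero_le_one ((Icc (0 : ℝ) 1).domRestrict γ) (u - b)
      else ((a - (u - b - 1) : ℝ) : ℂ) := by
    refine Continuous.if_le (by fun_prop) (Continuous.if_le (by fun_prop) (by fun_prop)
      continuous_id continuous_const ?_) continuous_id continuous_const ?_
    · rintro u rfl
      rw [IccExtend_of_mem _ _ (by constructor <;> simp)]
      simp only [domRestrict_apply, add_sub_cancel_left, hγ.target]
      simp [endpt]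
    · rintro u rfl
      rw [if_pos (by linarith), IccExtend_of_mem _ _ (by constructor <;> simp)]
      simp only [domRestrict_apply, sub_self, hγ.source]
      rw [max_eq_right (by linarith), max_eq_left hb.le]
      simp [endpt, mul_comm]
  refine hc.continuousOn.congr fun u _ => ?_
  beta_reduce
  rcases le_or_gt u b with h | h
  · rw [brokenArc_first h, if_pos h]
  rcases le_or_gt u (b + 1) with h' | h'
  · rw [brokenArc_second h h', if_neg (not_le.2 h), if_pos h',
      IccExtend_of_mem _ _ ⟨by linarith, by linarith⟩]
    rfl
  · rw [brokenArc_third h', if_neg (not_le.2 h), if_neg (not_le.2 h')]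

theorem brokenArc_first_mem (ha : 0 < a) (hb : 0 < b) {u : ℝ} (h : u ≤ b) (h' : -a ≤ u) :
    brokenArc a b γ u ∈ cross a b := by
  rw [brokenArc_first h, mem_cross_iff]
  rcases le_total u 0 with h0 | h0
  · refine Or.inl ((mem_seg_zero ha).2 ?_)
    rw [max_eq_left (by linarith), max_eq_right h0]
    refine ⟨by simp, by simpa, ?_⟩
    simp; linarith
  · refine Or.inr (Or.inr (Or.inr ((mem_seg_three hb).2 ?_)))
    rw [max_eq_right (by linarith), max_eq_left h0]
    refine ⟨by simp, by simpa, ?_⟩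
    simpa

/-- The parameter range leaves a gap of radius r about a/2. The first piece has real part at most
a/2 - r and the last at least a/2 + r, while the middle piece meets the cross only at its ends. -/
theorem injOn_brokenArc (ha : 0 < a) (hb : 0 < b) (hγ : IsAlphaArc a b γ) {r : ℝ} (hr : 0 < r)
    (hra : r < a / 2) :
    InjOn (brokenArc a b γ) (Icc (-(a / 2 - r)) (b + 1 + (a / 2 - r))) := by
  have hre1 : ∀ u, -(a / 2 - r) ≤ u → u ≤ b → (brokenArc a b γ u).re ≤ a / 2 - r := by
    intro u h h'
    rw [brokenArc_first h']
    simp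
    constructor <;> linarith
  have hre3 : ∀ u, b + 1 < u → (brokenArc a b γ u).re = a - (u - b - 1) := by
    intro u h
    rw [brokenArc_third h, Complex.ofReal_re]
  have key : ∀ u v, -(a / 2 - r) ≤ u → v ≤ b + 1 + (a / 2 - r) → u < v →
      brokenArc a b γ u ≠ brokenArc a b γ v := by
    intro u v hu hv huv heq
    rcases le_or_gt v b with h1 | h1
    · rw [brokenArc_first h1, brokenArc_first (huv.le.trans h1)] at heq
      have e1 := congrArg Complex.re heq
      have e2 := congrArg Complex.im heq
      simp at e1 e2
      have e3 := max_zero_sub_eq_self u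
      have e4 := max_zero_sub_eq_self v
      linarith
    rcases le_or_gt u b with h2 | h2
    · have h3 := hre1 u hu h2
      rcases le_or_gt v (b + 1) with h4 | h4
      · rcases eq_or_lt_of_le h4 with h5 | h5
        · rw [heq, brokenArc_second h1 h4, h5, add_sub_cancel_left, hγ.target] at h3
          simp [endpt] at h3
          linarith
        · have h6 := brokenArc_first_mem (γ := γ) ha hb h2 (by linarith)
          rw [heq, brokenArc_second h1 h4] at h6
          exact hγ.avoids (v - b) ⟨by linarith, by linarith⟩ h6
      · rw [heq, hre3 v h4] at h3
        linarith
    rcases le_or_gt v (b + 1) with h4 | h4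
    · rw [brokenArc_second h2 (huv.le.trans h4), brokenArc_second h1 h4] at heq
      have := hγ.injOn ⟨by linarith, by linarith⟩ ⟨by linarith, by linarith⟩ heq
      linarith
    rcases le_or_gt u (b + 1) with h5 | h5
    · rcases eq_or_lt_of_le h5 with h6 | h6
      · have := congrArg Complex.re heq
        rw [hre3 v h4, brokenArc_second h2 h5, h6, add_sub_cancel_left, hγ.target] at this
        simp [endpt] at this
        linarith
      · refine hγ.avoids (u - b) ⟨by linarith, by linarith⟩ ?_
        rw [← brokenArc_second (a := a) (γ := γ) h2 h5, heq, brokenArc_third h4, mem_cross_iff, mem_seg_zero ha]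
        refine Or.inl ⟨by simp, ?_, ?_⟩ <;> rw [Complex.ofReal_re] <;> linarith
    · have := congrArg Complex.re heq
      rw [hre3 v h4, hre3 u h5] at this
      linarith
  intro u hu v hv huv
  rcases lt_trichotomy u v with h | h | h
  · exact absurd huv (key u v hu.1 hv.2 h)
  · exact h
  · exact absurd huv.symm (key v u hv.1 hu.2 h)

theorem brokenArc_mem_cuts (ha : 0 < a) (hb : 0 < b) {u : ℝ} (h : -a ≤ u) (h' : u ≤ b + 1 + a) :
    brokenArc a b γ u ∈ cuts a b γ := by
  rcases le_or_gt u b with h1 | h1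
  · exact Or.inl (brokenArc_first_mem ha hb h1 h)
  rcases le_or_gt u (b + 1) with h2 | h2
  · rw [brokenArc_second h1 h2]
    exact Or.inr ⟨_, ⟨by linarith, by linarith⟩, rfl⟩
  · rw [brokenArc_third h2]
    refine Or.inl (mem_cross_iff.2 (Or.inl ((mem_seg_zero ha).2 ⟨by simp, ?_, ?_⟩))) <;>
      rw [Complex.ofReal_re] <;> linarith

theorem mem_brokenArc (ha : 0 < a) (hb : 0 < b) (hγ : IsAlphaArc a b γ) {r : ℝ}
    (hra : r < a / 2) {z : ℂ} (hz : z ∈ cuts a b γ) (hzQ : z ∈ closedQuadrant)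
    (hzr : r ≤ ‖z - ((a / 2 : ℝ) : ℂ)‖) :
    z ∈ brokenArc a b γ '' Icc (-(a / 2 - r)) (b + 1 + (a / 2 - r)) := by
  have hzero : z = 0 → z ∈ brokenArc a b γ '' Icc (-(a / 2 - r)) (b + 1 + (a / 2 - r)) := by
    rintro rfl
    exact ⟨0, ⟨by linarith, by linarith⟩, by rw [brokenArc_first hb.le]; simp⟩
  have hseg3 : z.re = 0 → z.im ≤ 0 → -b ≤ z.im →
      z ∈ brokenArc a b γ '' Icc (-(a / 2 - r)) (b + 1 + (a / 2 - r)) := by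
    intro h1 h2 h3
    refine ⟨-z.im, ⟨by linarith, by linarith⟩, ?_⟩
    rw [brokenArc_first (by linarith), max_eq_right (by linarith), max_eq_left (by linarith)]
    apply Complex.ext <;> simp [h1]
  rcases hz with hz | ⟨t, ht, rfl⟩
  · rcases mem_cross_iff.1 hz with h | h | h | h
    · rw [mem_seg_zero ha] at h
      have hzre : z = (z.re : ℂ) := by apply Complex.ext <;> simp [h.1]
      rw [hzre, ← Complex.ofReal_sub, Complex.norm_real, Real.norm_eq_abs, le_abs] at hzr
      rcases hzr with h5 | h5
      · rcases eq_or_lt_of_le h.2.2 with h6 | h6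
        · refine ⟨b + 1, ⟨by linarith, by linarith⟩, ?_⟩
          rw [brokenArc_second (by linarith) le_rfl, add_sub_cancel_left, hγ.target, hzre, h6]
          simp [endpt]
        · refine ⟨b + 1 + (a - z.re), ⟨by linarith, by linarith⟩, ?_⟩
          rw [brokenArc_third (by linarith), show a - (b + 1 + (a - z.re) - b - 1) = z.re by ring,
            ← hzre]
      · refine ⟨-z.re, ⟨by linarith, by linarith⟩, ?_⟩
        rw [brokenArc_first (by linarith), max_eq_left (by linarith), max_eq_right (by linarith)]
        apply Complex.ext <;> simp [h.1]
    · rw [mem_seg_one hb] at h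
      exact hzero (Complex.ext h.1 (le_antisymm hzQ.2 h.2.1))
    · rw [mem_seg_two ha] at h
      exact hzero (Complex.ext (le_antisymm h.2.1 hzQ.1) h.1)
    · rw [mem_seg_three hb] at h
      exact hseg3 h.1 h.2.1 h.2.2
  · rcases eq_or_lt_of_le ht.1 with h | h
    · rw [← h, hγ.source] at hseg3 ⊢
      exact hseg3 (by simp [endpt]) (by simp [endpt, hb.le]) (by simp [endpt])
    · refine ⟨b + t, ⟨by linarith, by linarith [ht.2]⟩, ?_⟩
      rw [brokenArc_second (by linarith) (by linarith [ht.2]), add_sub_cancel_left]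

/-- A frontier point inside U would have an open component meeting the given one, hence equal to it,
and would then be an interior point. -/
theorem frontier_connectedComponentIn_subset {U : Set ℂ} (hU : IsOpen U) (z : ℂ) :
    frontier (connectedComponentIn U z) ⊆ Uᶜ := by
  intro x hx hxU
  have hVo : IsOpen (connectedComponentIn U z) := hU.connectedComponentIn
  rw [hVo.frontier_eq] at hx
  have hxo : IsOpen (connectedComponentIn U x) := hU.connectedComponentIn
  obtain ⟨y, hy1, hy2⟩ := mem_closure_iff.1 hx.1 _ hxo (mem_connectedComponentIn hxU)
  have e1 := connectedComponentIn_eq hy1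
  have e2 := connectedComponentIn_eq hy2
  exact hx.2 (by rw [e2, ← e1]; exact mem_connectedComponentIn hxU)

/-- A bounded component reaches the lower side of Δ₁ near a/2. The upper side belongs to an
unbounded component, where the winding integral is 0. Crossing Δ₁ downwards adds 2πi by the Plemelj
formula for the constant density, while the other two integrals are continuous there. -/
theorem winding_eq_of_isBounded (ha : 0 < a) (hb : 0 < b) (hγ : IsAlphaArc a b γ) {p : ℂ}
    (hp : p ∉ cuts a b γ) (hbd : Bornology.IsBounded (connectedComponentIn (cuts a b γ)ᶜ p)) :
    winding a b γ p = 2 * Real.pi * Complex.I := by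
  obtain ⟨r, hr, hra, hball⟩ := hγ.exists_ball ha hb
  set V := connectedComponentIn (cuts a b γ)ᶜ p with hV
  have hVo : IsOpen V := hγ.isOpen_compl.connectedComponentIn
  have hVsub : V ⊆ (cuts a b γ)ᶜ := connectedComponentIn_subset _ _
  have hVQ : V ⊆ closedQuadrant := by
    intro z hz
    by_contra hzQ
    refine not_isBounded_of_notMem_closedQuadrant ha hb hγ (hVsub hz) hzQ ?_
    rwa [← connectedComponentIn_eq hz]
  -- Otherwise the frontier of the component would avoid the open ball about a/2 and would be
  -- contained in the broken arc, which is impossible for a bounded set disjoint from that arc.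
  have hhit : ∃ v ∈ V, v ∈ Metric.ball ((a / 2 : ℝ) : ℂ) r := by
    by_contra! hno
    refine not_frontier_subset_arc hbd ⟨p, mem_connectedComponentIn hp⟩ (by linarith)
      (continuousOn_brokenArc hb hγ _ _) (injOn_brokenArc ha hb hγ hr hra) (fun t ht h =>
        hVsub h (brokenArc_mem_cuts ha hb (by linarith [ht.1]) (by linarith [ht.2]))) ?_
    intro z hz
    have hz1 : z ∈ cuts a b γ := by
      have := frontier_connectedComponentIn_subset hγ.isOpen_compl p hz
      rwa [compl_compl] at this
    have hz2 : z ∈ closedQuadrant :=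
      closure_minimal hVQ isClosed_closedQuadrant (frontier_subset_closure hz)
    refine mem_brokenArc ha hb hγ hra hz1 hz2 ?_
    by_contra! hlt
    rw [← dist_eq_norm] at hlt
    obtain ⟨y, hy1, hy2⟩ := mem_closure_iff.1 (frontier_subset_closure hz) _
      Metric.isOpen_ball (Metric.mem_ball.2 hlt)
    exact hno y hy2 hy1
  obtain ⟨v, hvV, hvB⟩ := hhit
  have hsideN : ∀ S : Set ℂ, Convex ℝ S → (∀ z ∈ S, z.im ≠ 0) →
      Metric.ball ((a / 2 : ℝ) : ℂ) r ∩ S ⊆ (cuts a b γ)ᶜ := fun S _ hS z hz hzc =>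
    hS z hz.2 ((hball z hz.1).1 hzc)
  have hconvL : Convex ℝ {z : ℂ | z.im < 0} := convex_halfSpace_im_lt 0
  have hconvU : Convex ℝ {z : ℂ | 0 < z.im} := convex_halfSpace_im_gt 0
  have hvim : v.im < 0 := by
    have h1 : v.im ≠ 0 := fun h => hVsub hvV ((hball v hvB).2 h)
    exact lt_of_le_of_ne (hVQ hvV).2 h1
  have hlow : ∀ z ∈ Metric.ball ((a / 2 : ℝ) : ℂ) r ∩ {z | z.im < 0},
      winding a b γ z = winding a b γ p := by
    intro z hz
    rw [winding_eq_of_mem ha hb hγ (Metric.isOpen_ball.inter (isOpen_lt Complex.continuous_im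
      continuous_const)) ((convex_ball _ r).inter hconvL).isPreconnected
      (hsideN _ hconvL fun z hz => ne_of_lt hz) hz ⟨hvB, hvim⟩]
    exact winding_eq_of_mem ha hb hγ hVo isPreconnected_connectedComponentIn hVsub hvV
      (mem_connectedComponentIn hp)
  have hup : ∀ z ∈ Metric.ball ((a / 2 : ℝ) : ℂ) r ∩ {z | 0 < z.im}, winding a b γ z = 0 := by
    intro z hz
    have hzc := hsideN _ hconvU (fun z hz => (ne_of_lt hz).symm) hz
    exact winding_eq_zero_of_not_isBounded ha hb hγ hzc
      (not_isBounded_of_notMem_closedQuadrant ha hb hγ hzc fun h => not_le.2 hz.2 h.2)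
  have hx0 : coord a b 0 ((a / 2 : ℝ) : ℂ) = ((1 / 2 : ℝ) : ℂ) := by
    have : (a : ℂ) ≠ 0 := by exact_mod_cast ha.ne'
    simp only [coord, endpt, Matrix.cons_val_zero]
    push_cast
    field_simp
    ring
  obtain ⟨c, hc1, hc2⟩ := exists_tendsto_cauchy (φ := fun _ => 1) (by simp) (x := 1 / 2)
    (δ := 1 / 4) (K := 0) (by norm_num) (Icc_subset_Icc (by norm_num) (by norm_num))
    (by intro t _ u _; simp)
  have him : ∀ z : ℂ, (coord a b 0 z).im = -(z.im / a) := by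
    intro z
    simp [coord, endpt]
  have hcoord := (continuous_coord (a := a) (b := b) 0).tendsto ((a / 2 : ℝ) : ℂ)
  rw [hx0] at hcoord
  obtain ⟨K, hK⟩ := hγ.lipschitz
  set m : ℂ := ((a / 2 : ℝ) : ℂ) with hm
  have hmarc : ∀ t ∈ Icc (0 : ℝ) 1, γ t - 1 * m ≠ 0 := by
    intro t ht h
    rw [one_mul, sub_eq_zero] at h
    rcases eq_or_lt_of_le ht.1 with h0 | h0
    · rw [← h0, hγ.source] at h
      have := congrArg Complex.im h
      simp [endpt, m] at this
      exact hb.ne' this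
    rcases eq_or_lt_of_le ht.2 with h1 | h1
    · rw [h1, hγ.target] at h
      have := congrArg Complex.re h
      simp [endpt, m] at this
      linarith
    refine hγ.avoids t ⟨h0, h1⟩ ?_
    rw [h, mem_cross_iff, mem_seg_zero ha]
    refine Or.inl ⟨by simp [m], ?_, ?_⟩ <;> simp [m] <;> linarith
  have harc := (hasDerivAt_integral_div (intervalIntegrable_deriv_of_lipschitz hK) (p := γ)
    (q := fun _ => 1) hγ.continuousOn (by fun_prop) hmarc).continuousAt.tendsto
  simp only [one_mul] at harc
  have hm3 : m ∉ seg a b 3 := by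
    rw [mem_seg_three hb]
    intro h
    have := h.1
    simp [m] at this
    linarith
  have h3 : Tendsto (fun z => cauchy (fun _ => 1) (coord a b 3 z)) (𝓝 m)
      (𝓝 (cauchy (fun _ => 1) (coord a b 3 m))) :=
    ((hasDerivAt_cauchy (by simp) (coord_notMem ha hb hm3)).comp m
      (hasDerivAt_coord 3 m)).continuousAt.tendsto
  have hbm : Metric.ball m r ∈ 𝓝 m := Metric.ball_mem_nhds m hr
  have hLlim : Tendsto (winding a b γ) (𝓝[{z | z.im < 0}] m)
      (𝓝 ((∫ t in (0 : ℝ)..1, deriv γ t / (γ t - m)) + (c + Real.pi * Complex.I * 1) -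
        cauchy (fun _ => 1) (coord a b 3 m))) := by
    refine ((harc.mono_left nhdsWithin_le_nhds).add (hc1.comp (tendsto_nhdsWithin_iff.2
      ⟨hcoord.mono_left nhdsWithin_le_nhds, ?_⟩))).sub (h3.mono_left nhdsWithin_le_nhds)
    filter_upwards [self_mem_nhdsWithin] with z (hz : z.im < 0)
    rw [him, ← neg_div]
    exact div_pos (by linarith) ha
  have hUlim : Tendsto (winding a b γ) (𝓝[{z | 0 < z.im}] m)
      (𝓝 ((∫ t in (0 : ℝ)..1, deriv γ t / (γ t - m)) + (c - Real.pi * Complex.I * 1) -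
        cauchy (fun _ => 1) (coord a b 3 m))) := by
    refine ((harc.mono_left nhdsWithin_le_nhds).add (hc2.comp (tendsto_nhdsWithin_iff.2
      ⟨hcoord.mono_left nhdsWithin_le_nhds, ?_⟩))).sub (h3.mono_left nhdsWithin_le_nhds)
    filter_upwards [self_mem_nhdsWithin] with z (hz : 0 < z.im)
    rw [him, neg_lt_zero]
    positivity
  have hmem : ∀ s : Set ℂ, (∀ ε : ℝ, 0 < ε → ∃ z ∈ s, dist z m < ε) → (𝓝[s] m).NeBot := by
    intro s hs
    rw [← mem_closure_iff_nhdsWithin_neBot, Metric.mem_closure_iff]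
    intro ε hε
    obtain ⟨z, hz, hzε⟩ := hs ε hε
    exact ⟨z, hz, by rwa [dist_comm]⟩
  have hnL : (𝓝[{z : ℂ | z.im < 0}] m).NeBot := hmem _ fun ε hε =>
    ⟨m - (ε / 2 : ℝ) * Complex.I, by simpa [m] using hε, by
      simpa [dist_eq_norm, abs_of_pos hε] using hε⟩
  have hnU : (𝓝[{z : ℂ | 0 < z.im}] m).NeBot := hmem _ fun ε hε =>
    ⟨m + (ε / 2 : ℝ) * Complex.I, by simpa [m] using hε, by
      simpa [dist_eq_norm, abs_of_pos hε] using hε⟩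
  have e1 := tendsto_nhds_unique hLlim (tendsto_const_nhds.congr' (by
    filter_upwards [self_mem_nhdsWithin, mem_nhdsWithin_of_mem_nhds hbm] with z hz hz'
    exact (hlow z ⟨hz', hz⟩).symm))
  have e2 := tendsto_nhds_unique hUlim (tendsto_const_nhds.congr' (by
    filter_upwards [self_mem_nhdsWithin, mem_nhdsWithin_of_mem_nhds hbm] with z hz hz'
    exact (hup z ⟨hz', hz⟩).symm))
  rw [← e1]
  linear_combination e2

open Classical in
/-- The indicator function of the bounded component of the complement of the cuts. -/
noncomputable def innerIndicator (a b : ℝ) (γ : ℝ → ℂ) (z : ℂ) : ℂ :=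
  if z ∈ innerDomain a b γ then 1 else 0

/-- This takes the place of the Jordan curve theorem: nothing is needed about the number of bounded
components. -/
theorem winding_eq (ha : 0 < a) (hb : 0 < b) (hγ : IsAlphaArc a b γ) {z : ℂ}
    (hz : z ∉ cuts a b γ) :
    winding a b γ z = 2 * Real.pi * Complex.I * innerIndicator a b γ z := by
  by_cases h : Bornology.IsBounded (connectedComponentIn (cuts a b γ)ᶜ z)
  · rw [innerIndicator, if_pos ⟨hz, h⟩, winding_eq_of_isBounded ha hb hγ hz h, mul_one]
  · rw [innerIndicator, if_neg fun hm => h hm.2, winding_eq_zero_of_not_isBounded ha hb hγ hz h,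
      mul_zero]

theorem innerIndicator_eq_zero_of_notMem (ha : 0 < a) (hb : 0 < b) (hγ : IsAlphaArc a b γ) {z : ℂ}
    (hzQ : z ∉ closedQuadrant) : innerIndicator a b γ z = 0 :=
  if_neg fun h => not_isBounded_of_notMem_closedQuadrant ha hb hγ h.1 hzQ h.2

theorem innerIndicator_mem (z : ℂ) : innerIndicator a b γ z = 0 ∨ innerIndicator a b γ z = 1 := by
  rw [innerIndicator]; split_ifs <;> simp

end Cross

/-! ### Square roots and branches of w -/

namespace Cross

theorem cpow_half_sq (z : ℂ) : (z ^ (1 / 2 : ℂ)) ^ 2 = z := by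
  rw [one_div]; exact Complex.cpow_ofNat_inv_pow z 2

theorem sq_cpow_half {z : ℂ} (hz : 0 < z.re) : (z ^ 2) ^ (1 / 2 : ℂ) = z := by
  rw [one_div]; exact Complex.sq_cpow_two_inv hz

theorem cpow_half_eq_of_sq {z v : ℂ} (hz : 0 < z.re) (h : z ^ 2 = v) : v ^ (1 / 2 : ℂ) = z := by
  rw [← h, sq_cpow_half hz]

theorem re_cpow_half_nonneg (z : ℂ) : 0 ≤ (z ^ (1 / 2 : ℂ)).re := by
  rcases eq_or_ne z 0 with rfl | hz
  · simp
  rw [Complex.cpow_def_of_ne_zero hz, Complex.exp_re]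
  refine mul_nonneg (Real.exp_pos _).le (Real.cos_nonneg_of_mem_Icc ?_)
  have h : (Complex.log z * (1 / 2)).im = z.arg / 2 := by
    rw [show (1 / 2 : ℂ) = ((1 / 2 : ℝ) : ℂ) by push_cast; rfl, Complex.im_mul_ofReal,
      Complex.log_im]
    ring
  rw [h]
  constructor <;> linarith [Complex.neg_pi_lt_arg z, Complex.arg_le_pi z]

theorem re_cpow_half_pos {z : ℂ} (hz : z ∈ Complex.slitPlane) : 0 < (z ^ (1 / 2 : ℂ)).re := by
  refine lt_of_le_of_ne (re_cpow_half_nonneg z) fun h => ?_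
  have h1 := cpow_half_sq z
  set p := z ^ (1 / 2 : ℂ)
  rw [← h1, Complex.mem_slitPlane_iff] at hz
  simp only [sq, Complex.mul_re, Complex.mul_im, ← h] at hz
  rcases hz with hz | hz
  · nlinarith
  · simp at hz

/-- Here the principal root of -v has positive real and negative imaginary part, so i times it lies
in the right half plane. This exchanges the cut along the negative axis for one along the positive
axis. -/
theorem cpow_half_of_im_pos {v : ℂ} (hv : 0 < v.im) :
    v ^ (1 / 2 : ℂ) = Complex.I * (-v) ^ (1 / 2 : ℂ) := by
  have h0 : 0 < ((-v) ^ (1 / 2 : ℂ)).re := re_cpow_half_pos (by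
    rw [Complex.mem_slitPlane_iff]; right; simp [hv.ne'])
  have h1 := cpow_half_sq (-v)
  set p := (-v) ^ (1 / 2 : ℂ)
  have h2 := congrArg Complex.im h1
  simp only [sq, Complex.mul_im, Complex.neg_im] at h2
  refine cpow_half_eq_of_sq ?_ ?_
  · simp only [Complex.mul_re, Complex.I_re, Complex.I_im]
    nlinarith
  · rw [mul_pow, Complex.I_sq, h1]; ring

theorem cpow_half_of_im_neg {v : ℂ} (hv : v.im < 0) :
    v ^ (1 / 2 : ℂ) = -Complex.I * (-v) ^ (1 / 2 : ℂ) := by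
  have := cpow_half_of_im_pos (v := -v) (by simpa using hv)
  rw [this, neg_neg, ← mul_assoc]
  simp

theorem cpow_half_ofReal {r : ℝ} (hr : 0 ≤ r) : (r : ℂ) ^ (1 / 2 : ℂ) = (Real.sqrt r : ℂ) := by
  rcases eq_or_lt_of_le hr with rfl | h
  · simp
  · refine cpow_half_eq_of_sq (by simpa using h) ?_
    rw [← Complex.ofReal_pow, Real.sq_sqrt hr]

variable {a b : ℝ}

/-- The ratio is 1 + (a² + b²)/(z² - a²), so its imaginary part has the sign opposite to that of Im
z². -/
theorem im_ratio {z : ℂ} (hX : z ^ 2 - (a : ℂ) ^ 2 ≠ 0) :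
    ((z ^ 2 + (b : ℂ) ^ 2) / (z ^ 2 - (a : ℂ) ^ 2)).im =
      -((a ^ 2 + b ^ 2) * (z ^ 2).im / Complex.normSq (z ^ 2 - (a : ℂ) ^ 2)) := by
  have h : (z ^ 2 + (b : ℂ) ^ 2) / (z ^ 2 - (a : ℂ) ^ 2) =
      1 + ((a ^ 2 + b ^ 2 : ℝ) : ℂ) * (z ^ 2 - (a : ℂ) ^ 2)⁻¹ := by
    push_cast; field_simp; ring
  have h2 : (z ^ 2 - (a : ℂ) ^ 2).im = (z ^ 2).im := by
    rw [← Complex.ofReal_pow, Complex.sub_im, Complex.ofReal_im, sub_zero]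
  rw [h, Complex.add_im, Complex.im_ofReal_mul, Complex.inv_im, h2]
  simp; ring

theorem sq_sub_ne_zero {z : ℂ} (h1 : z ≠ a) (h2 : z ≠ -a) : z ^ 2 - (a : ℂ) ^ 2 ≠ 0 := by
  rw [sq_sub_sq]
  exact mul_ne_zero (fun h => h2 (by linear_combination h)) (sub_ne_zero.2 h1)

theorem sq_add_ne_zero {z : ℂ} (h1 : z ≠ Complex.I * b) (h2 : z ≠ -(Complex.I * b)) :
    z ^ 2 + (b : ℂ) ^ 2 ≠ 0 := by
  have : z ^ 2 + (b : ℂ) ^ 2 = (z - Complex.I * b) * (z + Complex.I * b) := by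
    linear_combination (b : ℂ) ^ 2 * Complex.I_sq
  rw [this]
  exact mul_ne_zero (sub_ne_zero.2 h1) (fun h => h2 (by linear_combination h))

/-- A nonpositive real ratio forces z² to be real with -b² ≤ z² < a², which places z on the cross.
-/
theorem ratio_mem_slitPlane (ha : 0 < a) (hb : 0 < b) {z : ℂ} (hz : z ∉ cross a b) :
    z ^ 2 - (a : ℂ) ^ 2 ≠ 0 ∧
      (z ^ 2 + (b : ℂ) ^ 2) / (z ^ 2 - (a : ℂ) ^ 2) ∈ Complex.slitPlane := by
  have hX : z ^ 2 - (a : ℂ) ^ 2 ≠ 0 :=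
    sq_sub_ne_zero (fun h => hz (h ▸ endpt_mem_cross 0)) (fun h => hz (h ▸ endpt_mem_cross 2))
  refine ⟨hX, ?_⟩
  by_contra hs
  rw [Complex.mem_slitPlane_iff, not_or, not_lt, not_not, im_ratio hX] at hs
  obtain ⟨hre, him⟩ := hs
  have h0 : (z ^ 2).im = 0 := by
    have := Complex.normSq_pos.2 hX
    have h3 : (a ^ 2 + b ^ 2) * (z ^ 2).im / Complex.normSq (z ^ 2 - (a : ℂ) ^ 2) = 0 := by linarith
    rcases div_eq_zero_iff.1 h3 with h4 | h4
    · rcases mul_eq_zero.1 h4 with h5 | h5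
      · nlinarith
      · exact h5
    · linarith
  have h1 : z ^ 2 = ((z ^ 2).re : ℂ) := Complex.ext (by simp) (by simpa using h0)
  set r := (z ^ 2).re with hr
  rw [h1] at hX hre
  norm_cast at hX hre
  have h2 : r < a ^ 2 := by
    by_contra! h
    have h3 : 0 < r - a ^ 2 := lt_of_le_of_ne (by linarith) (Ne.symm hX)
    have := div_pos (by nlinarith [sq_nonneg a, pow_pos hb 2] : 0 < r + b ^ 2) h3
    linarith
  have h3 : 0 ≤ r + b ^ 2 := by
    by_contra! h
    have := div_pos_of_neg_of_neg h (by linarith : r - a ^ 2 < 0)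
    linarith
  simp only [sq, Complex.mul_re, Complex.mul_im] at hr h0
  refine hz (mem_cross_iff.2 ?_)
  have h4 : z.re * z.im = 0 := by linarith
  rw [mem_seg_zero ha, mem_seg_one hb, mem_seg_two ha, mem_seg_three hb]
  rcases mul_eq_zero.1 h4 with h5 | h5
  · rw [h5] at hr
    have := abs_le_of_sq_le_sq (a := z.im) (b := b) (by nlinarith) hb.le
    rw [abs_le] at this
    rcases le_total 0 z.im with h6 | h6
    · exact Or.inr (Or.inl ⟨h5, h6, this.2⟩)
    · exact Or.inr (Or.inr (Or.inr ⟨h5, h6, this.1⟩))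
  · rw [h5] at hr
    have := abs_le_of_sq_le_sq (a := z.re) (b := a) (by nlinarith) ha.le
    rw [abs_le] at this
    rcases le_total 0 z.re with h6 | h6
    · exact Or.inl ⟨h5, h6, this.2⟩
    · exact Or.inr (Or.inr (Or.inl ⟨h5, h6, this.1⟩))

theorem differentiableAt_w (ha : 0 < a) (hb : 0 < b) {z : ℂ} (hz : z ∉ cross a b) :
    DifferentiableAt ℂ (w a b) z := by
  obtain ⟨h1, h2⟩ := ratio_mem_slitPlane ha hb hz
  unfold w
  have h3 : DifferentiableAt ℂ (fun z : ℂ => (z ^ 2 + (b : ℂ) ^ 2) / (z ^ 2 - (a : ℂ) ^ 2)) z :=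
    DifferentiableAt.div (by fun_prop) (by fun_prop) h1
  exact DifferentiableAt.mul (by fun_prop) (h3.cpow_const h2)

theorem analyticAt_w (ha : 0 < a) (hb : 0 < b) {z : ℂ} (hz : z ∉ cross a b) :
    AnalyticAt ℂ (w a b) z := by
  have hO : IsOpen (cross a b)ᶜ := (isCompact_cross a b).isClosed.isOpen_compl
  exact DifferentiableOn.analyticAt
    (fun y hy => (differentiableAt_w ha hb hy).differentiableWithinAt) (hO.mem_nhds hz)

theorem w_ne_zero {z : ℂ} (hz : ∀ i, z ≠ endpt a b i) : w a b z ≠ 0 := by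
  intro h
  have h1 := w_sq a b z
  rw [h, sq, zero_mul] at h1
  rcases mul_eq_zero.1 h1.symm with h2 | h2
  · exact sq_sub_ne_zero (hz 0) (hz 2) h2
  · exact sq_add_ne_zero (hz 1) (hz 3) h2

theorem ne_endpt_of_notMem {z : ℂ} (hz : z ∉ cross a b) (i : Fin 4) : z ≠ endpt a b i :=
  fun h => hz (h ▸ endpt_mem_cross i)

/-- The branch of `√((z² - a²)(z² + b²))` that is positive on the cross. -/
noncomputable def wCut (a b : ℝ) (z : ℂ) : ℂ :=
  -(z ^ 2 - (a : ℂ) ^ 2) * (-((z ^ 2 + (b : ℂ) ^ 2) / (z ^ 2 - (a : ℂ) ^ 2))) ^ (1 / 2 : ℂ)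

theorem w_eq_of_im_neg (ha : 0 < a) {z : ℂ} (hz : (z ^ 2).im < 0) :
    w a b z = -Complex.I * wCut a b z := by
  have hX : z ^ 2 - (a : ℂ) ^ 2 ≠ 0 := by
    intro h
    have := congrArg Complex.im h
    rw [← Complex.ofReal_pow, Complex.sub_im, Complex.ofReal_im] at this
    simp at this; linarith
  have := Complex.normSq_pos.2 hX
  rw [w, wCut, cpow_half_of_im_pos]
  · ring
  · rw [im_ratio hX, neg_pos]
    exact div_neg_of_neg_of_pos (mul_neg_of_pos_of_neg (by positivity) hz) this

theorem w_eq_of_im_pos (ha : 0 < a) {z : ℂ} (hz : 0 < (z ^ 2).im) :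
    w a b z = Complex.I * wCut a b z := by
  have hX : z ^ 2 - (a : ℂ) ^ 2 ≠ 0 := by
    intro h
    have := congrArg Complex.im h
    rw [← Complex.ofReal_pow, Complex.sub_im, Complex.ofReal_im] at this
    simp at this; linarith
  have := Complex.normSq_pos.2 hX
  rw [w, wCut, cpow_half_of_im_neg]
  · ring
  · rw [im_ratio hX, neg_lt_zero]
    exact div_pos (mul_pos (by positivity) hz) this

theorem exists_sq_eq_of_mem_cross (ha : 0 < a) (hb : 0 < b) {s : ℂ} (hs : s ∈ cross a b) :
    ∃ r : ℝ, s ^ 2 = r ∧ r ≤ a ^ 2 ∧ 0 ≤ r + b ^ 2 := by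
  rw [mem_cross_iff, mem_seg_zero ha, mem_seg_one hb, mem_seg_two ha, mem_seg_three hb] at hs
  rcases hs with h | h | h | h
  · exact ⟨s.re ^ 2, by apply Complex.ext <;> simp [sq, h.1], by nlinarith, by positivity⟩
  · exact ⟨-s.im ^ 2, by apply Complex.ext <;> simp [sq, h.1], by nlinarith, by nlinarith⟩
  · exact ⟨s.re ^ 2, by apply Complex.ext <;> simp [sq, h.1], by nlinarith, by positivity⟩
  · exact ⟨-s.im ^ 2, by apply Complex.ext <;> simp [sq, h.1], by nlinarith, by nlinarith⟩

theorem wCut_eq_of_mem_cross (ha : 0 < a) (hb : 0 < b) {s : ℂ} (hs : s ∈ cross a b) :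
    wCut a b s = (Real.sqrt ‖(s ^ 2 - (a : ℂ) ^ 2) * (s ^ 2 + (b : ℂ) ^ 2)‖ : ℂ) := by
  obtain ⟨r, h0, h1, h2⟩ := exists_sq_eq_of_mem_cross ha hb hs
  rw [wCut, h0]
  norm_cast
  rw [Real.norm_eq_abs]
  rcases eq_or_lt_of_le h1 with h | h
  · simp [h]
  · rw [← neg_div_neg_eq, neg_sub, cpow_half_ofReal (by
      rw [← neg_div, neg_neg]; exact div_nonneg h2 (by linarith)), ← Complex.ofReal_mul]
    rw [abs_of_nonpos (by nlinarith)]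
    congr 1
    rw [← Real.sqrt_sq (by linarith : 0 ≤ a ^ 2 - r), ← Real.sqrt_mul (by positivity)]
    congr 1
    have : a ^ 2 - r ≠ 0 := by linarith
    rw [Real.sqrt_sq (by linarith)]
    field_simp
    ring

theorem wPlus_eq (ha : 0 < a) (hb : 0 < b) {i : Fin 4} {s : ℂ} (hs : s ∈ seg a b i) :
    wPlus a b i s = (-1) ^ ((i : ℕ) + 1) * Complex.I * wCut a b s := by
  rw [wPlus, wCut_eq_of_mem_cross ha hb (mem_iUnion.2 ⟨i, hs⟩)]

/-- At a point of the cross other than an endpoint the ratio is a negative number, so its negative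
lies in the slit plane. Thus `wCut` continues w analytically across the segments and through the
origin. -/
theorem analyticAt_wCut (ha : 0 < a) (hb : 0 < b) {s : ℂ} (hs : s ∈ cross a b)
    (h : ∀ i, s ≠ endpt a b i) : AnalyticAt ℂ (wCut a b) s := by
  have hX := sq_sub_ne_zero (h 0) (h 2)
  have hY := sq_add_ne_zero (h 1) (h 3)
  obtain ⟨r, h0, h1, h2⟩ := exists_sq_eq_of_mem_cross ha hb hs
  unfold wCut
  have hra : AnalyticAt ℂ (fun z : ℂ => -((z ^ 2 + (b : ℂ) ^ 2) / (z ^ 2 - (a : ℂ) ^ 2))) s :=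
    ((by fun_prop : AnalyticAt ℂ (fun z : ℂ => z ^ 2 + (b : ℂ) ^ 2) s).div (by fun_prop) hX).neg
  refine AnalyticAt.mul (by fun_prop) (hra.cpow analyticAt_const ?_)
  rw [h0] at hX hY ⊢
  norm_cast at hX hY ⊢
  have h3 : r < a ^ 2 := lt_of_le_of_ne h1 (fun h => hX (by linarith))
  have h4 : 0 < r + b ^ 2 := lt_of_le_of_ne h2 (Ne.symm hY)
  exact Complex.ofReal_mem_slitPlane.2 (neg_pos.2 (div_neg_of_pos_of_neg h4 (sub_neg.2 h3)))

theorem endpt_sq_even {i : Fin 4} : endpt a b i ^ 2 =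
    (((-1) ^ (i : ℕ) * (if (i : ℕ) % 2 = 0 then a else b) ^ 2 : ℝ) : ℂ) := by
  fin_cases i <;> (simp [endpt, mul_pow]; try norm_num)

/-- Since z = a_i(1 - ζ) and a_i² is real with alternating sign, the sign of Im z² tells on which
side of the i-th segment z lies. -/
theorem im_sq_eq (ha : 0 < a) (hb : 0 < b) (i : Fin 4) (z : ℂ) :
    (z ^ 2).im = (-1) ^ ((i : ℕ) + 1) * (2 * (if (i : ℕ) % 2 = 0 then a else b) ^ 2) *
      ((coord a b i z).im * (1 - (coord a b i z).re)) := by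
  have h : z = endpt a b i * (1 - coord a b i z) := by
    have := endpt_ne_zero ha hb i
    rw [coord]; field_simp; ring
  have h2 : z ^ 2 = (((-1) ^ (i : ℕ) * (if (i : ℕ) % 2 = 0 then a else b) ^ 2 : ℝ) : ℂ) *
      (1 - coord a b i z) ^ 2 := by
    rw [← endpt_sq_even]
    conv_lhs => rw [h, mul_pow]
  rw [h2, Complex.im_ofReal_mul]
  simp only [sq, Complex.mul_im, Complex.sub_im, Complex.sub_re, Complex.one_im, Complex.one_re]
  ring

theorem w_eq_of_coord_im_pos (ha : 0 < a) (hb : 0 < b) {i : Fin 4} {z : ℂ}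
    (h1 : (coord a b i z).re < 1) (h2 : 0 < (coord a b i z).im) :
    w a b z = (-1) ^ ((i : ℕ) + 1) * Complex.I * wCut a b z := by
  have h := im_sq_eq ha hb i z
  have h3 : 0 < (coord a b i z).im * (1 - (coord a b i z).re) := mul_pos h2 (by linarith)
  have h4 : 0 < 2 * (if (i : ℕ) % 2 = 0 then a else b) ^ 2 := by split_ifs <;> positivity
  have h5 := mul_pos h4 h3
  rcases Nat.even_or_odd (i : ℕ) with he | he
  · rw [he.add_one.neg_one_pow] at h ⊢
    rw [w_eq_of_im_neg ha (by rw [h]; linarith)]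
    ring
  · rw [he.add_one.neg_one_pow] at h ⊢
    rw [w_eq_of_im_pos ha (by rw [h]; linarith)]
    ring

theorem w_eq_of_coord_im_neg (ha : 0 < a) (hb : 0 < b) {i : Fin 4} {z : ℂ}
    (h1 : (coord a b i z).re < 1) (h2 : (coord a b i z).im < 0) :
    w a b z = -((-1) ^ ((i : ℕ) + 1) * Complex.I * wCut a b z) := by
  have h := im_sq_eq ha hb i z
  have h3 : 0 < -(coord a b i z).im * (1 - (coord a b i z).re) := mul_pos (by linarith) (by linarith)
  have h4 : 0 < 2 * (if (i : ℕ) % 2 = 0 then a else b) ^ 2 := by split_ifs <;> positivity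
  have h5 := mul_pos h4 h3
  rcases Nat.even_or_odd (i : ℕ) with he | he
  · rw [he.add_one.neg_one_pow] at h ⊢
    rw [w_eq_of_im_pos ha (by rw [h]; linarith)]
    ring
  · rw [he.add_one.neg_one_pow] at h ⊢
    rw [w_eq_of_im_neg ha (by rw [h]; linarith)]
    ring

theorem w_eq_of_mem_quadrant (ha : 0 < a) {j : Fin 4} {z : ℂ} (hz : z ∈ quadrant j) :
    w a b z = (-1) ^ (j : ℕ) * Complex.I * wCut a b z := by
  fin_cases j
  · obtain ⟨h1, h2⟩ : 0 < z.re ∧ 0 < z.im := hz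
    rw [w_eq_of_im_pos ha (by simp only [sq, Complex.mul_im]; nlinarith)]
    simp
  · obtain ⟨h1, h2⟩ : z.re < 0 ∧ 0 < z.im := hz
    rw [w_eq_of_im_neg ha (by simp only [sq, Complex.mul_im]; nlinarith)]
    simp
  · obtain ⟨h1, h2⟩ : z.re < 0 ∧ z.im < 0 := hz
    rw [w_eq_of_im_pos ha (by simp only [sq, Complex.mul_im]; nlinarith)]
    simp
  · obtain ⟨h1, h2⟩ : 0 < z.re ∧ z.im < 0 := hz
    rw [w_eq_of_im_neg ha (by simp only [sq, Complex.mul_im]; nlinarith)]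
    simp; norm_num

theorem wCut_zero (ha : 0 < a) (hb : 0 < b) : wCut a b 0 = a * b := by
  rw [wCut_eq_of_mem_cross ha hb zero_mem_cross]
  rw [show ((0 : ℂ) ^ 2 - a ^ 2) * (0 ^ 2 + b ^ 2) = ((-(a * b) ^ 2 : ℝ) : ℂ) by push_cast; ring,
    Complex.norm_real, Real.norm_eq_abs, abs_neg, abs_of_nonneg (by positivity),
    Real.sqrt_sq (by positivity), Complex.ofReal_mul]

/-- The trace of `w` from the closed fourth quadrant. -/
noncomputable def wQuad (a b : ℝ) (z : ℂ) : ℂ :=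
  -Complex.I * ((Complex.I * (z ^ 2 - (a : ℂ) ^ 2)) ^ (1 / 2 : ℂ) *
    (Complex.I * (z ^ 2 + (b : ℂ) ^ 2)) ^ (1 / 2 : ℂ))

theorem wQuad_sq (z : ℂ) :
    (wQuad a b z) ^ 2 = (z ^ 2 - (a : ℂ) ^ 2) * (z ^ 2 + (b : ℂ) ^ 2) := by
  rw [wQuad, mul_pow, mul_pow, cpow_half_sq, cpow_half_sq, neg_sq]
  linear_combination (z ^ 2 - (a : ℂ) ^ 2) * (z ^ 2 + (b : ℂ) ^ 2) * (Complex.I ^ 2 - 1) * Complex.I_sq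

/-- The root of a number in the closed right half plane lies in the sector |arg| ≤ π/4. The product
and the quotient of two such roots therefore have nonnegative real part, which fixes the signs
below. -/
theorem abs_im_cpow_half_le {v : ℂ} (hv : 0 ≤ v.re) :
    |(v ^ (1 / 2 : ℂ)).im| ≤ (v ^ (1 / 2 : ℂ)).re := by
  have h0 := re_cpow_half_nonneg v
  have h1 := congrArg Complex.re (cpow_half_sq v)
  set p := v ^ (1 / 2 : ℂ)
  simp only [sq, Complex.mul_re] at h1
  exact abs_le_of_sq_le_sq (by nlinarith) h0

theorem re_I_mul_nonneg {z : ℂ} (hz : z ∈ closedQuadrant) (r : ℝ) :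
    0 ≤ (Complex.I * (z ^ 2 + r)).re := by
  simp only [sq, Complex.mul_re, Complex.I_re, Complex.I_im, Complex.add_im, Complex.mul_im,
    Complex.ofReal_im]
  nlinarith [mul_nonneg hz.1 (neg_nonneg.2 hz.2)]

theorem I_mul_mem_slitPlane {z : ℂ} (hz : z ∈ closedQuadrant) {r : ℝ} (h : z ^ 2 + r ≠ 0) :
    Complex.I * (z ^ 2 + r) ∈ Complex.slitPlane := by
  rw [Complex.mem_slitPlane_iff]
  by_contra! hc
  refine h ?_
  have h1 := le_antisymm hc.1 (re_I_mul_nonneg hz r)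
  have h2 : Complex.I * (z ^ 2 + r) = 0 := Complex.ext h1 hc.2
  simpa using h2

theorem wQuad_aux {z : ℂ} (hz : z ∈ closedQuadrant) :
    0 ≤ (Complex.I * (z ^ 2 - (a : ℂ) ^ 2)).re ∧ 0 ≤ (Complex.I * (z ^ 2 + (b : ℂ) ^ 2)).re := by
  have h1 := re_I_mul_nonneg hz (-a ^ 2)
  have h2 := re_I_mul_nonneg hz (b ^ 2)
  push_cast at h1 h2
  exact ⟨by rwa [sub_eq_add_neg], h2⟩

/-- In the closed fourth quadrant Im z² ≤ 0, so both roots in `wQuad` are taken in the right half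
plane. Their quotient q/p has nonnegative real part and its square is the ratio, which lies in the
slit plane; hence q/p is the principal root of the ratio. -/
theorem wQuad_eq_w (ha : 0 < a) (hb : 0 < b) {z : ℂ} (hz : z ∈ closedQuadrant)
    (hzc : z ∉ cross a b) : wQuad a b z = w a b z := by
  obtain ⟨hX, hs⟩ := ratio_mem_slitPlane ha hb hzc
  obtain ⟨h1, h2⟩ := wQuad_aux (a := a) (b := b) hz
  have p1 := abs_im_cpow_half_le h1
  have p2 := abs_im_cpow_half_le h2
  have p3 := cpow_half_sq (Complex.I * (z ^ 2 - (a : ℂ) ^ 2))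
  have p4 := cpow_half_sq (Complex.I * (z ^ 2 + (b : ℂ) ^ 2))
  rw [w, wQuad]
  set p := (Complex.I * (z ^ 2 - (a : ℂ) ^ 2)) ^ (1 / 2 : ℂ)
  set q := (Complex.I * (z ^ 2 + (b : ℂ) ^ 2)) ^ (1 / 2 : ℂ)
  have hp : p ≠ 0 := by
    intro h
    rw [h] at p3
    simp [hX] at p3
  have hqp : (q / p) ^ 2 = (z ^ 2 + (b : ℂ) ^ 2) / (z ^ 2 - (a : ℂ) ^ 2) := by
    rw [div_pow, p3, p4]
    field_simp
  have hre : 0 ≤ (q / p).re := by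
    rw [Complex.div_re, ← add_div]
    refine div_nonneg ?_ (Complex.normSq_nonneg _)
    have := abs_le.1 p1
    have := abs_le.1 p2
    nlinarith
  have hpos : 0 < (q / p).re := by
    refine lt_of_le_of_ne hre fun h => ?_
    rw [← hqp, Complex.mem_slitPlane_iff] at hs
    simp only [sq, Complex.mul_re, Complex.mul_im, ← h] at hs
    rcases hs with hz | hz
    · nlinarith
    · simp at hz
  rw [cpow_half_eq_of_sq hpos hqp]
  field_simp
  rw [p3]
  linear_combination -(z ^ 2 - (a : ℂ) ^ 2) * q * Complex.I_sq

/-- The product of the two roots and the positive root have equal squares; the sign follows from the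
nonnegative real part of the product. -/
theorem wQuad_eq_of_mem_cross (ha : 0 < a) (hb : 0 < b) {z : ℂ} (hz : z ∈ closedQuadrant)
    (hzc : z ∈ cross a b) : wQuad a b z = -Complex.I * wCut a b z := by
  obtain ⟨h1, h2⟩ := wQuad_aux (a := a) (b := b) hz
  have p1 := abs_le.1 (abs_im_cpow_half_le h1)
  have p2 := abs_le.1 (abs_im_cpow_half_le h2)
  have p3 := wQuad_sq (a := a) (b := b) z
  rw [wCut_eq_of_mem_cross ha hb hzc]
  obtain ⟨r, h0, h3, h4⟩ := exists_sq_eq_of_mem_cross ha hb hzc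
  rw [wQuad] at p3 ⊢
  set p := (Complex.I * (z ^ 2 - (a : ℂ) ^ 2)) ^ (1 / 2 : ℂ)
  set q := (Complex.I * (z ^ 2 + (b : ℂ) ^ 2)) ^ (1 / 2 : ℂ)
  have hre : 0 ≤ (p * q).re := by
    rw [Complex.mul_re]
    nlinarith
  rw [h0] at p3 ⊢
  norm_cast at p3 ⊢
  rw [Real.norm_eq_abs, abs_of_nonpos (by nlinarith)]
  congr 1
  have h5 : (p * q) ^ 2 = (Real.sqrt (-((r - a ^ 2) * (r + b ^ 2))) : ℂ) ^ 2 := by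
    rw [← Complex.ofReal_pow, Real.sq_sqrt (by nlinarith)]
    push_cast at p3 ⊢
    linear_combination -p3 + (p * q) ^ 2 * Complex.I_sq
  rcases sq_eq_sq_iff_eq_or_eq_neg.1 h5 with h | h
  · exact h
  · rw [h] at hre ⊢
    rw [Complex.neg_re, Complex.ofReal_re] at hre
    have := le_antisymm (by linarith) (Real.sqrt_nonneg (-((r - a ^ 2) * (r + b ^ 2))))
    rw [this]
    simp

theorem continuousAt_cpow_half_zero : ContinuousAt (fun z : ℂ => z ^ (1 / 2 : ℂ)) 0 := by
  rw [ContinuousAt, Complex.zero_cpow (by norm_num), tendsto_zero_iff_norm_tendsto_zero]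
  simp_rw [norm_cpow_half]
  have : Continuous fun z : ℂ => Real.sqrt ‖z‖ := by fun_prop
  simpa using this.tendsto 0

/-- Multiplication by i turns the radicand into the closed right half plane. The cut is touched only
at 0, where the root is continuous as well; this makes `wQuad` continuous even at a and -ib. -/
theorem continuousOn_cpow_half_I_mul (r : ℝ) :
    ContinuousOn (fun z : ℂ => (Complex.I * (z ^ 2 + r)) ^ (1 / 2 : ℂ)) closedQuadrant := by
  intro z hz
  have hc : ContinuousAt (fun z : ℂ => Complex.I * (z ^ 2 + r)) z := by fun_prop
  refine ContinuousAt.continuousWithinAt ?_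
  by_cases h : z ^ 2 + r = 0
  · refine ContinuousAt.comp (g := fun z : ℂ => z ^ (1 / 2 : ℂ)) ?_ hc
    rw [h, mul_zero]
    exact continuousAt_cpow_half_zero
  · exact hc.cpow continuousAt_const (I_mul_mem_slitPlane hz h)

theorem continuousOn_wQuad : ContinuousOn (wQuad a b) closedQuadrant := by
  have h1 := continuousOn_cpow_half_I_mul (-a ^ 2)
  have h2 := continuousOn_cpow_half_I_mul (b ^ 2)
  push_cast at h1 h2
  unfold wQuad
  simp only [sub_eq_add_neg]
  exact continuousOn_const.mul (h1.mul h2)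

theorem ne_of_mem_closedQuadrant (ha : 0 < a) (hb : 0 < b) {z : ℂ} (hz : z ∈ closedQuadrant)
    (h0 : z ≠ endpt a b 0) (h3 : z ≠ endpt a b 3) (i : Fin 4) : z ≠ endpt a b i := by
  fin_cases i
  · exact h0
  · intro h
    have := hz.2
    rw [h] at this
    simp [endpt] at this
    linarith
  · intro h
    have := hz.1
    rw [h] at this
    simp [endpt] at this
    linarith
  · exact h3

theorem analyticAt_wQuad {z : ℂ} (hz : z ∈ closedQuadrant)
    (h : ∀ i, z ≠ endpt a b i) : AnalyticAt ℂ (wQuad a b) z := by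
  have hX := sq_sub_ne_zero (h 0) (h 2)
  have hY := sq_add_ne_zero (h 1) (h 3)
  have h1 := I_mul_mem_slitPlane hz (r := -a ^ 2) (by push_cast; rwa [← sub_eq_add_neg])
  have h2 := I_mul_mem_slitPlane hz (r := b ^ 2) (by push_cast; exact hY)
  push_cast at h1 h2
  rw [← sub_eq_add_neg] at h1
  unfold wQuad
  refine analyticAt_const.mul (AnalyticAt.mul ?_ ?_)
  · exact AnalyticAt.cpow (by fun_prop) analyticAt_const h1
  · exact AnalyticAt.cpow (by fun_prop) analyticAt_const h2

theorem wQuad_ne_zero {z : ℂ} (h : ∀ i, z ≠ endpt a b i) : wQuad a b z ≠ 0 := by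
  intro h0
  have h1 := wQuad_sq (a := a) (b := b) z
  rw [h0, sq, zero_mul] at h1
  rcases mul_eq_zero.1 h1.symm with h2 | h2
  · exact sq_sub_ne_zero (h 0) (h 2) h2
  · exact sq_add_ne_zero (h 1) (h 3) h2

end Cross

/-! ### Behavior of w at the endpoints -/

namespace Cross

variable {a b : ℝ}

/-- `(z² - a²)(z² + b²) = -ζ * endPoly a b i ζ` with `ζ = coord a b i z`. -/
noncomputable def endPoly (a b : ℝ) (i : Fin 4) (ζ : ℂ) : ℂ :=
  if (i : ℕ) % 2 = 0 then a ^ 2 * (2 - ζ) * (a ^ 2 * (1 - ζ) ^ 2 + b ^ 2)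
  else b ^ 2 * (2 - ζ) * (b ^ 2 * (1 - ζ) ^ 2 + a ^ 2)

/-- The restriction of `endPoly` to the reals. -/
noncomputable def endPolyReal (a b : ℝ) (i : Fin 4) (t : ℝ) : ℝ :=
  if (i : ℕ) % 2 = 0 then a ^ 2 * (2 - t) * (a ^ 2 * (1 - t) ^ 2 + b ^ 2)
  else b ^ 2 * (2 - t) * (b ^ 2 * (1 - t) ^ 2 + a ^ 2)

theorem endPoly_ofReal (i : Fin 4) (t : ℝ) : endPoly a b i t = (endPolyReal a b i t : ℂ) := by
  rw [endPoly, endPolyReal]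
  split_ifs <;> push_cast <;> ring

theorem endPolyReal_pos (ha : 0 < a) (hb : 0 < b) (i : Fin 4) {t : ℝ} (ht : t ≤ 1) :
    0 < endPolyReal a b i t := by
  have : 0 < 2 - t := by linarith
  rw [endPolyReal]
  split_ifs <;> positivity

theorem eq_endpt_mul_coord (ha : 0 < a) (hb : 0 < b) (i : Fin 4) (z : ℂ) :
    z = endpt a b i * (1 - coord a b i z) := by
  have := endpt_ne_zero ha hb i
  rw [coord]; field_simp; ring

theorem mul_eq_endPoly (ha : 0 < a) (hb : 0 < b) (i : Fin 4) (z : ℂ) :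
    (z ^ 2 - (a : ℂ) ^ 2) * (z ^ 2 + (b : ℂ) ^ 2) =
      -coord a b i z * endPoly a b i (coord a b i z) := by
  have h := eq_endpt_mul_coord ha hb i z
  have h2 : z ^ 2 = (((-1) ^ (i : ℕ) * (if (i : ℕ) % 2 = 0 then a else b) ^ 2 : ℝ) : ℂ) *
      (1 - coord a b i z) ^ 2 := by
    rw [← endpt_sq_even]
    conv_lhs => rw [h, mul_pow]
  rw [h2, endPoly]
  rcases Nat.even_or_odd (i : ℕ) with he | he
  · rw [he.neg_one_pow, if_pos (Nat.even_iff.1 he), if_pos (Nat.even_iff.1 he)]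
    push_cast; ring
  · rw [he.neg_one_pow, if_neg (by rw [Nat.odd_iff.1 he]; norm_num),
      if_neg (by rw [Nat.odd_iff.1 he]; norm_num)]
    push_cast; ring

theorem coord_segment (ha : 0 < a) (hb : 0 < b) (i : Fin 4) (t : ℂ) :
    coord a b i ((1 - t) * endpt a b i) = t := by
  have := endpt_ne_zero ha hb i
  rw [coord]; field_simp; ring

theorem wPlus_segment (ha : 0 < a) (hb : 0 < b) (i : Fin 4) {t : ℝ} (ht : t ∈ Icc (0 : ℝ) 1) :
    wPlus a b i ((1 - t) * endpt a b i) = (-1) ^ ((i : ℕ) + 1) * Complex.I *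
      ((Real.sqrt t : ℂ) * (Real.sqrt (endPolyReal a b i t) : ℂ)) := by
  have := endPolyReal_pos ha hb i ht.2
  have h : ‖-(t : ℂ) * (endPolyReal a b i t : ℂ)‖ = t * endPolyReal a b i t := by
    rw [norm_mul, norm_neg, Complex.norm_real, Complex.norm_real, Real.norm_of_nonneg ht.1,
      Real.norm_of_nonneg this.le]
  rw [wPlus, mul_eq_endPoly ha hb i, coord_segment ha hb, endPoly_ofReal, h, Real.sqrt_mul ht.1]
  push_cast; ring

/-- Distinct endpoints are orthogonal or opposite. Hence in the disc |ζ| < 1 about a_i only the i-th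
segment of the cross is visible. -/
theorem re_endpt_div_nonpos {i k : Fin 4} (hik : k ≠ i) : (endpt a b k / endpt a b i).re ≤ 0 := by
  fin_cases i <;> fin_cases k <;> simp [endpt, Complex.div_re] at hik ⊢ <;>
    exact div_nonpos_of_nonpos_of_nonneg (neg_nonpos.2 (mul_self_nonneg _)) (mul_self_nonneg _)

theorem notMem_cross_of_coord (ha : 0 < a) (hb : 0 < b) {i : Fin 4} {z : ℂ}
    (h1 : ‖coord a b i z‖ < 1) (h2 : coord a b i z ∉ unitSeg) : z ∉ cross a b := by
  intro h
  have hre : 0 < (z / endpt a b i).re := by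
    have := (Complex.re_le_norm _).trans_lt h1
    rw [coord, Complex.sub_re, Complex.one_re] at this
    linarith
  obtain ⟨k, hk⟩ := mem_iUnion.1 h
  obtain ⟨t, ht, rfl⟩ := mem_seg_iff.1 hk
  by_cases hik : k = i
  · rw [hik, coord_segment ha hb] at h2
    exact h2 ⟨t, ht, rfl⟩
  · have hle := re_endpt_div_nonpos (a := a) (b := b) hik
    rw [mul_div_assoc, show (1 - (t : ℂ)) = ((1 - t : ℝ) : ℂ) by push_cast; rfl,
      Complex.re_ofReal_mul] at hre
    have := mul_nonneg (sub_nonneg.2 ht.2) (neg_nonneg.2 hle)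
    linarith

theorem isPreconnected_slitPlane_inter_ball {ε : ℝ} (hε : 0 < ε) :
    IsPreconnected (Complex.slitPlane ∩ Metric.ball 0 ε) := by
  have hs : StarConvex ℝ ((ε / 2 : ℝ) : ℂ) (Complex.slitPlane ∩ Metric.ball 0 ε) := by
    refine StarConvex.inter ?_ ((convex_ball 0 ε).starConvex ?_)
    · intro y hy p q hp hq hpq
      rw [Complex.mem_slitPlane_iff] at hy ⊢
      simp only [Complex.add_re, Complex.add_im, Complex.real_smul, Complex.re_ofReal_mul,
        Complex.im_ofReal_mul, Complex.ofReal_re, Complex.ofReal_im, mul_zero, zero_add]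
      rcases eq_or_lt_of_le hq with rfl | hq
      · left; simp at hpq; rw [hpq]; linarith
      rcases hy with hy | hy
      · left; have := mul_pos hq hy; positivity
      · right; exact mul_ne_zero hq.ne' hy
    · rw [mem_ball_zero_iff, Complex.norm_real, Real.norm_of_nonneg] <;> linarith
  refine (hs.isPathConnected ⟨Complex.ofReal_mem_slitPlane.2 (by linarith), ?_⟩).isConnected.isPreconnected
  · rw [mem_ball_zero_iff, Complex.norm_real, Real.norm_of_nonneg] <;> linarith

theorem neg_notMem_unitSeg {u : ℂ} (hu : u ∈ Complex.slitPlane) : -u ∉ unitSeg := by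
  rintro ⟨t, ht, h⟩
  rw [show u = ((-t : ℝ) : ℂ) by rw [← neg_neg u, ← h]; simp, Complex.ofReal_mem_slitPlane] at hu
  linarith [ht.1]

/-- On a slit disc in u = -ζ both sides are continuous with the same square and the right side has
no zero, so by connectedness they agree up to one sign. The sign is tested at u = ε/2, on the
prolongation of the segment beyond a_i. -/
theorem exists_w_eq (ha : 0 < a) (hb : 0 < b) (i : Fin 4) : ∃ ε, 0 < ε ∧ ε < 1 ∧
    ∀ z, ‖coord a b i z‖ < ε → endPoly a b i (coord a b i z) ∈ Complex.slitPlane ∧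
      (coord a b i z ∉ unitSeg → w a b z = (-1) ^ (i : ℕ) * ((-coord a b i z) ^ (1 / 2 : ℂ) *
        endPoly a b i (coord a b i z) ^ (1 / 2 : ℂ))) := by
  have hE : Continuous (endPoly a b i) := by
    unfold endPoly; split_ifs <;> fun_prop
  have h0 : endPoly a b i 0 ∈ Complex.slitPlane := by
    have := endPoly_ofReal (a := a) (b := b) i 0
    rw [Complex.ofReal_zero] at this
    rw [this, Complex.ofReal_mem_slitPlane]
    exact endPolyReal_pos ha hb i zero_le_one
  obtain ⟨ε', hε', hball⟩ := Metric.mem_nhds_iff.1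
    (hE.continuousAt.preimage_mem_nhds (Complex.isOpen_slitPlane.mem_nhds h0))
  set ε := min ε' (1 / 2) with hε
  have hεpos : 0 < ε := by positivity
  have hε1 : ε < 1 := (min_le_right _ _).trans_lt (by norm_num)
  have hP : ∀ ζ : ℂ, ‖ζ‖ < ε → endPoly a b i ζ ∈ Complex.slitPlane := fun ζ hζ =>
    hball (by rw [mem_ball_zero_iff]; exact hζ.trans_le (min_le_left _ _))
  have hend := endpt_ne_zero ha hb i
  set φ : ℂ → ℂ := fun u => endpt a b i * (1 + u) with hφ
  have hcoord : ∀ u, coord a b i (φ u) = -u := by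
    intro u; simp only [hφ, coord]; field_simp; ring
  set S := Complex.slitPlane ∩ Metric.ball (0 : ℂ) ε
  have hnot : ∀ u ∈ S, φ u ∉ cross a b := by
    intro u hu
    refine notMem_cross_of_coord ha hb (i := i) ?_ ?_
    · rw [hcoord, norm_neg]; exact (mem_ball_zero_iff.1 hu.2).trans hε1
    · rw [hcoord]; exact neg_notMem_unitSeg hu.1
  have hPS : ∀ u ∈ S, endPoly a b i (-u) ∈ Complex.slitPlane := fun u hu =>
    hP _ (by rw [norm_neg]; exact mem_ball_zero_iff.1 hu.2)
  have hc1 : ContinuousOn (fun u => w a b (φ u)) S := fun u hu =>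
    ((differentiableAt_w ha hb (hnot u hu)).continuousAt.comp
      (f := φ) (by fun_prop)).continuousWithinAt
  have hc2 : ContinuousOn (fun u => u ^ (1 / 2 : ℂ) * endPoly a b i (-u) ^ (1 / 2 : ℂ)) S := by
    intro u hu
    refine ContinuousAt.continuousWithinAt (ContinuousAt.mul ?_ ?_)
    · exact continuousAt_id.cpow continuousAt_const hu.1
    · exact (hE.comp continuous_neg).continuousAt.cpow continuousAt_const (hPS u hu)
  have hsq : EqOn ((fun u => w a b (φ u)) ^ 2)
      ((fun u => u ^ (1 / 2 : ℂ) * endPoly a b i (-u) ^ (1 / 2 : ℂ)) ^ 2) S := by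
    intro u _
    simp only [Pi.pow_apply]
    rw [w_sq, mul_eq_endPoly ha hb i, hcoord, mul_pow, cpow_half_sq, cpow_half_sq, neg_neg]
  have hne : ∀ {u}, u ∈ S → u ^ (1 / 2 : ℂ) * endPoly a b i (-u) ^ (1 / 2 : ℂ) ≠ 0 := by
    intro u hu h
    rcases mul_eq_zero.1 h with h | h
    · have := re_cpow_half_pos hu.1
      rw [h] at this; simp at this
    · have := re_cpow_half_pos (hPS u hu)
      rw [h] at this; simp at this
  have hS : ((ε / 2 : ℝ) : ℂ) ∈ S := by
    refine ⟨Complex.ofReal_mem_slitPlane.2 (by linarith), ?_⟩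
    rw [mem_ball_zero_iff, Complex.norm_real, Real.norm_of_nonneg] <;> linarith
  set δ := ε / 2
  have hδ : 0 < δ := by positivity
  have hgpos : 0 < (((δ : ℝ) : ℂ) ^ (1 / 2 : ℂ) * endPoly a b i (-(δ : ℂ)) ^ (1 / 2 : ℂ)).re := by
    have := endPolyReal_pos ha hb i (t := -δ) (by linarith)
    rw [← Complex.ofReal_neg, endPoly_ofReal, cpow_half_ofReal hδ.le, cpow_half_ofReal this.le]
    norm_cast
    exact mul_pos (Real.sqrt_pos.2 hδ) (Real.sqrt_pos.2 this)
  -- Just beyond ±a one has z² > a² and w > 0. Just beyond ±ib one has z² < -b², so the ratio is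
  -- still positive but its prefactor z² - a² is negative.
  have hw : 0 < ((-1) ^ (i : ℕ) * w a b (φ δ)).re := by
    have h2 : (φ δ) ^ 2 = (((-1) ^ (i : ℕ) * (if (i : ℕ) % 2 = 0 then a else b) ^ 2 *
      (1 + δ) ^ 2 : ℝ) : ℂ) := by
      simp only [hφ]
      rw [mul_pow, endpt_sq_even]
      push_cast; ring
    have hlt : ∀ x : ℝ, 0 < x → x ^ 2 < x ^ 2 * (1 + δ) ^ 2 := by
      intro x hx; nlinarith [mul_pos (pow_pos hx 2) hδ, mul_pos (pow_pos hx 2) (pow_pos hδ 2)]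
    have h3 := hlt a ha
    have h4 := hlt b hb
    have h5 := pow_pos ha 2
    have h6 := pow_pos hb 2
    rcases Nat.even_or_odd (i : ℕ) with he | he
    · rw [he.neg_one_pow, if_pos (Nat.even_iff.1 he), one_mul] at h2
      rw [he.neg_one_pow, one_mul, w, h2, ← Complex.ofReal_pow, ← Complex.ofReal_pow,
        ← Complex.ofReal_sub, ← Complex.ofReal_add, ← Complex.ofReal_div,
        cpow_half_ofReal (div_pos (by positivity) (by linarith)).le, ← Complex.ofReal_mul,
        Complex.ofReal_re]
      exact mul_pos (by linarith) (Real.sqrt_pos.2 (div_pos (by positivity) (by linarith)))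
    · rw [he.neg_one_pow, if_neg (by rw [Nat.odd_iff.1 he]; norm_num)] at h2
      rw [he.neg_one_pow, w, h2, ← Complex.ofReal_pow, ← Complex.ofReal_pow,
        ← Complex.ofReal_sub, ← Complex.ofReal_add, ← Complex.ofReal_div,
        cpow_half_ofReal (div_pos_of_neg_of_neg (by linarith) (by linarith)).le,
        ← Complex.ofReal_mul, neg_one_mul, Complex.neg_re, Complex.ofReal_re, neg_pos]
      exact mul_neg_of_neg_of_pos (by linarith)
        (Real.sqrt_pos.2 (div_pos_of_neg_of_neg (by linarith) (by linarith)))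
  have key : ∀ u ∈ S, w a b (φ u) =
      (-1) ^ (i : ℕ) * (u ^ (1 / 2 : ℂ) * endPoly a b i (-u) ^ (1 / 2 : ℂ)) := by
    intro u hu
    rcases neg_one_pow_eq_or ℂ (i : ℕ) with h1 | h1 <;>
    rcases (isPreconnected_slitPlane_inter_ball hεpos).eq_or_eq_neg_of_sq_eq hc1 hc2 hsq hne
      with h | h
    · rw [h1, one_mul]; exact h hu
    · have := h hS
      simp only [Pi.neg_apply] at this
      rw [h1, one_mul, this, Complex.neg_re] at hw
      linarith
    · have := h hS
      simp only at this
      rw [h1, this, neg_one_mul, Complex.neg_re] at hw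
      linarith
    · rw [h1, neg_one_mul]; exact h hu
  refine ⟨ε, hεpos, hε1, fun z hz => ⟨hP _ hz, fun hzs => ?_⟩⟩
  have hu : -coord a b i z ∈ S :=
    ⟨neg_mem_slitPlane_of_notMem_unitSeg (hz.trans hε1).le hzs, by
      rwa [mem_ball_zero_iff, norm_neg]⟩
  have := key _ hu
  rw [neg_neg] at this
  rw [← this]
  congr 1
  simp only [hφ]
  rw [← sub_eq_add_neg]
  exact eq_endpt_mul_coord ha hb i z

theorem exists_w_eq_mul (ha : 0 < a) (hb : 0 < b) (i : Fin 4) : ∃ C, 0 ≤ C ∧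
    ∀ᶠ z in 𝓝 (endpt a b i), coord a b i z ∉ unitSeg → ∃ g : ℂ,
      w a b z = (-coord a b i z) ^ (1 / 2 : ℂ) * g ∧
      ‖g - (-1) ^ (i : ℕ) * (Real.sqrt (endPolyReal a b i 0) : ℂ)‖ ≤ C * ‖coord a b i z‖ := by
  obtain ⟨ε, hε, hε1, h⟩ := exists_w_eq ha hb i
  have hp := endPolyReal_pos ha hb i zero_le_one
  have h0 : endPoly a b i 0 = (endPolyReal a b i 0 : ℂ) := by
    have := endPoly_ofReal (a := a) (b := b) i 0
    rwa [Complex.ofReal_zero] at this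
  have hd : DifferentiableAt ℂ (fun ζ => endPoly a b i ζ ^ (1 / 2 : ℂ)) 0 := by
    refine DifferentiableAt.cpow_const ?_ ?_
    · unfold endPoly; split_ifs <;> fun_prop
    · rw [h0, Complex.ofReal_mem_slitPlane]; exact hp
  obtain ⟨C, hC0, hC⟩ := hd.hasDerivAt.isBigO_sub.exists_nonneg
  have hC := hC.bound
  have htend : Tendsto (coord a b i) (𝓝 (endpt a b i)) (𝓝 0) := by
    have := (continuous_coord (a := a) (b := b) i).tendsto (endpt a b i)
    rwa [coord, div_self (endpt_ne_zero ha hb i), sub_self] at this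
  have hball : ∀ᶠ z in 𝓝 (endpt a b i), ‖coord a b i z‖ < ε := by
    have := htend.norm
    rw [norm_zero] at this
    exact this.eventually_lt_const hε
  refine ⟨C, hC0, ?_⟩
  filter_upwards [hball, htend.eventually hC] with z h1 h2 h3
  refine ⟨(-1) ^ (i : ℕ) * endPoly a b i (coord a b i z) ^ (1 / 2 : ℂ), ?_, ?_⟩
  · rw [(h z h1).2 h3]; ring
  · rw [← mul_sub, norm_mul, norm_pow, norm_neg, norm_one, one_pow, one_mul]
    rw [h0, cpow_half_ofReal hp.le, sub_zero] at h2
    exact h2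

end Cross

/-! ### Deforming arcs in the closed fourth quadrant -/

namespace Cross

variable {a b : ℝ} {γ : ℝ → ℂ}

/-- The midpoint of the endpoints `a` and `-ib` of the cross. -/
noncomputable def corner (a b : ℝ) : ℂ := ((a / 2 : ℝ) : ℂ) - (b / 2 : ℝ) * Complex.I

theorem corner_re : (corner a b).re = a / 2 := by simp [corner]

theorem corner_im : (corner a b).im = -(b / 2) := by simp [corner]

theorem re_corner_segment (s : ℂ) (t : ℝ) :
    (corner a b + t * (s - corner a b)).re = (1 - t) * (a / 2) + t * s.re := by
  rw [Complex.add_re, Complex.re_ofReal_mul, Complex.sub_re, corner_re]; ring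

theorem im_corner_segment (s : ℂ) (t : ℝ) :
    (corner a b + t * (s - corner a b)).im = -((1 - t) * (b / 2)) + t * s.im := by
  rw [Complex.add_im, Complex.im_ofReal_mul, Complex.sub_im, corner_im]; ring

theorem corner_segment_mem (ha : 0 < a) (hb : 0 < b) {s : ℂ} (hs : s ∈ closedQuadrant) {t : ℝ}
    (ht : t ∈ Icc (0 : ℝ) 1) : corner a b + t * (s - corner a b) ∈ closedQuadrant := by
  have h1 := mul_nonneg (sub_nonneg.2 ht.2) ha.le
  have h2 := mul_nonneg (sub_nonneg.2 ht.2) hb.le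
  have h3 := mul_nonneg ht.1 hs.1
  have h4 := mul_nonneg ht.1 (neg_nonneg.2 hs.2)
  constructor
  · rw [re_corner_segment]; linarith
  · rw [im_corner_segment]; linarith

theorem corner_segment_ne_endpt (ha : 0 < a) (hb : 0 < b) {s : ℂ} (hs : s ∈ closedQuadrant) {t : ℝ}
    (ht : t ∈ Ico (0 : ℝ) 1) (i : Fin 4) : corner a b + t * (s - corner a b) ≠ endpt a b i := by
  have h1 := mul_pos (sub_pos.2 ht.2) ha
  have h2 := mul_pos (sub_pos.2 ht.2) hb
  have h3 := mul_nonneg ht.1 hs.1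
  have h4 := mul_nonneg ht.1 (neg_nonneg.2 hs.2)
  refine ne_of_mem_closedQuadrant ha hb (corner_segment_mem ha hb hs ⟨ht.1, ht.2.le⟩) ?_ ?_ i
  · intro h
    have := congrArg Complex.im h
    rw [im_corner_segment] at this
    simp [endpt] at this
    linarith
  · intro h
    have := congrArg Complex.re h
    rw [re_corner_segment] at this
    simp [endpt] at this
    linarith

/-- On the segment from the corner to s the distances to a and -ib are at least (1 - t)b/2 and (1 -
t)a/2. They add up to at least a, so only one of them can be small, and the other two roots stay at
distance at least a and b. Thus |w|² ≥ κ(1 - t), uniformly in s. -/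
theorem exists_inv_wQuad_le (ha : 0 < a) (hb : 0 < b) : ∃ C, 0 ≤ C ∧ ∀ s ∈ closedQuadrant,
    ∀ t ∈ Ico (0 : ℝ) 1, ‖(wQuad a b (corner a b + t * (s - corner a b)))⁻¹‖ ≤
      C * (1 - t) ^ (-(1 / 2) : ℝ) := by
  set κ := min (a / 2 * (a / 2)) (a / 2 * (b / 2)) * (a * b) with hκ
  have hκ0 : 0 < κ := by positivity
  refine ⟨(Real.sqrt κ)⁻¹, by positivity, fun s hs t ht => ?_⟩
  set z := corner a b + t * (s - corner a b) with hz
  have ht1 : 0 < 1 - t := sub_pos.2 ht.2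
  have hre : (1 - t) * (a / 2) ≤ z.re := by
    rw [hz, re_corner_segment]; have := mul_nonneg ht.1 hs.1; linarith
  have him : z.im ≤ -((1 - t) * (b / 2)) := by
    rw [hz, im_corner_segment]; have := mul_nonneg ht.1 (neg_nonneg.2 hs.2); linarith
  have hre0 : 0 < z.re := lt_of_lt_of_le (by positivity) hre
  have him0 : z.im < 0 := lt_of_le_of_lt him (neg_lt_zero.2 (by positivity))
  have h1 : a ≤ ‖z + a‖ := by
    refine le_trans ?_ (Complex.re_le_norm _)
    simp; linarith
  have h2 : b ≤ ‖z - Complex.I * b‖ := by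
    refine le_trans ?_ (Complex.abs_im_le_norm _)
    simp; rw [abs_of_neg (by linarith)]; linarith
  have h3 : (1 - t) * (b / 2) ≤ ‖z - a‖ := by
    refine le_trans ?_ (Complex.abs_im_le_norm _)
    simp; rw [abs_of_neg (by linarith)]; linarith
  have h4 : (1 - t) * (a / 2) ≤ ‖z + Complex.I * b‖ := by
    refine le_trans ?_ (Complex.re_le_norm _)
    simp; linarith
  have h5 : a ≤ ‖z - a‖ + ‖z + Complex.I * b‖ := by
    have : ‖(z + Complex.I * b) - (z - a)‖ ≤ ‖z + Complex.I * b‖ + ‖z - a‖ := norm_sub_le _ _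
    have h6 : a ≤ ‖(z + Complex.I * b) - (z - a)‖ := by
      refine le_trans ?_ (Complex.re_le_norm _)
      simp
    linarith
  have h6 : (1 - t) * min (a / 2 * (a / 2)) (a / 2 * (b / 2)) ≤ ‖z - a‖ * ‖z + Complex.I * b‖ := by
    rcases le_total (a / 2) ‖z - a‖ with h | h
    · calc _ ≤ (1 - t) * (a / 2 * (a / 2)) := by gcongr; exact min_le_left _ _
        _ = a / 2 * ((1 - t) * (a / 2)) := by ring
        _ ≤ _ := by gcongr
    · have h7 : a / 2 ≤ ‖z + Complex.I * b‖ := by linarith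
      calc _ ≤ (1 - t) * (a / 2 * (b / 2)) := by gcongr; exact min_le_right _ _
        _ = (1 - t) * (b / 2) * (a / 2) := by ring
        _ ≤ _ := by gcongr
  have h7 : (1 - t) * κ ≤ ‖wQuad a b z‖ ^ 2 := by
    have e : (z ^ 2 - (a : ℂ) ^ 2) * (z ^ 2 + (b : ℂ) ^ 2) =
        ((z - a) * (z + Complex.I * b)) * ((z + a) * (z - Complex.I * b)) := by
      linear_combination ((z : ℂ) ^ 2 - a ^ 2) * (b : ℂ) ^ 2 * Complex.I_sq
    rw [← norm_pow, wQuad_sq, e, norm_mul, norm_mul, norm_mul, hκ, ← mul_assoc]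
    gcongr
  have h8 : Real.sqrt (1 - t) * Real.sqrt κ ≤ ‖wQuad a b z‖ := by
    rw [← Real.sqrt_mul ht1.le]
    exact Real.sqrt_le_iff.2 ⟨norm_nonneg _, h7⟩
  rw [norm_inv, Real.rpow_neg ht1.le, ← Real.sqrt_eq_rpow, ← mul_inv]
  refine inv_anti₀ (by positivity) ?_
  rw [mul_comm]; exact h8

theorem intervalIntegrable_one_sub_rpow :
    IntervalIntegrable (fun t : ℝ => (1 - t) ^ (-(1 / 2) : ℝ)) volume 0 1 := by
  have := (intervalIntegral.intervalIntegrable_rpow' (a := 0) (b := 1) (r := -(1 / 2))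
    (by norm_num)).comp_sub_left 1
  simpa using this.symm

/-- The bound by (1 - t)^(-1/2) does not depend on the target point, so dominated convergence gives
continuity also at the branch points a and -ib, where the integrand is unbounded. -/
theorem continuousOn_radialPrimitive (ha : 0 < a) (hb : 0 < b) {m : ℂ → ℂ}
    (hm : ContinuousOn m closedQuadrant) :
    ContinuousOn (radialPrimitive (fun s => m s / wQuad a b s) (corner a b)) closedQuadrant := by
  intro s₀ hs₀
  obtain ⟨C, hC0, hC⟩ := exists_inv_wQuad_le ha hb
  set R := ‖corner a b‖ + ‖s₀‖ + 1 with hR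
  have hcomp : IsCompact (closedQuadrant ∩ Metric.closedBall 0 R) :=
    (isCompact_closedBall _ _).inter_left isClosed_closedQuadrant
  obtain ⟨M, hM⟩ := hcomp.exists_bound_of_continuousOn (hm.mono inter_subset_left)
  have hseg : ∀ s ∈ closedQuadrant, ‖s‖ ≤ ‖s₀‖ + 1 → ∀ t ∈ Icc (0 : ℝ) 1,
      ‖corner a b + t * (s - corner a b)‖ ≤ R := by
    intro s _ hs t ht
    have e : corner a b + t * (s - corner a b) = ((1 - t : ℝ) : ℂ) * corner a b + (t : ℝ) * s := by
      push_cast; ring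
    rw [e]
    refine (norm_add_le _ _).trans ?_
    rw [norm_mul, norm_mul, Complex.norm_real, Complex.norm_real, Real.norm_of_nonneg ht.1,
      Real.norm_of_nonneg (sub_nonneg.2 ht.2)]
    nlinarith [norm_nonneg (corner a b), norm_nonneg s, mul_nonneg ht.1 (norm_nonneg (corner a b)),
      mul_nonneg (sub_nonneg.2 ht.2) (norm_nonneg s)]
  have hnear : ∀ᶠ s in 𝓝[closedQuadrant] s₀, s ∈ closedQuadrant ∧ ‖s‖ ≤ ‖s₀‖ + 1 := by
    filter_upwards [self_mem_nhdsWithin, mem_nhdsWithin_of_mem_nhds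
      (Metric.ball_mem_nhds s₀ zero_lt_one)] with s h1 h2
    refine ⟨h1, ?_⟩
    rw [mem_ball_iff_norm] at h2
    have := norm_le_insert' s s₀
    linarith
  have hcont : ∀ s ∈ closedQuadrant, ∀ t ∈ Ico (0 : ℝ) 1,
      ContinuousWithinAt (fun s => m s / wQuad a b s) closedQuadrant
        (corner a b + t * (s - corner a b)) := by
    intro s hs t ht
    have hmem := corner_segment_mem ha hb hs ⟨ht.1, ht.2.le⟩
    exact (hm _ hmem).div (continuousOn_wQuad _ hmem)
      (wQuad_ne_zero (corner_segment_ne_endpt ha hb hs ht))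
  unfold radialPrimitive
  refine ContinuousWithinAt.mul (by fun_prop) ?_
  refine intervalIntegral.continuousWithinAt_of_dominated_interval
    (bound := fun t => |M| * (C * (1 - t) ^ (-(1 / 2) : ℝ))) ?_ ?_
    ((intervalIntegrable_one_sub_rpow.const_mul _).const_mul _) ?_
  · filter_upwards [hnear] with s hs
    rw [uIoc_of_le zero_le_one, ← restrict_Ioo_eq_restrict_Ioc]
    refine ContinuousOn.aestronglyMeasurable ?_ measurableSet_Ioo
    intro t ht
    refine (hcont s hs.1 t ⟨ht.1.le, ht.2⟩).comp (t := closedQuadrant)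
      (f := fun t : ℝ => corner a b + t * (s - corner a b)) (by fun_prop) ?_
    intro u hu
    exact corner_segment_mem ha hb hs.1 ⟨hu.1.le, hu.2.le⟩
  · filter_upwards [hnear] with s hs
    have : ∀ᵐ t : ℝ ∂volume, t ≠ 1 := by simp [ae_iff]
    filter_upwards [this] with t ht1 ht
    rw [uIoc_of_le zero_le_one] at ht
    have htlt : t < 1 := lt_of_le_of_ne ht.2 ht1
    rw [div_eq_mul_inv, norm_mul]
    refine mul_le_mul ?_ (hC s hs.1 t ⟨ht.1.le, htlt⟩) (norm_nonneg _) (abs_nonneg _)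
    exact (hM _ ⟨corner_segment_mem ha hb hs.1 ⟨ht.1.le, ht.2⟩,
      mem_closedBall_zero_iff.2 (hseg s hs.1 hs.2 t ⟨ht.1.le, ht.2⟩)⟩).trans (le_abs_self _)
  · have : ∀ᵐ t : ℝ ∂volume, t ≠ 1 := by simp [ae_iff]
    filter_upwards [this] with t ht1 ht
    rw [uIoc_of_le zero_le_one] at ht
    have htlt : t < 1 := lt_of_le_of_ne ht.2 ht1
    refine (hcont s₀ hs₀ t ⟨ht.1.le, htlt⟩).comp (t := closedQuadrant)
      (f := fun s : ℂ => corner a b + t * (s - corner a b)) (by fun_prop) ?_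
    intro u hu
    exact corner_segment_mem ha hb hu ⟨ht.1.le, ht.2⟩

/-- Off the branch points the radial integral is a primitive of m/w, and it is continuous up to
them. Hence the improper integral depends only on the ends of the curve. -/
theorem tendsto_integral_wQuad (ha : 0 < a) (hb : 0 < b) {m : ℂ → ℂ}
    (hm : ContinuousOn m closedQuadrant)
    (hma : ∀ s ∈ closedQuadrant, (∀ i, s ≠ endpt a b i) → AnalyticAt ℂ m s) {K : ℝ≥0}
    (hγ : LipschitzOnWith K γ (Icc 0 1)) (hmem : ∀ t ∈ Icc (0 : ℝ) 1, γ t ∈ closedQuadrant)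
    (hne : ∀ t ∈ Ioo (0 : ℝ) 1, ∀ i, γ t ≠ endpt a b i) :
    Tendsto (fun ε : ℝ => ∫ t in ε..(1 - ε), m (γ t) / wQuad a b (γ t) * deriv γ t) (𝓝[>] 0)
      (𝓝 (radialPrimitive (fun s => m s / wQuad a b s) (corner a b) (γ 1) -
        radialPrimitive (fun s => m s / wQuad a b s) (corner a b) (γ 0))) := by
  set P := radialPrimitive (fun s => m s / wQuad a b s) (corner a b)
  have hP : ∀ s ∈ closedQuadrant, (∀ i, s ≠ endpt a b i) →
      ∀ᶠ s' in 𝓝 s, HasDerivAt P (m s' / wQuad a b s') s' := by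
    intro s hs hse
    refine hasDerivAt_radialPrimitive
      (isOpen_analyticAt ℂ fun s => m s / wQuad a b s) (fun x hx => ?_) fun t ht => ?_
    · exact AnalyticAt.differentiableWithinAt hx
    · have h1 := corner_segment_mem ha hb hs ht
      have h2 : ∀ i, corner a b + t * (s - corner a b) ≠ endpt a b i := by
        rcases eq_or_lt_of_le ht.2 with h | h
        · rw [h]; simpa using hse
        · exact corner_segment_ne_endpt ha hb hs ⟨ht.1, h⟩
      exact (hma _ h1 h2).div (analyticAt_wQuad h1 h2) (wQuad_ne_zero h2)
  have hPγ : ContinuousOn (fun t => P (γ t)) (Icc 0 1) :=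
    (continuousOn_radialPrimitive ha hb hm).comp hγ.continuousOn hmem
  have hev : ∀ᶠ ε : ℝ in 𝓝[>] 0, ε ∈ Ioo (0 : ℝ) (1 / 2) := Ioo_mem_nhdsGT (by norm_num)
  have h1 : Tendsto (fun ε : ℝ => P (γ (1 - ε))) (𝓝[>] 0) (𝓝 (P (γ 1))) := by
    refine Tendsto.comp (f := fun ε : ℝ => 1 - ε) (hPγ 1 (by simp))
      (tendsto_nhdsWithin_iff.2 ⟨?_, ?_⟩)
    · have : Continuous fun ε : ℝ => 1 - ε := by fun_prop
      have := (this.tendsto 0).mono_left (nhdsWithin_le_nhds (s := Ioi 0))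
      simpa using this
    · filter_upwards [hev] with ε hε
      exact ⟨by linarith [hε.2], by linarith [hε.1]⟩
  have h0 : Tendsto (fun ε : ℝ => P (γ ε)) (𝓝[>] 0) (𝓝 (P (γ 0))) := by
    refine Tendsto.comp (f := fun ε : ℝ => ε) (hPγ 0 (by simp))
      (tendsto_nhdsWithin_iff.2 ⟨tendsto_id.mono_left nhdsWithin_le_nhds, ?_⟩)
    filter_upwards [hev] with ε hε
    exact ⟨hε.1.le, by linarith [hε.2]⟩
  refine (h1.sub h0).congr' ?_
  filter_upwards [hev] with ε hε
  have hsub : Icc ε (1 - ε) ⊆ Ioo 0 1 := fun t ht => ⟨hε.1.trans_le ht.1, by linarith [ht.2, hε.1]⟩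
  refine ((integral_comp_mul_deriv_of_lipschitz (k := fun s => m s / wQuad a b s)
    (by linarith [hε.2]) (hγ.mono (hsub.trans Ioo_subset_Icc_self)) fun t ht => ?_).2).symm
  exact hP _ (hmem t (Ioo_subset_Icc_self (hsub ht))) (hne t (hsub ht))

theorem tendsto_integral_shrink {f : ℝ → ℂ} (hf : IntervalIntegrable f volume 0 1) :
    Tendsto (fun ε : ℝ => ∫ t in ε..(1 - ε), f t) (𝓝[>] 0) (𝓝 (∫ t in (0 : ℝ)..1, f t)) := by
  have hc := intervalIntegral.continuousOn_primitive_interval' hf (left_mem_uIcc)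
  rw [uIcc_of_le zero_le_one] at hc
  have hev : ∀ᶠ ε : ℝ in 𝓝[>] 0, ε ∈ Ioo (0 : ℝ) (1 / 2) := Ioo_mem_nhdsGT (by norm_num)
  have h1 : Tendsto (fun ε : ℝ => ∫ t in (0 : ℝ)..(1 - ε), f t) (𝓝[>] 0)
      (𝓝 (∫ t in (0 : ℝ)..1, f t)) := by
    refine Tendsto.comp (f := fun ε : ℝ => 1 - ε) (hc 1 (by simp))
      (tendsto_nhdsWithin_iff.2 ⟨?_, ?_⟩)
    · have : Continuous fun ε : ℝ => 1 - ε := by fun_prop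
      have := (this.tendsto 0).mono_left (nhdsWithin_le_nhds (s := Ioi 0))
      simpa using this
    · filter_upwards [hev] with ε hε
      exact ⟨by linarith [hε.2], by linarith [hε.1]⟩
  have h0 : Tendsto (fun ε : ℝ => ∫ t in (0 : ℝ)..ε, f t) (𝓝[>] 0)
      (𝓝 (∫ t in (0 : ℝ)..0, f t)) := by
    refine Tendsto.comp (f := fun ε : ℝ => ε) (hc 0 (by simp))
      (tendsto_nhdsWithin_iff.2 ⟨tendsto_id.mono_left nhdsWithin_le_nhds, ?_⟩)
    filter_upwards [hev] with ε hε
    exact ⟨hε.1.le, by linarith [hε.2]⟩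
  have := h1.sub h0
  rw [intervalIntegral.integral_same, sub_zero] at this
  refine this.congr' ?_
  filter_upwards [hev] with ε hε
  rw [intervalIntegral.integral_interval_sub_left]
  · exact hf.mono_set (by
      rw [uIcc_of_le zero_le_one, uIcc_of_le (by linarith [hε.2])]
      exact Icc_subset_Icc_right (by linarith [hε.1]))
  · exact hf.mono_set (by
      rw [uIcc_of_le zero_le_one, uIcc_of_le hε.1.le]
      exact Icc_subset_Icc_right (by linarith [hε.2]))

/-- The point of the `i`-th segment with affine coordinate `t`. -/
noncomputable def segPt (a b : ℝ) (i : Fin 4) (t : ℝ) : ℂ := (1 - t) * endpt a b i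

/-- The reciprocal of the left trace of `w` on the `i`-th segment. -/
noncomputable def invW (a b : ℝ) (i : Fin 4) (t : ℝ) : ℂ := (wPlus a b i (segPt a b i t))⁻¹

theorem continuous_segPt (i : Fin 4) : Continuous (segPt a b i) := by unfold segPt; fun_prop

theorem deriv_segPt (i : Fin 4) (t : ℝ) : deriv (segPt a b i) t = -endpt a b i := by
  have h1 : HasDerivAt (fun t : ℝ => (t : ℂ)) 1 t := Complex.ofRealCLM.hasDerivAt
  have h : HasDerivAt (segPt a b i) (-1 * endpt a b i) t :=
    (h1.const_sub 1).mul_const (endpt a b i)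
  rw [h.deriv]; ring

theorem segPt_zero (i : Fin 4) : segPt a b i 0 = endpt a b i := by simp [segPt]

theorem segPt_one (i : Fin 4) : segPt a b i 1 = 0 := by simp [segPt]

theorem segPt_mem_seg (i : Fin 4) {t : ℝ} (ht : t ∈ Icc (0 : ℝ) 1) : segPt a b i t ∈ seg a b i :=
  mem_seg_iff.2 ⟨t, ht, rfl⟩

theorem coord_segPt (ha : 0 < a) (hb : 0 < b) (i : Fin 4) (t : ℝ) :
    coord a b i (segPt a b i t) = t := coord_segment ha hb i t

theorem segPt_sub (ha : 0 < a) (hb : 0 < b) (i : Fin 4) (t : ℝ) (z : ℂ) :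
    segPt a b i t - z = -endpt a b i * (t - coord a b i z) := by
  have := endpt_ne_zero ha hb i
  rw [segPt, coord]; field_simp; ring

theorem lipschitz_segPt (i : Fin 4) : ∃ K : ℝ≥0, LipschitzOnWith K (segPt a b i) (Icc 0 1) := by
  refine ⟨⟨‖endpt a b i‖, norm_nonneg _⟩, LipschitzOnWith.of_dist_le_mul fun x _ y _ => ?_⟩
  rw [dist_eq_norm, dist_eq_norm, show segPt a b i x - segPt a b i y =
    ((y - x : ℝ) : ℂ) * endpt a b i by simp only [segPt]; push_cast; ring, norm_mul,
    Complex.norm_real, norm_sub_rev, mul_comm]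
  rfl

theorem segPt_ne_endpt (ha : 0 < a) (hb : 0 < b) (i : Fin 4) {t : ℝ} (ht : t ∈ Ioc (0 : ℝ) 1)
    (j : Fin 4) : segPt a b i t ≠ endpt a b j := by
  intro h
  have h1 : (segPt a b i t) ^ 2 = (endpt a b j) ^ 2 := by rw [h]
  have h0 := mul_eq_endPoly ha hb i (segPt a b i t)
  rw [coord_segPt ha hb, endPoly_ofReal, h1] at h0
  have h2 : (endpt a b j ^ 2 - (a : ℂ) ^ 2) * (endpt a b j ^ 2 + (b : ℂ) ^ 2) = 0 := by
    fin_cases j <;> simp [endpt, mul_pow]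
  rw [h2] at h0
  have h3 := endPolyReal_pos ha hb i ht.2
  have h4 : -(t : ℂ) * (endPolyReal a b i t : ℂ) ≠ 0 := by
    rw [← Complex.ofReal_neg, ← Complex.ofReal_mul, Complex.ofReal_ne_zero]
    exact mul_ne_zero (neg_ne_zero.2 ht.1.ne') h3.ne'
  exact h4 h0.symm

/-- At t = 0 both sides are 0 by the convention for division by zero. -/
theorem invW_eq (ha : 0 < a) (hb : 0 < b) (i : Fin 4) {t : ℝ} (ht : t ∈ Icc (0 : ℝ) 1) :
    invW a b i t = ((-1) ^ (i : ℕ) * Complex.I / (Real.sqrt (endPolyReal a b i t) : ℂ)) /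
      (Real.sqrt t : ℂ) := by
  have h : ((-1 : ℂ) ^ ((i : ℕ) + 1) * Complex.I)⁻¹ = (-1) ^ (i : ℕ) * Complex.I := by
    rcases neg_one_pow_eq_or ℂ (i : ℕ) with h | h <;> rw [pow_succ, h] <;> simp
  rw [invW, segPt, wPlus_segment ha hb i ht, mul_inv, h, mul_inv]
  ring

theorem continuous_endPolyReal (i : Fin 4) : Continuous (endPolyReal a b i) := by
  unfold endPolyReal; split_ifs <;> fun_prop

theorem intervalIntegrable_invW (ha : 0 < a) (hb : 0 < b) (i : Fin 4) :
    IntervalIntegrable (invW a b i) volume 0 1 := by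
  have h1 : IntervalIntegrable (fun t : ℝ => (1 : ℂ) / (Real.sqrt t : ℂ)) volume 0 1 := by
    refine LogLipschitz.intervalIntegrable (M := 0) (F := fun _ => 1) ?_
    intro t _ u _
    simp
  have h2 : ContinuousOn (fun t : ℝ => (-1 : ℂ) ^ (i : ℕ) * Complex.I /
      (Real.sqrt (endPolyReal a b i t) : ℂ)) (uIcc 0 1) := by
    have := (continuous_endPolyReal (a := a) (b := b) i)
    refine ContinuousOn.div (by fun_prop) (by fun_prop) fun t ht => ?_
    rw [uIcc_of_le zero_le_one] at ht
    exact Complex.ofReal_ne_zero.2 (Real.sqrt_pos.2 (endPolyReal_pos ha hb i ht.2)).ne'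
  refine (h1.continuousOn_mul h2).congr fun t ht => ?_
  rw [uIoc_of_le zero_le_one] at ht
  rw [invW_eq ha hb i ⟨ht.1.le, ht.2⟩]
  ring

theorem mem_closedQuadrant_of_mem_seg_zero (ha : 0 < a) {s : ℂ} (hs : s ∈ seg a b 0) :
    s ∈ closedQuadrant := by
  rw [mem_seg_zero ha] at hs
  exact ⟨hs.2.1, hs.1.le⟩

theorem mem_closedQuadrant_of_mem_seg_three (hb : 0 < b) {s : ℂ} (hs : s ∈ seg a b 3) :
    s ∈ closedQuadrant := by
  rw [mem_seg_three hb] at hs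
  exact ⟨hs.1.ge, hs.2.1⟩

theorem inv_wQuad_segPt_zero (ha : 0 < a) (hb : 0 < b) {t : ℝ} (ht : t ∈ Icc (0 : ℝ) 1) :
    (wQuad a b (segPt a b 0 t))⁻¹ = invW a b 0 t := by
  have h := segPt_mem_seg (a := a) (b := b) 0 ht
  rw [invW, wPlus_eq ha hb h, wQuad_eq_of_mem_cross ha hb
    (mem_closedQuadrant_of_mem_seg_zero ha h) (mem_iUnion.2 ⟨0, h⟩)]
  simp

/-- The fourth quadrant lies to the right of Δ₄ oriented towards the origin, hence the minus sign;
it lies to the left of Δ₁. -/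
theorem inv_wQuad_segPt_three (ha : 0 < a) (hb : 0 < b) {t : ℝ} (ht : t ∈ Icc (0 : ℝ) 1) :
    (wQuad a b (segPt a b 3 t))⁻¹ = -invW a b 3 t := by
  have h := segPt_mem_seg (a := a) (b := b) 3 ht
  rw [invW, wPlus_eq ha hb h, wQuad_eq_of_mem_cross ha hb
    (mem_closedQuadrant_of_mem_seg_three hb h) (mem_iUnion.2 ⟨3, h⟩), ← inv_neg]
  congr 1
  simp; norm_num

/-- The integral of `m / w` along an arc in the closed fourth quadrant agrees with the integrals
over the two segments of the cross that bound this quadrant. -/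
theorem tendsto_integral_arc (ha : 0 < a) (hb : 0 < b) (hγ : IsAlphaArc a b γ) {m : ℂ → ℂ}
    (hm : ContinuousOn m closedQuadrant)
    (hma : ∀ s ∈ closedQuadrant, (∀ i, s ≠ endpt a b i) → AnalyticAt ℂ m s) :
    Tendsto (fun ε : ℝ => ∫ t in ε..(1 - ε), m (γ t) / w a b (γ t) * deriv γ t) (𝓝[>] 0)
      (𝓝 (endpt a b 0 * (∫ t in (0 : ℝ)..1, m (segPt a b 0 t) * invW a b 0 t) +
        endpt a b 3 * ∫ t in (0 : ℝ)..1, m (segPt a b 3 t) * invW a b 3 t)) := by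
  obtain ⟨K, hK⟩ := hγ.lipschitz
  have h1 := tendsto_integral_wQuad ha hb hm hma hK
    (fun t ht => hγ.mem_closedQuadrant ha hb ht)
    (fun t ht i => ne_endpt_of_notMem (hγ.avoids t ht) i)
  rw [hγ.source, hγ.target] at h1
  have hev : ∀ᶠ ε : ℝ in 𝓝[>] 0, ε ∈ Ioo (0 : ℝ) (1 / 2) := Ioo_mem_nhdsGT (by norm_num)
  have hseg : ∀ i : Fin 4, (∀ t ∈ Icc (0 : ℝ) 1, segPt a b i t ∈ closedQuadrant) → ∀ σ : ℂ,
      (∀ t ∈ Icc (0 : ℝ) 1, (wQuad a b (segPt a b i t))⁻¹ = σ * invW a b i t) →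
      -endpt a b i * σ * (∫ t in (0 : ℝ)..1, m (segPt a b i t) * invW a b i t) =
        radialPrimitive (fun s => m s / wQuad a b s) (corner a b) 0 -
        radialPrimitive (fun s => m s / wQuad a b s) (corner a b) (endpt a b i) := by
    intro i hQ σ hσ
    obtain ⟨K, hK⟩ := lipschitz_segPt (a := a) (b := b) i
    have h2 := tendsto_integral_wQuad ha hb hm hma hK hQ
      (fun t ht => segPt_ne_endpt ha hb i ⟨ht.1, ht.2.le⟩)
    rw [segPt_zero, segPt_one] at h2
    have hint : IntervalIntegrable (fun t => m (segPt a b i t) * invW a b i t) volume 0 1 := by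
      refine (intervalIntegrable_invW ha hb i).continuousOn_mul ?_
      rw [uIcc_of_le zero_le_one]
      exact hm.comp (continuous_segPt i).continuousOn hQ
    have h3 := (tendsto_integral_shrink hint).const_mul (-endpt a b i * σ)
    refine tendsto_nhds_unique (h3.congr' ?_) h2
    filter_upwards [hev] with ε hε
    rw [← intervalIntegral.integral_const_mul]
    refine intervalIntegral.integral_congr fun t ht => ?_
    rw [uIcc_of_le (by linarith [hε.2])] at ht
    rw [div_eq_mul_inv, hσ t ⟨hε.1.le.trans ht.1, by linarith [ht.2, hε.1]⟩, deriv_segPt]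
    ring
  have h2 := hseg 0 (fun t ht => mem_closedQuadrant_of_mem_seg_zero ha (segPt_mem_seg 0 ht)) 1
    (fun t ht => by rw [inv_wQuad_segPt_zero ha hb ht, one_mul])
  have h3 := hseg 3 (fun t ht => mem_closedQuadrant_of_mem_seg_three hb (segPt_mem_seg 3 ht)) (-1)
    (fun t ht => by rw [inv_wQuad_segPt_three ha hb ht, neg_one_mul])
  -- The path -ib → 0 → a has the same ends as the arc. Both terms acquire a plus sign: Δ₁ is run
  -- against its orientation, and on Δ₄ the branch has the opposite sign.
  rw [show radialPrimitive (fun s => m s / wQuad a b s) (corner a b) (endpt a b 0) -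
    radialPrimitive (fun s => m s / wQuad a b s) (corner a b) (endpt a b 3) =
    endpt a b 0 * (∫ t in (0 : ℝ)..1, m (segPt a b 0 t) * invW a b 0 t) +
        endpt a b 3 * ∫ t in (0 : ℝ)..1, m (segPt a b 3 t) * invW a b 3 t by
      linear_combination h2 - h3] at h1
  refine h1.congr' ?_
  filter_upwards [hev] with ε hε
  refine intervalIntegral.integral_congr fun t ht => ?_
  rw [uIcc_of_le (by linarith [hε.2])] at ht
  have ht' : t ∈ Ioo (0 : ℝ) 1 := ⟨hε.1.trans_le ht.1, by linarith [ht.2, hε.1]⟩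
  rw [wQuad_eq_w ha hb (hγ.mem_closedQuadrant ha hb (Ioo_subset_Icc_self ht')) (hγ.avoids t ht')]

end Cross

/-! ### Periods as integrals over the cross -/

namespace Cross

variable {a b : ℝ} {γ : ℝ → ℂ}

/-- The indicator of the two segments that bound the fourth quadrant. -/
noncomputable def alphaSide (i : Fin 4) : ℂ := ![1, 0, 0, 1] i

/-- `∑ i, -∫_{Δ_i} m φ_i ds` in terms of the affine coordinates. -/
noncomputable def crossIntegral (a b : ℝ) (φ : Fin 4 → ℝ → ℂ) (m : ℂ → ℂ) : ℂ :=
  ∑ i, endpt a b i * ∫ t in (0 : ℝ)..1, m (segPt a b i t) * φ i t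

theorem crossIntegral_const_mul (φ : Fin 4 → ℝ → ℂ) (c : ℂ) (m : ℂ → ℂ) :
    crossIntegral a b φ (fun s => c * m s) = c * crossIntegral a b φ m := by
  simp only [crossIntegral, Finset.mul_sum, mul_assoc, intervalIntegral.integral_const_mul]
  exact Finset.sum_congr rfl fun i _ => by ring

theorem intervalIntegrable_mul_segPt {φ : ℝ → ℂ} (hφ : IntervalIntegrable φ volume 0 1) {i : Fin 4}
    {m : ℂ → ℂ} (hm : ContinuousOn m (seg a b i)) :
    IntervalIntegrable (fun t => m (segPt a b i t) * φ t) volume 0 1 := by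
  refine hφ.continuousOn_mul ?_
  rw [uIcc_of_le zero_le_one]
  exact hm.comp (continuous_segPt i).continuousOn fun t ht => segPt_mem_seg i ht

theorem crossIntegral_sub {φ : Fin 4 → ℝ → ℂ} (hφ : ∀ i, IntervalIntegrable (φ i) volume 0 1)
    {m m' : ℂ → ℂ} (hm : ∀ i, ContinuousOn m (seg a b i)) (hm' : ∀ i, ContinuousOn m' (seg a b i)) :
    crossIntegral a b φ (fun s => m s - m' s) = crossIntegral a b φ m - crossIntegral a b φ m' := by
  simp only [crossIntegral, sub_mul, ← Finset.sum_sub_distrib, ← mul_sub]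
  refine Finset.sum_congr rfl fun i _ => ?_
  rw [intervalIntegral.integral_sub (intervalIntegrable_mul_segPt (hφ i) (hm i))
    (intervalIntegrable_mul_segPt (hφ i) (hm' i))]

theorem crossIntegral_add_const_mul {φ ψ : Fin 4 → ℝ → ℂ}
    (hφ : ∀ i, IntervalIntegrable (φ i) volume 0 1) (hψ : ∀ i, IntervalIntegrable (ψ i) volume 0 1)
    (c : ℂ) {m : ℂ → ℂ} (hm : ∀ i, ContinuousOn m (seg a b i)) :
    crossIntegral a b (fun i t => φ i t + c * ψ i t) m =
      crossIntegral a b φ m + c * crossIntegral a b ψ m := by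
  simp only [crossIntegral, Finset.mul_sum, ← Finset.sum_add_distrib]
  refine Finset.sum_congr rfl fun i _ => ?_
  have e : ∫ t in (0 : ℝ)..1, m (segPt a b i t) * (φ i t + c * ψ i t) =
      (∫ t in (0 : ℝ)..1, m (segPt a b i t) * φ i t) +
        c * ∫ t in (0 : ℝ)..1, m (segPt a b i t) * ψ i t := by
    rw [← intervalIntegral.integral_const_mul,
      ← intervalIntegral.integral_add (intervalIntegrable_mul_segPt (hφ i) (hm i))
      ((intervalIntegrable_mul_segPt (hψ i) (hm i)).const_mul c)]
    congr 1
    ext t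
    ring
  rw [e]
  ring

/-- On the second lift both w and the direction change sign, so the two lifts contribute equally.
The minus sign comes from ds = -a_i dt, and integrability turns the improper limits into ordinary
integrals. -/
theorem deltaIntegral_eq {f : Fin 4 → ℂ → ℂ} {m : ℂ → ℂ} (hm : ∀ i, ContinuousOn m (seg a b i))
    (hf : ∀ i, IntervalIntegrable (fun t => f i (segPt a b i t) * invW a b i t) volume 0 1) :
    deltaIntegral a b f (fun s ω => m s * (1 / ω)) =
      -2 * crossIntegral a b (fun i t => f i (segPt a b i t) * invW a b i t) m := by
  rw [deltaIntegral, crossIntegral, Finset.mul_sum]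
  refine Finset.sum_congr rfl fun i _ => ?_
  have h := (tendsto_integral_shrink (intervalIntegrable_mul_segPt (hf i) (hm i))).const_mul
    (endpt a b i)
  set I := endpt a b i * ∫ t in (0 : ℝ)..1, m (segPt a b i t) * (f i (segPt a b i t) * invW a b i t)
  have h1 : liftIntegral (fun t => (1 - t) * endpt a b i)
      (fun t => wPlus a b i ((1 - t) * endpt a b i)) (fun s ω => f i s * (m s * (1 / ω))) = -I := by
    refine Tendsto.limUnder_eq (h.neg.congr fun ε => ?_)
    rw [← intervalIntegral.integral_const_mul, ← intervalIntegral.integral_neg]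
    refine intervalIntegral.integral_congr fun t _ => ?_
    beta_reduce
    rw [show deriv (fun t : ℝ => (1 - (t : ℂ)) * endpt a b i) t = -endpt a b i from deriv_segPt i t]
    simp only [invW, segPt]
    ring
  have h2 : liftIntegral (fun t => (1 - t) * endpt a b i)
      (fun t => -wPlus a b i ((1 - t) * endpt a b i)) (fun s ω => f i s * (m s * (1 / ω))) = I := by
    refine Tendsto.limUnder_eq (h.congr fun ε => ?_)
    rw [← intervalIntegral.integral_const_mul]
    refine intervalIntegral.integral_congr fun t _ => ?_
    beta_reduce
    rw [show deriv (fun t : ℝ => (1 - (t : ℂ)) * endpt a b i) t = -endpt a b i from deriv_segPt i t]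
    simp only [invW, segPt, one_div, inv_neg]
    ring
  rw [cycleIntegral, h1, h2]
  ring

theorem alphaIntegral_eq {m : ℂ → ℂ} {I : ℂ}
    (h : Tendsto (fun ε : ℝ => ∫ t in ε..(1 - ε), m (γ t) / w a b (γ t) * deriv γ t) (𝓝[>] 0)
      (𝓝 I)) : alphaIntegral a b γ (fun s ω => m s * (1 / ω)) = 2 * I := by
  have h1 : liftIntegral γ (fun t => w a b (γ t)) (fun s ω => m s * (1 / ω)) = I := by
    refine Tendsto.limUnder_eq (h.congr fun ε => ?_)
    refine intervalIntegral.integral_congr fun t _ => ?_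
    beta_reduce
    ring
  have h2 : liftIntegral γ (fun t => -w a b (γ t)) (fun s ω => m s * (1 / ω)) = -I := by
    refine Tendsto.limUnder_eq (h.neg.congr fun ε => ?_)
    rw [← intervalIntegral.integral_neg]
    refine intervalIntegral.integral_congr fun t _ => ?_
    beta_reduce
    rw [one_div, inv_neg]
    ring
  rw [alphaIntegral, cycleIntegral, h1, h2]
  ring

theorem crossIntegral_alphaSide (m : ℂ → ℂ) :
    crossIntegral a b (fun i t => alphaSide i * invW a b i t) m =
      endpt a b 0 * (∫ t in (0 : ℝ)..1, m (segPt a b 0 t) * invW a b 0 t) +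
        endpt a b 3 * ∫ t in (0 : ℝ)..1, m (segPt a b 3 t) * invW a b 3 t := by
  simp [crossIntegral, Fin.sum_univ_four, alphaSide]

theorem alphaIntegral_eq_crossIntegral (ha : 0 < a) (hb : 0 < b) (hγ : IsAlphaArc a b γ) {m : ℂ → ℂ}
    (hm : ContinuousOn m closedQuadrant)
    (hma : ∀ s ∈ closedQuadrant, (∀ i, s ≠ endpt a b i) → AnalyticAt ℂ m s) :
    alphaIntegral a b γ (fun s ω => m s * (1 / ω)) =
      2 * crossIntegral a b (fun i t => alphaSide i * invW a b i t) m := by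
  rw [crossIntegral_alphaSide]
  exact alphaIntegral_eq (tendsto_integral_arc ha hb hγ hm hma)

theorem alphaIntegral_one (ha : 0 < a) (hb : 0 < b) (hγ : IsAlphaArc a b γ) :
    alphaIntegral a b γ (fun _ v => 1 / v) =
      2 * crossIntegral a b (fun i t => alphaSide i * invW a b i t) (fun _ => 1) := by
  have := alphaIntegral_eq_crossIntegral ha hb hγ (m := fun _ => 1) continuousOn_const
    fun _ _ _ => analyticAt_const
  simpa only [one_mul] using this

theorem invW_eq_inv_mul (i : Fin 4) (t : ℝ) : invW a b i t = (-1) ^ (i : ℕ) * Complex.I *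
    (((Real.sqrt ‖((segPt a b i t) ^ 2 - (a : ℂ) ^ 2) * ((segPt a b i t) ^ 2 + (b : ℂ) ^ 2)‖)⁻¹ : ℝ) :
      ℂ) := by
  have h : ((-1 : ℂ) ^ ((i : ℕ) + 1) * Complex.I)⁻¹ = (-1) ^ (i : ℕ) * Complex.I := by
    rcases neg_one_pow_eq_or ℂ (i : ℕ) with h | h <;> rw [pow_succ, h] <;> simp
  rw [invW, wPlus, mul_inv, h, Complex.ofReal_inv]

/-- The part over Δ₁ is purely imaginary and nonzero, and the part over Δ₄ is real, so the imaginary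
part of the period does not vanish. -/
theorem alphaIntegral_one_ne_zero (ha : 0 < a) (hb : 0 < b) (hγ : IsAlphaArc a b γ) :
    alphaIntegral a b γ (fun _ v => 1 / v) ≠ 0 := by
  rw [alphaIntegral_one ha hb hγ, crossIntegral_alphaSide]
  simp only [one_mul]
  set q : Fin 4 → ℝ → ℝ := fun i t =>
    (Real.sqrt ‖((segPt a b i t) ^ 2 - (a : ℂ) ^ 2) * ((segPt a b i t) ^ 2 + (b : ℂ) ^ 2)‖)⁻¹ with hq
  have h0 : ∀ i, ∫ t in (0 : ℝ)..1, invW a b i t =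
      (-1) ^ (i : ℕ) * Complex.I * ((∫ t in (0 : ℝ)..1, q i t : ℝ) : ℂ) := by
    intro i
    rw [← intervalIntegral.integral_ofReal, ← intervalIntegral.integral_const_mul]
    simp only [invW_eq_inv_mul, hq]
  have hpos : 0 < ∫ t in (0 : ℝ)..1, q 0 t := by
    refine intervalIntegral.intervalIntegral_pos_of_pos_on ?_ (fun t ht => ?_) zero_lt_one
    · have := (intervalIntegrable_invW ha hb 0).norm
      refine this.congr fun t _ => ?_
      rw [invW_eq_inv_mul, norm_mul, norm_mul, norm_pow, norm_neg, norm_one, one_pow, one_mul,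
        Complex.norm_I, one_mul, Complex.norm_real, Real.norm_of_nonneg (by positivity)]
    · refine inv_pos.2 (Real.sqrt_pos.2 (norm_pos_iff.2 ?_))
      have h := segPt_ne_endpt ha hb 0 ⟨ht.1, ht.2.le⟩
      exact mul_ne_zero (sq_sub_ne_zero (h 0) (h 2)) (sq_add_ne_zero (h 1) (h 3))
  have e3 : (-1 : ℂ) ^ ((3 : Fin 4) : ℕ) = -1 := by
    rw [show ((3 : Fin 4) : ℕ) = 3 from rfl]; norm_num
  rw [h0, h0, e3]
  intro h
  have := congrArg Complex.im h
  simp [endpt] at this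
  rcases this with h | h
  · exact ha.ne' h
  · exact hpos.ne' h

/-- The divided difference (w(s) - w(z))/(s - z) is the regular part left after the pole at z is
split off. -/
theorem continuousOn_dslope_wQuad {z : ℂ} (hz : z ∈ closedQuadrant)
    (hzc : z ∉ cross a b) : ContinuousOn (dslope (wQuad a b) z) closedQuadrant := by
  intro s hs
  by_cases h : s = z
  · rw [h]
    exact (continuousAt_dslope_same.2
      (analyticAt_wQuad hz (ne_endpt_of_notMem hzc)).differentiableAt).continuousWithinAt
  · exact (continuousWithinAt_dslope_of_ne h).2 (continuousOn_wQuad s hs)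

theorem analyticAt_dslope_wQuad {z : ℂ} (hz : z ∈ closedQuadrant)
    (hzc : z ∉ cross a b) {s : ℂ} (hs : s ∈ closedQuadrant) (hse : ∀ i, s ≠ endpt a b i) :
    AnalyticAt ℂ (dslope (wQuad a b) z) s := by
  have hO := isOpen_analyticAt ℂ (wQuad a b)
  have h1 : {x | AnalyticAt ℂ (wQuad a b) x} ∈ 𝓝 z :=
    hO.mem_nhds (analyticAt_wQuad hz (ne_endpt_of_notMem hzc))
  have h2 : DifferentiableOn ℂ (dslope (wQuad a b) z) {x | AnalyticAt ℂ (wQuad a b) x} :=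
    (Complex.differentiableOn_dslope h1).2 fun x hx => AnalyticAt.differentiableWithinAt hx
  exact h2.analyticAt (hO.mem_nhds (analyticAt_wQuad hs hse))

/-- This holds for every z: where t equals the coordinate of z both integrands are 0 by convention.
-/
theorem endpt_mul_integral_div_segPt_sub (ha : 0 < a) (hb : 0 < b) (i : Fin 4) (φ : ℝ → ℂ) (z : ℂ) :
    endpt a b i * ∫ t in (0 : ℝ)..1, 1 / (segPt a b i t - z) * φ t =
      -cauchy φ (coord a b i z) := by
  have := endpt_ne_zero ha hb i
  rw [cauchy, ← intervalIntegral.integral_const_mul, ← intervalIntegral.integral_neg]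
  refine intervalIntegral.integral_congr fun t _ => ?_
  rw [segPt_sub ha hb]
  by_cases h : (t : ℂ) - coord a b i z = 0
  · simp [h]
  · field_simp

theorem crossIntegral_div (ha : 0 < a) (hb : 0 < b) (φ : Fin 4 → ℝ → ℂ) (z : ℂ) :
    crossIntegral a b φ (fun s => 1 / (s - z)) = -∑ i, cauchy (φ i) (coord a b i z) := by
  simp only [crossIntegral, endpt_mul_integral_div_segPt_sub ha hb, Finset.sum_neg_distrib]

theorem continuousOn_div_sub {z : ℂ} (hz : z ∉ cross a b) (i : Fin 4) :
    ContinuousOn (fun s : ℂ => 1 / (s - z)) (seg a b i) := by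
  refine ContinuousOn.div (by fun_prop) (by fun_prop) fun s hs h => hz ?_
  rw [← sub_eq_zero.1 h]
  exact mem_iUnion.2 ⟨i, hs⟩

/-- If z is outside the closed quadrant, the kernel is regular and the deformation applies directly.
Otherwise w(z)/((s - z)w(s)) is 1/(s - z) minus the divided difference of w over w(s). The second
term is deformed to the cross; the first one, on the arc and on the two segments, makes up the
winding integral. -/
theorem tendsto_integral_div_arc (ha : 0 < a) (hb : 0 < b) (hγ : IsAlphaArc a b γ) {z : ℂ}
    (hz : z ∉ cuts a b γ) :
    Tendsto (fun ε : ℝ => ∫ t in ε..(1 - ε), 1 / (γ t - z) / w a b (γ t) * deriv γ t) (𝓝[>] 0)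
      (𝓝 (winding a b γ z / w a b z -
        ∑ i, cauchy (fun t => alphaSide i * invW a b i t) (coord a b i z))) := by
  have hzc : z ∉ cross a b := fun h => hz (Or.inl h)
  by_cases hzQ : z ∈ closedQuadrant
  swap
  · rw [winding_eq_zero_of_not_isBounded ha hb hγ hz
      (not_isBounded_of_notMem_closedQuadrant ha hb hγ hz hzQ), zero_div, zero_sub,
      ← crossIntegral_div ha hb, crossIntegral_alphaSide]
    have hne : ∀ s ∈ closedQuadrant, s - z ≠ 0 := fun s hs h => hzQ (by rwa [← sub_eq_zero.1 h])
    refine tendsto_integral_arc ha hb hγ (m := fun s => 1 / (s - z)) ?_ fun s hs _ => ?_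
    · exact ContinuousOn.div (by fun_prop) (by fun_prop) hne
    · exact AnalyticAt.div (by fun_prop) (by fun_prop) (hne s hs)
  have hwz : w a b z ≠ 0 := w_ne_zero (ne_endpt_of_notMem hzc)
  have hwQ := wQuad_eq_w ha hb hzQ hzc
  obtain ⟨K, hK⟩ := hγ.lipschitz
  have hds : ∀ s, s ≠ z → dslope (wQuad a b) z s = (wQuad a b s - w a b z) / (s - z) := by
    intro s hs
    rw [dslope_of_ne _ hs, slope_def_field, hwQ]
  have h1 := tendsto_integral_arc ha hb hγ (continuousOn_dslope_wQuad hzQ hzc)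
    fun s hs hse => analyticAt_dslope_wQuad hzQ hzc hs hse
  have hne : ∀ t ∈ Icc (0 : ℝ) 1, γ t - z ≠ 0 := fun t ht h =>
    hz (Or.inr ⟨t, ht, sub_eq_zero.1 h⟩)
  have hint : IntervalIntegrable (fun t => deriv γ t / (γ t - z)) volume 0 1 := by
    simp only [div_eq_mul_inv]
    refine (intervalIntegrable_deriv_of_lipschitz hK).mul_continuousOn (ContinuousOn.inv₀ ?_ ?_)
    · rw [uIcc_of_le zero_le_one]; exact hγ.continuousOn.sub continuousOn_const
    · rw [uIcc_of_le zero_le_one]; exact hne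
  have h2 := ((tendsto_integral_shrink hint).sub h1).const_mul (w a b z)⁻¹
  have hseg : ∀ i : Fin 4, ∀ σ : ℂ, σ ^ 2 = 1 →
      (∀ t ∈ Icc (0 : ℝ) 1, (wQuad a b (segPt a b i t))⁻¹ = σ * invW a b i t) →
      endpt a b i * (∫ t in (0 : ℝ)..1, dslope (wQuad a b) z (segPt a b i t) * invW a b i t) =
        -σ * cauchy (fun _ => 1) (coord a b i z) + w a b z * cauchy (invW a b i) (coord a b i z) := by
    intro i σ hσ hi
    rw [← neg_neg (cauchy (fun _ => 1) _), ← neg_neg (cauchy (invW a b i) _),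
      ← endpt_mul_integral_div_segPt_sub ha hb, ← endpt_mul_integral_div_segPt_sub ha hb]
    have hi1 := intervalIntegrable_mul_segPt (intervalIntegrable_const (c := (1 : ℂ)))
      (continuousOn_div_sub hzc i)
    have hi2 := intervalIntegrable_mul_segPt (intervalIntegrable_invW ha hb i)
      (continuousOn_div_sub hzc i)
    have e : ∫ t in (0 : ℝ)..1, dslope (wQuad a b) z (segPt a b i t) * invW a b i t =
        ∫ t in (0 : ℝ)..1, (σ * (1 / (segPt a b i t - z) * 1) -
          w a b z * (1 / (segPt a b i t - z) * invW a b i t)) := by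
      refine intervalIntegral.integral_congr_ae (ae_of_all _ fun t ht => ?_)
      rw [uIoc_of_le zero_le_one] at ht
      have hs := segPt_mem_seg (a := a) (b := b) i ⟨ht.1.le, ht.2⟩
      have hsz : segPt a b i t ≠ z := fun h => hzc (by rw [← h]; exact mem_iUnion.2 ⟨i, hs⟩)
      have hs0 := sub_ne_zero.2 hsz
      have hw0 := wQuad_ne_zero (segPt_ne_endpt ha hb i ht)
      have hi' := hi t ⟨ht.1.le, ht.2⟩
      have hinv : invW a b i t = σ * (wQuad a b (segPt a b i t))⁻¹ := by
        rw [hi', ← mul_assoc, ← sq, hσ, one_mul]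
      rw [hds _ hsz, hinv]
      field_simp
    rw [e, intervalIntegral.integral_sub (hi1.const_mul _) (hi2.const_mul _),
      intervalIntegral.integral_const_mul, intervalIntegral.integral_const_mul]
    ring
  have e0 := hseg 0 1 (by norm_num)
    (fun t ht => by rw [inv_wQuad_segPt_zero ha hb ht, one_mul])
  have e3 := hseg 3 (-1) (by norm_num)
    (fun t ht => by rw [inv_wQuad_segPt_three ha hb ht, neg_one_mul])
  rw [e0, e3] at h2
  have hsum : ∑ i, cauchy (fun t => alphaSide i * invW a b i t) (coord a b i z) =
      cauchy (invW a b 0) (coord a b 0 z) + cauchy (invW a b 3) (coord a b 3 z) := by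
    simp [Fin.sum_univ_four, alphaSide, cauchy]
  have hval : winding a b γ z / w a b z -
      ∑ i, cauchy (fun t => alphaSide i * invW a b i t) (coord a b i z) =
      (w a b z)⁻¹ * ((∫ t in (0 : ℝ)..1, deriv γ t / (γ t - z)) -
        (-1 * cauchy (fun _ => 1) (coord a b 0 z) + w a b z * cauchy (invW a b 0) (coord a b 0 z) +
        (-(-1) * cauchy (fun _ => 1) (coord a b 3 z) +
          w a b z * cauchy (invW a b 3) (coord a b 3 z)))) := by
    rw [hsum, winding]
    field_simp
    ring
  rw [hval]
  refine h2.congr' ?_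
  have hev : ∀ᶠ ε : ℝ in 𝓝[>] 0, ε ∈ Ioo (0 : ℝ) (1 / 2) := Ioo_mem_nhdsGT (by norm_num)
  filter_upwards [hev] with ε hε
  have hsub : uIcc ε (1 - ε) ⊆ uIcc 0 1 := by
    rw [uIcc_of_le zero_le_one, uIcc_of_le (by linarith [hε.2])]
    exact Icc_subset_Icc hε.1.le (by linarith [hε.1])
  have hIoo : ∀ t ∈ uIcc ε (1 - ε), t ∈ Ioo (0 : ℝ) 1 := by
    intro t ht
    rw [uIcc_of_le (by linarith [hε.2])] at ht
    exact ⟨hε.1.trans_le ht.1, by linarith [ht.2, hε.1]⟩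
  have hwγ : ∀ t ∈ uIcc ε (1 - ε), wQuad a b (γ t) = w a b (γ t) ∧ w a b (γ t) ≠ 0 := by
    intro t ht
    have h := hIoo t ht
    exact ⟨wQuad_eq_w ha hb (hγ.mem_closedQuadrant ha hb (Ioo_subset_Icc_self h)) (hγ.avoids t h),
      w_ne_zero (ne_endpt_of_notMem (hγ.avoids t h))⟩
  have hint2 : IntervalIntegrable
      (fun t => dslope (wQuad a b) z (γ t) / w a b (γ t) * deriv γ t) volume ε (1 - ε) := by
    refine ((intervalIntegrable_deriv_of_lipschitz hK).mono_set hsub).continuousOn_mul ?_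
    refine ContinuousOn.div ?_ ?_ fun t ht => (hwγ t ht).2
    · exact (continuousOn_dslope_wQuad hzQ hzc).comp
        (hγ.continuousOn.mono fun t ht => Ioo_subset_Icc_self (hIoo t ht))
        fun t ht => hγ.mem_closedQuadrant ha hb (Ioo_subset_Icc_self (hIoo t ht))
    · intro t ht
      exact (differentiableAt_w ha hb (hγ.avoids t (hIoo t ht))).continuousAt.comp_continuousWithinAt
        ((hγ.continuousOn.mono fun t ht => Ioo_subset_Icc_self (hIoo t ht)) t ht)
  rw [← intervalIntegral.integral_sub (hint.mono_set hsub) hint2,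
    ← intervalIntegral.integral_const_mul]
  refine intervalIntegral.integral_congr fun t ht => ?_
  have hs0 := hne t (Ioo_subset_Icc_self (hIoo t ht))
  rw [hds _ (sub_ne_zero.1 hs0), (hwγ t ht).1]
  have := (hwγ t ht).2
  field_simp
  ring

end Cross

/-! ### The Szegő function as a Cauchy integral -/

namespace Cross

variable {a b : ℝ} {γ : ℝ → ℂ} {L : Fin 4 → ℂ → ℂ}

/-- The density `log (ρ w_+) / w_+` on the `i`-th segment. -/
noncomputable def logDensity (a b : ℝ) (L : Fin 4 → ℂ → ℂ) (i : Fin 4) (t : ℝ) : ℂ :=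
  logRhoW a b L i (segPt a b i t) * invW a b i t

/-- The density whose Cauchy integral represents the Szegő function. -/
noncomputable def density (a b : ℝ) (γ : ℝ → ℂ) (L : Fin 4 → ℂ → ℂ) (i : Fin 4) (t : ℝ) : ℂ :=
  logDensity a b L i t + 2 * Real.pi * Complex.I * cRho a b γ L * (alphaSide i * invW a b i t)

/-- The Cauchy integral of `density` over the cross. -/
noncomputable def szegoCauchy (a b : ℝ) (γ : ℝ → ℂ) (L : Fin 4 → ℂ → ℂ) (z : ℂ) : ℂ :=
  1 / (2 * Real.pi * Complex.I) * ∑ i, cauchy (density a b γ L i) (coord a b i z)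

theorem intervalIntegrable_alphaSide_invW (ha : 0 < a) (hb : 0 < b) (i : Fin 4) :
    IntervalIntegrable (fun t => alphaSide i * invW a b i t) volume 0 1 :=
  (intervalIntegrable_invW ha hb i).const_mul _

theorem intervalIntegrable_density (ha : 0 < a) (hb : 0 < b)
    (hL : ∀ i, IntervalIntegrable (logDensity a b L i) volume 0 1) (i : Fin 4) :
    IntervalIntegrable (density a b γ L i) volume 0 1 :=
  (hL i).add ((intervalIntegrable_alphaSide_invW ha hb i).const_mul _)

theorem cRho_eq (hL : ∀ i, IntervalIntegrable (logDensity a b L i) volume 0 1) :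
    cRho a b γ L = -(1 / (Real.pi * Complex.I)) * (alphaIntegral a b γ fun _ v => 1 / v)⁻¹ *
      crossIntegral a b (logDensity a b L) (fun _ => 1) := by
  have h := deltaIntegral_eq (f := logRhoW a b L)
    (m := fun _ => (alphaIntegral a b γ fun _ v => 1 / v)⁻¹ * 1) (fun i => continuousOn_const) hL
  rw [crossIntegral_const_mul] at h
  simp only [mul_one] at h
  rw [cRho, show Omega a b γ = fun _ ω => (alphaIntegral a b γ fun _ v => 1 / v)⁻¹ * (1 / ω) from rfl,
    h]
  have : (Real.pi : ℂ) ≠ 0 := Complex.ofReal_ne_zero.2 Real.pi_ne_zero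
  unfold logDensity
  field_simp

theorem crossIntegral_density (ha : 0 < a) (hb : 0 < b)
    (hL : ∀ i, IntervalIntegrable (logDensity a b L i) volume 0 1) {m : ℂ → ℂ}
    (hm : ∀ i, ContinuousOn m (seg a b i)) :
    crossIntegral a b (density a b γ L) m = crossIntegral a b (logDensity a b L) m +
      2 * Real.pi * Complex.I * cRho a b γ L *
        crossIntegral a b (fun i t => alphaSide i * invW a b i t) m :=
  crossIntegral_add_const_mul hL (intervalIntegrable_alphaSide_invW ha hb) _ hm

/-- The period B of ds/w is twice the integral of ε/w₊ over the cross, and c_ρ is -1/(πi B) times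
the integral of log(ρw₊)/w₊. The two parts of the density therefore cancel. -/
theorem crossIntegral_density_one (ha : 0 < a) (hb : 0 < b) (hγ : IsAlphaArc a b γ)
    (hL : ∀ i, IntervalIntegrable (logDensity a b L i) volume 0 1) :
    crossIntegral a b (density a b γ L) (fun _ => 1) = 0 := by
  have h0 := alphaIntegral_one_ne_zero ha hb hγ
  rw [crossIntegral_density ha hb hL fun i => continuousOn_const, cRho_eq hL]
  have h1 := alphaIntegral_one ha hb hγ
  set B := alphaIntegral a b γ fun _ v => 1 / v
  rw [show crossIntegral a b (fun i t => alphaSide i * invW a b i t) (fun _ => 1) = B / 2 by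
    rw [h1]; ring]
  have : (Real.pi : ℂ) ≠ 0 := Complex.ofReal_ne_zero.2 Real.pi_ne_zero
  field_simp
  ring

/-- The coefficient of `ds / w` in the third kind differential. -/
noncomputable def thirdCoeff (P : Surface a b) (s : ℂ) : ℂ :=
  match P with
  | .pt p => p.ω * (1 / (s - p.z))
  | .infty k => -(-1) ^ (k : ℕ) * s

theorem thirdKind_eq (P : Surface a b) :
    thirdKind P = fun s ω => thirdCoeff P s * (1 / ω) := by
  ext s ω
  cases P with
  | pt p => simp only [thirdKind, thirdCoeff]; ring
  | infty k => rfl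

/-- The correction that normalizes the third kind differential is A/B times ds/w. By the definition
of c_ρ its contribution to the exponent is c_ρ A/2. -/
theorem szego_eq (ha : 0 < a) (hb : 0 < b) (hγ : IsAlphaArc a b γ)
    (hL : ∀ i, IntervalIntegrable (logDensity a b L i) volume 0 1) (P : Surface a b)
    (hP : ∀ i, ContinuousOn (thirdCoeff P) (seg a b i)) :
    szego a b γ L P = Complex.exp (1 / (2 * Real.pi * Complex.I) *
        crossIntegral a b (logDensity a b L) (thirdCoeff P) +
      cRho a b γ L * (alphaIntegral a b γ (fun s ω => thirdCoeff P s * (1 / ω)) / 2)) := by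
  have h0 := alphaIntegral_one_ne_zero ha hb hγ
  have hc := cRho_eq (γ := γ) hL
  have hO : OmegaThird γ P = fun s ω => (thirdCoeff P s -
      (alphaIntegral a b γ (fun s ω => thirdCoeff P s * (1 / ω)) *
        (alphaIntegral a b γ fun _ v => 1 / v)⁻¹) * 1) * (1 / ω) := by
    ext s ω
    rw [OmegaThird, thirdKind_eq, Omega]
    ring
  rw [szego, hO, deltaIntegral_eq (m := fun s => thirdCoeff P s -
      (alphaIntegral a b γ (fun s ω => thirdCoeff P s * (1 / ω)) *
        (alphaIntegral a b γ fun _ v => 1 / v)⁻¹) * 1)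
      (fun i => (hP i).sub continuousOn_const) hL,
    show (fun i t => logRhoW a b L i (segPt a b i t) * invW a b i t) = logDensity a b L from rfl,
    crossIntegral_sub hL hP (fun i => continuousOn_const), crossIntegral_const_mul]
  set A := alphaIntegral a b γ (fun s ω => thirdCoeff P s * (1 / ω))
  set B := alphaIntegral a b γ fun _ v => 1 / v
  have : (Real.pi : ℂ) ≠ 0 := Complex.ofReal_ne_zero.2 Real.pi_ne_zero
  congr 1
  rw [hc]
  field_simp
  ring

/-- The α-period of the third kind kernel consists of a Cauchy integral over Δ₁ and Δ₄, which is
absorbed into the density, and of the residue term, which is the winding number divided by w(z). -/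
theorem szego_pt (ha : 0 < a) (hb : 0 < b) (hγ : IsAlphaArc a b γ)
    (hL : ∀ i, IntervalIntegrable (logDensity a b L i) volume 0 1) {p : Curve a b}
    (hp : p.z ∉ cuts a b γ) :
    szego a b γ L (.pt p) = Complex.exp (-p.ω * szegoCauchy a b γ L p.z +
      2 * Real.pi * Complex.I * cRho a b γ L *
        (p.ω / w a b p.z * innerIndicator a b γ p.z)) := by
  have hpc : p.z ∉ cross a b := fun h => hp (Or.inl h)
  have hpi : (Real.pi : ℂ) ≠ 0 := Complex.ofReal_ne_zero.2 Real.pi_ne_zero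
  have hT : thirdCoeff (Surface.pt p) = fun s => p.ω * (1 / (s - p.z)) := rfl
  have hA : alphaIntegral a b γ (fun s ω => thirdCoeff (Surface.pt p) s * (1 / ω)) =
      2 * (p.ω * (winding a b γ p.z / w a b p.z -
        ∑ i, cauchy (fun t => alphaSide i * invW a b i t) (coord a b i p.z))) := by
    refine alphaIntegral_eq (((tendsto_integral_div_arc ha hb hγ hp).const_mul p.ω).congr fun ε => ?_)
    rw [← intervalIntegral.integral_const_mul, hT]
    refine intervalIntegral.integral_congr fun t _ => ?_
    beta_reduce
    ring
  rw [szego_eq ha hb hγ hL _ fun i => by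
    rw [hT]; exact continuousOn_const.mul (continuousOn_div_sub hpc i), hA,
    winding_eq ha hb hγ hp, hT, crossIntegral_const_mul,
    szegoCauchy]
  have hd := crossIntegral_density (γ := γ) ha hb hL (continuousOn_div_sub hpc)
  rw [crossIntegral_div ha hb, crossIntegral_div ha hb, crossIntegral_div ha hb] at hd
  rw [crossIntegral_div ha hb, show ∑ i, cauchy (density a b γ L i) (coord a b i p.z) =
    ∑ i, cauchy (logDensity a b L i) (coord a b i p.z) + 2 * Real.pi * Complex.I * cRho a b γ L *
      ∑ i, cauchy (fun t => alphaSide i * invW a b i t) (coord a b i p.z) by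
    linear_combination -hd]
  congr 1
  field_simp
  ring

/-- For the points over infinity the kernel is a multiple of s, which has no pole, so deforming the
α-period leaves no residue. -/
theorem szego_infty (ha : 0 < a) (hb : 0 < b) (hγ : IsAlphaArc a b γ)
    (hL : ∀ i, IntervalIntegrable (logDensity a b L i) volume 0 1) (k : Fin 2) :
    szego a b γ L (.infty k) = Complex.exp (-(-1) ^ (k : ℕ) * (1 / (2 * Real.pi * Complex.I) *
      crossIntegral a b (density a b γ L) (fun s => s))) := by
  have hpi : (Real.pi : ℂ) ≠ 0 := Complex.ofReal_ne_zero.2 Real.pi_ne_zero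
  have hT : thirdCoeff (a := a) (b := b) (Surface.infty k) = fun s => -(-1) ^ (k : ℕ) * s := rfl
  rw [szego_eq ha hb hγ hL _ fun i => by rw [hT]; fun_prop, hT,
    alphaIntegral_eq_crossIntegral ha hb hγ (by fun_prop) (fun s _ _ => by fun_prop),
    crossIntegral_const_mul, crossIntegral_const_mul,
    crossIntegral_density (m := fun s => s) ha hb hL fun i => continuousOn_id' _]
  congr 1
  field_simp
  ring

end Cross

/-! ### Holomorphy and symmetry -/

namespace Cross

variable {a b : ℝ} {γ : ℝ → ℂ} {L : Fin 4 → ℂ → ℂ}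

theorem continuous_curve_z : Continuous (Curve.z (a := a) (b := b)) :=
  continuous_fst.comp continuous_subtype_val

theorem continuous_curve_ω : Continuous (Curve.ω (a := a) (b := b)) :=
  continuous_snd.comp continuous_subtype_val

theorem Curve.ω_sq (p : Curve a b) : p.ω ^ 2 = (w a b p.z) ^ 2 := by
  rw [w_sq]; exact p.2

theorem Curve.ω_eq_or (p : Curve a b) : p.ω = w a b p.z ∨ p.ω = -w a b p.z :=
  sq_eq_sq_iff_eq_or_eq_neg.1 p.ω_sq

theorem Curve.ω_ne_zero {p : Curve a b} (h : ∀ i, p.z ≠ endpt a b i) : p.ω ≠ 0 := by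
  intro h0
  have := p.ω_sq
  rw [h0] at this
  exact w_ne_zero h (pow_eq_zero_iff two_ne_zero |>.1 (this.symm.trans (by ring)))

theorem analyticAt_szegoCauchy (ha : 0 < a) (hb : 0 < b)
    (hL : ∀ i, IntervalIntegrable (logDensity a b L i) volume 0 1) {z : ℂ} (hz : z ∉ cross a b) :
    AnalyticAt ℂ (szegoCauchy a b γ L) z := by
  unfold szegoCauchy
  refine analyticAt_const.mul (Finset.analyticAt_fun_sum _ fun i _ => ?_)
  have h1 : AnalyticAt ℂ (coord a b i) z := by
    unfold coord
    exact analyticAt_const.sub (analyticAt_id.div_const)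
  exact (analyticAt_cauchy (intervalIntegrable_density ha hb hL i)
    (coord_notMem ha hb fun h => hz (mem_iUnion.2 ⟨i, h⟩))).comp h1

/-- On nearby points ω = ±w(z). The difference of the two choices has modulus 2|w(z)|, which stays
away from 0, so continuity fixes the sign. -/
theorem eventually_ω_eq (ha : 0 < a) (hb : 0 < b) {p : Curve a b} (hp : p.z ∉ cross a b) :
    ∀ᶠ q in 𝓝 p, q.ω = p.ω / w a b p.z * w a b q.z := by
  have hw := w_ne_zero (ne_endpt_of_notMem hp)
  have hc : ContinuousAt (fun q : Curve a b => q.ω - p.ω / w a b p.z * w a b q.z) p :=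
    continuous_curve_ω.continuousAt.sub (continuousAt_const.mul
      (((differentiableAt_w ha hb hp).continuousAt).comp continuous_curve_z.continuousAt))
  have hw2 : ContinuousAt (fun q : Curve a b => ‖w a b q.z‖) p :=
    (((differentiableAt_w ha hb hp).continuousAt).comp continuous_curve_z.continuousAt).norm
  have h0 : Tendsto (fun q : Curve a b => ‖q.ω - p.ω / w a b p.z * w a b q.z‖) (𝓝 p) (𝓝 0) := by
    have := hc.norm.tendsto
    rwa [div_mul_cancel₀ _ hw, sub_self, norm_zero] at this
  filter_upwards [h0.eventually_lt hw2.tendsto (norm_pos_iff.2 hw)] with q hq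
  rcases p.ω_eq_or with h | h <;> rcases q.ω_eq_or with h' | h' <;> rw [h, h'] at hq ⊢
  · rw [div_self hw, one_mul]
  · rw [div_self hw, one_mul, show -w a b q.z - w a b q.z = -2 * w a b q.z by ring, norm_mul,
      norm_neg, Complex.norm_ofNat] at hq
    linarith [norm_nonneg (w a b q.z)]
  · rw [neg_div, div_self hw, show w a b q.z - -1 * w a b q.z = 2 * w a b q.z by ring, norm_mul,
      Complex.norm_ofNat] at hq
    linarith [norm_nonneg (w a b q.z)]
  · rw [neg_div, div_self hw, neg_one_mul]

theorem holomorphicAt_szego_pt (ha : 0 < a) (hb : 0 < b) (hγ : IsAlphaArc a b γ)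
    (hL : ∀ i, IntervalIntegrable (logDensity a b L i) volume 0 1) {p : Curve a b}
    (hp : p.z ∉ cuts a b γ) : HolomorphicAt (szego a b γ L) (.pt p) := by
  have hpc : p.z ∉ cross a b := fun h => hp (Or.inl h)
  refine ⟨fun _ => ?_, fun h => absurd h (Curve.ω_ne_zero (ne_endpt_of_notMem hpc))⟩
  set σ := p.ω / w a b p.z
  -- The locally constant ω/w is replaced by its value σ, and 2πi χ by the winding integral, which
  -- has an explicit derivative off the cuts.
  refine ⟨fun z => Complex.exp (-(σ * w a b z) * szegoCauchy a b γ L z +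
    cRho a b γ L * (σ * winding a b γ z)), ?_, ?_⟩
  · have hw : AnalyticAt ℂ (winding a b γ) p.z := DifferentiableOn.analyticAt
      (s := (cuts a b γ)ᶜ) (fun z hz =>
        (hasDerivAt_winding ha hb hγ hz).differentiableAt.differentiableWithinAt)
      (hγ.isOpen_compl.mem_nhds hp)
    exact (((analyticAt_const.mul (analyticAt_w ha hb hpc)).neg.mul
      (analyticAt_szegoCauchy ha hb hL hpc)).add
      (analyticAt_const.mul (analyticAt_const.mul hw))).cexp
  · filter_upwards [eventually_ω_eq ha hb hpc,
      continuous_curve_z.continuousAt.preimage_mem_nhds (hγ.isOpen_compl.mem_nhds hp)] with q h1 h2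
    have hq : q.z ∉ cuts a b γ := h2
    have hwq := w_ne_zero (ne_endpt_of_notMem (z := q.z) fun h => hq (Or.inl h))
    rw [szego_pt ha hb hγ hL hq, winding_eq ha hb hγ hq, h1]
    congr 1
    simp only [σ]
    field_simp

theorem w_eq_of_inv {z : ℂ} (hz : z ≠ 0) : w a b z = (1 - (a : ℂ) ^ 2 * z⁻¹ ^ 2) *
    ((1 + (b : ℂ) ^ 2 * z⁻¹ ^ 2) / (1 - (a : ℂ) ^ 2 * z⁻¹ ^ 2)) ^ (1 / 2 : ℂ) * z ^ 2 := by
  have h1 : z ^ 2 - (a : ℂ) ^ 2 = z ^ 2 * (1 - (a : ℂ) ^ 2 * z⁻¹ ^ 2) := by field_simp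
  have h2 : z ^ 2 + (b : ℂ) ^ 2 = z ^ 2 * (1 + (b : ℂ) ^ 2 * z⁻¹ ^ 2) := by field_simp
  rw [w, h1, h2, mul_div_mul_left _ _ (pow_ne_zero 2 hz)]
  ring

theorem eventually_cobounded_notMem_cuts (ha : 0 < a) (hb : 0 < b) (hγ : IsAlphaArc a b γ) :
    ∀ᶠ z in Bornology.cobounded ℂ, z ∉ cuts a b γ ∧ innerIndicator a b γ z = 0 := by
  have h1 : ∀ᶠ z in Bornology.cobounded ℂ, z ∈ (cuts a b γ)ᶜ :=
    Bornology.isBounded_def.1 hγ.isCompact_cuts.isBounded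
  have h2 := (tendsto_winding_cobounded ha hb hγ).norm
  rw [norm_zero] at h2
  filter_upwards [h1, h2.eventually_lt_const Real.two_pi_pos] with z h3 h4
  refine ⟨h3, ?_⟩
  rcases innerIndicator_mem (a := a) (b := b) (γ := γ) z with h | h
  · exact h
  · rw [winding_eq ha hb hγ h3, h, mul_one, norm_mul, norm_mul, Complex.norm_I, mul_one,
      Complex.norm_ofNat, Complex.norm_real, Real.norm_of_nonneg Real.pi_pos.le] at h4
    exact absurd h4 (lt_irrefl _)

/-- From 1/(s - z) = -z⁻¹ - z⁻² s/(1 - s/z): the first term drops out because the density has total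
integral 0. -/
theorem sum_cauchy_eq_of_inv (ha : 0 < a) (hb : 0 < b) {φ : Fin 4 → ℝ → ℂ}
    (hφ : ∀ i, IntervalIntegrable (φ i) volume 0 1)
    (h1 : crossIntegral a b φ (fun _ => 1) = 0) {z : ℂ} (hz : z ∉ cross a b) (hz0 : z ≠ 0) :
    ∑ i, cauchy (φ i) (coord a b i z) =
      z⁻¹ ^ 2 * ∑ i, endpt a b i *
        ∫ t in (0 : ℝ)..1, segPt a b i t * φ i t / (1 - segPt a b i t * z⁻¹) := by
  have h2 := crossIntegral_div ha hb φ z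
  have hne : ∀ i, ∀ t ∈ Icc (0 : ℝ) 1, z - segPt a b i t ≠ 0 := by
    intro i t ht h
    refine hz (mem_iUnion.2 ⟨i, ?_⟩)
    rw [sub_eq_zero.1 h]
    exact segPt_mem_seg i ht
  have hint : ∀ i, IntervalIntegrable
      (fun t => segPt a b i t * φ i t / (1 - segPt a b i t * z⁻¹)) volume 0 1 := by
    intro i
    simp only [div_eq_mul_inv]
    have hc := continuous_segPt (a := a) (b := b) i
    refine ((hφ i).continuousOn_mul hc.continuousOn).mul_continuousOn
      (ContinuousOn.inv₀ (by fun_prop) fun t ht h => ?_)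
    rw [uIcc_of_le zero_le_one] at ht
    apply hne i t ht
    field_simp at h
    simpa using h
  have hsplit : crossIntegral a b φ (fun s => 1 / (s - z)) =
      -z⁻¹ * crossIntegral a b φ (fun _ => 1) - z⁻¹ ^ 2 * ∑ i, endpt a b i *
        ∫ t in (0 : ℝ)..1, segPt a b i t * φ i t / (1 - segPt a b i t * z⁻¹) := by
    rw [crossIntegral, crossIntegral, Finset.mul_sum, Finset.mul_sum, ← Finset.sum_sub_distrib]
    refine Finset.sum_congr rfl fun i _ => ?_
    have e : ∫ t in (0 : ℝ)..1, 1 / (segPt a b i t - z) * φ i t =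
        -z⁻¹ * (∫ t in (0 : ℝ)..1, 1 * φ i t) -
          z⁻¹ ^ 2 * ∫ t in (0 : ℝ)..1, segPt a b i t * φ i t / (1 - segPt a b i t * z⁻¹) := by
      simp only [one_mul]
      rw [← intervalIntegral.integral_const_mul, ← intervalIntegral.integral_const_mul,
        ← intervalIntegral.integral_sub ((hφ i).const_mul _) ((hint i).const_mul _)]
      refine intervalIntegral.integral_congr fun t ht => ?_
      rw [uIcc_of_le zero_le_one] at ht
      have h3 := hne i t ht
      have h4 : segPt a b i t - z ≠ 0 := fun h => h3 (by linear_combination -h)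
      have h5 : 1 - segPt a b i t * z⁻¹ = (z - segPt a b i t) * z⁻¹ := by field_simp
      rw [h5]
      field_simp
      ring
    rw [e]
    ring
  rw [h1, mul_zero, zero_sub] at hsplit
  rw [hsplit] at h2
  linear_combination h2

/-- The factor z⁻² of the Cauchy integral cancels the factor z² of w. What is left is analytic in u
= 1/z, and χ vanishes near infinity because the winding integral tends to 0. -/
theorem holomorphicAt_szego_infty (ha : 0 < a) (hb : 0 < b) (hγ : IsAlphaArc a b γ)
    (hL : ∀ i, IntervalIntegrable (logDensity a b L i) volume 0 1) (k : Fin 2) :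
    HolomorphicAt (szego a b γ L) (.infty k) := by
  have hd := intervalIntegrable_density (γ := γ) ha hb hL
  have hd1 := crossIntegral_density_one ha hb hγ hL
  set W : ℂ → ℂ := fun u => (1 - (a : ℂ) ^ 2 * u ^ 2) *
    ((1 + (b : ℂ) ^ 2 * u ^ 2) / (1 - (a : ℂ) ^ 2 * u ^ 2)) ^ (1 / 2 : ℂ) with hW
  set E : ℂ → ℂ := fun u => ∑ i, endpt a b i *
    ∫ t in (0 : ℝ)..1, segPt a b i t * density a b γ L i t / (1 - segPt a b i t * u) with hE
  refine ⟨fun u => Complex.exp (-(-1) ^ (k : ℕ) * W u *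
    (1 / (2 * Real.pi * Complex.I) * E u)), ?_, ?_, ?_⟩
  · have hWa : AnalyticAt ℂ W 0 := by
      refine AnalyticAt.mul (by fun_prop) (AnalyticAt.cpow ?_ analyticAt_const ?_)
      · exact AnalyticAt.div (by fun_prop) (by fun_prop) (by simp)
      · simp
    have hEa : AnalyticAt ℂ E 0 := by
      refine Finset.analyticAt_fun_sum _ fun i _ => analyticAt_const.mul ?_
      have hc := continuous_segPt (a := a) (b := b) i
      rw [Complex.analyticAt_iff_eventually_differentiableAt]
      obtain ⟨R, hR⟩ := isCompact_Icc.exists_bound_of_continuousOn (hc.continuousOn (s := Icc 0 1))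
      have hev : ∀ᶠ u : ℂ in 𝓝 0, |R| * ‖u‖ < 1 := by
        have : Continuous fun u : ℂ => |R| * ‖u‖ := by fun_prop
        have := this.tendsto 0
        rw [norm_zero, mul_zero] at this
        exact this.eventually_lt_const zero_lt_one
      filter_upwards [hev] with u hu
      refine (hasDerivAt_integral_div (p := fun _ => 1) (q := segPt a b i)
        ((hd i).continuousOn_mul hc.continuousOn) (by fun_prop) (by fun_prop)
        fun t ht h => ?_).differentiableAt
      have h1 : ‖segPt a b i t * u‖ = 1 := by rw [← sub_eq_zero.1 h, norm_one]
      rw [norm_mul] at h1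
      have := mul_le_mul_of_nonneg_right ((hR t ht).trans (le_abs_self R)) (norm_nonneg u)
      linarith
    exact ((analyticAt_const.mul hWa).mul (analyticAt_const.mul hEa)).cexp
  · rw [szego_infty ha hb hγ hL]
    congr 1
    simp [hW, hE, crossIntegral]
  · filter_upwards [eventually_cobounded_notMem_cuts ha hb hγ] with z hz
    have hzc : z ∉ cross a b := fun h => hz.1 (Or.inl h)
    have hz0 : z ≠ 0 := fun h => hzc (h ▸ zero_mem_cross)
    rw [szego_pt ha hb hγ hL (p := lift a b k z) hz.1]
    change Complex.exp (-((-1) ^ (k : ℕ) * w a b z) * szegoCauchy a b γ L z +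
      2 * Real.pi * Complex.I * cRho a b γ L *
        ((lift a b k z).ω / w a b z * innerIndicator a b γ z)) = _
    rw [hz.2, mul_zero, mul_zero, add_zero, szegoCauchy, sum_cauchy_eq_of_inv ha hb hd hd1 hzc hz0,
      w_eq_of_inv hz0]
    congr 1
    simp only [hW, hE]
    field_simp

theorem szego_mul_star (ha : 0 < a) (hb : 0 < b) (hγ : IsAlphaArc a b γ)
    (hL : ∀ i, IntervalIntegrable (logDensity a b L i) volume 0 1) {P : Surface a b}
    (hP : P ∉ surfaceCuts a b γ) : szego a b γ L P * szego a b γ L P.star = 1 := by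
  cases P with
  | pt p =>
    have hp : p.z ∉ cuts a b γ := fun h => hP ⟨p, rfl, h⟩
    rw [Surface.star, szego_pt ha hb hγ hL hp, szego_pt ha hb hγ hL (p := p.star) hp,
      ← Complex.exp_add, Complex.exp_eq_one_iff]
    refine ⟨0, ?_⟩
    rw [show p.star.z = p.z from rfl, show p.star.ω = -p.ω from rfl]
    push_cast
    ring
  | infty k =>
    rw [Surface.star, szego_infty ha hb hγ hL, szego_infty ha hb hγ hL, ← Complex.exp_add,
      ← add_mul, show (-(-1 : ℂ) ^ (k : ℕ) + -(-1 : ℂ) ^ ((1 - k : Fin 2) : ℕ)) = 0 by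
        fin_cases k <;> simp, zero_mul, Complex.exp_zero]

end Cross

/-! ### Regularity of the logarithmic densities -/

namespace Cross

/-- Take H to be the integral of f'/f from 0: then f e^(-H) has zero derivative, and H is Lipschitz
because f'/f is bounded. -/
theorem exists_lipschitz_log {f f' : ℝ → ℂ} (hf : ∀ t ∈ Icc (0 : ℝ) 1, HasDerivAt f (f' t) t)
    (hf' : ContinuousOn f' (Icc 0 1)) (h0 : ∀ t ∈ Icc (0 : ℝ) 1, f t ≠ 0) :
    ∃ (H : ℝ → ℂ) (K : ℝ), (∀ t ∈ Icc (0 : ℝ) 1, ∀ u ∈ Icc (0 : ℝ) 1, ‖H t - H u‖ ≤ K * |t - u|) ∧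
      ∀ t ∈ Icc (0 : ℝ) 1, f t = f 0 * Complex.exp (H t) := by
  have hfc : ContinuousOn f (Icc 0 1) := fun t ht => (hf t ht).continuousAt.continuousWithinAt
  have hkc : ContinuousOn (fun t => f' t / f t) (Icc 0 1) := hf'.div hfc h0
  set k := IccExtend zero_le_one ((Icc (0 : ℝ) 1).domRestrict fun t => f' t / f t) with hk
  have hkcont : Continuous k := (continuousOn_iff_continuous_domRestrict.1 hkc).Icc_extend'
  have hkeq : ∀ t ∈ Icc (0 : ℝ) 1, k t = f' t / f t := by
    intro t ht
    rw [hk, IccExtend_of_mem _ _ ht]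
    rfl
  obtain ⟨M, hM⟩ := isCompact_Icc.exists_bound_of_continuousOn (hkcont.continuousOn (s := Icc 0 1))
  have hH : ∀ t, HasDerivAt (fun t => ∫ u in (0 : ℝ)..t, k u) (k t) t := fun t =>
    intervalIntegral.integral_hasDerivAt_right (hkcont.intervalIntegrable _ _)
      (hkcont.stronglyMeasurableAtFilter _ _) hkcont.continuousAt
  refine ⟨fun t => ∫ u in (0 : ℝ)..t, k u, M, fun t ht u hu => ?_, fun t ht => ?_⟩
  · rw [intervalIntegral.integral_interval_sub_left (hkcont.intervalIntegrable _ _)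
      (hkcont.intervalIntegrable _ _)]
    refine intervalIntegral.norm_integral_le_of_norm_le_const fun x hx => hM x ?_
    have : uIcc u t ⊆ Icc 0 1 := uIcc_subset_Icc hu ht
    exact this (uIoc_subset_uIcc hx)
  · have h1 : ∀ x ∈ Icc (0 : ℝ) 1,
        HasDerivAt (fun t => f t * Complex.exp (-∫ u in (0 : ℝ)..t, k u)) 0 x := by
      intro x hx
      have h2 := (hf x hx).mul (hH x).neg.cexp
      refine HasDerivAt.congr_deriv h2 ?_
      rw [hkeq x hx]
      have := h0 x hx
      field_simp
      ring
    have h2 := constant_of_has_deriv_right_zero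
      (fun x hx => (h1 x hx).continuousAt.continuousWithinAt)
      (fun x hx => (h1 x (Ico_subset_Icc_self hx)).hasDerivWithinAt) t ht
    simp only [intervalIntegral.integral_same, neg_zero, Complex.exp_zero, mul_one] at h2
    rw [← h2, mul_assoc, ← Complex.exp_add, neg_add_cancel, Complex.exp_zero, mul_one]

/-- For 0 < u ≤ t ≤ 1 both t - u and |log t|(t - u) are at most (t - u)/t ≤ log t - log u. This
absorbs the Lipschitz terms and also the product of log t with an increment of g. -/
theorem exists_logLipschitz_mul (A : ℝ) {G g : ℝ → ℂ} {K k : ℝ}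
    (hG : ∀ t ∈ Ioc (0 : ℝ) 1, ∀ u ∈ Ioc (0 : ℝ) 1, ‖G t - G u‖ ≤ K * |t - u|)
    (hg : ∀ t ∈ Ioc (0 : ℝ) 1, ∀ u ∈ Ioc (0 : ℝ) 1, ‖g t - g u‖ ≤ k * |t - u|) :
    ∃ M, LogLipschitz M (fun t => ((A * Real.log t : ℝ) + G t) * g t) := by
  have h12 : |(1 : ℝ) / 2 - 1| = 1 / 2 := by norm_num [abs_of_neg]
  have hnn : ∀ {F : ℝ → ℂ} {K : ℝ}, (∀ t ∈ Ioc (0 : ℝ) 1, ∀ u ∈ Ioc (0 : ℝ) 1,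
      ‖F t - F u‖ ≤ K * |t - u|) → 0 ≤ K := by
    intro F K h
    have := (norm_nonneg _).trans (h (1 / 2) (by norm_num) 1 (by norm_num))
    rw [h12] at this
    linarith
  have hbd : ∀ {F : ℝ → ℂ} {K : ℝ}, (∀ t ∈ Ioc (0 : ℝ) 1, ∀ u ∈ Ioc (0 : ℝ) 1,
      ‖F t - F u‖ ≤ K * |t - u|) → ∀ t ∈ Ioc (0 : ℝ) 1, ‖F t‖ ≤ ‖F 1‖ + K := by
    intro F K h t ht
    have h1 := h t ht 1 (by norm_num)
    have h2 := hnn h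
    have h3 := norm_le_insert' (F t) (F 1)
    have h4 : |t - 1| ≤ 1 := by rw [abs_le]; constructor <;> linarith [ht.1, ht.2]
    nlinarith
  have hK := hnn hG
  have hk := hnn hg
  set M := (|A| + K) * (‖g 1‖ + k) + k * |A| + (‖G 1‖ + K) * k
  refine ⟨M, ?_⟩
  have key : ∀ u t : ℝ, u ∈ Ioc (0 : ℝ) 1 → t ∈ Ioc (0 : ℝ) 1 → u ≤ t →
      ‖((A * Real.log t : ℝ) + G t) * g t - ((A * Real.log u : ℝ) + G u) * g u‖ ≤
        M * (Real.log t - Real.log u) := by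
    intro u t hu ht hut
    set D := Real.log t - Real.log u with hD
    have hlog : (t - u) / t ≤ D := by
      have h1 := Real.one_sub_inv_le_log_of_pos (div_pos ht.1 hu.1)
      rw [Real.log_div ht.1.ne' hu.1.ne', inv_div] at h1
      have : (t - u) / t = 1 - u / t := by
        have := ht.1.ne'
        field_simp
      rw [this]; exact h1
    have htu : 0 ≤ t - u := sub_nonneg.2 hut
    have hle : t - u ≤ D := by
      refine le_trans ?_ hlog
      rw [le_div_iff₀ ht.1]
      nlinarith [ht.2]
    have hD0 : 0 ≤ D := htu.trans hle
    have hlt : |Real.log t| * (t - u) ≤ D := by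
      rw [abs_of_nonpos (Real.log_nonpos ht.1.le ht.2)]
      have h1 := Real.one_sub_inv_le_log_of_pos ht.1
      have h2 : -Real.log t ≤ t⁻¹ := by linarith
      calc _ ≤ t⁻¹ * (t - u) := by gcongr
        _ = (t - u) / t := by ring
        _ ≤ D := hlog
    have e : ((A * Real.log t : ℝ) + G t) * g t - ((A * Real.log u : ℝ) + G u) * g u =
        (((A * D : ℝ) : ℂ) + (G t - G u)) * g u + (((A * Real.log t : ℝ) : ℂ) + G t) * (g t - g u) := by
      rw [hD]; push_cast; ring
    rw [e]
    have b1 : ‖((A * D : ℝ) : ℂ) + (G t - G u)‖ ≤ (|A| + K) * D := by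
      refine (norm_add_le _ _).trans ?_
      rw [Complex.norm_real, Real.norm_eq_abs, abs_mul, abs_of_nonneg hD0]
      have := hG t ht u hu
      rw [abs_of_nonneg htu] at this
      nlinarith
    have b2 : ‖((A * Real.log t : ℝ) : ℂ) + G t‖ ≤ |A| * |Real.log t| + (‖G 1‖ + K) := by
      refine (norm_add_le _ _).trans ?_
      rw [Complex.norm_real, Real.norm_eq_abs, abs_mul]
      have := hbd hG t ht
      linarith
    have b3 : ‖g t - g u‖ ≤ k * (t - u) := by
      have := hg t ht u hu
      rwa [abs_of_nonneg htu] at this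
    have b4 := hbd hg u hu
    refine (norm_add_le _ _).trans ?_
    rw [norm_mul, norm_mul]
    have c1 : ‖((A * D : ℝ) : ℂ) + (G t - G u)‖ * ‖g u‖ ≤ (|A| + K) * D * (‖g 1‖ + k) :=
      mul_le_mul b1 b4 (norm_nonneg _) (by positivity)
    have c2 : ‖((A * Real.log t : ℝ) : ℂ) + G t‖ * ‖g t - g u‖ ≤
        (|A| * |Real.log t| + (‖G 1‖ + K)) * (k * (t - u)) :=
      mul_le_mul b2 b3 (norm_nonneg _) (by positivity)
    have c3 : (|A| * |Real.log t| + (‖G 1‖ + K)) * (k * (t - u)) ≤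
        (k * |A| + (‖G 1‖ + K) * k) * D := by
      have d1 : k * |A| * (|Real.log t| * (t - u)) ≤ k * |A| * D := by gcongr
      have d2 : (‖G 1‖ + K) * k * (t - u) ≤ (‖G 1‖ + K) * k * D := by gcongr
      nlinarith
    calc _ ≤ (|A| + K) * D * (‖g 1‖ + k) + (k * |A| + (‖G 1‖ + K) * k) * D :=
          add_le_add c1 (c2.trans c3)
      _ = M * D := by ring
  intro t ht u hu
  rcases le_total u t with h | h
  · rw [abs_of_nonneg (sub_nonneg.2 (Real.log_le_log hu.1 h))]
    exact key u t hu ht h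
  · rw [norm_sub_rev, abs_sub_comm, abs_of_nonneg (sub_nonneg.2 (Real.log_le_log ht.1 h))]
    exact key t u ht hu h

variable {a b : ℝ} {γ : ℝ → ℂ} {L : Fin 4 → ℂ → ℂ}

theorem contDiff_endPolyReal (i : Fin 4) : ContDiff ℝ 1 (endPolyReal a b i) := by
  unfold endPolyReal; split_ifs <;> fun_prop

/-- The reciprocal of the left trace of `w` on the `i`-th segment, without its singular factor. -/
noncomputable def invWReg (a b : ℝ) (i : Fin 4) (t : ℝ) : ℂ :=
  (-1) ^ (i : ℕ) * Complex.I / (Real.sqrt (endPolyReal a b i t) : ℂ)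

theorem exists_lipschitz_invWReg (ha : 0 < a) (hb : 0 < b) (i : Fin 4) : ∃ K : ℝ,
    ∀ t ∈ Icc (0 : ℝ) 1, ∀ u ∈ Icc (0 : ℝ) 1,
      ‖invWReg a b i t - invWReg a b i u‖ ≤ K * |t - u| := by
  have h1 : ContDiffOn ℝ 1 (fun t => (Real.sqrt (endPolyReal a b i t))⁻¹) (Icc 0 1) := by
    refine ContDiffOn.inv (ContDiffOn.sqrt (contDiff_endPolyReal i).contDiffOn fun t ht => ?_)
      fun t ht => ?_
    · exact (endPolyReal_pos ha hb i ht.2).ne'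
    · exact (Real.sqrt_pos.2 (endPolyReal_pos ha hb i ht.2)).ne'
  obtain ⟨K, hK⟩ := h1.exists_lipschitzOnWith (by norm_num) (convex_Icc 0 1) isCompact_Icc
  refine ⟨K, fun t ht u hu => ?_⟩
  have h2 := hK.dist_le_mul t ht u hu
  rw [Real.dist_eq, Real.dist_eq] at h2
  rw [show invWReg a b i t - invWReg a b i u = (-1) ^ (i : ℕ) * Complex.I *
    (((Real.sqrt (endPolyReal a b i t))⁻¹ - (Real.sqrt (endPolyReal a b i u))⁻¹ : ℝ) : ℂ) by
      simp only [invWReg]; push_cast; ring, norm_mul, norm_mul, norm_pow, norm_neg, norm_one,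
    one_pow, one_mul, Complex.norm_I, one_mul, Complex.norm_real, Real.norm_eq_abs]
  exact h2

theorem logWPlus_segPt (ha : 0 < a) (hb : 0 < b) (i : Fin 4) {t : ℝ} (ht : t ∈ Ioc (0 : ℝ) 1) :
    logWPlus a b i (segPt a b i t) = ((1 / 2 * Real.log t : ℝ) : ℂ) +
      ((1 / 2 * Real.log (endPolyReal a b i t) : ℝ) +
        (-1) ^ ((i : ℕ) + 1) * (Real.pi * Complex.I / 2)) := by
  have hp := endPolyReal_pos ha hb i ht.2
  have h : ‖-(t : ℂ) * (endPolyReal a b i t : ℂ)‖ = t * endPolyReal a b i t := by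
    rw [norm_mul, norm_neg, Complex.norm_real, Complex.norm_real, Real.norm_of_nonneg ht.1.le,
      Real.norm_of_nonneg hp.le]
  rw [logWPlus, mul_eq_endPoly ha hb i, coord_segPt ha hb, endPoly_ofReal, h,
    Real.log_sqrt (mul_nonneg ht.1.le hp.le), Real.log_mul ht.1.ne' hp.ne']
  push_cast; ring

theorem exists_lipschitz_logWPlus (ha : 0 < a) (hb : 0 < b) (i : Fin 4) : ∃ K : ℝ,
    ∀ t ∈ Ioc (0 : ℝ) 1, ∀ u ∈ Ioc (0 : ℝ) 1,
      |Real.log (endPolyReal a b i t) - Real.log (endPolyReal a b i u)| ≤ K * |t - u| := by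
  have h1 : ContDiffOn ℝ 1 (fun t => Real.log (endPolyReal a b i t)) (Icc 0 1) :=
    ContDiffOn.log (contDiff_endPolyReal i).contDiffOn fun t ht =>
      (endPolyReal_pos ha hb i ht.2).ne'
  obtain ⟨K, hK⟩ := h1.exists_lipschitzOnWith (by norm_num) (convex_Icc 0 1) isCompact_Icc
  refine ⟨K, fun t ht u hu => ?_⟩
  have h2 := hK.dist_le_mul t (Ioc_subset_Icc_self ht) u (Ioc_subset_Icc_self hu)
  rwa [Real.dist_eq, Real.dist_eq] at h2

theorem segPt_ne_self (ha : 0 < a) (hb : 0 < b) (i : Fin 4) {t : ℝ} (ht : t ∈ Ioc (0 : ℝ) 1) :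
    segPt a b i t ∈ seg a b i \ {endpt a b i} :=
  ⟨segPt_mem_seg i ⟨ht.1.le, ht.2⟩, segPt_ne_endpt ha hb i ht i⟩

/-- A continuous branch of log ρ_i can differ from α_i log t plus a Lipschitz logarithm of ρ_i^*
only by a constant, since (0, 1] is connected. -/
theorem exists_log_rho_eq (ha : 0 < a) (hb : 0 < b) {ℓ : ℕ∞} {ρ : ℂ → ℂ} {α : Fin 4 → ℝ}
    {h : Fin 4 → ℂ → ℂ} (hρ : IsWeight a b ℓ ρ α h) (hL : IsLogBranch a b α h L) (i : Fin 4) :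
    ∃ K : ℝ, ∀ t ∈ Ioc (0 : ℝ) 1, ∀ u ∈ Ioc (0 : ℝ) 1,
      ‖(L i (segPt a b i t) - (α i * Real.log t : ℝ)) -
        (L i (segPt a b i u) - (α i * Real.log u : ℝ))‖ ≤ K * |t - u| := by
  have hd : ∀ t ∈ Icc (0 : ℝ) 1, HasDerivAt (fun t => h i (segPt a b i t))
      (deriv (h i) (segPt a b i t) * -endpt a b i) t := by
    intro t ht
    have h1 := (hρ.analytic i _ (segPt_mem_seg i ht)).differentiableAt.hasDerivAt
    have h2 : HasDerivAt (segPt a b i) (-endpt a b i) t := by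
      rw [← deriv_segPt i t]
      refine DifferentiableAt.hasDerivAt ?_
      unfold segPt
      exact ((Complex.ofRealCLM.differentiableAt (x := t)).const_sub 1).mul_const _
    exact h1.comp t h2
  have hdc : ContinuousOn (fun t => deriv (h i) (segPt a b i t) * -endpt a b i) (Icc 0 1) := by
    refine ContinuousOn.mul (fun t ht => ?_) continuousOn_const
    exact ((hρ.analytic i _ (segPt_mem_seg i ht)).deriv.continuousAt.comp
      (continuous_segPt i).continuousAt).continuousWithinAt
  obtain ⟨H, K, hK, hH⟩ := exists_lipschitz_log hd hdc
    fun t ht => hρ.ne_zero i _ (segPt_mem_seg i ht)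
  refine ⟨K, ?_⟩
  have hcont : ContinuousOn (fun t => L i (segPt a b i t) - (α i * Real.log t : ℝ) - H t)
      (Ioc 0 1) := by
    refine ContinuousOn.sub (ContinuousOn.sub ?_ ?_) ?_
    · exact (hL.continuousOn i).comp (continuous_segPt i).continuousOn
        fun t ht => segPt_ne_self ha hb i ht
    · refine Complex.continuous_ofReal.comp_continuousOn (continuousOn_const.mul ?_)
      exact Real.continuousOn_log.mono fun t ht => ht.1.ne'
    · have : LipschitzOnWith (Real.toNNReal K) H (Ioc 0 1) :=
        LipschitzOnWith.of_dist_le_mul fun t ht u hu => by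
          rw [dist_eq_norm, Real.dist_eq]
          refine (hK t (Ioc_subset_Icc_self ht) u (Ioc_subset_Icc_self hu)).trans ?_
          gcongr
          exact Real.le_coe_toNNReal K
      exact this.continuousOn
  -- The factor t^α is cancelled by α log t and the variation of ρ_i^* by H, which leaves a
  -- constant.
  have hexp : ∀ t ∈ Ioc (0 : ℝ) 1,
      Complex.exp (L i (segPt a b i t) - (α i * Real.log t : ℝ) - H t) =
        h i (segPt a b i 0) * (-endpt a b i) ^ (α i : ℂ) := by
    intro t ht
    rw [Complex.exp_sub, Complex.exp_sub, hL.exp_eq i _ (segPt_ne_self ha hb i ht), rhoExt,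
      branchPow, show 1 - segPt a b i t / endpt a b i = t from coord_segPt ha hb i t,
      hH t (Ioc_subset_Icc_self ht),
      Complex.cpow_def_of_ne_zero (Complex.ofReal_ne_zero.2 ht.1.ne'), ← Complex.ofReal_log ht.1.le,
      show (Real.log t : ℂ) * (α i : ℂ) = ((α i * Real.log t : ℝ) : ℂ) by push_cast; ring]
    have h1 := Complex.exp_ne_zero (H t)
    have h2 := Complex.exp_ne_zero ((α i * Real.log t : ℝ) : ℂ)
    field_simp
  intro t ht u hu
  have he := eqOn_of_exp_eq_const isPreconnected_Ioc hcont hexp ht hu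
  rw [show (L i (segPt a b i t) - (α i * Real.log t : ℝ)) -
        (L i (segPt a b i u) - (α i * Real.log u : ℝ)) = H t - H u by
    linear_combination he]
  exact hK t (Ioc_subset_Icc_self ht) u (Ioc_subset_Icc_self hu)

/-- The structure of the logarithms on a segment: logarithmic at the endpoint, otherwise
Lipschitz. -/
theorem exists_logRhoW_eq (ha : 0 < a) (hb : 0 < b) {ℓ : ℕ∞} {ρ : ℂ → ℂ} {α : Fin 4 → ℝ}
    {h : Fin 4 → ℂ → ℂ} (hρ : IsWeight a b ℓ ρ α h) (hL : IsLogBranch a b α h L) (i : Fin 4)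
    (c : ℂ) : ∃ (G : ℝ → ℂ) (K : ℝ),
      (∀ t ∈ Ioc (0 : ℝ) 1, ∀ u ∈ Ioc (0 : ℝ) 1, ‖G t - G u‖ ≤ K * |t - u|) ∧
      ∀ t ∈ Ioc (0 : ℝ) 1, logRhoW a b L i (segPt a b i t) + c =
        (((α i + 1 / 2) * Real.log t : ℝ) : ℂ) + G t := by
  obtain ⟨K₁, h1⟩ := exists_log_rho_eq ha hb hρ hL i
  obtain ⟨K₂, h2⟩ := exists_lipschitz_logWPlus ha hb i
  refine ⟨fun t => (L i (segPt a b i t) - (α i * Real.log t : ℝ)) +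
    (((1 / 2 * Real.log (endPolyReal a b i t) : ℝ) +
        (-1) ^ ((i : ℕ) + 1) * (Real.pi * Complex.I / 2)) + c), K₁ + 1 / 2 * K₂,
    fun t ht u hu => ?_, fun t ht => ?_⟩
  · have e : ∀ x y : ℂ, x + (((1 / 2 * Real.log (endPolyReal a b i t) : ℝ) +
        (-1) ^ ((i : ℕ) + 1) * (Real.pi * Complex.I / 2)) + c) -
        (y + (((1 / 2 * Real.log (endPolyReal a b i u) : ℝ) +
        (-1) ^ ((i : ℕ) + 1) * (Real.pi * Complex.I / 2)) + c)) = (x - y) +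
        ((1 / 2 * (Real.log (endPolyReal a b i t) - Real.log (endPolyReal a b i u)) : ℝ) : ℂ) := by
      intro x y; push_cast; ring
    beta_reduce
    rw [e]
    refine (norm_add_le _ _).trans ?_
    rw [Complex.norm_real, Real.norm_eq_abs, abs_mul, abs_of_pos (by norm_num : (0 : ℝ) < 1 / 2)]
    have := h1 t ht u hu
    have := h2 t ht u hu
    linarith
  · rw [logRhoW, logWPlus_segPt ha hb i ht]
    push_cast; ring

/-- The additive constant c makes room for the term 2πi c_ρ ε of the full density. -/
theorem exists_logDensity_eq (ha : 0 < a) (hb : 0 < b) {ℓ : ℕ∞} {ρ : ℂ → ℂ} {α : Fin 4 → ℝ}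
    {h : Fin 4 → ℂ → ℂ} (hρ : IsWeight a b ℓ ρ α h) (hL : IsLogBranch a b α h L) (i : Fin 4)
    (c : ℂ) : ∃ (G : ℝ → ℂ) (K M : ℝ),
      (∀ t ∈ Ioc (0 : ℝ) 1, ∀ u ∈ Ioc (0 : ℝ) 1, ‖G t - G u‖ ≤ K * |t - u|) ∧
      LogLipschitz M (fun t => ((((α i + 1 / 2) * Real.log t : ℝ) : ℂ) + G t) * invWReg a b i t) ∧
      ∀ t ∈ Ioc (0 : ℝ) 1, (logRhoW a b L i (segPt a b i t) + c) * invW a b i t =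
        ((((α i + 1 / 2) * Real.log t : ℝ) : ℂ) + G t) * invWReg a b i t / (Real.sqrt t : ℂ) := by
  obtain ⟨G, K, hG, hGe⟩ := exists_logRhoW_eq ha hb hρ hL i c
  obtain ⟨k, hk⟩ := exists_lipschitz_invWReg ha hb i
  obtain ⟨M, hM⟩ := exists_logLipschitz_mul (α i + 1 / 2) hG
    fun t ht u hu => hk t (Ioc_subset_Icc_self ht) u (Ioc_subset_Icc_self hu)
  refine ⟨G, K, M, hG, hM, fun t ht => ?_⟩
  rw [hGe t ht, invW_eq ha hb i (Ioc_subset_Icc_self ht), invWReg]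
  ring

theorem intervalIntegrable_logDensity (ha : 0 < a) (hb : 0 < b) {ℓ : ℕ∞} {ρ : ℂ → ℂ}
    {α : Fin 4 → ℝ} {h : Fin 4 → ℂ → ℂ} (hρ : IsWeight a b ℓ ρ α h) (hL : IsLogBranch a b α h L)
    (i : Fin 4) : IntervalIntegrable (logDensity a b L i) volume 0 1 := by
  obtain ⟨G, K, M, hG, hM, he⟩ := exists_logDensity_eq ha hb hρ hL i 0
  refine hM.intervalIntegrable.congr fun t ht => ?_
  rw [uIoc_of_le zero_le_one] at ht
  rw [← he t ht, add_zero, logDensity]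

theorem density_eq (i : Fin 4) (t : ℝ) : density a b γ L i t =
    (logRhoW a b L i (segPt a b i t) + 2 * Real.pi * Complex.I * cRho a b γ L * alphaSide i) *
      invW a b i t := by
  rw [density, logDensity]; ring

theorem exists_density_eq (ha : 0 < a) (hb : 0 < b) {ℓ : ℕ∞} {ρ : ℂ → ℂ} {α : Fin 4 → ℝ}
    {h : Fin 4 → ℂ → ℂ} (hρ : IsWeight a b ℓ ρ α h) (hL : IsLogBranch a b α h L) (γ : ℝ → ℂ)
    (i : Fin 4) : ∃ (G : ℝ → ℂ) (K M : ℝ),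
      (∀ t ∈ Ioc (0 : ℝ) 1, ∀ u ∈ Ioc (0 : ℝ) 1, ‖G t - G u‖ ≤ K * |t - u|) ∧
      LogLipschitz M (fun t => ((((α i + 1 / 2) * Real.log t : ℝ) : ℂ) + G t) * invWReg a b i t) ∧
      ∀ t ∈ Ioc (0 : ℝ) 1, density a b γ L i t =
        ((((α i + 1 / 2) * Real.log t : ℝ) : ℂ) + G t) * invWReg a b i t / (Real.sqrt t : ℂ) := by
  obtain ⟨G, K, M, hG, hM, he⟩ := exists_logDensity_eq ha hb hρ hL i
    (2 * Real.pi * Complex.I * cRho a b γ L * alphaSide i)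
  exact ⟨G, K, M, hG, hM, fun t ht => by rw [density_eq, he t ht]⟩

theorem cauchy_congr {φ ψ : ℝ → ℂ} (h : ∀ t ∈ Ioc (0 : ℝ) 1, φ t = ψ t) : cauchy φ = cauchy ψ := by
  ext ζ
  refine intervalIntegral.integral_congr_ae (ae_of_all _ fun t ht => ?_)
  rw [uIoc_of_le zero_le_one] at ht
  rw [h t ht]

end Cross

/-! ### Asymptotics at the endpoints and at the origin -/

namespace Cross

open Asymptotics

variable {a b : ℝ} {γ : ℝ → ℂ} {L : Fin 4 → ℂ → ℂ}

/-- Two positive functions are comparable when the difference of their logarithms is bounded; the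
summand 1 in the exponent makes the constant exceed 1. -/
theorem comparable_of_isBigO {l : Filter ℂ} {f g x y : ℂ → ℝ}
    (hf : ∀ᶠ z in l, f z = Real.exp (x z)) (hg : ∀ᶠ z in l, g z = Real.exp (y z))
    (h : (fun z => x z - y z) =O[l] (fun _ => (1 : ℝ))) : Comparable l f g := by
  obtain ⟨C, hC⟩ := h.bound
  refine ⟨Real.exp (|C| + 1), by rw [Real.one_lt_exp_iff]; positivity, ?_⟩
  filter_upwards [hf, hg, hC] with z h1 h2 h3
  rw [norm_one, mul_one, Real.norm_eq_abs] at h3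
  have h4 := abs_le.1 (h3.trans (le_abs_self C))
  rw [h1, h2, ← Real.exp_neg, ← Real.exp_add, ← Real.exp_add, Real.exp_le_exp, Real.exp_le_exp]
  constructor <;> linarith

theorem lift_z (k : Fin 2) (z : ℂ) : (lift a b k z).z = z := rfl

theorem lift_ω (k : Fin 2) (z : ℂ) : (lift a b k z).ω = (-1) ^ (k : ℕ) * w a b z := rfl

theorem norm_szego_lift (ha : 0 < a) (hb : 0 < b) (hγ : IsAlphaArc a b γ)
    (hL : ∀ i, IntervalIntegrable (logDensity a b L i) volume 0 1) {z : ℂ}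
    (hz : z ∉ cuts a b γ) : ‖szego a b γ L (.pt (lift a b 0 z))‖ =
      Real.exp (-(w a b z * szegoCauchy a b γ L z) +
        2 * Real.pi * Complex.I * cRho a b γ L * innerIndicator a b γ z).re := by
  have hw := w_ne_zero (ne_endpt_of_notMem (a := a) (b := b) (z := z) fun h => hz (Or.inl h))
  rw [szego_pt ha hb hγ hL (p := lift a b 0 z) hz, Complex.norm_exp, lift_z, lift_ω]
  simp only [Fin.val_zero, pow_zero, one_mul, div_self hw, neg_mul]

theorem isBigO_re {l : Filter ℂ} {f : ℂ → ℂ} (h : f =O[l] (fun _ => (1 : ℝ))) :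
    (fun z => (f z).re) =O[l] (fun _ => (1 : ℝ)) :=
  (IsBigO.of_norm_le fun z => Complex.abs_re_le_norm (f z)).trans h.norm_left

theorem isBigO_innerIndicator (l : Filter ℂ) (c : ℂ) :
    (fun z => c * innerIndicator a b γ z) =O[l] (fun _ => (1 : ℝ)) := by
  refine IsBigO.of_bound ‖c‖ (Eventually.of_forall fun z => ?_)
  rw [norm_mul, norm_one, mul_one]
  rcases innerIndicator_mem (a := a) (b := b) (γ := γ) z with h | h <;> simp [h]

theorem coord_endpt (ha : 0 < a) (hb : 0 < b) (i : Fin 4) : coord a b i (endpt a b i) = 0 := by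
  rw [coord, div_self (endpt_ne_zero ha hb i), sub_self]

theorem tendsto_coord_endpt (ha : 0 < a) (hb : 0 < b) (i : Fin 4) :
    Tendsto (coord a b i) (𝓝 (endpt a b i)) (𝓝 0) := by
  rw [← coord_endpt ha hb i]
  exact (continuous_coord i).tendsto _

theorem norm_sub_endpt (ha : 0 < a) (hb : 0 < b) (i : Fin 4) (z : ℂ) :
    ‖z - endpt a b i‖ = ‖endpt a b i‖ * ‖coord a b i z‖ := by
  rw [← norm_mul, coord, mul_sub, mul_one, mul_div_cancel₀ _ (endpt_ne_zero ha hb i), norm_sub_rev]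

theorem abs_mul_log_le {r : ℝ} (h0 : 0 < r) (h1 : r ≤ 1) : r * |Real.log r| ≤ 1 := by
  have := Real.one_sub_inv_le_log_of_pos h0
  rw [abs_of_nonpos (Real.log_nonpos h0.le h1)]
  calc r * -Real.log r ≤ r * r⁻¹ := by gcongr; linarith
    _ = 1 := mul_inv_cancel₀ h0.ne'

/-- The factor √(-ζ) of w cancels the singularity of the Cauchy integral. The remaining coefficient
is i up to O(ζ), and this error times log|ζ| stays bounded. -/
theorem isBigO_w_mul_cauchy_self (ha : 0 < a) (hb : 0 < b) {ℓ : ℕ∞} {ρ : ℂ → ℂ} {α : Fin 4 → ℝ}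
    {h : Fin 4 → ℂ → ℂ} (hρ : IsWeight a b ℓ ρ α h) (hL : IsLogBranch a b α h L) (γ : ℝ → ℂ)
    (i : Fin 4) :
    (fun z => w a b z * cauchy (density a b γ L i) (coord a b i z) -
      Real.pi * Complex.I * (((α i + 1 / 2) * Real.log ‖coord a b i z‖ : ℝ) : ℂ))
      =O[𝓝[(cross a b)ᶜ] (endpt a b i)] (fun _ => (1 : ℝ)) := by
  obtain ⟨G, K, M, hG, hM, he⟩ := exists_density_eq ha hb hρ hL γ i
  obtain ⟨k, hk⟩ := exists_lipschitz_invWReg ha hb i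
  obtain ⟨C₀, hC₀⟩ := exists_norm_cauchy_zero_le hM
  obtain ⟨C₁, hC₁0, hC₁⟩ := exists_w_eq_mul ha hb i
  set A := α i + 1 / 2
  set F : ℝ → ℂ := fun t => (((A * Real.log t : ℝ) : ℂ) + G t) * invWReg a b i t with hF
  set g₀ : ℂ := (-1) ^ (i : ℕ) * (Real.sqrt (endPolyReal a b i 0) : ℂ) with hg₀
  have hP0 := Real.sqrt_pos.2 (endPolyReal_pos ha hb i zero_le_one)
  -- The leading coefficients of w and 1/w₊ at a_i carry the same sign and reciprocal moduli, so
  -- only the factor i is left.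
  have hg0I : g₀ * invWReg a b i 0 = Complex.I := by
    have hs : ((-1 : ℂ) ^ (i : ℕ)) ^ 2 = 1 := by rw [← pow_mul, mul_comm, pow_mul]; simp
    have := Complex.ofReal_ne_zero.2 hP0.ne'
    rw [hg₀, invWReg]
    field_simp
    exact hs
  have hK0 : 0 ≤ K := by
    have := (norm_nonneg _).trans (hG (1 / 2) (by norm_num) 1 (by norm_num))
    rw [show |(1 : ℝ) / 2 - 1| = 1 / 2 by norm_num [abs_of_neg]] at this
    linarith
  have hk0 : 0 ≤ k := by
    have := (norm_nonneg _).trans (hk 0 (by norm_num) 1 (by norm_num))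
    simpa using this
  have hsmall : ∀ᶠ z in 𝓝 (endpt a b i), ‖coord a b i z‖ < 1 / 4 := by
    have := (tendsto_coord_endpt ha hb i).norm
    rw [norm_zero] at this
    exact this.eventually_lt_const (by norm_num)
  set B := ‖invWReg a b i 0‖ + k
  set D := C₁ * B + ‖g₀‖ * k
  have hD : 0 ≤ D := by positivity
  refine IsBigO.of_bound ((‖g₀‖ + C₁) * C₀ + Real.pi * (D * (|A| + (‖G 1‖ + K)) + (‖G 1‖ + K))) ?_
  filter_upwards [self_mem_nhdsWithin, mem_nhdsWithin_of_mem_nhds hC₁,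
    mem_nhdsWithin_of_mem_nhds hsmall] with z hz hz1 hz2
  have hzs : coord a b i z ∉ unitSeg := coord_notMem ha hb fun h => hz (mem_iUnion.2 ⟨i, h⟩)
  obtain ⟨g, hwg, hg⟩ := hz1 hzs
  rw [norm_one, mul_one]
  set r := ‖coord a b i z‖ with hr
  have hr0 : 0 < r := by
    rw [hr, norm_pos_iff]
    intro h0
    exact hzs (h0 ▸ ⟨0, by simp, by simp⟩)
  have hr1 : r ≤ 1 := by linarith
  have hrI : r ∈ Ioc (0 : ℝ) 1 := ⟨hr0, hr1⟩
  have h1 := hC₀ _ hz2.le hzs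
  rw [← hr] at h1
  rw [cauchy_congr he, hwg]
  set T := cauchy (fun t => (((A * Real.log t : ℝ) : ℂ) + G t) * invWReg a b i t /
    (Real.sqrt t : ℂ)) (coord a b i z)
  set η := (-coord a b i z) ^ (1 / 2 : ℂ)
  have hgn : ‖g‖ ≤ ‖g₀‖ + C₁ := by
    have h2 := norm_le_insert' g g₀
    have h3 : C₁ * r ≤ C₁ * 1 := by gcongr
    linarith
  have hGr : ‖G r‖ ≤ ‖G 1‖ + K := by
    have h2 := hG r hrI 1 (by norm_num)
    have h3 := norm_le_insert' (G r) (G 1)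
    have h4 : |r - 1| ≤ 1 := by rw [abs_le]; constructor <;> linarith
    nlinarith
  have hir := hk r ⟨hr0.le, hr1⟩ 0 (by norm_num)
  rw [sub_zero, abs_of_pos hr0] at hir
  have hirB : ‖invWReg a b i r‖ ≤ B := by
    have h3 := norm_le_insert' (invWReg a b i r) (invWReg a b i 0)
    have h4 : k * r ≤ k * 1 := by gcongr
    have : B = ‖invWReg a b i 0‖ + k := rfl
    linarith
  have hgI : ‖g * invWReg a b i r - Complex.I‖ ≤ D * r := by
    rw [← hg0I, show g * invWReg a b i r - g₀ * invWReg a b i 0 =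
      (g - g₀) * invWReg a b i r + g₀ * (invWReg a b i r - invWReg a b i 0) by ring]
    refine (norm_add_le _ _).trans ?_
    rw [norm_mul, norm_mul]
    have c1 : ‖g - g₀‖ * ‖invWReg a b i r‖ ≤ C₁ * r * B :=
      mul_le_mul hg hirB (norm_nonneg _) (by positivity)
    have c2 : ‖g₀‖ * ‖invWReg a b i r - invWReg a b i 0‖ ≤ ‖g₀‖ * (k * r) := by gcongr
    calc _ ≤ C₁ * r * B + ‖g₀‖ * (k * r) := add_le_add c1 c2
      _ = D * r := by ring
  have e : η * g * T - Real.pi * Complex.I * ((A * Real.log r : ℝ) : ℂ) =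
      g * (η * T - Real.pi * F r) + Real.pi * ((g * invWReg a b i r - Complex.I) *
        (((A * Real.log r : ℝ) : ℂ) + G r) + Complex.I * G r) := by
    rw [hF]; ring
  rw [e]
  refine (norm_add_le _ _).trans (add_le_add ?_ ?_)
  · rw [norm_mul]
    exact mul_le_mul hgn h1 (norm_nonneg _) (by positivity)
  · rw [norm_mul, Complex.norm_real, Real.norm_of_nonneg Real.pi_pos.le]
    refine mul_le_mul_of_nonneg_left ?_ Real.pi_pos.le
    refine (norm_add_le _ _).trans (add_le_add ?_ ?_)
    · rw [norm_mul]
      have h5 : ‖((A * Real.log r : ℝ) : ℂ) + G r‖ ≤ |A| * |Real.log r| + (‖G 1‖ + K) := by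
        refine (norm_add_le _ _).trans ?_
        rw [Complex.norm_real, Real.norm_eq_abs, abs_mul]
        linarith
      have h6 := abs_mul_log_le hr0 hr1
      calc _ ≤ D * r * (|A| * |Real.log r| + (‖G 1‖ + K)) :=
            mul_le_mul hgI h5 (norm_nonneg _) (by positivity)
        _ = D * (|A| * (r * |Real.log r|) + (‖G 1‖ + K) * r) := by ring
        _ ≤ D * (|A| * 1 + (‖G 1‖ + K) * 1) := by gcongr
        _ = _ := by ring
    · rw [norm_mul, Complex.norm_I, one_mul]
      exact hGr

theorem isBigO_w_endpt (i : Fin 4) :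
    w a b =O[𝓝[(cross a b)ᶜ] (endpt a b i)] (fun _ => (1 : ℝ)) := by
  have hc : Continuous fun z : ℂ => (z ^ 2 - (a : ℂ) ^ 2) * (z ^ 2 + (b : ℂ) ^ 2) := by fun_prop
  have h2 : (fun z => (w a b z) ^ 2) =O[𝓝 (endpt a b i)] (fun _ => (1 : ℝ) ^ 2) := by
    simp_rw [w_sq, one_pow]
    exact hc.continuousAt.isBigO_one ℝ
  exact (h2.of_pow two_ne_zero).mono nhdsWithin_le_nhds

theorem endpt_injective (ha : 0 < a) (hb : 0 < b) : Function.Injective (endpt a b) := by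
  intro i j h
  have h1 := congrArg Complex.re h
  have h2 := congrArg Complex.im h
  clear h
  fin_cases i <;> fin_cases j <;> first | rfl | (exfalso; simp [endpt] at h1 h2; linarith)

theorem endpt_notMem_seg (ha : 0 < a) (hb : 0 < b) {i j : Fin 4} (hij : j ≠ i) :
    endpt a b i ∉ seg a b j := by
  intro h
  obtain ⟨t, ht, h⟩ := mem_seg_iff.1 h
  rcases eq_or_lt_of_le ht.1 with h0 | h0
  · rw [← h0] at h
    simp only [Complex.ofReal_zero, sub_zero, one_mul] at h
    exact hij (endpt_injective ha hb h).symm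
  · exact segPt_ne_endpt ha hb j ⟨h0, ht.2⟩ i h.symm

theorem isBigO_cauchy_endpt (ha : 0 < a) (hb : 0 < b) {φ : ℝ → ℂ}
    (hφ : IntervalIntegrable φ volume 0 1) {i j : Fin 4} (hij : j ≠ i) :
    (fun z => cauchy φ (coord a b j z)) =O[𝓝[(cross a b)ᶜ] (endpt a b i)] (fun _ => (1 : ℝ)) := by
  have h1 := hasDerivAt_cauchy hφ (coord_notMem ha hb (endpt_notMem_seg ha hb hij))
  have h2 : ContinuousAt (fun z => cauchy φ (coord a b j z)) (endpt a b i) :=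
    ContinuousAt.comp (f := coord a b j) h1.continuousAt (continuous_coord j).continuousAt
  exact (h2.isBigO_one ℝ).mono nhdsWithin_le_nhds

/-- Only the Cauchy integral over the i-th segment is singular at a_i; the others are continuous
there and w and χ are bounded. Division of πi(α_i + 1/2) log|ζ| by 2πi gives the exponent -(2α_i +
1)/4. -/
theorem comparable_szego_endpt (ha : 0 < a) (hb : 0 < b) (hγ : IsAlphaArc a b γ) {ℓ : ℕ∞}
    {ρ : ℂ → ℂ} {α : Fin 4 → ℝ} {h : Fin 4 → ℂ → ℂ} (hρ : IsWeight a b ℓ ρ α h)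
    (hL : IsLogBranch a b α h L) (i : Fin 4) :
    Comparable (𝓝[(cuts a b γ)ᶜ] (endpt a b i))
      (fun z => ‖szego a b γ L (.pt (lift a b 0 z))‖)
      (fun z => ‖z - endpt a b i‖ ^ (-(2 * α i + 1) / 4)) := by
  have hint := intervalIntegrable_logDensity ha hb hρ hL
  have hden := intervalIntegrable_density (γ := γ) ha hb hint
  have hpi : (Real.pi : ℂ) ≠ 0 := Complex.ofReal_ne_zero.2 Real.pi_ne_zero
  have hsub : 𝓝[(cuts a b γ)ᶜ] (endpt a b i) ≤ 𝓝[(cross a b)ᶜ] (endpt a b i) :=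
    nhdsWithin_mono _ (compl_subset_compl.2 subset_union_left)
  refine comparable_of_isBigO (x := fun z => (-(w a b z * szegoCauchy a b γ L z) +
      2 * Real.pi * Complex.I * cRho a b γ L * innerIndicator a b γ z).re)
    (y := fun z => Real.log ‖z - endpt a b i‖ * (-(2 * α i + 1) / 4)) ?_ ?_ ?_
  · filter_upwards [self_mem_nhdsWithin] with z hz
    exact norm_szego_lift ha hb hγ hint hz
  · filter_upwards [self_mem_nhdsWithin] with z hz
    refine Real.rpow_def_of_pos (norm_pos_iff.2 (sub_ne_zero.2 ?_)) _
    exact ne_endpt_of_notMem (fun h => hz (Or.inl h)) i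
  · have h1 := isBigO_w_mul_cauchy_self ha hb hρ hL γ i
    have h2 : (fun z => w a b z * ∑ j ∈ Finset.univ.erase i, cauchy (density a b γ L j)
        (coord a b j z)) =O[𝓝[(cross a b)ᶜ] (endpt a b i)] (fun _ => (1 : ℝ)) := by
      have := (isBigO_w_endpt i).mul (IsBigO.sum (s := Finset.univ.erase i) fun j hj =>
        isBigO_cauchy_endpt ha hb (hden j) (Finset.ne_of_mem_erase hj))
      simpa using this
    have h3 := (((h1.add h2).const_mul_left (-(1 / (2 * Real.pi * Complex.I)))).mono hsub).add
      ((isBigO_innerIndicator (a := a) (b := b) (γ := γ) _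
        (2 * Real.pi * Complex.I * cRho a b γ L)).add
      ((isBigO_const_const ((((2 * α i + 1) / 4 * Real.log ‖endpt a b i‖ : ℝ)) : ℂ)
        (one_ne_zero (α := ℝ)) (𝓝[(cuts a b γ)ᶜ] (endpt a b i)))))
    refine (isBigO_re h3).congr' ?_ EventuallyEq.rfl
    filter_upwards [self_mem_nhdsWithin] with z hz
    have hzs : coord a b i z ∉ unitSeg :=
      coord_notMem ha hb fun h => hz (Or.inl (mem_iUnion.2 ⟨i, h⟩))
    have hr0 : ‖coord a b i z‖ ≠ 0 := by
      intro h0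
      exact hzs ((norm_eq_zero.1 h0) ▸ ⟨0, by simp, by simp⟩)
    have e : (-(1 / (2 * Real.pi * Complex.I)) * (w a b z * cauchy (density a b γ L i) (coord a b i z) -
        Real.pi * Complex.I * (((α i + 1 / 2) * Real.log ‖coord a b i z‖ : ℝ) : ℂ) +
        w a b z * ∑ j ∈ Finset.univ.erase i, cauchy (density a b γ L j) (coord a b j z)) +
        (2 * Real.pi * Complex.I * cRho a b γ L * innerIndicator a b γ z +
          (((2 * α i + 1) / 4 * Real.log ‖endpt a b i‖ : ℝ) : ℂ))) =
        (-(w a b z * szegoCauchy a b γ L z) +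
          2 * Real.pi * Complex.I * cRho a b γ L * innerIndicator a b γ z) -
        ((Real.log ‖z - endpt a b i‖ * (-(2 * α i + 1) / 4) : ℝ) : ℂ) := by
      rw [szegoCauchy, ← Finset.add_sum_erase _ _ (Finset.mem_univ i), norm_sub_endpt ha hb,
        Real.log_mul (norm_ne_zero_iff.2 (endpt_ne_zero ha hb i)) hr0]
      push_cast
      field_simp
      ring
    rw [e, Complex.sub_re, Complex.ofReal_re]

theorem coord_im_ne_zero_of_mem_quadrant (ha : 0 < a) (hb : 0 < b) {j : Fin 4} {z : ℂ}
    (hz : z ∈ quadrant j) (i : Fin 4) : (coord a b i z).im ≠ 0 := by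
  have h : z.re ≠ 0 ∧ z.im ≠ 0 := by
    fin_cases j
    · exact ⟨hz.1.ne', hz.2.ne'⟩
    · exact ⟨hz.1.ne, hz.2.ne'⟩
    · exact ⟨hz.1.ne, hz.2.ne⟩
    · exact ⟨hz.1.ne', hz.2.ne⟩
  fin_cases i <;>
    simp [coord, endpt, Complex.div_im, ha.ne', hb.ne', h.1, h.2]

theorem notMem_cross_of_mem_quadrant (ha : 0 < a) (hb : 0 < b) {j : Fin 4} {z : ℂ}
    (hz : z ∈ quadrant j) : z ∉ cross a b := by
  intro h
  obtain ⟨i, hi⟩ := mem_iUnion.1 h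
  obtain ⟨t, ht, rfl⟩ := mem_seg_iff.1 hi
  refine coord_im_ne_zero_of_mem_quadrant ha hb hz i ?_
  rw [coord_segment ha hb, Complex.ofReal_im]

theorem zero_notMem_arc (ha : 0 < a) (hb : 0 < b) (hγ : IsAlphaArc a b γ) : (0 : ℂ) ∉ γ '' Icc 0 1 := by
  rintro ⟨t, ht, h⟩
  rcases eq_or_lt_of_le ht.1 with h0 | h0
  · rw [← h0, hγ.source] at h
    exact endpt_ne_zero ha hb 3 h
  rcases eq_or_lt_of_le ht.2 with h1 | h1
  · rw [h1, hγ.target] at h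
    exact endpt_ne_zero ha hb 0 h
  · exact hγ.avoids t ⟨h0, h1⟩ (h ▸ zero_mem_cross)

theorem invW_one (ha : 0 < a) (hb : 0 < b) (i : Fin 4) :
    invW a b i 1 = (-1) ^ (i : ℕ) * Complex.I / (a * b) := by
  have h : ((-1 : ℂ) ^ ((i : ℕ) + 1) * Complex.I)⁻¹ = (-1) ^ (i : ℕ) * Complex.I := by
    rcases neg_one_pow_eq_or ℂ (i : ℕ) with h | h <;> rw [pow_succ, h] <;> simp
  rw [invW, segPt_one, wPlus_eq ha hb (left_mem_segment ℝ _ _), wCut_zero ha hb, mul_inv, h,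
    div_eq_mul_inv]

/-- At the origin 1/w₊ equals ±i/(ab) with alternating signs, which reproduces the alternating sum
in ν. The contributions of c_ρ from Δ₁ and Δ₄ have opposite signs and cancel. -/
theorem sum_density_one (ha : 0 < a) (hb : 0 < b) :
    ∑ i, density a b γ L i 1 = 2 * Real.pi * nu a b L / (a * b) := by
  have hpi : (Real.pi : ℂ) ≠ 0 := Complex.ofReal_ne_zero.2 Real.pi_ne_zero
  have ha' : (a : ℂ) ≠ 0 := Complex.ofReal_ne_zero.2 ha.ne'
  have hb' : (b : ℂ) ≠ 0 := Complex.ofReal_ne_zero.2 hb.ne'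
  simp only [density_eq, invW_one ha hb, segPt_one, nu, Fin.sum_univ_four]
  simp [alphaSide]
  field_simp
  ring_nf

theorem norm_one_sub_coord (i : Fin 4) (z : ℂ) :
    ‖1 - coord a b i z‖ = ‖z‖ / ‖endpt a b i‖ := by
  rw [coord, sub_sub_cancel, norm_div]

/-- In a quadrant no coordinate of z is real, so the estimate at t = 1 applies to all four segments.
Each log|1 - ζ_i| differs from log|z| by the constant log|a_i|. -/
theorem isBigO_szegoCauchy_zero (ha : 0 < a) (hb : 0 < b) {ℓ : ℕ∞} {ρ : ℂ → ℂ} {α : Fin 4 → ℝ}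
    {h : Fin 4 → ℂ → ℂ} (hρ : IsWeight a b ℓ ρ α h) (hL : IsLogBranch a b α h L) (γ : ℝ → ℂ)
    (j : Fin 4) :
    (fun z => szegoCauchy a b γ L z + Complex.I * nu a b L / (a * b) * (Real.log ‖z‖ : ℂ))
      =O[𝓝[quadrant j] 0] (fun _ => (1 : ℝ)) := by
  have hpi : (Real.pi : ℂ) ≠ 0 := Complex.ofReal_ne_zero.2 Real.pi_ne_zero
  have hden := intervalIntegrable_density (γ := γ) ha hb (intervalIntegrable_logDensity ha hb hρ hL)
  have h1 : ∀ i, (fun z => cauchy (density a b γ L i) (coord a b i z) -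
      density a b γ L i 1 * (Real.log ‖z‖ : ℂ)) =O[𝓝[quadrant j] 0] (fun _ => (1 : ℝ)) := by
    intro i
    obtain ⟨G, K, M, hG, hM, he⟩ := exists_density_eq ha hb hρ hL γ i
    obtain ⟨k, _, hk⟩ := hM.exists_lipschitz (δ := 1 / 2) (by norm_num)
    have hk' : ∀ t ∈ Icc (1 / 2 : ℝ) 1, ∀ u ∈ Icc (1 / 2 : ℝ) 1,
        ‖density a b γ L i t - density a b γ L i u‖ ≤ k * |t - u| := by
      intro t ht u hu
      rw [he t ⟨by linarith [ht.1], ht.2⟩, he u ⟨by linarith [hu.1], hu.2⟩]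
      exact hk t ht u hu
    obtain ⟨C, hC⟩ := exists_norm_cauchy_one_le (hden i) hk'
    have hsmall : ∀ᶠ z : ℂ in 𝓝 0, ‖1 - coord a b i z‖ < 1 / 4 := by
      have hc : Continuous fun z => ‖1 - coord a b i z‖ :=
        (continuous_const.sub (continuous_coord i)).norm
      have := hc.tendsto 0
      rw [norm_one_sub_coord, norm_zero, zero_div] at this
      exact this.eventually_lt_const (by norm_num)
    have h2 : (fun z => cauchy (density a b γ L i) (coord a b i z) -
      density a b γ L i 1 * (Real.log ‖1 - coord a b i z‖ : ℂ)) =O[𝓝[quadrant j] 0]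
        (fun _ => (1 : ℝ)) := by
      refine IsBigO.of_bound C ?_
      filter_upwards [self_mem_nhdsWithin, mem_nhdsWithin_of_mem_nhds hsmall] with z hz hz1
      rw [norm_one, mul_one]
      exact hC _ hz1.le (coord_im_ne_zero_of_mem_quadrant ha hb hz i)
    refine (h2.sub (isBigO_const_const (density a b γ L i 1 * (Real.log ‖endpt a b i‖ : ℂ))
        (one_ne_zero (α := ℝ)) (𝓝[quadrant j] 0))).congr' ?_ EventuallyEq.rfl
    filter_upwards [self_mem_nhdsWithin] with z hz
    have hz0 : z ≠ 0 := fun h => notMem_cross_of_mem_quadrant ha hb hz (h ▸ zero_mem_cross)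
    rw [norm_one_sub_coord, Real.log_div (norm_ne_zero_iff.2 hz0)
      (norm_ne_zero_iff.2 (endpt_ne_zero ha hb i))]
    push_cast
    ring
  refine ((IsBigO.sum (s := Finset.univ) fun i _ => h1 i).const_mul_left
    (1 / (2 * Real.pi * Complex.I))).congr_left fun z => ?_
  simp only [Finset.sum_apply]
  rw [Finset.sum_sub_distrib, ← Finset.sum_mul, sum_density_one ha hb, szegoCauchy, mul_sub]
  have ha' : (a : ℂ) ≠ 0 := Complex.ofReal_ne_zero.2 ha.ne'
  have hb' : (b : ℂ) ≠ 0 := Complex.ofReal_ne_zero.2 hb.ne'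
  rw [sub_eq_add_neg]
  congr 1
  field_simp
  rw [Complex.I_sq]
  ring

theorem isBigO_norm_mul_log : (fun z : ℂ => z * (Real.log ‖z‖ : ℂ)) =O[𝓝 0] (fun _ => (1 : ℝ)) := by
  refine IsBigO.of_bound 1 ?_
  filter_upwards [Metric.ball_mem_nhds (0 : ℂ) zero_lt_one] with z hz
  rw [norm_one, mul_one, norm_mul, Complex.norm_real, Real.norm_eq_abs]
  rcases eq_or_ne z 0 with rfl | h
  · simp
  · exact abs_mul_log_le (norm_pos_iff.2 h) (mem_ball_zero_iff.1 hz).le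

theorem comparable_szego_zero (ha : 0 < a) (hb : 0 < b) (hγ : IsAlphaArc a b γ) {ℓ : ℕ∞}
    {ρ : ℂ → ℂ} {α : Fin 4 → ℝ} {h : Fin 4 → ℂ → ℂ} (hρ : IsWeight a b ℓ ρ α h)
    (hL : IsLogBranch a b α h L) (j : Fin 4) :
    Comparable (𝓝[quadrant j] 0)
      (fun z => ‖szego a b γ L (.pt (lift a b 0 z))‖)
      (fun z => ‖z‖ ^ ((-1) ^ ((j : ℕ) + 1) * (nu a b L).re)) := by
  have hint := intervalIntegrable_logDensity ha hb hρ hL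
  have hden := intervalIntegrable_density (γ := γ) ha hb hint
  have ha' : (a : ℂ) ≠ 0 := Complex.ofReal_ne_zero.2 ha.ne'
  have hb' : (b : ℂ) ≠ 0 := Complex.ofReal_ne_zero.2 hb.ne'
  have hO : IsOpen (γ '' Icc 0 1)ᶜ :=
    (isCompact_Icc.image_of_continuousOn hγ.continuousOn).isClosed.isOpen_compl
  refine comparable_of_isBigO (x := fun z => (-(w a b z * szegoCauchy a b γ L z) +
      2 * Real.pi * Complex.I * cRho a b γ L * innerIndicator a b γ z).re)
    (y := fun z => Real.log ‖z‖ * ((-1) ^ ((j : ℕ) + 1) * (nu a b L).re)) ?_ ?_ ?_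
  · filter_upwards [self_mem_nhdsWithin, mem_nhdsWithin_of_mem_nhds
      (hO.mem_nhds (zero_notMem_arc ha hb hγ))] with z hz hz'
    refine norm_szego_lift ha hb hγ hint fun hc => ?_
    rcases hc with hc | hc
    · exact notMem_cross_of_mem_quadrant ha hb hz hc
    · exact hz' hc
  · filter_upwards [self_mem_nhdsWithin] with z hz
    refine Real.rpow_def_of_pos (norm_pos_iff.2 fun h => ?_) _
    exact notMem_cross_of_mem_quadrant ha hb hz (h ▸ zero_mem_cross)
  · have hd : DifferentiableAt ℂ (wCut a b) 0 :=
      (analyticAt_wCut ha hb zero_mem_cross fun i => (endpt_ne_zero ha hb i).symm).differentiableAt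
    have h1 : (fun z => wCut a b z - a * b) =O[𝓝 0] (fun z : ℂ => z) := by
      have := hd.isBigO_sub
      simpa [wCut_zero ha hb] using this
    have h2 := ((hd.continuousAt.isBigO_one ℝ).mono nhdsWithin_le_nhds).mul
      (isBigO_szegoCauchy_zero ha hb hρ hL γ j)
    have h3 : (fun z => (wCut a b z - a * b) * (Real.log ‖z‖ : ℂ)) =O[𝓝[quadrant j] 0]
        (fun _ => (1 : ℝ)) :=
      ((h1.mul (isBigO_refl (fun z : ℂ => (Real.log ‖z‖ : ℂ)) _)).trans
        isBigO_norm_mul_log).mono nhdsWithin_le_nhds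
    -- With w = ±i `wCut`, the product wC is `wCut` times the bounded remainder of C plus `wCut`
    -- times a multiple of log|z|. In the second term `wCut` may be replaced by ab, because (`wCut`
    -- - ab) log|z| is bounded.
    have h4 := ((h2.const_mul_left (-((-1) ^ (j : ℕ) * Complex.I))).congr_right
      (fun _ => one_mul (1 : ℝ))).add ((h3.const_mul_left
        (-((-1) ^ (j : ℕ) * nu a b L / (a * b)))).add
        (isBigO_innerIndicator (a := a) (b := b) (γ := γ) _
          (2 * Real.pi * Complex.I * cRho a b γ L)))
    refine (isBigO_re h4).congr' ?_ EventuallyEq.rfl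
    filter_upwards [self_mem_nhdsWithin] with z hz
    rw [← Complex.ofReal_re (Real.log ‖z‖ * ((-1) ^ ((j : ℕ) + 1) * (nu a b L).re)),
      show (((Real.log ‖z‖ * ((-1) ^ ((j : ℕ) + 1) * (nu a b L).re) : ℝ) : ℂ)).re =
        ((Real.log ‖z‖ : ℂ) * ((-1) ^ ((j : ℕ) + 1) * nu a b L)).re by
        rw [Complex.ofReal_re, Complex.re_ofReal_mul, show ((-1 : ℂ) ^ ((j : ℕ) + 1)) =
          (((-1 : ℝ) ^ ((j : ℕ) + 1) : ℝ) : ℂ) by push_cast; rfl, Complex.re_ofReal_mul],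
      ← Complex.sub_re, w_eq_of_mem_quadrant ha hz]
    congr 1
    field_simp
    ring_nf
    simp only [Complex.I_sq]
    ring

end Cross

/-! ### One-sided limits on the cross -/

namespace Cross

variable {a b : ℝ} {γ : ℝ → ℂ} {L : Fin 4 → ℂ → ℂ}

/-- One of the two half planes bounded by the line through the `i`-th segment: the left one
for `κ = 1` and the right one for `κ = -1`. -/
def side (a b : ℝ) (i : Fin 4) (κ : ℝ) : Set ℂ := {z | 0 < κ * (coord a b i z).im}

theorem segPt_notMem_seg (ha : 0 < a) (hb : 0 < b) {i j : Fin 4} (hij : j ≠ i) {x : ℝ}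
    (hx : x < 1) : segPt a b i x ∉ seg a b j := by
  intro h
  obtain ⟨t, ht, h⟩ := mem_seg_iff.1 h
  have h1 := congrArg (fun z => (z / endpt a b i).re) h
  have h2 := endpt_ne_zero ha hb i
  simp only [segPt] at h1
  rw [mul_div_cancel_right₀ _ h2, mul_div_assoc, show (1 - (t : ℂ)) = ((1 - t : ℝ) : ℂ) by
    push_cast; rfl, Complex.re_ofReal_mul, Complex.sub_re, Complex.one_re, Complex.ofReal_re] at h1
  have h3 := mul_nonneg (sub_nonneg.2 ht.2) (neg_nonneg.2 (re_endpt_div_nonpos (a := a) (b := b) hij))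
  linarith

theorem tendsto_nhdsWithin_side (ha : 0 < a) (hb : 0 < b) (i : Fin 4) (x : ℝ) {κ : ℝ}
    (hκ : κ = 1 ∨ κ = -1) :
    Tendsto (fun ε : ℝ => endpt a b i * (1 - ((x : ℂ) + (κ * ε : ℝ) * Complex.I))) (𝓝[>] 0)
      (𝓝[side a b i κ] (segPt a b i x)) := by
  have hend := endpt_ne_zero ha hb i
  refine tendsto_nhdsWithin_iff.2 ⟨?_, ?_⟩
  · have hc : Continuous fun ε : ℝ => endpt a b i * (1 - ((x : ℂ) + (κ * ε : ℝ) * Complex.I)) := by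
      fun_prop
    have := (hc.tendsto 0).mono_left (nhdsWithin_le_nhds (s := Ioi 0))
    have e : endpt a b i * (1 - ((x : ℂ) + (κ * 0 : ℝ) * Complex.I)) = segPt a b i x := by
      rw [segPt]; push_cast; ring
    rwa [e] at this
  · filter_upwards [self_mem_nhdsWithin] with ε hε
    have h1 : coord a b i (endpt a b i * (1 - ((x : ℂ) + (κ * ε : ℝ) * Complex.I))) =
        (x : ℂ) + (κ * ε : ℝ) * Complex.I := by
      rw [coord]; field_simp; ring
    change 0 < κ * (coord a b i _).im
    rw [h1, Complex.add_im, Complex.ofReal_im, Complex.im_ofReal_mul, Complex.I_im]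
    have hε0 : 0 < ε := hε
    rcases hκ with rfl | rfl <;> linarith

theorem neBot_nhdsWithin_side (ha : 0 < a) (hb : 0 < b) (i : Fin 4) (x : ℝ) {κ : ℝ}
    (hκ : κ = 1 ∨ κ = -1) : (𝓝[side a b i κ] (segPt a b i x)).NeBot :=
  (tendsto_nhdsWithin_side ha hb i x hκ).neBot

theorem exists_tendsto_cauchy_side (ha : 0 < a) (hb : 0 < b) {φ : ℝ → ℂ}
    (hφ : IntervalIntegrable φ volume 0 1) {x δ K : ℝ}
    (hδ : 0 < δ) (hsub : Icc (x - δ) (x + δ) ⊆ Icc 0 1)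
    (hK : ∀ t ∈ Icc (x - δ) (x + δ), ∀ u ∈ Icc (x - δ) (x + δ), ‖φ t - φ u‖ ≤ K * |t - u|)
    (i : Fin 4) : ∃ c : ℂ, ∀ κ : ℝ, κ = 1 ∨ κ = -1 →
      Tendsto (fun z => cauchy φ (coord a b i z)) (𝓝[side a b i κ] (segPt a b i x))
        (𝓝 (c + κ * (Real.pi * Complex.I * φ x))) := by
  obtain ⟨c, h1, h2⟩ := exists_tendsto_cauchy hφ hδ hsub hK
  have hc : Tendsto (coord a b i) (𝓝 (segPt a b i x)) (𝓝 x) := by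
    have := (continuous_coord (a := a) (b := b) i).tendsto (segPt a b i x)
    rwa [coord_segPt ha hb] at this
  refine ⟨c, fun κ hκ => ?_⟩
  rcases hκ with rfl | rfl
  · rw [Complex.ofReal_one, one_mul]
    refine h1.comp (tendsto_nhdsWithin_iff.2 ⟨hc.mono_left nhdsWithin_le_nhds, ?_⟩)
    filter_upwards [self_mem_nhdsWithin] with z hz
    have hz' : 0 < 1 * (coord a b i z).im := hz
    change 0 < (coord a b i z).im
    linarith
  · rw [Complex.ofReal_neg, Complex.ofReal_one, neg_one_mul, ← sub_eq_add_neg]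
    refine h2.comp (tendsto_nhdsWithin_iff.2 ⟨hc.mono_left nhdsWithin_le_nhds, ?_⟩)
    filter_upwards [self_mem_nhdsWithin] with z hz
    have hz' : 0 < -1 * (coord a b i z).im := hz
    change (coord a b i z).im < 0
    linarith

theorem tendsto_cauchy_of_ne (ha : 0 < a) (hb : 0 < b) {φ : ℝ → ℂ}
    (hφ : IntervalIntegrable φ volume 0 1) {i j : Fin 4} (hij : j ≠ i) {x : ℝ} (hx : x < 1) :
    Tendsto (fun z => cauchy φ (coord a b j z)) (𝓝 (segPt a b i x))
      (𝓝 (cauchy φ (coord a b j (segPt a b i x)))) :=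
  ContinuousAt.tendsto (f := fun z => cauchy φ (coord a b j z)) (ContinuousAt.comp (f := coord a b j)
    (hasDerivAt_cauchy hφ (coord_notMem ha hb (segPt_notMem_seg ha hb hij hx))).continuousAt
    (continuous_coord j).continuousAt)

/-- Only the integral over the i-th segment jumps. The constant c is common to both sides, so
differences of one-sided limits can be formed later. -/
theorem exists_tendsto_szegoCauchy (ha : 0 < a) (hb : 0 < b) {ℓ : ℕ∞} {ρ : ℂ → ℂ} {α : Fin 4 → ℝ}
    {h : Fin 4 → ℂ → ℂ} (hρ : IsWeight a b ℓ ρ α h) (hL : IsLogBranch a b α h L) (γ : ℝ → ℂ)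
    (i : Fin 4) {x : ℝ} (hx : x ∈ Ioo (0 : ℝ) 1) : ∃ c : ℂ, ∀ κ : ℝ, κ = 1 ∨ κ = -1 →
      Tendsto (szegoCauchy a b γ L) (𝓝[side a b i κ] (segPt a b i x))
        (𝓝 (c + κ * (density a b γ L i x / 2))) := by
  have hpi : (Real.pi : ℂ) ≠ 0 := Complex.ofReal_ne_zero.2 Real.pi_ne_zero
  have hden := intervalIntegrable_density (γ := γ) ha hb (intervalIntegrable_logDensity ha hb hρ hL)
  obtain ⟨G, K, M, hG, hM, he⟩ := exists_density_eq ha hb hρ hL γ i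
  set δ := min x (1 - x) / 2 with hδ
  have hδ0 : 0 < δ := by
    have := sub_pos.2 hx.2
    have := hx.1
    positivity
  have hd1 : δ ≤ x / 2 := by rw [hδ]; gcongr; exact min_le_left _ _
  have hd2 : δ ≤ (1 - x) / 2 := by rw [hδ]; gcongr; exact min_le_right _ _
  have hx0 := hx.1
  have hx1 := hx.2
  obtain ⟨k, _, hk⟩ := hM.exists_lipschitz (δ := x / 2) (by linarith)
  have hsub : Icc (x - δ) (x + δ) ⊆ Icc (x / 2) 1 := Icc_subset_Icc (by linarith) (by linarith)
  obtain ⟨c, hc⟩ := exists_tendsto_cauchy_side ha hb (hden i) hδ0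
    (hsub.trans (Icc_subset_Icc_left (by linarith))) (K := k) (fun t ht u hu => by
      have ht' := hsub ht
      have hu' := hsub hu
      rw [he t ⟨by linarith [ht'.1], ht'.2⟩, he u ⟨by linarith [hu'.1], hu'.2⟩]
      exact hk t ht' u hu') i
  refine ⟨1 / (2 * Real.pi * Complex.I) * (c + ∑ j ∈ Finset.univ.erase i,
    cauchy (density a b γ L j) (coord a b j (segPt a b i x))), fun κ hκ => ?_⟩
  have h1 := ((hc κ hκ).add (tendsto_finsetSum (Finset.univ.erase i) fun j hj =>
    (tendsto_cauchy_of_ne ha hb (hden j) (Finset.ne_of_mem_erase hj) hx.2).mono_left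
      (nhdsWithin_le_nhds (s := side a b i κ)))).const_mul (1 / (2 * Real.pi * Complex.I))
  have e : 1 / (2 * Real.pi * Complex.I) * (c + κ * (Real.pi * Complex.I * density a b γ L i x) +
      ∑ j ∈ Finset.univ.erase i, cauchy (density a b γ L j) (coord a b j (segPt a b i x))) =
      1 / (2 * Real.pi * Complex.I) * (c + ∑ j ∈ Finset.univ.erase i,
    cauchy (density a b γ L j) (coord a b j (segPt a b i x))) + κ * (density a b γ L i x / 2) := by
    field_simp
    ring
  rw [e] at h1
  refine h1.congr fun z => ?_
  rw [szegoCauchy, ← Finset.add_sum_erase _ _ (Finset.mem_univ i)]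

/-- The orientation of the segments in the boundary of the bounded component. -/
noncomputable def windSign (i : Fin 4) : ℂ := ![1, 0, 0, -1] i

theorem notMem_arc_of_mem_seg (ha : 0 < a) (hb : 0 < b) (hγ : IsAlphaArc a b γ) {i : Fin 4} {x : ℝ}
    (hx : x ∈ Ioc (0 : ℝ) 1) : segPt a b i x ∉ γ '' Icc 0 1 := by
  rintro ⟨t, ht, h⟩
  rcases eq_or_lt_of_le ht.1 with h0 | h0
  · rw [← h0, hγ.source] at h
    exact segPt_ne_endpt ha hb i hx 3 h.symm
  rcases eq_or_lt_of_le ht.2 with h1 | h1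
  · rw [h1, hγ.target] at h
    exact segPt_ne_endpt ha hb i hx 0 h.symm
  · exact hγ.avoids t ⟨h0, h1⟩ (h ▸ mem_iUnion.2 ⟨i, segPt_mem_seg i (Ioc_subset_Icc_self hx)⟩)

theorem IsAlphaArc.isOpen_compl_arc (hγ : IsAlphaArc a b γ) : IsOpen (γ '' Icc 0 1)ᶜ :=
  (isCompact_Icc.image_of_continuousOn hγ.continuousOn).isClosed.isOpen_compl

theorem eventually_side_notMem_cuts (ha : 0 < a) (hb : 0 < b) (hγ : IsAlphaArc a b γ) (i : Fin 4)
    {x : ℝ} (hx : x ∈ Ioo (0 : ℝ) 1) (κ : ℝ) :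
    ∀ᶠ z in 𝓝[side a b i κ] (segPt a b i x), z ∉ cuts a b γ := by
  have h1 : ∀ᶠ z in 𝓝 (segPt a b i x), ‖coord a b i z‖ < 1 := by
    have := ((continuous_coord (a := a) (b := b) i).norm).tendsto (segPt a b i x)
    rw [coord_segPt ha hb, Complex.norm_real, Real.norm_of_nonneg hx.1.le] at this
    exact this.eventually_lt_const hx.2
  filter_upwards [self_mem_nhdsWithin, mem_nhdsWithin_of_mem_nhds h1, mem_nhdsWithin_of_mem_nhds
    (hγ.isOpen_compl_arc.mem_nhds (notMem_arc_of_mem_seg ha hb hγ (i := i) ⟨hx.1, hx.2.le⟩))]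
    with z h2 h3 h4 h5
  rcases h5 with h5 | h5
  · refine notMem_cross_of_coord ha hb h3 ?_ h5
    rintro ⟨t, ht, h⟩
    have h6 : 0 < κ * (coord a b i z).im := h2
    rw [← h] at h6
    simp at h6
  · exact h4 h5

/-- The jump across a segment is known from the Plemelj formula and the winding integral takes only
the values 0 and 2πi. A jump of ±2πi then determines both limits, with no need to locate the
components. -/
theorem tendsto_winding_side (ha : 0 < a) (hb : 0 < b) (hγ : IsAlphaArc a b γ) (i : Fin 4)
    {x : ℝ} (hx : x ∈ Ioo (0 : ℝ) 1) (κ : ℝ) (hκ : κ = 1 ∨ κ = -1) :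
    Tendsto (winding a b γ) (𝓝[side a b i κ] (segPt a b i x))
      (𝓝 (Real.pi * Complex.I * (alphaSide i + κ * windSign i))) := by
  have hpi : (Real.pi : ℂ) ≠ 0 := Complex.ofReal_ne_zero.2 Real.pi_ne_zero
  obtain ⟨K, hK⟩ := hγ.lipschitz
  have hne : ∀ t ∈ Icc (0 : ℝ) 1, γ t - 1 * segPt a b i x ≠ 0 := fun t ht h =>
    notMem_arc_of_mem_seg ha hb hγ (i := i) ⟨hx.1, hx.2.le⟩ ⟨t, ht, by
      rw [one_mul] at h; exact sub_eq_zero.1 h⟩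
  have harc := (hasDerivAt_integral_div (intervalIntegrable_deriv_of_lipschitz hK) (p := γ)
    (q := fun _ => 1) hγ.continuousOn (by fun_prop) hne).continuousAt.tendsto
  simp only [one_mul] at harc
  set δ := min x (1 - x) with hδ
  have hδ0 : 0 < δ := lt_min hx.1 (sub_pos.2 hx.2)
  have hd1 : δ ≤ x := min_le_left _ _
  have hd2 : δ ≤ 1 - x := min_le_right _ _
  have hone : ∀ j : Fin 4, ∃ c : ℂ, ∀ κ : ℝ, κ = 1 ∨ κ = -1 →
      Tendsto (fun z => cauchy (fun _ => 1) (coord a b j z)) (𝓝[side a b i κ] (segPt a b i x))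
        (𝓝 (c + if j = i then κ * (Real.pi * Complex.I) else 0)) := by
    intro j
    by_cases hji : j = i
    · subst hji
      obtain ⟨c, hc⟩ := exists_tendsto_cauchy_side ha hb (φ := fun _ => 1) (K := 0) (by simp) hδ0
        (Icc_subset_Icc (by linarith) (by linarith)) (by simp) j
      exact ⟨c, fun κ hκ => by simpa using hc κ hκ⟩
    · refine ⟨cauchy (fun _ => 1) (coord a b j (segPt a b i x)), fun κ hκ => ?_⟩
      rw [if_neg hji, add_zero]
      exact (tendsto_cauchy_of_ne ha hb (by simp) hji hx.2).mono_left nhdsWithin_le_nhds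
  obtain ⟨c₀, h0⟩ := hone 0
  obtain ⟨c₃, h3⟩ := hone 3
  obtain ⟨W, hW⟩ : ∃ W : ℂ, ∀ κ : ℝ, κ = 1 ∨ κ = -1 →
      Tendsto (winding a b γ) (𝓝[side a b i κ] (segPt a b i x))
        (𝓝 (W + Real.pi * Complex.I * (κ * windSign i))) := by
    refine ⟨(∫ t in (0 : ℝ)..1, deriv γ t / (γ t - segPt a b i x)) + c₀ - c₃, fun κ hκ => ?_⟩
    have h := ((harc.mono_left (nhdsWithin_le_nhds (s := side a b i κ))).add (h0 κ hκ)).sub (h3 κ hκ)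
    have e : (∫ t in (0 : ℝ)..1, deriv γ t / (γ t - segPt a b i x)) + c₀ - c₃ +
        Real.pi * Complex.I * (κ * windSign i) =
        (∫ t in (0 : ℝ)..1, deriv γ t / (γ t - segPt a b i x)) +
          (c₀ + if 0 = i then κ * (Real.pi * Complex.I) else 0) -
          (c₃ + if 3 = i then κ * (Real.pi * Complex.I) else 0) := by
      clear h h0 h3 hone harc hne
      fin_cases i <;> simp [windSign] <;> ring
    rw [e]
    exact h
  have hval : ∀ κ : ℝ, κ = 1 ∨ κ = -1 → W + Real.pi * Complex.I * (κ * windSign i) = 0 ∨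
      W + Real.pi * Complex.I * (κ * windSign i) = 2 * Real.pi * Complex.I := by
    intro κ hκ
    have := neBot_nhdsWithin_side ha hb i x hκ
    have hcl : IsClosed ({0, 2 * Real.pi * Complex.I} : Set ℂ) := (Set.toFinite _).isClosed
    refine hcl.mem_of_tendsto (hW κ hκ) ?_
    filter_upwards [eventually_side_notMem_cuts ha hb hγ i hx κ] with z hz
    rw [winding_eq ha hb hγ hz]
    rcases innerIndicator_mem (a := a) (b := b) (γ := γ) z with h | h <;> simp [h]
  have hzero : segPt a b i x ∉ closedQuadrant → W + Real.pi * Complex.I * (κ * windSign i) = 0 := by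
    intro hQ
    have := neBot_nhdsWithin_side ha hb i x hκ
    refine tendsto_nhds_unique (hW κ hκ) (tendsto_const_nhds.congr' ?_)
    filter_upwards [eventually_side_notMem_cuts ha hb hγ i hx κ, mem_nhdsWithin_of_mem_nhds
      (isClosed_closedQuadrant.isOpen_compl.mem_nhds hQ)] with z hz hz'
    rw [winding_eq ha hb hγ hz, innerIndicator_eq_zero_of_notMem ha hb hγ hz', mul_zero]
  have hx1 := sub_pos.2 hx.2
  -- On Δ₁ and Δ₄ the numbers W + πi and W - πi both belong to {0, 2πi}, hence W = πi. On Δ₂ and Δ₃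
  -- there is no jump, and the points lie outside the closed quadrant, where χ = 0.
  have hWv : W = Real.pi * Complex.I * alphaSide i := by
    have hp := hval 1 (Or.inl rfl)
    have hm := hval (-1) (Or.inr rfl)
    have hpI : (Real.pi : ℂ) * Complex.I ≠ 0 := mul_ne_zero hpi Complex.I_ne_zero
    fin_cases i
    · simp [windSign, alphaSide] at hp hm ⊢
      rcases hm with hm | hm
      · linear_combination hm
      · rcases hp with hp | hp
        · exact absurd (by linear_combination (1 / 4 : ℂ) * (hp - hm)) hpI
        · exact absurd (by linear_combination (1 / 2 : ℂ) * (hp - hm)) hpI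
    · have := hzero fun h => by
        have := h.2
        simp [segPt, endpt] at this
        have := mul_pos hx1 hb
        linarith
      simpa [windSign, alphaSide] using this
    · have := hzero fun h => by
        have := h.1
        simp [segPt, endpt] at this
        have := mul_pos hx1 ha
        linarith
      simpa [windSign, alphaSide] using this
    · simp [windSign, alphaSide] at hp hm ⊢
      rcases hp with hp | hp
      · linear_combination hp
      · rcases hm with hm | hm
        · exact absurd (by linear_combination (1 / 4 : ℂ) * (hm - hp)) hpI
        · exact absurd (by linear_combination (1 / 2 : ℂ) * (hm - hp)) hpI
  rw [mul_add, ← hWv]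
  exact hW κ hκ

theorem w_eq_of_mem_side (ha : 0 < a) (hb : 0 < b) {i : Fin 4} {κ : ℝ} (hκ : κ = 1 ∨ κ = -1) {z : ℂ}
    (h1 : (coord a b i z).re < 1) (h2 : z ∈ side a b i κ) :
    w a b z = κ * ((-1) ^ ((i : ℕ) + 1) * Complex.I * wCut a b z) := by
  have h3 : 0 < κ * (coord a b i z).im := h2
  rcases hκ with rfl | rfl
  · rw [w_eq_of_coord_im_pos ha hb h1 (by linarith), Complex.ofReal_one, one_mul]
  · rw [w_eq_of_coord_im_neg ha hb h1 (by linarith), Complex.ofReal_neg, Complex.ofReal_one,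
      neg_one_mul]

theorem wPlus_sq (ha : 0 < a) (hb : 0 < b) {i : Fin 4} {s : ℂ} (hs : s ∈ seg a b i) :
    (wPlus a b i s) ^ 2 = (s ^ 2 - (a : ℂ) ^ 2) * (s ^ 2 + (b : ℂ) ^ 2) := by
  obtain ⟨r, h0, h1, h2⟩ := exists_sq_eq_of_mem_cross ha hb (mem_iUnion.2 ⟨i, hs⟩)
  rw [wPlus, mul_pow, mul_pow, ← pow_mul, mul_comm, pow_mul', Complex.I_sq, h0, ← Complex.ofReal_pow,
    Real.sq_sqrt (norm_nonneg _), show (-1 : ℂ) ^ 2 = 1 by norm_num, one_pow]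
  norm_cast
  rw [Real.norm_eq_abs, abs_of_nonpos (by nlinarith)]
  push_cast
  ring

theorem exists_ω_eq (ha : 0 < a) (hb : 0 < b) {i : Fin 4} {p : Curve a b} (hp : p.z ∈ seg a b i) :
    ∃ κ : ℝ, (κ = 1 ∨ κ = -1) ∧ p.ω = κ * wPlus a b i p.z := by
  have h : p.ω ^ 2 = (wPlus a b i p.z) ^ 2 := by rw [wPlus_sq ha hb hp]; exact p.2
  rcases sq_eq_sq_iff_eq_or_eq_neg.1 h with h | h
  · exact ⟨1, Or.inl rfl, by simpa using h⟩
  · exact ⟨-1, Or.inr rfl, by simpa using h⟩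

/-- Near p the value ω stays close to the continuation v of ω(p) through the cut. On the side
opposite to κ, sheet k carries -v, at distance 2|v| from v. So sheet k reaches p from one side of
the segment only. -/
theorem eventually_mem_side (ha : 0 < a) (hb : 0 < b) {i : Fin 4} {x : ℝ} (hx : x ∈ Ioo (0 : ℝ) 1)
    {p : Curve a b} (hpz : p.z = segPt a b i x) {k : Fin 2} {κ : ℝ} (hκ : κ = 1 ∨ κ = -1)
    (hpω : p.ω = κ * ((-1) ^ (k : ℕ) * wPlus a b i p.z)) :
    ∀ᶠ q in 𝓝[sheet a b k] p, q.ω = (-1) ^ (k : ℕ) * w a b q.z ∧ q.z ∈ side a b i κ := by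
  have hps : p.z ∈ seg a b i := hpz ▸ segPt_mem_seg i ⟨hx.1.le, hx.2.le⟩
  have hpe : ∀ j, p.z ≠ endpt a b j := fun j => hpz ▸ segPt_ne_endpt ha hb i ⟨hx.1, hx.2.le⟩ j
  have hω0 : p.ω ≠ 0 := Curve.ω_ne_zero hpe
  set v : ℂ → ℂ := fun z => κ * ((-1) ^ (k : ℕ) * ((-1) ^ ((i : ℕ) + 1) * Complex.I * wCut a b z))
    with hv
  have hvp : v p.z = p.ω := by rw [hpω, wPlus_eq ha hb hps]
  have hvc : ContinuousAt v p.z :=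
    continuousAt_const.mul (continuousAt_const.mul (continuousAt_const.mul
      (analyticAt_wCut ha hb (mem_iUnion.2 ⟨i, hps⟩) hpe).continuousAt))
  have hvc' : ContinuousAt (fun q : Curve a b => v q.z) p :=
    ContinuousAt.comp (f := Curve.z) hvc continuous_curve_z.continuousAt
  have hcc : ContinuousAt (fun q : Curve a b => coord a b i q.z) p :=
    ((continuous_coord i).comp continuous_curve_z).continuousAt
  have hcp : coord a b i p.z = x := by rw [hpz, coord_segPt ha hb]
  have e1 : ∀ᶠ q in 𝓝 p, (coord a b i q.z).re ∈ Ioo (0 : ℝ) 1 := by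
    have h1 : ContinuousAt (fun q : Curve a b => (coord a b i q.z).re) p :=
      Complex.continuous_re.continuousAt.comp hcc
    refine h1.preimage_mem_nhds (Ioo_mem_nhds ?_ ?_) <;> rw [hcp, Complex.ofReal_re]
    · exact hx.1
    · exact hx.2
  have e2 : ∀ᶠ q in 𝓝 p, ‖q.ω - v q.z‖ < ‖v q.z‖ := by
    have h1 : Tendsto (fun q : Curve a b => ‖q.ω - v q.z‖) (𝓝 p) (𝓝 0) := by
      have := (continuous_curve_ω.continuousAt.sub hvc').norm.tendsto
      simpa only [Pi.sub_apply, hvp, sub_self, norm_zero] using this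
    refine h1.eventually_lt hvc'.norm.tendsto ?_
    rw [hvp]
    exact norm_pos_iff.2 hω0
  filter_upwards [self_mem_nhdsWithin, mem_nhdsWithin_of_mem_nhds e1, mem_nhdsWithin_of_mem_nhds e2]
    with q hq h1 h2
  obtain ⟨z, hz, rfl⟩ := hq
  rw [lift_z] at h1 h2 ⊢
  rw [lift_ω] at h2 ⊢
  refine ⟨rfl, ?_⟩
  rcases lt_trichotomy 0 (κ * (coord a b i z).im) with h3 | h3 | h3
  · exact h3
  · exfalso
    have h4 : (coord a b i z).im = 0 := by
      rcases hκ with rfl | rfl <;> linarith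
    refine hz (mem_iUnion.2 ⟨i, mem_seg_iff.2 ⟨(coord a b i z).re, ⟨h1.1.le, h1.2.le⟩, ?_⟩⟩)
    have h5 : ((coord a b i z).re : ℂ) = coord a b i z := Complex.ext (by simp) (by simp [h4])
    rw [h5, mul_comm]
    exact eq_endpt_mul_coord ha hb i z
  · exfalso
    have h4 : w a b z = (-κ : ℝ) * ((-1) ^ ((i : ℕ) + 1) * Complex.I * wCut a b z) :=
      w_eq_of_mem_side ha hb (by rcases hκ with rfl | rfl <;> simp) h1.2 (by
        change 0 < -κ * (coord a b i z).im; linarith)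
    rw [h4, show (-1) ^ (k : ℕ) * (((-κ : ℝ) : ℂ) * ((-1) ^ ((i : ℕ) + 1) * Complex.I * wCut a b z)) -
      v z = -2 * v z by simp only [hv]; push_cast; ring, norm_mul, norm_neg,
      Complex.norm_ofNat] at h2
    linarith [norm_nonneg (v z)]

/-- The lifts to sheet k of points approaching from the side κ converge to p, so p is a limit point
of the sheet and limits along it are unique. -/
theorem neBot_nhdsWithin_sheet (ha : 0 < a) (hb : 0 < b) {i : Fin 4} {x : ℝ} (hx : x ∈ Ioo (0 : ℝ) 1)
    {p : Curve a b} (hpz : p.z = segPt a b i x) {k : Fin 2} {κ : ℝ} (hκ : κ = 1 ∨ κ = -1)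
    (hpω : p.ω = κ * ((-1) ^ (k : ℕ) * wPlus a b i p.z)) : (𝓝[sheet a b k] p).NeBot := by
  have hps : p.z ∈ seg a b i := hpz ▸ segPt_mem_seg i ⟨hx.1.le, hx.2.le⟩
  have hpe : ∀ j, p.z ≠ endpt a b j := fun j => hpz ▸ segPt_ne_endpt ha hb i ⟨hx.1, hx.2.le⟩ j
  have := neBot_nhdsWithin_side ha hb i x hκ
  rw [← hpz] at this
  have hre : ∀ᶠ z in 𝓝 p.z, ‖coord a b i z‖ < 1 := by
    have := ((continuous_coord (a := a) (b := b) i).norm).tendsto p.z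
    rw [hpz, coord_segPt ha hb, Complex.norm_real, Real.norm_of_nonneg hx.1.le] at this
    rw [hpz]
    exact this.eventually_lt_const hx.2
  have hw : Tendsto (w a b) (𝓝[side a b i κ] p.z) (𝓝 (κ * wPlus a b i p.z)) := by
    rw [wPlus_eq ha hb hps]
    have h1 : ContinuousAt (fun z => (κ : ℂ) * ((-1) ^ ((i : ℕ) + 1) * Complex.I * wCut a b z)) p.z :=
      continuousAt_const.mul (continuousAt_const.mul
        (analyticAt_wCut ha hb (mem_iUnion.2 ⟨i, hps⟩) hpe).continuousAt)
    refine (h1.tendsto.mono_left nhdsWithin_le_nhds).congr' ?_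
    filter_upwards [self_mem_nhdsWithin, mem_nhdsWithin_of_mem_nhds hre] with z h2 h3
    exact (w_eq_of_mem_side ha hb hκ ((Complex.re_le_norm _).trans_lt h3) h2).symm
  have hl : Tendsto (lift a b k) (𝓝[side a b i κ] p.z) (𝓝[sheet a b k] p) := by
    refine tendsto_nhdsWithin_iff.2 ⟨?_, ?_⟩
    · refine tendsto_subtype_rng.2 ?_
      have h1 : (p.1 : ℂ × ℂ) = (p.z, (-1) ^ (k : ℕ) * (κ * wPlus a b i p.z)) := by
        refine Prod.ext rfl ?_
        change p.ω = _
        rw [hpω]; ring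
      rw [h1]
      exact Tendsto.prodMk_nhds (tendsto_id.mono_left nhdsWithin_le_nhds) (hw.const_mul _)
    · filter_upwards [self_mem_nhdsWithin, mem_nhdsWithin_of_mem_nhds hre] with z h2 h3
      refine ⟨z, notMem_cross_of_coord ha hb h3 ?_, rfl⟩
      rintro ⟨t, ht, h⟩
      have h6 : 0 < κ * (coord a b i z).im := h2
      rw [← h] at h6
      simp at h6
  exact hl.neBot

/-- The constant c is chosen before the sheet and the side, so the limits from the two sheets can be
compared. -/
theorem exists_tendsto_szego_sheet (ha : 0 < a) (hb : 0 < b) (hγ : IsAlphaArc a b γ) {ℓ : ℕ∞}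
    {ρ : ℂ → ℂ} {α : Fin 4 → ℝ} {h : Fin 4 → ℂ → ℂ} (hρ : IsWeight a b ℓ ρ α h)
    (hL : IsLogBranch a b α h L) {i : Fin 4} {x : ℝ} (hx : x ∈ Ioo (0 : ℝ) 1) {p : Curve a b}
    (hpz : p.z = segPt a b i x) : ∃ c : ℂ, ∀ k : Fin 2, ∀ κ : ℝ, (κ = 1 ∨ κ = -1) →
      p.ω = κ * ((-1) ^ (k : ℕ) * wPlus a b i p.z) →
      Tendsto (fun q => szego a b γ L (.pt q)) (𝓝[sheet a b k] p)
        (𝓝 (Complex.exp (-p.ω * (c + κ * (density a b γ L i x / 2)) + cRho a b γ L *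
          ((-1) ^ (k : ℕ) * (Real.pi * Complex.I * (alphaSide i + κ * windSign i)))))) := by
  have hint := intervalIntegrable_logDensity ha hb hρ hL
  obtain ⟨c, hc⟩ := exists_tendsto_szegoCauchy ha hb hρ hL γ i hx
  refine ⟨c, fun k κ hκ hpω => ?_⟩
  have hside := eventually_mem_side ha hb hx hpz hκ hpω
  have hz : Tendsto (Curve.z (a := a) (b := b)) (𝓝[sheet a b k] p)
      (𝓝[side a b i κ] (segPt a b i x)) := by
    refine tendsto_nhdsWithin_iff.2 ⟨?_, hside.mono fun q hq => hq.2⟩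
    rw [← hpz]
    exact continuous_curve_z.continuousAt.tendsto.mono_left nhdsWithin_le_nhds
  have hω : Tendsto (Curve.ω (a := a) (b := b)) (𝓝[sheet a b k] p) (𝓝 p.ω) :=
    continuous_curve_ω.continuousAt.tendsto.mono_left nhdsWithin_le_nhds
  have h1 := ((hω.neg.mul ((hc κ hκ).comp hz)).add ((((tendsto_winding_side ha hb hγ i hx κ hκ).comp
    hz).const_mul ((-1) ^ (k : ℕ))).const_mul (cRho a b γ L))).cexp
  refine h1.congr' ?_
  filter_upwards [hside, hz.eventually (eventually_side_notMem_cuts ha hb hγ i hx κ)] with q h2 h3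
  have hw := w_ne_zero (ne_endpt_of_notMem (a := a) (b := b) (z := q.z) fun h => h3 (Or.inl h))
  simp only [Function.comp_apply]
  rw [szego_pt ha hb hγ hint h3, winding_eq ha hb hγ h3, h2.1, mul_div_cancel_right₀ _ hw]
  congr 1
  ring

theorem exp_logWPlus {i : Fin 4} {s : ℂ}
    (hse : ∀ j, s ≠ endpt a b j) : Complex.exp (logWPlus a b i s) = wPlus a b i s := by
  have h1 : 0 < ‖(s ^ 2 - (a : ℂ) ^ 2) * (s ^ 2 + (b : ℂ) ^ 2)‖ :=
    norm_pos_iff.2 (mul_ne_zero (sq_sub_ne_zero (hse 0) (hse 2)) (sq_add_ne_zero (hse 1) (hse 3)))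
  have h2 : Complex.exp ((-1) ^ ((i : ℕ) + 1) * (Real.pi * Complex.I / 2)) =
      (-1) ^ ((i : ℕ) + 1) * Complex.I := by
    rcases neg_one_pow_eq_or ℂ ((i : ℕ) + 1) with h | h <;> rw [h]
    · rw [one_mul, one_mul, mul_div_right_comm, Complex.exp_pi_div_two_mul_I]
    · rw [neg_one_mul, neg_one_mul, Complex.exp_neg, mul_div_right_comm,
        Complex.exp_pi_div_two_mul_I, Complex.inv_I]
  rw [logWPlus, Complex.exp_add, h2, ← Complex.ofReal_exp, Real.exp_log (Real.sqrt_pos.2 h1), wPlus]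
  ring

end Cross

/-! ### Traces and jumps -/

namespace Cross

variable {a b : ℝ} {γ : ℝ → ℂ} {L : Fin 4 → ℂ → ℂ}

open Classical in
/-- A boundary value of the Szegő function: over the cross the limit from the sheet `k`, and
elsewhere the value for which the winding term is `n₀` on the sheet `0` and `n₁` on the
sheet `1`. -/
noncomputable def szegoTrace (a b : ℝ) (γ : ℝ → ℂ) (L : Fin 4 → ℂ → ℂ) (k : Fin 2) (n₀ n₁ : ℂ)
    (p : Curve a b) : ℂ :=
  if p.z ∈ cross a b then extendFrom (sheet a b k) (fun q => szego a b γ L (.pt q)) p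
  else Complex.exp (-p.ω * szegoCauchy a b γ L p.z + 2 * Real.pi * Complex.I * cRho a b γ L *
    (if p.ω = w a b p.z then n₀ else n₁))

theorem isOpen_preimage_compl_cross (a b : ℝ) : IsOpen {q : Curve a b | q.z ∉ cross a b} :=
  (isCompact_cross a b).isClosed.isOpen_compl.preimage continuous_curve_z

theorem continuousAt_szegoCauchy (ha : 0 < a) (hb : 0 < b)
    (hint : ∀ i, IntervalIntegrable (logDensity a b L i) volume 0 1) {p : Curve a b}
    (hp : p.z ∉ cross a b) : ContinuousAt (fun q : Curve a b => -q.ω * szegoCauchy a b γ L q.z) p :=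
  continuous_curve_ω.continuousAt.neg.mul (ContinuousAt.comp (f := Curve.z)
    (analyticAt_szegoCauchy ha hb hint hp).continuousAt continuous_curve_z.continuousAt)

theorem continuousAt_szegoTrace (ha : 0 < a) (hb : 0 < b)
    (hint : ∀ i, IntervalIntegrable (logDensity a b L i) volume 0 1) (k : Fin 2) (n₀ n₁ : ℂ)
    {p : Curve a b} (hp : p.z ∉ cross a b) : ContinuousAt (szegoTrace a b γ L k n₀ n₁) p := by
  have hw := w_ne_zero (ne_endpt_of_notMem hp)
  have h1 : ContinuousAt (fun q : Curve a b => Complex.exp (-q.ω * szegoCauchy a b γ L q.z +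
      2 * Real.pi * Complex.I * cRho a b γ L * (if p.ω = w a b p.z then n₀ else n₁))) p :=
    ((continuousAt_szegoCauchy ha hb hint hp).add continuousAt_const).cexp
  refine h1.congr ?_
  filter_upwards [eventually_ω_eq ha hb hp, (isOpen_preimage_compl_cross a b).mem_nhds hp]
    with q hq hqz
  rw [szegoTrace, if_neg hqz]
  congr 3
  have hwq := w_ne_zero (ne_endpt_of_notMem hqz)
  -- Off the cross the ratio ω/w is locally constant, so the same winding term is selected near p.
  have : q.ω = w a b q.z ↔ p.ω = w a b p.z := by
    rw [hq, mul_eq_right₀ hwq, div_eq_one_iff_eq hw]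
  simp only [this]

theorem exists_segPt_of_regular {p : Curve a b}
    (hp : p ∈ regularCuts a b γ) (hpz : p.z ∈ cross a b) :
    ∃ i, ∃ x ∈ Ioo (0 : ℝ) 1, p.z = segPt a b i x := by
  obtain ⟨i, hi⟩ := mem_iUnion.1 hpz
  obtain ⟨x, hx, h⟩ := mem_seg_iff.1 hi
  refine ⟨i, x, ⟨lt_of_le_of_ne hx.1 ?_, lt_of_le_of_ne hx.2 ?_⟩, h⟩
  · rintro rfl
    exact hp.2.2 i (by rw [h]; simp)
  · rintro rfl
    exact hp.2.1 (by rw [h]; simp)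

theorem exists_sheet_sign (ha : 0 < a) (hb : 0 < b) {i : Fin 4} {p : Curve a b}
    (hp : p.z ∈ seg a b i) (k : Fin 2) :
    ∃ κ : ℝ, (κ = 1 ∨ κ = -1) ∧ p.ω = κ * ((-1) ^ (k : ℕ) * wPlus a b i p.z) := by
  obtain ⟨κ, hκ, h⟩ := exists_ω_eq ha hb hp
  rcases neg_one_pow_eq_or ℂ (k : ℕ) with hk | hk
  · exact ⟨κ, hκ, by rw [h, hk, one_mul]⟩
  · refine ⟨-κ, ?_, by rw [h, hk]; push_cast; ring⟩
    rcases hκ with rfl | rfl <;> simp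

/-- Near a regular point of the cross the arc is absent, and there the trace is an extension by
limits, which is automatically continuous. Off the cross the trace is given by an explicit
continuous formula. -/
theorem continuousOn_szegoTrace (ha : 0 < a) (hb : 0 < b) (hγ : IsAlphaArc a b γ) {ℓ : ℕ∞}
    {ρ : ℂ → ℂ} {α : Fin 4 → ℝ} {h : Fin 4 → ℂ → ℂ} (hρ : IsWeight a b ℓ ρ α h)
    (hL : IsLogBranch a b α h L) (k : Fin 2) (n₀ n₁ : ℂ) :
    ContinuousOn (szegoTrace a b γ L k n₀ n₁) (regularCuts a b γ) := by
  intro p hp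
  by_cases hpz : p.z ∈ cross a b
  · set B : Set (Curve a b) := {q | q ∈ regularCuts a b γ ∧ q.z ∈ cross a b} with hB
    have hext : ContinuousOn (extendFrom (sheet a b k) fun q => szego a b γ L (.pt q)) B := by
      refine continuousOn_extendFrom (fun q hq => ?_) fun q hq => ?_
      · obtain ⟨i, x, hx, hqz⟩ := exists_segPt_of_regular hq.1 hq.2
        obtain ⟨κ, hκ, hω⟩ := exists_sheet_sign ha hb
          (hqz ▸ segPt_mem_seg i ⟨hx.1.le, hx.2.le⟩ : q.z ∈ seg a b i) k
        exact mem_closure_iff_nhdsWithin_neBot.2 (neBot_nhdsWithin_sheet ha hb hx hqz hκ hω)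
      · obtain ⟨i, x, hx, hqz⟩ := exists_segPt_of_regular hq.1 hq.2
        obtain ⟨κ, hκ, hω⟩ := exists_sheet_sign ha hb
          (hqz ▸ segPt_mem_seg i ⟨hx.1.le, hx.2.le⟩ : q.z ∈ seg a b i) k
        obtain ⟨c, hc⟩ := exists_tendsto_szego_sheet ha hb hγ hρ hL hx hqz
        exact ⟨_, hc k κ hκ hω⟩
    have hc : ContinuousWithinAt (szegoTrace a b γ L k n₀ n₁) B p :=
      (hext p ⟨hp, hpz⟩).congr (fun q hq => if_pos hq.2) (if_pos hpz)
    refine hc.mono_of_mem_nhdsWithin ?_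
    obtain ⟨i, x, hx, hz⟩ := exists_segPt_of_regular hp hpz
    have hV : p ∈ Curve.z ⁻¹' (γ '' Icc 0 1)ᶜ := by
      change p.z ∉ γ '' Icc 0 1
      rw [hz]
      exact notMem_arc_of_mem_seg ha hb hγ ⟨hx.1, hx.2.le⟩
    filter_upwards [self_mem_nhdsWithin, mem_nhdsWithin_of_mem_nhds
      ((hγ.isOpen_compl_arc.preimage continuous_curve_z).mem_nhds hV)] with q hq hq'
    exact ⟨hq, hq.1.resolve_right hq'⟩
  · exact (continuousAt_szegoTrace ha hb (intervalIntegrable_logDensity ha hb hρ hL) k n₀ n₁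
      hpz).continuousWithinAt

theorem tendsto_szego_of_winding (ha : 0 < a) (hb : 0 < b) (hγ : IsAlphaArc a b γ)
    (hint : ∀ i, IntervalIntegrable (logDensity a b L i) volume 0 1) {p : Curve a b}
    (hp : p.z ∉ cross a b) (k : Fin 2) (n₀ n₁ : ℂ) {s : Set (Curve a b)}
    (h : ∀ q ∈ s, q.z ∉ cuts a b γ ∧
      q.ω / w a b q.z * innerIndicator a b γ q.z = if q.ω = w a b q.z then n₀ else n₁) :
    Tendsto (fun q => szego a b γ L (.pt q)) (𝓝[s] p) (𝓝 (szegoTrace a b γ L k n₀ n₁ p)) := by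
  refine ((continuousAt_szegoTrace ha hb hint k n₀ n₁ hp).tendsto.mono_left
    nhdsWithin_le_nhds).congr' ?_
  filter_upwards [self_mem_nhdsWithin] with q hq
  obtain ⟨h1, h2⟩ := h q hq
  rw [szego_pt ha hb hγ hint h1, szegoTrace, if_neg fun h3 => h1 (Or.inl h3), h2]

theorem notMem_cross_of_regular_of_mem_arc (hγ : IsAlphaArc a b γ) {p : Curve a b}
    (hp : p ∈ regularCuts a b γ) (hpz : p.z ∈ γ '' Icc 0 1) : p.z ∉ cross a b := by
  obtain ⟨t, ht, h⟩ := hpz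
  rw [← h]
  refine hγ.avoids t ⟨lt_of_le_of_ne ht.1 ?_, lt_of_le_of_ne ht.2 ?_⟩
  · rintro rfl
    exact hp.2.2 3 (by rw [← h, hγ.source])
  · rintro rfl
    exact hp.2.2 0 (by rw [← h, hγ.target])

theorem neg_w_ne {z : ℂ} (hz : z ∉ cross a b) : -w a b z ≠ w a b z := fun h =>
  w_ne_zero (ne_endpt_of_notMem hz) (self_eq_neg.1 h.symm)

/-- The term ωC is continuous across α. The winding term (ω/w)χ is 1 on the left and 0 on the right
on sheet 0, and 0 on the left and -1 on the right on sheet 1; in both cases it drops by 1 from left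
to right. -/
theorem szego_jump_alpha (ha : 0 < a) (hb : 0 < b) (hγ : IsAlphaArc a b γ)
    (hint : ∀ i, IntervalIntegrable (logDensity a b L i) volume 0 1) {p : Curve a b}
    (hp : p ∈ regularCuts a b γ) (hpz : p.z ∈ γ '' Icc 0 1) :
    Tendsto (fun q => szego a b γ L (.pt q)) (𝓝[alphaLeft a b γ] p)
      (𝓝 (szegoTrace a b γ L 0 1 0 p)) ∧
    Tendsto (fun q => szego a b γ L (.pt q)) (𝓝[alphaRight a b γ] p)
      (𝓝 (szegoTrace a b γ L 1 0 (-1) p)) ∧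
    szegoTrace a b γ L 0 1 0 p = szegoTrace a b γ L 1 0 (-1) p *
      Complex.exp (2 * Real.pi * Complex.I * cRho a b γ L) := by
  have hpc := notMem_cross_of_regular_of_mem_arc hγ hp hpz
  have hin : ∀ {z}, z ∈ innerDomain a b γ → innerIndicator a b γ z = 1 := fun h => if_pos h
  have hout : ∀ {z}, z ∈ outerDomain a b γ → innerIndicator a b γ z = 0 :=
    fun h => if_neg fun h' => h.2 h'.2
  have h0 : ∀ {z}, z ∉ cuts a b γ → z ∉ cross a b := fun h h' => h (Or.inl h')
  have hw : ∀ {z}, z ∉ cuts a b γ → w a b z ≠ 0 := fun h => w_ne_zero (ne_endpt_of_notMem (h0 h))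
  refine ⟨tendsto_szego_of_winding ha hb hγ hint hpc _ _ _ ?_,
    tendsto_szego_of_winding ha hb hγ hint hpc _ _ _ ?_, ?_⟩
  · rintro q (⟨z, hz, rfl⟩ | ⟨z, hz, rfl⟩) <;> refine ⟨hz.1, ?_⟩ <;> rw [lift_z, lift_ω]
    · simp [hin hz, hw hz.1]
    · simp [hout hz, neg_w_ne (h0 hz.1)]
  · rintro q (⟨z, hz, rfl⟩ | ⟨z, hz, rfl⟩) <;> refine ⟨hz.1, ?_⟩ <;> rw [lift_z, lift_ω]
    · simp [hout hz]
    · simp [hin hz, hw hz.1, neg_w_ne (h0 hz.1)]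
  · rw [szegoTrace, szegoTrace, if_neg hpc, if_neg hpc, ← Complex.exp_add]
    congr 1
    split_ifs <;> ring

theorem exp_neg_logRhoW (ha : 0 < a) (hb : 0 < b) {ℓ : ℕ∞}
    {ρ : ℂ → ℂ} {α : Fin 4 → ℝ} {h : Fin 4 → ℂ → ℂ} (hρ : IsWeight a b ℓ ρ α h)
    (hL : IsLogBranch a b α h L) {i : Fin 4} {x : ℝ} (hx : x ∈ Ioo (0 : ℝ) 1) :
    Complex.exp (-logRhoW a b L i (segPt a b i x)) =
      1 / (ρ (segPt a b i x) * wPlus a b i (segPt a b i x)) := by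
  have hne := segPt_ne_endpt ha hb i ⟨hx.1, hx.2.le⟩
  rw [Complex.exp_neg, logRhoW, Complex.exp_add, exp_logWPlus hne,
    hL.exp_eq i _ ⟨segPt_mem_seg i ⟨hx.1.le, hx.2.le⟩, hne i⟩,
    hρ.eq_rho i (segPt a b i x) (mem_seg'_iff.2 ⟨x, hx, rfl⟩), one_div]

/-- If sheet 0 reaches p from the side κ, sheet 1 reaches it from the side -κ. The exponent jumps by
-(log(ρw₊) + 2πi c_ρ ε) from the Cauchy integral and by πi c_ρ((ε + κσ) + (ε - κσ)) = 2πi c_ρ ε from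
the winding terms, where σ is `windSign`. -/
theorem szego_jump_cross (ha : 0 < a) (hb : 0 < b) (hγ : IsAlphaArc a b γ) {ℓ : ℕ∞}
    {ρ : ℂ → ℂ} {α : Fin 4 → ℝ} {h : Fin 4 → ℂ → ℂ} (hρ : IsWeight a b ℓ ρ α h)
    (hL : IsLogBranch a b α h L) {i : Fin 4} {p : Curve a b} (hpz : p.z ∈ seg' a b i)
    (m₀ m₁ n₀ n₁ : ℂ) :
    Tendsto (fun q => szego a b γ L (.pt q)) (𝓝[sheet a b 0] p)
      (𝓝 (szegoTrace a b γ L 0 m₀ m₁ p)) ∧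
    Tendsto (fun q => szego a b γ L (.pt q)) (𝓝[sheet a b 1] p)
      (𝓝 (szegoTrace a b γ L 1 n₀ n₁ p)) ∧
    szegoTrace a b γ L 0 m₀ m₁ p = szegoTrace a b γ L 1 n₀ n₁ p *
      (1 / (ρ p.z * wPlus a b i p.z)) := by
  obtain ⟨x, hx, hz⟩ := mem_seg'_iff.1 hpz
  change p.z = segPt a b i x at hz
  have hps : p.z ∈ seg a b i := hz ▸ segPt_mem_seg i ⟨hx.1.le, hx.2.le⟩
  have hpc : p.z ∈ cross a b := mem_iUnion.2 ⟨i, hps⟩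
  obtain ⟨κ, hκ, hω⟩ := exists_ω_eq ha hb hps
  have hω0 : p.ω = κ * ((-1) ^ ((0 : Fin 2) : ℕ) * wPlus a b i p.z) := by simpa using hω
  have hω1 : p.ω = (-κ : ℝ) * ((-1) ^ ((1 : Fin 2) : ℕ) * wPlus a b i p.z) := by simpa using hω
  have hκ' : -κ = 1 ∨ -κ = -1 := by rcases hκ with rfl | rfl <;> simp
  obtain ⟨c, hc⟩ := exists_tendsto_szego_sheet ha hb hγ hρ hL hx hz
  have h0 := hc 0 κ hκ hω0
  have h1 := hc 1 (-κ) hκ' hω1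
  have e0 : szegoTrace a b γ L 0 m₀ m₁ p = _ := (if_pos hpc).trans (extendFrom_eq
    (mem_closure_iff_nhdsWithin_neBot.2 (neBot_nhdsWithin_sheet ha hb hx hz hκ hω0)) h0)
  have e1 : szegoTrace a b γ L 1 n₀ n₁ p = _ := (if_pos hpc).trans (extendFrom_eq
    (mem_closure_iff_nhdsWithin_neBot.2 (neBot_nhdsWithin_sheet ha hb hx hz hκ' hω1)) h1)
  refine ⟨e0 ▸ h0, e1 ▸ h1, ?_⟩
  have hW : wPlus a b i (segPt a b i x) * invW a b i x = 1 := by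
    refine mul_inv_cancel₀ fun h2 => Curve.ω_ne_zero (p := p)
      (fun j => hz ▸ segPt_ne_endpt ha hb i ⟨hx.1, hx.2.le⟩ j) ?_
    rw [hω, hz, h2, mul_zero]
  have hκ2 : (κ : ℂ) * κ = 1 := by rcases hκ with rfl | rfl <;> simp
  rw [e0, e1, hz, ← exp_neg_logRhoW ha hb hρ hL hx, ← Complex.exp_add, hω, hz, density_eq]
  congr 1
  simp only [Fin.val_zero, Fin.val_one, pow_zero, pow_one, Complex.ofReal_neg]
  -- The coefficient is the numerator of the density; the identities used are w₊ · (1/w₊) = 1 and κ²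
  -- = 1.
  linear_combination (-(logRhoW a b L i (segPt a b i x) +
    2 * Real.pi * Complex.I * cRho a b γ L * alphaSide i)) * (κ * κ * hW + hκ2)

end Cross

theorem mainTheorem3 (a b : ℝ) (ha : 0 < a) (hb : 0 < b)
    (γ : ℝ → ℂ) (hγ : Cross.IsAlphaArc a b γ)
    (ρ : ℂ → ℂ) (α : Fin 4 → ℝ) (h : Fin 4 → ℂ → ℂ) (hρ : Cross.IsWeight a b 1 ρ α h)
    (L : Fin 4 → ℂ → ℂ) (hL : Cross.IsLogBranch a b α h L) :
    -- holomorphic and non-vanishing off the cuts, including the points over infinity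
    (∀ P : Cross.Surface a b, P ∉ Cross.surfaceCuts a b γ →
      Cross.HolomorphicAt (Cross.szego a b γ L) P ∧ Cross.szego a b γ L P ≠ 0) ∧
    -- continuous traces and jumps
    (∃ Sp Sm : Cross.Curve a b → ℂ,
      ContinuousOn Sp (Cross.regularCuts a b γ) ∧
      ContinuousOn Sm (Cross.regularCuts a b γ) ∧
      (∀ p ∈ Cross.regularCuts a b γ, p.z ∈ γ '' Icc 0 1 →
        Tendsto (fun q => Cross.szego a b γ L (.pt q)) (𝓝[Cross.alphaLeft a b γ] p)
          (𝓝 (Sp p)) ∧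
        Tendsto (fun q => Cross.szego a b γ L (.pt q)) (𝓝[Cross.alphaRight a b γ] p)
          (𝓝 (Sm p)) ∧
        Sp p = Sm p * Complex.exp (2 * Real.pi * Complex.I * Cross.cRho a b γ L)) ∧
      (∀ i, ∀ p ∈ Cross.regularCuts a b γ, p.z ∈ Cross.seg' a b i →
        Tendsto (fun q => Cross.szego a b γ L (.pt q)) (𝓝[Cross.sheet a b 0] p)
          (𝓝 (Sp p)) ∧
        Tendsto (fun q => Cross.szego a b γ L (.pt q)) (𝓝[Cross.sheet a b 1] p)
          (𝓝 (Sm p)) ∧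
        Sp p = Sm p * (1 / (ρ p.z * Cross.wPlus a b i p.z)))) ∧
    -- symmetry
    (∀ P : Cross.Surface a b, P ∉ Cross.surfaceCuts a b γ →
      Cross.szego a b γ L P * Cross.szego a b γ L P.star = 1) ∧
    -- behavior near the endpoints
    (∀ i, Cross.Comparable (𝓝[(Cross.cuts a b γ)ᶜ] (Cross.endpt a b i))
      (fun z => ‖Cross.szego a b γ L (.pt (Cross.lift a b 0 z))‖)
      (fun z => ‖z - Cross.endpt a b i‖ ^ (-(2 * α i + 1) / 4))) ∧
    -- behavior near the origin in each quadrant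
    (∀ j : Fin 4, Cross.Comparable (𝓝[Cross.quadrant j] 0)
      (fun z => ‖Cross.szego a b γ L (.pt (Cross.lift a b 0 z))‖)
      (fun z => ‖z‖ ^ ((-1) ^ ((j : ℕ) + 1) * (Cross.nu a b L).re))) := by
  have hint := Cross.intervalIntegrable_logDensity ha hb hρ hL
  refine ⟨fun P hP => ⟨?_, Complex.exp_ne_zero _⟩,
    ⟨Cross.szegoTrace a b γ L 0 1 0, Cross.szegoTrace a b γ L 1 0 (-1),
      Cross.continuousOn_szegoTrace ha hb hγ hρ hL _ _ _,
      Cross.continuousOn_szegoTrace ha hb hγ hρ hL _ _ _,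
      fun p hp hpz => Cross.szego_jump_alpha ha hb hγ hint hp hpz,
      fun i p _ hpz => Cross.szego_jump_cross ha hb hγ hρ hL hpz _ _ _ _⟩,
    fun P hP => Cross.szego_mul_star ha hb hγ hint hP,
    fun i => Cross.comparable_szego_endpt ha hb hγ hρ hL i,
    fun j => Cross.comparable_szego_zero ha hb hγ hρ hL j⟩
  cases P with
  | pt p => exact Cross.holomorphicAt_szego_pt ha hb hγ hint fun h => hP ⟨p, rfl, h⟩
  | infty k => exact Cross.holomorphicAt_szego_infty ha hb hγ hint k
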